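/- Let $k$ be a commutative ring (with unit). **Notation.** Let $\Delta S_+$ be the category of noncommutative sets: its objects are the finite sets $\underline{n}=\{1,\dots,n\}$, $n\ge 0$ (write $\underline n=[n-1]$), and a morphism is a map of sets together with a total order on each of its fibres; fibres of composites are ordered by concatenation. Let $\odot$ be the block sum of morphisms and let $\Delta S\subset\Delta S_+$ be the full subcategory of the nonempty objects. For an associative unital $k$-algebra $A$ let $B^{sym_+}A:\Delta S_+\to k\text{-}\mathbf{Mod}$ be the functor $\underline n\mapsto A^{\otimes n}$ ($\underline 0\mapsto k$), where a morphism multiplies the factors of each fibre in their order (empty product $=1$), and let $B^{sym}A$ be its restriction to $\Delta S$. Symmetric homology is $HS_*(A)=\mathrm{Tor}^{\Delta S}_*(k,B^{sym}A)$. Put $$Y^+_*A=k[N(-\setminus\Delta S_+)]\otimes_{\Delta S_+}B^{sym_+}A,$$ a simplicial $k$-module, where $N(x\setminus \Delta S_+)$ is the nerve of the category of objects under $x$. Let $\mathcal N$ denote the normalized chain complex. For $\sigma\in S_m$ let $\sigma\{j_1,\dots,j_m\}$ be the permutation that moves the $s$-th block (of size $j_s$) to the $\sigma(s)$-th place. Let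 $\mathscr D_{cat}(m)$ be the category with object set $S_m$ and exactly one morphism between any two objects, with $S_m$ acting by right multiplication, unit $1\in S_1$ and multiplication determined on objects by $$(\sigma,\tau_1,\dots,\tau_m)\mapsto \sigma\{j_1,\dots,j_m\}(\tau_1\oplus\dots\oplus\tau_m).$$ Put $\mathscr D_{sm}=k[N\mathscr D_{cat}]$ and $\mathscr D_{ch}=\mathcal N\mathscr D_{sm}$. Let $\mathscr K_{cat}(m)=[m-1]\setminus\Delta S_+$ be the category of objects under $\underline m$, with $S_m$ acting by precomposition, and let $$\mu:\mathscr D_{cat}(m)\times\prod_{s=1}^m\mathscr K_{cat}(j_s)\to\mathscr K_{cat}\Big(\sum_s j_s\Big)$$ be the functor given, for $f_s:\underline{j_s}\to\underline{p_s}$ and $g_s:\underline{p_s}\to\underline{q_s}$, on objects by $\mu(\sigma,f_1,\dots,f_m)=\sigma\{p_1,\dots,p_m\}(f_1\odot\dots\odot f_m)$, and sending the morphism $(\sigma,f_1,\dots,f_m)\to(\tau,g_1f_1,\dots,g_mf_m)$ to $$(\tau\sigma^{-1})\{q_{\sigma^{-1}(1)},\dots,q_{\sigma^{-1}(m)}\}\,(g_{\sigma^{-1}(1)}\odot\dots\odot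 g_{\sigma^{-1}(m)}).$$ **Theorem.** 1. $\mathscr D_{cat}$ is an operad in categories with $\mathscr D_{cat}(0)$ the one-point category, and $\mu$ makes $\mathscr K_{cat}$ a module over it. 2. The operad structure of $\mathscr D_{cat}$ induces, through the nerve, linearization and the shuffle maps, an operad structure on the chain complexes $\mathscr D_{ch}(n)$, and $\mathscr D_{ch}$ is an $E_\infty$-operad: there are augmentations $\mathscr D_{ch}(n)\to k$, compatible with the operad structures of $\mathscr D_{ch}$ and of the commutative operad, making each $\mathscr D_{ch}(n)$ a resolution of $k$ by free $k[S_n]$-modules. 3. There are isomorphisms $HS_n(A)\cong H_n(\mathcal N Y^+_*A)$ for all $n\ge 0$, natural in $A$. 4. For every $A$, $Y^+_*A$ is an algebra over the operad $\mathscr D_{sm}$ in simplicial $k$-modules, by the structure maps which $\mu$ induces: for $q$-simplices $c$ of $N\mathscr D_{cat}(m)$ and $f_s$ of $N\mathscr K_{cat}(j_s)$, and simple tensors $V_s\in A^{\otimes j_s}$, $$c\otimes[f_1\otimes V_1]\otimes\dots\otimes[f_m\otimes V_m]\mapsto[\mu(c,f_1,\dots,f_m)\otimes(V_1\otimes\dots\otimes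 V_m)].$$ 5. This structure induces, through the shuffle maps, the structure of a $\mathscr D_{ch}$-algebra on the complex $\mathcal NY^+_*A$, with structure maps $\widetilde\chi:\mathscr D_{ch}(n)\otimes_{S_n}(\mathcal NY^+_*A)^{\otimes n}\to\mathcal NY^+_*A$. So $\mathcal NY^+_*A$ is an $E_\infty$-algebra. 6. Consequently $HS_*(A)$ carries a Pontryagin product, which makes it a unital associative graded-commutative $k$-algebra. Under the isomorphisms of 3 it is given by $[x]\cdot[y]=[\widetilde\chi(c\otimes x\otimes y)]$ for cycles $x,y$, where $c\in\mathscr D_{ch}(2)_0$ is any $0$-chain whose coefficients sum to $1$, that is, any $0$-chain representing the generator $1\in H_0(\mathscr D_{ch}(2))=k$; the product does not depend on $c$. -/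

import Mathlib

open CategoryTheory Opposite
open scoped Simplicial TensorProduct
universe u

namespace SymHom

/-- The category of noncommutative sets. Its objects are the finite sets `{1, …, n}`, `n ≥ 0`
(here `Fin n`), and a morphism is a map of sets together with a total order on each of its fibres.
Identifying `n + 1` points with the ordinal `[n]` and the empty set with `[-1]`, this is the category
`ΔS₊` obtained from the symmetric category `ΔS` by adding an initial object. -/
structure FAs where
  card : ℕ

namespace FAs

/-- A map with totally ordered fibres: `fib j` lists the elements of the fibre over `j` in their
order. The condition says that every `i` lies in exactly one fibre and is listed there once. -/
@[ext]
structure Hom (X Y : FAs) where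
  fib : Fin Y.card → List (Fin X.card)
  count_fib : ∀ i, ∑ j, (fib j).count i = 1

theorem sum_count_flatMap {n m p : ℕ} (f : Fin m → List (Fin n)) (g : Fin p → List (Fin m))
    (hf : ∀ i, ∑ j, (f j).count i = 1) (hg : ∀ i, ∑ j, (g j).count i = 1) (i : Fin n) :
    ∑ j, ((g j).flatMap f).count i = 1 := by
  have h : ∀ l : List (Fin m), (l.flatMap f).count i = ∑ x, l.count x * (f x).count i := by
    intro l
    induction l with
    | nil => simp
    | cons a l ih =>
      simp [List.count_append, ih, List.count_cons, add_mul, Finset.sum_add_distrib, add_comm]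
  simp_rw [h]
  rw [Finset.sum_comm]
  simp_rw [← Finset.sum_mul, hg, one_mul, hf]

/-- Composition: the fibre of `g f` over `j` is the concatenation of the fibres of `f` over the
elements of the fibre of `g` over `j`, in the order of the latter. -/
instance : Category FAs where
  Hom := Hom
  id X := ⟨fun j => [j], fun i => by simp [List.count_singleton]⟩
  comp f g := ⟨fun j => (g.fib j).flatMap f.fib,
    fun i => sum_count_flatMap f.fib g.fib f.count_fib g.count_fib i⟩
  id_comp f := Hom.ext (by funext j; simp)
  comp_id f := Hom.ext (by funext j; simp)
  assoc f g h := Hom.ext (by funext j; simp [List.flatMap_assoc])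

@[ext]
theorem hom_ext {X Y : FAs} {f g : X ⟶ Y} (h : ∀ j, f.fib j = g.fib j) : f = g :=
  Hom.ext (funext h)

@[simp] theorem id_fib (X : FAs) (j : Fin X.card) : Hom.fib (𝟙 X) j = [j] := rfl

@[simp] theorem comp_fib {X Y Z : FAs} (f : X ⟶ Y) (g : Y ⟶ Z) (j : Fin Z.card) :
    (f ≫ g).fib j = (g.fib j).flatMap f.fib := rfl

/-- A bijection, as a morphism (an isomorphism) of noncommutative sets. -/
def ofEquiv {n m : ℕ} (e : Fin n ≃ Fin m) : FAs.mk n ⟶ FAs.mk m :=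
  Hom.mk (X := ⟨n⟩) (Y := ⟨m⟩) (fun j => [e.symm j]) (fun i => by
    simp only [List.count_singleton, beq_iff_eq, Equiv.symm_apply_eq]
    simp)

theorem ofEquiv_symm_comp {n m : ℕ} (e : Fin n ≃ Fin m) :
    ofEquiv e.symm ≫ ofEquiv e = 𝟙 _ := by
  ext1 j
  simp [ofEquiv]

theorem ofEquiv_comp_symm {n m : ℕ} (e : Fin n ≃ Fin m) :
    ofEquiv e ≫ ofEquiv e.symm = 𝟙 _ := by
  ext1 j
  simp [ofEquiv]

theorem ofEquiv_comp_symm_assoc {n m : ℕ} (e : Fin n ≃ Fin m) {Z : FAs} (h : FAs.mk n ⟶ Z) :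
    ofEquiv e ≫ ofEquiv e.symm ≫ h = h := by
  rw [← Category.assoc, ofEquiv_comp_symm, Category.id_comp]

/-- The fibres of the block sum, indexed by a block `v.1` and a position `v.2` in it. -/
def odotFib {m : ℕ} {X Y : Fin m → FAs} (f : ∀ s, X s ⟶ Y s) (v : (s : Fin m) × Fin (Y s).card) :
    List (Fin (∑ s, (X s).card)) :=
  ((f v.1).fib v.2).map fun t => finSigmaFinEquiv ⟨v.1, t⟩

theorem odotFib_count {m : ℕ} {X Y : Fin m → FAs} (f : ∀ s, X s ⟶ Y s)
    (i : Fin (∑ s, (X s).card)) :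
    ∑ r : Fin (∑ s, (Y s).card), (odotFib f (finSigmaFinEquiv.symm r)).count i = 1 := by
  obtain ⟨⟨s, t⟩, rfl⟩ := finSigmaFinEquiv.surjective i
  rw [finSigmaFinEquiv.symm.sum_comp
    (fun v => (odotFib f v).count (finSigmaFinEquiv ⟨s, t⟩)), Fintype.sum_sigma,
    Finset.sum_eq_single s]
  · rw [← (f s).count_fib t]
    refine Finset.sum_congr rfl fun u _ => ?_
    have hinj : Function.Injective
        (fun t' => finSigmaFinEquiv (n := fun s => (X s).card) ⟨s, t'⟩) := fun a b h =>
      eq_of_heq (Sigma.mk.inj (finSigmaFinEquiv.injective h)).2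
    exact List.count_map_of_injective ((f s).fib u) _ hinj t
  · intro s' _ hs
    refine Finset.sum_eq_zero fun u _ => List.count_eq_zero.2 ?_
    simp only [odotFib, List.mem_map, not_exists, not_and]
    intro t' _ h
    exact hs (congrArg Sigma.fst (finSigmaFinEquiv.injective h))
  · simp

/-- The block sum `f₁ ⊙ … ⊙ f_m`, the symmetric monoidal product given by juxtaposition of the
sets `X₁, …, X_m` in this order. -/
def odot {m : ℕ} {X Y : Fin m → FAs} (f : ∀ s, X s ⟶ Y s) :
    FAs.mk (∑ s, (X s).card) ⟶ FAs.mk (∑ s, (Y s).card) :=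
  Hom.mk (X := ⟨∑ s, (X s).card⟩) (Y := ⟨∑ s, (Y s).card⟩)
    (fun r => odotFib f (finSigmaFinEquiv.symm r)) (odotFib_count f)

theorem odot_comp {m : ℕ} {X Y Z : Fin m → FAs} (f : ∀ s, X s ⟶ Y s) (g : ∀ s, Y s ⟶ Z s) :
    odot (fun s => f s ≫ g s) = odot f ≫ odot g := by
  ext1 r
  change odotFib (fun s => f s ≫ g s) (finSigmaFinEquiv.symm r) =
    (odotFib g (finSigmaFinEquiv.symm r)).flatMap fun r' => odotFib f (finSigmaFinEquiv.symm r')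
  generalize finSigmaFinEquiv.symm r = v
  have h : ∀ u, odotFib f (finSigmaFinEquiv.symm (finSigmaFinEquiv ⟨v.1, u⟩)) =
      odotFib f ⟨v.1, u⟩ := fun u => congrArg (odotFib f) (Equiv.symm_apply_apply _ _)
  simp only [odotFib, comp_fib, List.map_flatMap, List.flatMap_map] at h ⊢
  exact congrArg (fun F => List.flatMap F _) (funext fun u => (h u).symm)

theorem odot_id {m : ℕ} (X : Fin m → FAs) : odot (fun s => 𝟙 (X s)) = 𝟙 _ := by
  ext1 r
  simp [odot, odotFib]

end FAs

/-- The multilinear map `(a₁, …, a_n) ↦ b₁ ⊗ … ⊗ b_p` for `f : n → p`, where `b_j` is the product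
in `A` of the `a_i`, `i` in the fibre of `f` over `j`, in the order of that fibre (the empty product
is `1`). -/
def substMultilinear (k A : Type u) [CommRing k] [Ring A] [Algebra k A] {X Y : FAs} (f : X ⟶ Y) :
    MultilinearMap k (fun _ : Fin X.card => A) (⨂[k] _ : Fin Y.card, A) := by
  have key : ∀ (d : DecidableEq (Fin X.card)) (a : Fin X.card → A) (i : Fin X.card),
      ∃ (j : Fin Y.card) (p q : A), ∀ x : A,
        (fun j' => ((f.fib j').map (@Function.update _ _ d a i x)).prod) =
          Function.update (fun j' => ((f.fib j').map a).prod) j (p * x * q) := by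
    intro d a i
    obtain rfl : d = instDecidableEqFin _ := Subsingleton.elim _ _
    have hsum := f.count_fib i
    obtain ⟨j, hj⟩ : ∃ j, (f.fib j).count i ≠ 0 := by
      by_contra! h
      simp [h] at hsum
    have hle : ∑ j' ∈ Finset.univ.erase j, (f.fib j').count i + (f.fib j).count i = 1 := by
      rw [Finset.sum_erase_add _ _ (Finset.mem_univ j)]; exact hsum
    have h1 : (f.fib j).count i = 1 := by omega
    have h0 : ∀ j', j' ≠ j → i ∉ f.fib j' := by
      intro j' hne
      have hz : ∑ j' ∈ Finset.univ.erase j, (f.fib j').count i = 0 := by omega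
      exact List.count_eq_zero.1 (Finset.sum_eq_zero_iff.1 hz j' (by simp [hne]))
    have hmem : i ∈ f.fib j := List.count_pos_iff.1 (by omega)
    obtain ⟨l₁, l₂, hl⟩ := List.append_of_mem hmem
    rw [hl] at h1
    simp only [List.count_append, List.count_cons_self] at h1
    have n1 : i ∉ l₁ := List.count_eq_zero.1 (by omega)
    have n2 : i ∉ l₂ := List.count_eq_zero.1 (by omega)
    have hupd : ∀ (l : List (Fin X.card)) (x : A), i ∉ l →
        l.map (Function.update a i x) = l.map a := by
      intro l x hi
      refine List.map_congr_left fun y hy => ?_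
      rw [Function.update_of_ne]
      rintro rfl; exact hi hy
    refine ⟨j, (l₁.map a).prod, (l₂.map a).prod, fun x => ?_⟩
    funext j'
    by_cases hjj : j' = j
    · subst hjj
      simp [hl, hupd _ _ n1, hupd _ _ n2, mul_assoc]
    · rw [Function.update_of_ne hjj, hupd _ _ (h0 j' hjj)]
  exact
    { toFun := fun a => PiTensorProduct.tprod k (fun j => ((f.fib j).map a).prod)
      map_update_add' := by
        intro d a i x y
        obtain ⟨j, p, q, h⟩ := key d a i
        simp only [h, mul_add, add_mul, MultilinearMap.map_update_add]
      map_update_smul' := by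
        intro d a i c x
        obtain ⟨j, p, q, h⟩ := key d a i
        simp only [h, mul_smul_comm, smul_mul_assoc, MultilinearMap.map_update_smul] }

@[simp] theorem substMultilinear_apply (k A : Type u) [CommRing k] [Ring A] [Algebra k A]
    {X Y : FAs} (f : X ⟶ Y) (a : Fin X.card → A) :
    substMultilinear k A f a = PiTensorProduct.tprod k (fun j => ((f.fib j).map a).prod) := rfl

theorem prod_map_flatMap {α β M : Type*} [Monoid M] (l : List α) (f : α → List β) (a : β → M) :
    ((l.flatMap f).map a).prod = (l.map fun x => ((f x).map a).prod).prod := by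
  induction l with
  | nil => simp
  | cons x l ih => simp [ih]

/-- The symmetric bar construction extended to `ΔS₊`: the functor `n ↦ A^{⊗ n}`, with `0 ↦ k`. -/
noncomputable def BsymPlus (k A : Type u) [CommRing k] [Ring A] [Algebra k A] :
    FAs ⥤ ModuleCat.{u} k where
  obj X := ModuleCat.of k (⨂[k] _ : Fin X.card, A)
  map f := ModuleCat.ofHom (PiTensorProduct.lift (substMultilinear k A f))
  map_id X := by
    refine ModuleCat.hom_ext (PiTensorProduct.ext ?_)
    ext a
    simp
  map_comp f g := by
    refine ModuleCat.hom_ext (PiTensorProduct.ext ?_)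
    ext a
    simp [prod_map_flatMap]

/-- The map of symmetric bar constructions induced by an algebra homomorphism. -/
noncomputable def BsymPlusMap (k : Type u) {A B : Type u} [CommRing k] [Ring A] [Algebra k A]
    [Ring B] [Algebra k B] (φ : A →ₐ[k] B) : BsymPlus k A ⟶ BsymPlus k B where
  app X := ModuleCat.ofHom (PiTensorProduct.map fun _ => φ.toLinearMap)
  naturality X Y f := by
    refine ModuleCat.hom_ext (PiTensorProduct.ext ?_)
    ext a
    change PiTensorProduct.map (R := k) (fun _ => φ.toLinearMap)
        (PiTensorProduct.lift (substMultilinear k A f) (PiTensorProduct.tprod k a)) =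
      PiTensorProduct.lift (substMultilinear k B f)
        (PiTensorProduct.map (fun _ => φ.toLinearMap) (PiTensorProduct.tprod k a))
    simp [map_list_prod, Function.comp_def]

/-! ### Operads in categories and modules over them

The operations of arity `n` are acted on by `S_n` from the right. It is convenient to record this as a
contravariant functor on the groupoid of all bijections `Fin n ≃ Fin m` (which is the disjoint union
of the symmetric groups): its values on `Fin n ≃ Fin n` are the right action of `S_n`, and its value
on `finCongr h`, `h : n = m`, is the identification of the operations of arities `n` and `m`. -/

/-- The block permutation `σ{j₁, …, j_m}`: it moves the `s`-th block, of size `j_s`, to the place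
`σ s`, keeping the order inside the blocks. -/
def blockEquiv {m : ℕ} (σ : Equiv.Perm (Fin m)) (j : Fin m → ℕ) :
    Fin (∑ s, j s) ≃ Fin (∑ s, j (σ.symm s)) :=
  finSigmaFinEquiv.symm.trans
    ((Equiv.sigmaCongrLeft' (β := fun s => Fin (j s)) σ).trans finSigmaFinEquiv)

/-- The direct sum `τ₁ ⊕ … ⊕ τ_m` of permutations, acting blockwise. -/
def sumEquiv {m : ℕ} {j : Fin m → ℕ} (τ : ∀ s, Equiv.Perm (Fin (j s))) :
    Equiv.Perm (Fin (∑ s, j s)) :=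
  finSigmaFinEquiv.symm.trans ((Equiv.sigmaCongrRight τ).trans finSigmaFinEquiv)

theorem sum_flatten {m : ℕ} {j : Fin m → ℕ} (i : ∀ s, Fin (j s) → ℕ) :
    ∑ r : Fin (∑ s, j s), i (finSigmaFinEquiv.symm r).1 (finSigmaFinEquiv.symm r).2 =
      ∑ s, ∑ t, i s t := by
  rw [finSigmaFinEquiv.symm.sum_comp (fun v : (s : Fin m) × Fin (j s) => i v.1 v.2),
    Fintype.sum_sigma]

theorem card_eq_of_equiv {n m : ℕ} (e : Fin n ≃ Fin m) : n = m := by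
  simpa using Fintype.card_congr e

/-- The data of an operad in categories: operations, right actions of the symmetric groups, unit
and multiplication. -/
structure CatOperadData where
  obj : ℕ → Type
  [cat : ∀ n, Category.{0} (obj n)]
  act : ∀ {n m : ℕ}, (Fin n ≃ Fin m) → (obj m ⥤ obj n)
  one : obj 1
  mul : ∀ (m : ℕ) (j : Fin m → ℕ), obj m × (∀ s, obj (j s)) ⥤ obj (∑ s, j s)

attribute [instance] CatOperadData.cat

namespace CatOperadData

variable (P : CatOperadData)

/-- The multiplication applied to generalized elements, that is to functors from a category `T`.
Taking for `T` the product of all factors, an identity between such composites that is natural in `T`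
is an identity of functors. -/
def comp {T : Type} [Category.{0} T] {m : ℕ} {j : Fin m → ℕ} (c : T ⥤ P.obj m)
    (d : ∀ s, T ⥤ P.obj (j s)) : T ⥤ P.obj (∑ s, j s) :=
  (c.prod' (Functor.pi' d)) ⋙ P.mul m j

/-- The operad axioms: the operations of arity zero form a one-point category, the symmetric
groups act, the unit is a two-sided unit, and the multiplication is associative and equivariant.
The two equivariance axioms are
`γ(cσ; d₁, …, d_m) = γ(c; d_{σ⁻¹(1)}, …, d_{σ⁻¹(m)}) σ{j₁, …, j_m}` and
`γ(c; d₁τ₁, …, d_mτ_m) = γ(c; d₁, …, d_m) (τ₁ ⊕ … ⊕ τ_m)`. -/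
structure IsOperad : Prop where
  zero : Nonempty (Unique (P.obj 0)) ∧ ∀ x y : P.obj 0, Nonempty (Unique (x ⟶ y))
  act_refl : ∀ n, P.act (Equiv.refl (Fin n)) = 𝟭 _
  act_trans : ∀ {n m l : ℕ} (e : Fin n ≃ Fin m) (f : Fin m ≃ Fin l),
    P.act (e.trans f) = P.act f ⋙ P.act e
  one_comp : ∀ (T : Type) [Category.{0} T] (j : Fin 1 → ℕ) (d : ∀ s, T ⥤ P.obj (j s)),
    P.comp ((Functor.const T).obj P.one) d = d 0 ⋙ P.act (finCongr (Fin.sum_univ_one j))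
  comp_one : ∀ (T : Type) [Category.{0} T] (m : ℕ) (c : T ⥤ P.obj m),
    P.comp c (fun _ : Fin m => (Functor.const T).obj P.one) =
      c ⋙ P.act (finCongr (show ∑ _ : Fin m, 1 = m by simp))
  assoc : ∀ (T : Type) [Category.{0} T] (m : ℕ) (j : Fin m → ℕ) (i : ∀ s, Fin (j s) → ℕ)
    (c : T ⥤ P.obj m) (d : ∀ s, T ⥤ P.obj (j s)) (b : ∀ s t, T ⥤ P.obj (i s t)),
    P.comp (P.comp c d)
        (fun r => b (finSigmaFinEquiv.symm r).1 (finSigmaFinEquiv.symm r).2) =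
      P.comp c (fun s => P.comp (d s) (b s)) ⋙ P.act (finCongr (sum_flatten i))
  equivariance_left : ∀ (T : Type) [Category.{0} T] (m : ℕ) (j : Fin m → ℕ)
    (σ : Equiv.Perm (Fin m)) (c : T ⥤ P.obj m) (d : ∀ s, T ⥤ P.obj (j s)),
    P.comp (c ⋙ P.act σ) d =
      P.comp c (fun s => d (σ.symm s)) ⋙ P.act (blockEquiv σ j)
  equivariance_right : ∀ (T : Type) [Category.{0} T] (m : ℕ) (j : Fin m → ℕ)
    (τ : ∀ s, Equiv.Perm (Fin (j s))) (c : T ⥤ P.obj m) (d : ∀ s, T ⥤ P.obj (j s)),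
    P.comp c (fun s => d s ⋙ P.act (τ s)) = P.comp c d ⋙ P.act (sumEquiv τ)

end CatOperadData

/-- The data of a (left) module over an operad `P` in categories: categories with right actions of
the symmetric groups and multiplications `P(m) × M(j₁) × … × M(j_m) → M(j₁ + … + j_m)`. -/
structure CatModuleData (P : CatOperadData) where
  obj : ℕ → Type
  [cat : ∀ n, Category.{0} (obj n)]
  act : ∀ {n m : ℕ}, (Fin n ≃ Fin m) → (obj m ⥤ obj n)
  mul : ∀ (m : ℕ) (j : Fin m → ℕ), P.obj m × (∀ s, obj (j s)) ⥤ obj (∑ s, j s)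

attribute [instance] CatModuleData.cat

namespace CatModuleData

variable {P : CatOperadData} (M : CatModuleData P)

/-- The multiplication applied to generalized elements. -/
def comp {T : Type} [Category.{0} T] {m : ℕ} {j : Fin m → ℕ} (c : T ⥤ P.obj m)
    (d : ∀ s, T ⥤ M.obj (j s)) : T ⥤ M.obj (∑ s, j s) :=
  (c.prod' (Functor.pi' d)) ⋙ M.mul m j

/-- The axioms of a module over an operad: unit, associativity, and the two equivariance axioms. -/
structure IsModule : Prop where
  act_refl : ∀ n, M.act (Equiv.refl (Fin n)) = 𝟭 _
  act_trans : ∀ {n m l : ℕ} (e : Fin n ≃ Fin m) (f : Fin m ≃ Fin l),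
    M.act (e.trans f) = M.act f ⋙ M.act e
  one_comp : ∀ (T : Type) [Category.{0} T] (j : Fin 1 → ℕ) (d : ∀ s, T ⥤ M.obj (j s)),
    M.comp ((Functor.const T).obj P.one) d = d 0 ⋙ M.act (finCongr (Fin.sum_univ_one j))
  assoc : ∀ (T : Type) [Category.{0} T] (m : ℕ) (j : Fin m → ℕ) (i : ∀ s, Fin (j s) → ℕ)
    (c : T ⥤ P.obj m) (d : ∀ s, T ⥤ P.obj (j s)) (b : ∀ s t, T ⥤ M.obj (i s t)),
    M.comp (P.comp c d)
        (fun r => b (finSigmaFinEquiv.symm r).1 (finSigmaFinEquiv.symm r).2) =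
      M.comp c (fun s => M.comp (d s) (b s)) ⋙ M.act (finCongr (sum_flatten i))
  equivariance_left : ∀ (T : Type) [Category.{0} T] (m : ℕ) (j : Fin m → ℕ)
    (σ : Equiv.Perm (Fin m)) (c : T ⥤ P.obj m) (d : ∀ s, T ⥤ M.obj (j s)),
    M.comp (c ⋙ P.act σ) d =
      M.comp c (fun s => d (σ.symm s)) ⋙ M.act (blockEquiv σ j)
  equivariance_right : ∀ (T : Type) [Category.{0} T] (m : ℕ) (j : Fin m → ℕ)
    (τ : ∀ s, Equiv.Perm (Fin (j s))) (c : T ⥤ P.obj m) (d : ∀ s, T ⥤ M.obj (j s)),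
    M.comp c (fun s => d s ⋙ M.act (τ s)) = M.comp c d ⋙ M.act (sumEquiv τ)

end CatModuleData

/-- The operad `D_cat`. The category `D_cat(m)` has the elements of `S_m` as objects and exactly
one morphism between any two of them, `S_m` acts by right multiplication, and
`(σ, τ₁, …, τ_m) ↦ σ{k₁, …, k_m} (τ₁ ⊕ … ⊕ τ_m)`. The nerve of `D_cat` is the Barratt–Eccles operad. -/
def Dcat : CatOperadData where
  obj m := Codiscrete (Equiv.Perm (Fin m))
  act e := Codiscrete.functor fun σ =>
    e.trans (σ.as.trans (finCongr (card_eq_of_equiv e).symm))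
  one := ⟨1⟩
  mul _ j := Codiscrete.functor fun x =>
    ((blockEquiv x.1.as j).trans (finCongr (x.1.as.symm.sum_comp j))) *
      sumEquiv fun s => (x.2 s).as

/-- The categories `K_cat(m) = [m-1] \ ΔS₊` of morphisms of noncommutative sets out of `m`, with
`S_m` acting by precomposition. The functors `μ : D_cat(m) × ∏ K_cat(j_s) → K_cat(∑ j_s)` are
`(σ, f₁, …, f_m) ↦ σ{p₁, …, p_m} (f₁ ⊙ … ⊙ f_m)` on objects (`p_s` the target of `f_s`). A morphism
`(σ, f) → (τ, gf)` goes to `τ{q₁, …, q_m} (g₁ ⊙ … ⊙ g_m) σ{p₁, …, p_m}⁻¹`, which is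
`(τσ⁻¹){q_{σ⁻¹(1)}, …, q_{σ⁻¹(m)}} (g_{σ⁻¹(1)} ⊙ … ⊙ g_{σ⁻¹(m)})`. -/
def Kcat : CatModuleData Dcat where
  obj m := Under (FAs.mk m)
  act e := Under.map (FAs.ofEquiv e)
  mul m j :=
    { obj := fun x => Under.mk (X := FAs.mk (∑ s, j s))
        (FAs.odot (fun s => (x.2 s).hom) ≫
          FAs.ofEquiv (blockEquiv x.1.as fun s => (x.2 s).right.card))
      map := fun {x y} g => Under.homMk
        (FAs.ofEquiv (blockEquiv x.1.as fun s => (x.2 s).right.card).symm ≫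
          FAs.odot (fun s => (g.2 s).right) ≫
          FAs.ofEquiv (blockEquiv y.1.as fun s => (y.2 s).right.card)) (by
            have h : (fun s => (y.2 s).hom) = fun s => (x.2 s).hom ≫ (g.2 s).right :=
              funext fun s => (Under.w (g.2 s)).symm
            simp only [Under.mk_hom, Category.assoc, FAs.ofEquiv_comp_symm_assoc, h,
              FAs.odot_comp])
      map_id := fun x => by
        ext1
        change FAs.ofEquiv _ ≫ FAs.odot (fun s => 𝟙 (x.2 s).right) ≫ FAs.ofEquiv _ = 𝟙 _
        rw [FAs.odot_id, Category.id_comp, FAs.ofEquiv_symm_comp]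
      map_comp := fun {x y z} f g => by
        ext1
        change FAs.ofEquiv _ ≫ FAs.odot (fun s => (f.2 s).right ≫ (g.2 s).right) ≫
          FAs.ofEquiv _ = (FAs.ofEquiv _ ≫ FAs.odot _ ≫ FAs.ofEquiv _) ≫
            (FAs.ofEquiv _ ≫ FAs.odot _ ≫ FAs.ofEquiv _)
        simp only [FAs.odot_comp, Category.assoc, FAs.ofEquiv_comp_symm_assoc] }

/-! ### Linearized nerves, tensor products over a category, and the complex `Y₊` -/

/-- The free `k`-module functor. -/
noncomputable def freeMod (k : Type u) [CommRing k] : Type ⥤ ModuleCat.{u} k where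
  obj X := ModuleCat.of k (X →₀ k)
  map f := ModuleCat.ofHom (Finsupp.lmapDomain k k f)
  map_id X := by
    refine ModuleCat.hom_ext (Finsupp.lhom_ext' fun x => LinearMap.ext_ring ?_)
    simp
  map_comp f g := by
    refine ModuleCat.hom_ext (Finsupp.lhom_ext' fun x => LinearMap.ext_ring ?_)
    simp

/-- The simplicial `k`-module `k[N C]` spanned by the nerve of `C`. -/
noncomputable def linNerve (k : Type u) [CommRing k] (C : Type) [Category.{0} C] :
    SimplicialObject (ModuleCat.{u} k) :=
  ((SimplicialObject.whiskering _ _).obj (freeMod k)).obj (nerve C)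

/-- The map of linearized nerves induced by a functor. -/
noncomputable def linNerveMap (k : Type u) [CommRing k] {C D : Type} [Category.{0} C]
    [Category.{0} D] (F : C ⥤ D) : linNerve k C ⟶ linNerve k D :=
  ((SimplicialObject.whiskering _ _).obj (freeMod k)).map (nerveMap F)

/-- The `q`-simplex of the nerve of `C` given by a string of `q` morphisms, as an element of `k[N C]`. -/
noncomputable def chain (k : Type u) [CommRing k] {C : Type} [Category.{0} C] {q : ℕ}
    (s : Fin (q + 1) ⥤ C) : (linNerve k C).obj (op ⦋q⦌) :=
  (Finsupp.single s 1 : (Fin (q + 1) ⥤ C) →₀ k)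

/-- The simplicial right `C`-module `k[N(- \ C)]`, which sends an object `x` to the linearized nerve
of the category of objects under `x`. A morphism `x → y` acts by precomposition. -/
noncomputable def barRight (k : Type u) [CommRing k] (C : Type) [Category.{0} C] :
    SimplexCategoryᵒᵖ ⥤ Cᵒᵖ ⥤ ModuleCat.{u} k :=
  Functor.flip (C := Cᵒᵖ) (D := SimplexCategoryᵒᵖ) (E := ModuleCat.{u} k)
    (Under.mapFunctor C ⋙ nerveFunctor ⋙ (SimplicialObject.whiskering _ _).obj (freeMod k))

section Tensor

variable {k : Type u} [CommRing k] {C : Type} [Category.{0} C]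

open Classical in
/-- The submodule of `⨁_X M(X) ⊗ N(X)` spanned by the elements `y ⊗ f_*(x) - f^*(y) ⊗ x`. -/
def tensorRel (M : Cᵒᵖ ⥤ ModuleCat.{u} k) (N : C ⥤ ModuleCat.{u} k) :
    Submodule k (DirectSum C fun X => M.obj (op X) ⊗[k] N.obj X) :=
  Submodule.span k {z | ∃ (X Y : C) (f : X ⟶ Y) (y : M.obj (op Y)) (x : N.obj X),
    z = DirectSum.lof k C (fun X => M.obj (op X) ⊗[k] N.obj X) Y (y ⊗ₜ[k] N.map f x) -
      DirectSum.lof k C (fun X => M.obj (op X) ⊗[k] N.obj X) X (M.map f.op y ⊗ₜ[k] x)}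

/-- The tensor product `M ⊗_C N` of a right and a left `C`-module (a coend). -/
abbrev TensorOver (M : Cᵒᵖ ⥤ ModuleCat.{u} k) (N : C ⥤ ModuleCat.{u} k) : Type u :=
  (DirectSum C fun X => M.obj (op X) ⊗[k] N.obj X) ⧸ tensorRel M N

open Classical in
/-- The canonical map `M(X) ⊗ N(X) → M ⊗_C N`. -/
noncomputable def TensorOver.mk (M : Cᵒᵖ ⥤ ModuleCat.{u} k) (N : C ⥤ ModuleCat.{u} k) (X : C) :
    M.obj (op X) ⊗[k] N.obj X →ₗ[k] TensorOver M N :=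
  (tensorRel M N).mkQ ∘ₗ DirectSum.lof k C (fun X => M.obj (op X) ⊗[k] N.obj X) X

variable {M M' : Cᵒᵖ ⥤ ModuleCat.{u} k} {N N' : C ⥤ ModuleCat.{u} k}

theorem TensorOver.condition {X Y : C} (f : X ⟶ Y) (y : M.obj (op Y)) (x : N.obj X) :
    TensorOver.mk M N Y (y ⊗ₜ N.map f x) = TensorOver.mk M N X (M.map f.op y ⊗ₜ x) :=
  (Submodule.Quotient.eq _).2 (Submodule.subset_span ⟨X, Y, f, y, x, rfl⟩)

theorem TensorOver.hom_ext {Z : Type*} [AddCommGroup Z] [Module k Z]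
    {f g : TensorOver M N →ₗ[k] Z}
    (h : ∀ (X : C) (y : M.obj (op X)) (x : N.obj X),
      f (TensorOver.mk M N X (y ⊗ₜ x)) = g (TensorOver.mk M N X (y ⊗ₜ x))) : f = g := by
  classical
  refine Submodule.linearMap_qext (tensorRel M N) ?_
  refine DirectSum.linearMap_ext k fun X => ?_
  exact TensorProduct.ext' fun y x => h X y x

open Classical in
/-- Functoriality of the tensor product over a category in both variables. -/
noncomputable def TensorOver.map (α : M ⟶ M') (β : N ⟶ N') :
    TensorOver M N →ₗ[k] TensorOver M' N' :=
  (tensorRel M N).liftQ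
    (DirectSum.toModule k C _ fun X =>
      TensorOver.mk M' N' X ∘ₗ TensorProduct.map (α.app (op X)).hom (β.app X).hom)
    (by
      refine Submodule.span_le.2 ?_
      rintro _ ⟨X, Y, f, y, x, rfl⟩
      have h1 : (α.app (op X)).hom (M.map f.op y) = M'.map f.op ((α.app (op Y)).hom y) :=
        ConcreteCategory.congr_hom (α.naturality f.op) y
      have h2 : (β.app Y).hom (N.map f x) = N'.map f ((β.app X).hom x) :=
        ConcreteCategory.congr_hom (β.naturality f) x
      simp only [SetLike.mem_coe, LinearMap.mem_ker, map_sub, DirectSum.toModule_lof,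
        LinearMap.comp_apply, TensorProduct.map_tmul, h1, h2]
      rw [TensorOver.condition, sub_self])

@[simp] theorem TensorOver.map_mk (α : M ⟶ M') (β : N ⟶ N') (X : C) (y : M.obj (op X))
    (x : N.obj X) :
    TensorOver.map α β (TensorOver.mk M N X (y ⊗ₜ x)) =
      TensorOver.mk M' N' X ((α.app (op X)).hom y ⊗ₜ (β.app X).hom x) := by
  classical
  simp [TensorOver.map, TensorOver.mk]

/-- The functor `- ⊗_C N`. -/
noncomputable def tensorRight (N : C ⥤ ModuleCat.{u} k) :
    (Cᵒᵖ ⥤ ModuleCat.{u} k) ⥤ ModuleCat.{u} k where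
  obj M := ModuleCat.of k (TensorOver M N)
  map α := ModuleCat.ofHom (TensorOver.map α (𝟙 N))
  map_id M := ModuleCat.hom_ext (TensorOver.hom_ext fun X y x => by simp)
  map_comp α β := ModuleCat.hom_ext (TensorOver.hom_ext fun X y x => by simp)

/-- Naturality of `- ⊗_C N` in `N`. -/
noncomputable def tensorRightMap (β : N ⟶ N') : tensorRight N ⟶ tensorRight N' where
  app M := ModuleCat.ofHom (TensorOver.map (𝟙 M) β)
  naturality M M' α := ModuleCat.hom_ext (TensorOver.hom_ext fun X y x => by
    change TensorOver.map (𝟙 M') β (TensorOver.map α (𝟙 N) (TensorOver.mk M N X (y ⊗ₜ x))) =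
      TensorOver.map α (𝟙 N') (TensorOver.map (𝟙 M) β (TensorOver.mk M N X (y ⊗ₜ x)))
    simp)

instance (N : C ⥤ ModuleCat.{u} k) : (tensorRight N).Additive where
  map_add {M M' α β} := ModuleCat.hom_ext (TensorOver.hom_ext fun X y x => by
    change TensorOver.map (α + β) (𝟙 N) _ =
      TensorOver.map α (𝟙 N) _ + TensorOver.map β (𝟙 N) _
    simp only [TensorOver.map_mk, ← map_add, ← TensorProduct.add_tmul]
    rfl)

end Tensor

/-- The simplicial `k`-module `Y₊A = k[N(- \ ΔS₊)] ⊗_{ΔS₊} B^{sym₊}A`. -/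
noncomputable def YPlus (k A : Type u) [CommRing k] [Ring A] [Algebra k A] :
    SimplicialObject (ModuleCat.{u} k) :=
  barRight k FAs ⋙ tensorRight (BsymPlus k A)

/-- The map `Y₊A → Y₊B` induced by an algebra homomorphism. -/
noncomputable def YPlusMap (k : Type u) {A B : Type u} [CommRing k] [Ring A] [Algebra k A]
    [Ring B] [Algebra k B] (φ : A →ₐ[k] B) : YPlus k A ⟶ YPlus k B :=
  Functor.whiskerLeft (barRight k FAs) (tensorRightMap (BsymPlusMap k φ))

/-- The class in `(Y₊A)_q` of `s ⊗ (a₁ ⊗ … ⊗ a_m)`, for a `q`-simplex `s` of the nerve of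
`K_cat(m)`. -/
noncomputable def YPlus.mk (k : Type u) {A : Type u} [CommRing k] [Ring A] [Algebra k A] {q m : ℕ}
    (s : Fin (q + 1) ⥤ Kcat.obj m) (a : Fin m → A) : (YPlus k A).obj (op ⦋q⦌) :=
  TensorOver.mk ((barRight k FAs).obj (op ⦋q⦌)) (BsymPlus k A) (FAs.mk m)
    (chain k s ⊗ₜ[k] PiTensorProduct.tprod k a)

/-! ### Symmetric homology -/

section Projectives

variable (k : Type u) [CommRing k] {D : Type} [Category.{0} D]

/-- The free `D`-module on one generator at `X`. -/
noncomputable def freeAt (X : D) : D ⥤ ModuleCat.{u} k := coyoneda.obj (op X) ⋙ freeMod k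

variable {k}

/-- The map out of `freeAt k X` that sends the generator to `m`. -/
noncomputable def freeAtDesc {X : D} {M : D ⥤ ModuleCat.{u} k} (m : M.obj X) :
    freeAt k X ⟶ M where
  app Y := ModuleCat.ofHom (Finsupp.lift (M.obj Y) k (X ⟶ Y) fun f => M.map f m)
  naturality Y Z g := by
    refine ModuleCat.hom_ext (Finsupp.lhom_ext' fun f => LinearMap.ext_ring ?_)
    change Finsupp.lift (M.obj Z) k (X ⟶ Z) (fun f => M.map f m)
        (Finsupp.lmapDomain k k (fun f : X ⟶ Y => f ≫ g) (Finsupp.single f 1)) =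
      M.map g (Finsupp.lift (M.obj Y) k (X ⟶ Y) (fun f => M.map f m) (Finsupp.single f 1))
    simp

theorem freeAtDesc_id {X : D} {M : D ⥤ ModuleCat.{u} k} (m : M.obj X) :
    ((freeAtDesc m).app X).hom (Finsupp.single (𝟙 X) 1 : (X ⟶ X) →₀ k) = m := by
  change Finsupp.lift (M.obj X) k (X ⟶ X) (fun f => M.map f m) (Finsupp.single (𝟙 X) 1) = m
  simp

theorem freeAt_hom_ext {X : D} {M : D ⥤ ModuleCat.{u} k} {f g : freeAt k X ⟶ M}
    (h : (f.app X).hom (Finsupp.single (𝟙 X) 1 : (X ⟶ X) →₀ k) =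
      (g.app X).hom (Finsupp.single (𝟙 X) 1 : (X ⟶ X) →₀ k)) : f = g := by
  have key : ∀ (f : freeAt k X ⟶ M) (Y : D) (a : X ⟶ Y),
      (f.app Y).hom (Finsupp.single a 1 : (X ⟶ Y) →₀ k) =
        M.map a ((f.app X).hom (Finsupp.single (𝟙 X) 1 : (X ⟶ X) →₀ k)) := by
    intro f Y a
    have h1 := ConcreteCategory.congr_hom (f.naturality a)
      (Finsupp.single (𝟙 X) 1 : (X ⟶ X) →₀ k)
    have h2 : (freeAt k X).map a (Finsupp.single (𝟙 X) 1 : (X ⟶ X) →₀ k) =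
        (Finsupp.single a 1 : (X ⟶ Y) →₀ k) := by
      change Finsupp.lmapDomain k k (fun f : X ⟶ X => f ≫ a) (Finsupp.single (𝟙 X) 1) = _
      simp
    rw [← h2]
    exact h1
  ext Y : 2
  refine ModuleCat.hom_ext (Finsupp.lhom_ext' fun a => LinearMap.ext_ring ?_)
  change (f.app Y).hom (Finsupp.single a 1 : (X ⟶ Y) →₀ k) =
    (g.app Y).hom (Finsupp.single a 1 : (X ⟶ Y) →₀ k)
  exact (key f Y a).trans ((congrArg _ h).trans (key g Y a).symm)

instance (X : D) : Projective (freeAt k X) where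
  factors {E M} f e _ := by
    have : Epi (e.app X) := inferInstance
    obtain ⟨x, hx⟩ := (ModuleCat.epi_iff_surjective (e.app X)).1 this
      ((f.app X).hom (Finsupp.single (𝟙 X) 1 : (X ⟶ X) →₀ k))
    refine ⟨freeAtDesc x, freeAt_hom_ext ?_⟩
    change (e.app X).hom (((freeAtDesc x).app X).hom _) = _
    rw [freeAtDesc_id]
    exact hx

instance : EnoughProjectives (D ⥤ ModuleCat.{u} k) where
  presentation M := by
    let F : ((X : D) × M.obj X) → (D ⥤ ModuleCat.{u} k) := fun x => freeAt k x.1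
    let p : ∐ F ⟶ M := Limits.Sigma.desc fun x => freeAtDesc x.2
    have : ∀ X, Epi (p.app X) := fun X => by
      rw [ModuleCat.epi_iff_surjective]
      intro m
      refine ⟨((Limits.Sigma.ι F ⟨X, m⟩).app X).hom
        (Finsupp.single (𝟙 X) 1 : (X ⟶ X) →₀ k), ?_⟩
      have h : Limits.Sigma.ι F ⟨X, m⟩ ≫ p = freeAtDesc m := Limits.Sigma.ι_desc _ _
      have h2 := congrArg (fun q : freeAt k X ⟶ M => (q.app X).hom
        (Finsupp.single (𝟙 X) 1 : (X ⟶ X) →₀ k)) h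
      exact h2.trans (freeAtDesc_id m)
    have : Epi p := NatTrans.epi_of_epi_app p
    exact ⟨{ p := ∐ F, f := p }⟩

end Projectives

/-- The symmetric category `ΔS`: the full subcategory of noncommutative sets on the nonempty
objects, `n` standing for `[n] = {0, …, n}`. -/
abbrev DeltaS : Type := InducedCategory FAs (fun n : ℕ => FAs.mk (n + 1))

/-- The inclusion of `ΔS` in `ΔS₊`. -/
abbrev DeltaS.incl : DeltaS ⥤ FAs := inducedFunctor _

/-- `Tor_n^C(M, N)`, as the left derived functors of `- ⊗_C N`. -/
noncomputable def tor (k : Type u) [CommRing k] {C : Type} [Category.{0} C]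
    (M : Cᵒᵖ ⥤ ModuleCat.{u} k) (N : C ⥤ ModuleCat.{u} k) (n : ℕ) : ModuleCat.{u} k :=
  ((tensorRight N).leftDerived n).obj M

/-- Symmetric homology, `HS_n(A) = Tor_n^{ΔS}(k, B^{sym}A)`, with `k` the constant right module and
`B^{sym}A : [n] ↦ A^{⊗ (n+1)}`. -/
noncomputable def HS (k A : Type u) [CommRing k] [Ring A] [Algebra k A] (n : ℕ) :
    ModuleCat.{u} k :=
  tor k ((Functor.const DeltaSᵒᵖ).obj (ModuleCat.of k k)) (DeltaS.incl ⋙ BsymPlus k A) n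

/-- The map on symmetric homology induced by an algebra homomorphism. -/
noncomputable def HSMap (k : Type u) {A B : Type u} [CommRing k] [Ring A] [Algebra k A]
    [Ring B] [Algebra k B] (φ : A →ₐ[k] B) (n : ℕ) : HS k A n ⟶ HS k B n :=
  (NatTrans.leftDerived (tensorRightMap (Functor.whiskerLeft DeltaS.incl (BsymPlusMap k φ)))
    n).app _

/-! ### Normalized chain complexes -/

section Normalized

variable {k : Type u} [CommRing k]

/-- The submodule of `X_n` generated by the degenerate simplices. -/
def degenerate (X : SimplicialObject (ModuleCat.{u} k)) (n : ℕ) :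
    Submodule k (X.obj (op ⦋n⦌)) :=
  match n with
  | 0 => ⊥
  | n + 1 => ⨆ i : Fin (n + 1), LinearMap.range (X.σ i).hom

theorem degenerate_le_comap (X : SimplicialObject (ModuleCat.{u} k)) (n : ℕ) :
    degenerate X (n + 1) ≤ (degenerate X n).comap
      (AlgebraicTopology.AlternatingFaceMapComplex.objD X n).hom := by
  refine iSup_le fun j => ?_
  rintro _ ⟨x, rfl⟩
  have hsum : (AlgebraicTopology.AlternatingFaceMapComplex.objD X n).hom ((X.σ j).hom x) =
      ∑ i : Fin (n + 2), (-1 : ℤ) ^ (i : ℕ) • (X.σ j ≫ X.δ i).hom x := by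
    simp [AlgebraicTopology.AlternatingFaceMapComplex.objD, ModuleCat.hom_sum,
      LinearMap.sum_apply]
  have hdeg : ∀ i : Fin (n + 2), i ≠ j.castSucc → i ≠ j.succ →
      (X.σ j ≫ X.δ i).hom x ∈ degenerate X n := by
    intro i h1 h2
    cases n with
    | zero =>
      exfalso
      fin_cases j
      fin_cases i
      · exact h1 rfl
      · exact h2 rfl
    | succ n =>
      have hmem : ∀ (l : Fin (n + 1)) y, (X.σ l).hom y ∈ degenerate X (n + 1) := fun l y =>
        Submodule.mem_iSup_of_mem l ⟨y, rfl⟩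
      rcases lt_or_gt_of_ne h1 with h | h
      · obtain ⟨j', rfl⟩ : ∃ j' : Fin (n + 1), j = j'.succ := by
          refine Fin.exists_succ_eq.2 ?_ |>.imp fun _ h => h.symm
          rintro rfl
          simp at h
        obtain ⟨i', rfl⟩ : ∃ i' : Fin (n + 2), i = i'.castSucc := by
          refine ⟨i.castLT ?_, rfl⟩
          have := Fin.lt_def.1 h
          simp at this
          omega
        rw [X.δ_comp_σ_of_le (by
          have := Fin.lt_def.1 h
          refine Fin.le_def.2 ?_
          simp at this ⊢
          omega)]
        exact hmem _ _
      · have hgt : j.succ < i := by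
          have a1 := Fin.lt_def.1 h
          have a2 : (i : ℕ) ≠ j.succ := fun e => h2 (Fin.ext e)
          refine Fin.lt_def.2 ?_
          simp at a1 a2 ⊢
          omega
        rw [X.δ_comp_σ_of_gt' hgt]
        exact hmem _ _
  rw [Submodule.mem_comap, hsum]
  have hne : j.castSucc ≠ j.succ := (Fin.castSucc_lt_succ).ne
  rw [← Finset.add_sum_erase _ _ (Finset.mem_univ j.castSucc),
    ← Finset.add_sum_erase _ _ (Finset.mem_erase.2 ⟨hne.symm, Finset.mem_univ j.succ⟩),
    X.δ_comp_σ_self, X.δ_comp_σ_succ, ← add_assoc]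
  have h0 : (-1 : ℤ) ^ (j.castSucc : ℕ) • (𝟙 (X.obj (op ⦋n⦌)) : X.obj (op ⦋n⦌) ⟶ _).hom x +
      (-1 : ℤ) ^ (j.succ : ℕ) • (𝟙 (X.obj (op ⦋n⦌)) : X.obj (op ⦋n⦌) ⟶ _).hom x = 0 := by
    simp [pow_succ]
  rw [h0, zero_add]
  refine Submodule.sum_mem _ fun i hi => ?_
  simp only [Finset.mem_erase, Finset.mem_univ, and_true] at hi
  exact zsmul_mem (hdeg i hi.2 hi.1) _

/-- The normalized chain complex of a simplicial `k`-module: the quotient of the complex with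
differential `∑ (-1)^i d_i` by the degenerate simplices. -/
noncomputable def normalized (X : SimplicialObject (ModuleCat.{u} k)) :
    ChainComplex (ModuleCat.{u} k) ℕ :=
  ChainComplex.of (fun n => ModuleCat.of k ((X.obj (op ⦋n⦌)) ⧸ degenerate X n))
    (fun n => ModuleCat.ofHom ((degenerate X (n + 1)).mapQ (degenerate X n)
      (AlgebraicTopology.AlternatingFaceMapComplex.objD X n).hom (degenerate_le_comap X n)))
    (fun n => by
      refine ModuleCat.hom_ext (Submodule.linearMap_qext _ (LinearMap.ext fun x => ?_))
      have h := ConcreteCategory.congr_hom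
        (AlgebraicTopology.AlternatingFaceMapComplex.d_squared X n) x
      exact congrArg (degenerate X n).mkQ h)

theorem normalized_d (X : SimplicialObject (ModuleCat.{u} k)) (n : ℕ) :
    (normalized X).d (n + 1) n = ModuleCat.ofHom ((degenerate X (n + 1)).mapQ (degenerate X n)
      (AlgebraicTopology.AlternatingFaceMapComplex.objD X n).hom (degenerate_le_comap X n)) := by
  simp [normalized, ChainComplex.of_d]

theorem degenerate_le_comap_map {X Y : SimplicialObject (ModuleCat.{u} k)} (f : X ⟶ Y) (n : ℕ) :
    degenerate X n ≤ (degenerate Y n).comap (f.app (op ⦋n⦌)).hom := by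
  cases n with
  | zero => exact bot_le
  | succ n =>
    refine iSup_le fun j => ?_
    rintro _ ⟨x, rfl⟩
    refine Submodule.mem_iSup_of_mem j ⟨(f.app (op ⦋n⦌)).hom x, ?_⟩
    exact (ConcreteCategory.congr_hom (SimplicialObject.σ_naturality f j) x).symm

/-- The map of normalized complexes induced by a map of simplicial `k`-modules. -/
noncomputable def normalizedMap {X Y : SimplicialObject (ModuleCat.{u} k)} (f : X ⟶ Y) :
    normalized X ⟶ normalized Y :=
  ChainComplex.ofHom
    (fun n => ModuleCat.ofHom ((degenerate X n).mapQ (degenerate Y n) (f.app (op ⦋n⦌)).hom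
      (degenerate_le_comap_map f n)))
    (fun n => by
      rw [normalized_d, normalized_d]
      refine ModuleCat.hom_ext (Submodule.linearMap_qext _ (LinearMap.ext fun x => ?_))
      have h : (AlgebraicTopology.AlternatingFaceMapComplex.objD Y n).hom
          ((f.app (op ⦋n + 1⦌)).hom x) = (f.app (op ⦋n⦌)).hom
          ((AlgebraicTopology.AlternatingFaceMapComplex.objD X n).hom x) := by
        have h1 := ((AlgebraicTopology.alternatingFaceMapComplex (ModuleCat.{u} k)).map f).comm
          (n + 1) n
        simp only [AlgebraicTopology.alternatingFaceMapComplex_obj_d,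
          AlgebraicTopology.alternatingFaceMapComplex_map_f] at h1
        exact ConcreteCategory.congr_hom h1 x
      exact congrArg (degenerate Y n).mkQ h)

end Normalized

/-! ### Operads in chain complexes and their algebras

A chain complex `C` is handled through the direct sum `Tot C` of its components. A chain map out of a
tensor product of complexes is a multilinear map on these direct sums that respects degrees and
satisfies the Leibniz rule with the Koszul signs. -/

section Chain

variable {k : Type u} [CommRing k]

/-- The direct sum of the components of a chain complex. -/
abbrev Tot (C : ChainComplex (ModuleCat.{u} k) ℕ) : Type u := DirectSum ℕ fun n => C.X n

/-- The inclusion of the component of degree `n`. -/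
noncomputable def Tot.of (C : ChainComplex (ModuleCat.{u} k) ℕ) (n : ℕ) : C.X n →ₗ[k] Tot C :=
  DirectSum.lof k ℕ (fun n => C.X n) n

/-- The differential, on the direct sum. -/
noncomputable def Tot.d (C : ChainComplex (ModuleCat.{u} k) ℕ) : Tot C →ₗ[k] Tot C :=
  DirectSum.toModule k ℕ _ fun n => Tot.of C (n - 1) ∘ₗ (C.d n (n - 1)).hom

/-- A chain map, on the direct sums. -/
noncomputable def Tot.map {C D : ChainComplex (ModuleCat.{u} k) ℕ} (f : C ⟶ D) :
    Tot C →ₗ[k] Tot D :=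
  DirectSum.toModule k ℕ _ fun n => Tot.of D n ∘ₗ (f.f n).hom

/-- The multilinear map `F` is a chain map `C ⊗ X₁ ⊗ … ⊗ X_m → Z`. -/
structure IsChainMap {m : ℕ} {C : ChainComplex (ModuleCat.{u} k) ℕ}
    {X : Fin m → ChainComplex (ModuleCat.{u} k) ℕ} {Z : ChainComplex (ModuleCat.{u} k) ℕ}
    (F : Tot C →ₗ[k] MultilinearMap k (fun s => Tot (X s)) (Tot Z)) : Prop where
  degree : ∀ (a : ℕ) (c : C.X a) (p : Fin m → ℕ) (x : ∀ s, (X s).X (p s)),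
    F (Tot.of C a c) (fun s => Tot.of (X s) (p s) (x s)) ∈
      LinearMap.range (Tot.of Z (a + ∑ s, p s))
  leibniz : ∀ (a : ℕ) (c : C.X a) (p : Fin m → ℕ) (x : ∀ s, (X s).X (p s)),
    Tot.d Z (F (Tot.of C a c) fun s => Tot.of (X s) (p s) (x s)) =
      F (Tot.d C (Tot.of C a c)) (fun s => Tot.of (X s) (p s) (x s)) +
      ∑ s, (-1 : ℤ) ^ (a + ∑ t with t < s, p t) •
        F (Tot.of C a c) (Function.update (fun s => Tot.of (X s) (p s) (x s)) s
          (Tot.d (X s) (Tot.of (X s) (p s) (x s))))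

/-- The Koszul sign of `x₁ ⊗ … ⊗ x_m ↦ x_{σ⁻¹(1)} ⊗ … ⊗ x_{σ⁻¹(m)}`, for `x_s` of degree `p_s`. -/
def permSign {m : ℕ} (σ : Equiv.Perm (Fin m)) (p : Fin m → ℕ) : ℤ :=
  (-1) ^ (∑ s, ∑ t with s < t ∧ σ t < σ s, p s * p t)

/-- The Koszul sign of `d₁ ⊗ … ⊗ d_m ⊗ x₁ ⊗ … ⊗ x_m ↦ d₁ ⊗ x₁ ⊗ … ⊗ d_m ⊗ x_m`, for `d_s` of
degree `b_s` and `x_s` of degree `e_s`. -/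
def interchangeSign {m : ℕ} (b e : Fin m → ℕ) : ℤ :=
  (-1) ^ (∑ s, ∑ t with s < t, e s * b t)

/-- An operad structure on the chain complexes `P(n)`: right actions of the symmetric groups, a
unit, multiplications `P(m) ⊗ P(j₁) ⊗ … ⊗ P(j_m) → P(j₁ + … + j_m)`, with `P(0) ≅ k`, the unit axioms,
associativity and equivariance. -/
structure ChainOperad (k : Type u) [CommRing k] (P : ℕ → ChainComplex (ModuleCat.{u} k) ℕ) where
  act : ∀ {n m : ℕ}, (Fin n ≃ Fin m) → (P m ⟶ P n)
  one : (P 1).X 0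
  mul : ∀ (m : ℕ) (j : Fin m → ℕ),
    Tot (P m) →ₗ[k] MultilinearMap k (fun s => Tot (P (j s))) (Tot (P (∑ s, j s)))
  mul_isChainMap : ∀ (m : ℕ) (j : Fin m → ℕ), IsChainMap (mul m j)
  zero : Nonempty (P 0 ≅ (ChainComplex.single₀ (ModuleCat.{u} k)).obj (ModuleCat.of k k))
  act_refl : ∀ n, act (Equiv.refl (Fin n)) = 𝟙 _
  act_trans : ∀ {n m l : ℕ} (e : Fin n ≃ Fin m) (f : Fin m ≃ Fin l),
    act (e.trans f) = act f ≫ act e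
  one_mul : ∀ (j : Fin 1 → ℕ) (d : ∀ s, Tot (P (j s))),
    mul 1 j (Tot.of (P 1) 0 one) d = Tot.map (act (finCongr (Fin.sum_univ_one j))) (d 0)
  mul_one : ∀ (m : ℕ) (c : Tot (P m)),
    mul m (fun _ => 1) c (fun _ => Tot.of (P 1) 0 one) =
      Tot.map (act (finCongr (show ∑ _ : Fin m, 1 = m by simp))) c
  assoc : ∀ (m : ℕ) (j : Fin m → ℕ) (i : ∀ s, Fin (j s) → ℕ) (c : Tot (P m))
    (b : Fin m → ℕ) (d : ∀ s, (P (j s)).X (b s))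
    (e : ∀ s, Fin (j s) → ℕ) (x : ∀ s t, (P (i s t)).X (e s t)),
    mul (∑ s, j s) (fun r => i (finSigmaFinEquiv.symm r).1 (finSigmaFinEquiv.symm r).2)
        (mul m j c fun s => Tot.of _ _ (d s))
        (fun r => Tot.of _ _ (x (finSigmaFinEquiv.symm r).1 (finSigmaFinEquiv.symm r).2)) =
      interchangeSign b (fun s => ∑ t, e s t) •
        Tot.map (act (finCongr (sum_flatten i)))
          (mul m (fun s => ∑ t, i s t) c
            fun s => mul (j s) (i s) (Tot.of _ _ (d s)) fun t => Tot.of _ _ (x s t))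
  equivariance_left : ∀ (m : ℕ) (j : Fin m → ℕ) (σ : Equiv.Perm (Fin m)) (c : Tot (P m))
    (p : Fin m → ℕ) (d : ∀ s, (P (j s)).X (p s)),
    mul m j (Tot.map (act σ) c) (fun s => Tot.of _ _ (d s)) =
      permSign σ p • Tot.map (act (blockEquiv σ j))
        (mul m (fun s => j (σ.symm s)) c fun s => Tot.of _ _ (d (σ.symm s)))
  equivariance_right : ∀ (m : ℕ) (j : Fin m → ℕ) (τ : ∀ s, Equiv.Perm (Fin (j s)))
    (c : Tot (P m)) (d : ∀ s, Tot (P (j s))),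
    mul m j c (fun s => Tot.map (act (τ s)) (d s)) =
      Tot.map (act (sumEquiv τ)) (mul m j c d)

/-- An `E_∞`-operad: there are augmentations `P(n) → k`, compatible with the operad structures of
`P` and of the commutative operad, which make each `P(n)` a resolution of `k` by free
`k[S_n]`-modules. -/
structure ChainOperad.IsEInfinity {P : ℕ → ChainComplex (ModuleCat.{u} k) ℕ}
    (O : ChainOperad k P) : Prop where
  resolution : ∃ ε : ∀ n, Tot (P n) →ₗ[k] k,
    (∀ (n q : ℕ) (x : (P n).X (q + 1)), ε n (Tot.of _ _ x) = 0) ∧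
    ε 1 (Tot.of _ _ O.one) = 1 ∧
    (∀ (n m : ℕ) (e : Fin n ≃ Fin m) (c : Tot (P m)), ε n (Tot.map (O.act e) c) = ε m c) ∧
    (∀ (m : ℕ) (j : Fin m → ℕ) (c : Tot (P m)) (d : ∀ s, Tot (P (j s))),
      ε _ (O.mul m j c d) = ε m c * ∏ s, ε (j s) (d s)) ∧
    ∀ n, Function.Surjective (fun x : (P n).X 0 => ε n (Tot.of _ _ x)) ∧
      Function.Exact ((P n).d 1 0).hom (fun x : (P n).X 0 => ε n (Tot.of _ _ x)) ∧
      ∀ q, Function.Exact ((P n).d (q + 2) (q + 1)).hom ((P n).d (q + 1) q).hom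
  free : ∀ n q, ∃ (ι : Type u) (b : Module.Basis (ι × Equiv.Perm (Fin n)) k ((P n).X q)),
    ∀ i σ, b (i, σ) = ((O.act σ).f q).hom (b (i, 1))

/-- The structure of an algebra over a chain operad on a complex `X`: chain maps
`P(n) ⊗ X^{⊗ n} → X` that are unital, equivariant (they factor over `P(n) ⊗_{S_n} X^{⊗ n}`) and
associative. -/
structure ChainAlgebra {P : ℕ → ChainComplex (ModuleCat.{u} k) ℕ} (O : ChainOperad k P)
    (X : ChainComplex (ModuleCat.{u} k) ℕ) where
  act : ∀ n : ℕ, Tot (P n) →ₗ[k] MultilinearMap k (fun _ : Fin n => Tot X) (Tot X)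
  act_isChainMap : ∀ n, IsChainMap (act n)
  one_act : ∀ x : Fin 1 → Tot X, act 1 (Tot.of _ _ O.one) x = x 0
  equivariance : ∀ (n : ℕ) (σ : Equiv.Perm (Fin n)) (c : Tot (P n)) (p : Fin n → ℕ)
    (x : ∀ s, X.X (p s)),
    act n (Tot.map (O.act σ) c) (fun s => Tot.of _ _ (x s)) =
      permSign σ p • act n c fun s => Tot.of _ _ (x (σ.symm s))
  assoc : ∀ (m : ℕ) (j : Fin m → ℕ) (c : Tot (P m))
    (b : Fin m → ℕ) (d : ∀ s, (P (j s)).X (b s))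
    (e : ∀ s, Fin (j s) → ℕ) (x : ∀ s t, X.X (e s t)),
    act (∑ s, j s) (O.mul m j c fun s => Tot.of _ _ (d s))
        (fun r => Tot.of _ _ (x (finSigmaFinEquiv.symm r).1 (finSigmaFinEquiv.symm r).2)) =
      interchangeSign b (fun s => ∑ t, e s t) •
        act m c fun s => act (j s) (Tot.of _ _ (d s)) fun t => Tot.of _ _ (x s t)

/-! ### Algebras over the simplicial operad, and passage to chain complexes by shuffles -/

/-- The structure of an algebra over the operad `k[N P]` in simplicial `k`-modules (with the
degreewise tensor product) on `Y`: maps `k[N P(n)] ⊗ Y^{⊗ n} → Y` of simplicial `k`-modules that are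
unital, equivariant and associative. The last three conditions are stated for the basis `N P` of
`k[N P]`, whose operad structure is that of `P` applied to simplices. -/
structure SimplicialAlgebra (P : CatOperadData) (Y : SimplicialObject (ModuleCat.{u} k)) where
  act : ∀ n q : ℕ, (linNerve k (P.obj n)).obj (op ⦋q⦌) →ₗ[k]
    MultilinearMap k (fun _ : Fin n => Y.obj (op ⦋q⦌)) (Y.obj (op ⦋q⦌))
  naturality : ∀ (n q q' : ℕ) (φ : ⦋q'⦌ ⟶ ⦋q⦌) (c : (linNerve k (P.obj n)).obj (op ⦋q⦌))
    (y : Fin n → Y.obj (op ⦋q⦌)),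
    (Y.map φ.op).hom (act n q c y) =
      act n q' (((linNerve k (P.obj n)).map φ.op).hom c) fun s => (Y.map φ.op).hom (y s)
  one_act : ∀ (q : ℕ) (y : Fin 1 → Y.obj (op ⦋q⦌)),
    act 1 q (chain k ((Functor.const (Fin (q + 1))).obj P.one)) y = y 0
  equivariance : ∀ (n q : ℕ) (σ : Equiv.Perm (Fin n)) (c : Fin (q + 1) ⥤ P.obj n)
    (y : Fin n → Y.obj (op ⦋q⦌)),
    act n q (chain k (c ⋙ P.act σ)) y = act n q (chain k c) fun s => y (σ.symm s)
  assoc : ∀ (q m : ℕ) (j : Fin m → ℕ) (c : Fin (q + 1) ⥤ P.obj m)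
    (d : ∀ s, Fin (q + 1) ⥤ P.obj (j s)) (y : ∀ s, Fin (j s) → Y.obj (op ⦋q⦌)),
    act (∑ s, j s) q (chain k (P.comp c d))
        (fun r => y (finSigmaFinEquiv.symm r).1 (finSigmaFinEquiv.symm r).2) =
      act m q (chain k c) fun s => act (j s) q (chain k (d s)) (y s)

/-! shuffles -/

/-- The `(a, p₁, …, p_m)`-shuffles, written as words: `w r = 0` if the `r`-th step is taken in the
first factor, `w r = s + 1` if it is taken in the factor with index `s`. -/
def Shuffle {m : ℕ} (a : ℕ) (p : Fin m → ℕ) : Type :=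
  {w : Fin (a + ∑ s, p s) → Fin (m + 1) //
    Finset.card {r | w r = 0} = a ∧ ∀ s : Fin m, Finset.card {r | w r = s.succ} = p s}

instance {m : ℕ} (a : ℕ) (p : Fin m → ℕ) : Fintype (Shuffle a p) :=
  inferInstanceAs (Fintype {w : Fin (a + ∑ s, p s) → Fin (m + 1) //
    Finset.card {r | w r = 0} = a ∧ ∀ s : Fin m, Finset.card {r | w r = s.succ} = p s})

/-- The surjective monotone map that increases at the steps labelled `v`. It is a composite of
degeneracies. -/
def stepMap {q n b : ℕ} (w : Fin q → Fin n) (v : Fin n)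
    (h : Finset.card {r | w r = v} = b) : ⦋q⦌ ⟶ ⦋b⦌ :=
  SimplexCategory.mkHom
    { toFun := fun t => ⟨Finset.card (Finset.univ.filter fun r : Fin q => (r : ℕ) < t ∧ w r = v), by
        refine Nat.lt_succ_of_le ?_
        conv_rhs => rw [← h]
        exact Finset.card_le_card fun r hr => by simp at hr ⊢; exact hr.2⟩
      monotone' := fun t t' htt => Fin.le_def.2 (Finset.card_le_card fun r hr => by
        simp at hr ⊢
        exact ⟨hr.1.trans_le htt, hr.2⟩) }

namespace Shuffle

variable {m a : ℕ} {p : Fin m → ℕ} (w : Shuffle a p)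

/-- The sign of the shuffle. -/
def sign : ℤ := (-1) ^ Finset.card (Finset.univ.filter
  fun x : Fin (a + ∑ s, p s) × Fin (a + ∑ s, p s) => x.1 < x.2 ∧ w.1 x.2 < w.1 x.1)

/-- The degeneracy applied to the first factor. -/
def fst : ⦋a + ∑ s, p s⦌ ⟶ ⦋a⦌ := stepMap w.1 0 w.2.1

/-- The degeneracy applied to the factor with index `s`. -/
def snd (s : Fin m) : ⦋a + ∑ s, p s⦌ ⟶ ⦋p s⦌ := stepMap w.1 s.succ (w.2.2 s)

end Shuffle

/-- The class of a simplex in the normalized complex. -/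
noncomputable def cls (X : SimplicialObject (ModuleCat.{u} k)) (n : ℕ) (x : X.obj (op ⦋n⦌)) :
    Tot (normalized X) :=
  Tot.of (normalized X) n ((degenerate X n).mkQ x)

/-- The action of a simplicial operator on a string of morphisms. -/
def pull {C : Type} [Category.{0} C] {a q : ℕ} (c : Fin (a + 1) ⥤ C) (φ : ⦋q⦌ ⟶ ⦋a⦌) :
    Fin (q + 1) ⥤ C :=
  (nerve C).map φ.op c

/-- The normalized complexes of `k[N P(n)]`. For `P = D_cat` they form `D_ch`. -/
noncomputable abbrev normalizedNerve (k : Type u) [CommRing k] (P : CatOperadData) (n : ℕ) :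
    ChainComplex (ModuleCat.{u} k) ℕ :=
  normalized (linNerve k (P.obj n))

/-- The operad structure on the normalized complexes of `k[N P]` is the one induced by `P` through the
shuffle maps. -/
structure ChainOperad.IsInduced (P : CatOperadData) (O : ChainOperad k (normalizedNerve k P)) :
    Prop where
  act : ∀ {n m : ℕ} (e : Fin n ≃ Fin m), O.act e = normalizedMap (linNerveMap k (P.act e))
  one : Tot.of _ _ O.one = cls (linNerve k (P.obj 1)) 0
    (chain k ((Functor.const (Fin (0 + 1))).obj P.one))
  mul : ∀ (m : ℕ) (j : Fin m → ℕ) (a : ℕ) (p : Fin m → ℕ) (c : Fin (a + 1) ⥤ P.obj m)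
    (d : ∀ s, Fin (p s + 1) ⥤ P.obj (j s)),
    O.mul m j (cls _ a (chain k c)) (fun s => cls _ (p s) (chain k (d s))) =
      ∑ w : Shuffle a p, w.sign • cls (linNerve k (P.obj (∑ s, j s))) (a + ∑ s, p s)
        (chain k (P.comp (pull c w.fst) fun s => pull (d s) (w.snd s)))

/-- The algebra structure on the normalized complex of `Y` is the one induced by the simplicial
algebra structure on `Y` through the shuffle maps. -/
def ChainAlgebra.IsInduced {P : CatOperadData} {O : ChainOperad k (normalizedNerve k P)}
    {Y : SimplicialObject (ModuleCat.{u} k)} (S : SimplicialAlgebra P Y)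
    (T : ChainAlgebra O (normalized Y)) : Prop :=
  ∀ (n a : ℕ) (p : Fin n → ℕ) (c : (linNerve k (P.obj n)).obj (op ⦋a⦌))
    (y : ∀ s, Y.obj (op ⦋p s⦌)),
    T.act n (cls _ a c) (fun s => cls Y (p s) (y s)) =
      ∑ w : Shuffle a p, w.sign • cls Y (a + ∑ s, p s)
        (S.act n (a + ∑ s, p s) (((linNerve k (P.obj n)).map w.fst.op).hom c)
          fun s => (Y.map (w.snd s).op).hom (y s))

/-- A unital, associative, graded-commutative `k`-algebra structure on a graded `k`-module. -/
structure GradedCommAlgebra (H : ℕ → ModuleCat.{u} k) where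
  one : H 0
  mul : ∀ {p q r : ℕ}, p + q = r → (H p →ₗ[k] H q →ₗ[k] H r)
  one_mul : ∀ {p : ℕ} (x : H p), mul (Nat.zero_add p) one x = x
  mul_assoc : ∀ {p q r pq qr n : ℕ} (h₁ : p + q = pq) (h₂ : pq + r = n) (h₃ : q + r = qr)
    (h₄ : p + qr = n) (x : H p) (y : H q) (z : H r),
    mul h₂ (mul h₁ x y) z = mul h₄ x (mul h₃ y z)
  mul_comm : ∀ {p q n : ℕ} (h : p + q = n) (h' : q + p = n) (x : H p) (y : H q),
    mul h x y = (-1 : ℤ) ^ (p * q) • mul h' y x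

end Chain

end SymHom

open SymHom

namespace SymHom

/-! ### Order characterizations of the block bijections -/

/-! Operad and module. A permutation of a finite ordinal is determined by the order that it pulls
back, and the operadic product of permutations pulls back the lexicographic order: first compare the
blocks by `σ`, then the places inside a block. Since `D_cat(m)` is codiscrete, two functors to it
agree as soon as these orders agree (`Dcat_functor_ext`), and each operad axiom becomes an
equivalence between lexicographic comparisons. The target of `μ(σ, f₁, …, f_m)` is likewise the
disjoint union of the targets in a lexicographic order, with the fibres of the `f_s`. Functors to
`K_cat` are compared through an order-preserving bijection of targets under which the fibres
correspond (`Kcat_functor_ext'`).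

Action on `Y₊A`. The functor `μ` is natural for precomposition with all morphisms of noncommutative
sets, not only with permutations (`Kcat_comp_map`), and concatenation of tensors has the same
naturality (`tensorConcat_map`). So the formula for the action respects the relation that defines
the tensor product over `ΔS₊`, and the module axioms for `K_cat` give the algebra axioms on
generators.

Passage to chains. A shuffle is a word `w` in which the letter `i` occurs `p i` times; its
degeneracies count occurrences, and its sign is the parity of its inversions. Everything needed from
the shuffle maps is a statement on words. Leibniz rule (`words_leibniz`): a face between two
different letters cancels against the word with these letters exchanged, and every other face is a
face of one factor. Composition (`words_comp`): shuffles of shuffles are shuffles in a refined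
alphabet, and inversions add. Reordering (`words_reorder`): renaming the letters multiplies by a
Koszul sign that does not depend on the word. Together with the vanishing on degenerate simplices
(`NatMul.eval_degenerate`), these turn simplicial operads and algebras into chain operads and
algebras.

The `E_∞` property. Every object of `D_cat(n)` is initial, and putting an initial object in front of
a string contracts the complex of a nerve. Normalized chains have the nondegenerate strings as a
basis, on which `S_n` acts freely because it acts freely on first vertices.

Symmetric homology. In each degree `k[N(- \ C)]` is a free right module on the strings in `C`, and
at each `X` the nerve of `X \ C` is contractible because `𝟙 X` is initial there. So it is a
projective resolution of the constant module, and `k[N(- \ C)] ⊗_C N` computes `Tor^C(k, N)`. To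
pass from `ΔS` to `ΔS₊`, use the functor that adjoins a point. Together with the inclusion it gives
endofunctors that receive natural transformations from the identities. These induce endomorphisms of
the bar resolutions that preserve the augmentation, hence are homotopic to the identity
(`barHomotopy`), so restriction along the inclusion is an isomorphism on homology
(`barRestrictIso`).

Product. Two operations of degree zero with the same augmentation differ by a boundary, so they act
in the same way on homology classes (`ChainAlgebra.act_sub_mem`). Unit, associativity and
commutativity hold because in each case the two sides come from operations with equal augmentations.
-/

theorem finSigmaFinEquiv_lt {m : ℕ} {n : Fin m → ℕ} (x y : (s : Fin m) × Fin (n s)) :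
    finSigmaFinEquiv x < finSigmaFinEquiv y ↔
      x.1 < y.1 ∨ (x.1 = y.1 ∧ (x.2 : ℕ) < y.2) := by
  -- The offset of a block is rewritten as a sum over an initial segment of `ℕ`, with default value
  -- `0` beyond `m`, so that offsets of different blocks become comparable.
  have key : ∀ x : (s : Fin m) × Fin (n s), (finSigmaFinEquiv x : ℕ) =
      ∑ i ∈ Finset.range x.1, (if h : i < m then n ⟨i, h⟩ else 0) + x.2 := by
    intro x
    rw [finSigmaFinEquiv_apply, ← Fin.sum_univ_eq_sum_range]
    congr 1
    refine Finset.sum_congr rfl fun i _ => ?_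
    rw [dif_pos (i.2.trans x.1.2)]
    rfl
  have h1 : ∀ x y : (s : Fin m) × Fin (n s), x.1 < y.1 →
      finSigmaFinEquiv x < finSigmaFinEquiv y := by
    intro x y h
    rw [Fin.lt_def, key, key]
    have h2 : ∑ i ∈ Finset.range (x.1 + 1), (if h : i < m then n ⟨i, h⟩ else 0) ≤
        ∑ i ∈ Finset.range y.1, (if h : i < m then n ⟨i, h⟩ else 0) :=
      Finset.sum_le_sum_of_subset (Finset.range_mono h)
    rw [Finset.sum_range_succ, dif_pos x.1.2] at h2
    have := x.2.2
    simp only [Fin.eta] at h2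
    omega
  have h2 : ∀ x y : (s : Fin m) × Fin (n s), x.1 = y.1 → (x.2 : ℕ) < y.2 →
      finSigmaFinEquiv x < finSigmaFinEquiv y := by
    rintro ⟨s, t⟩ ⟨s', t'⟩ h h'
    obtain rfl : s = s' := h
    rw [Fin.lt_def, key, key]
    exact Nat.add_lt_add_left h' _
  constructor
  · intro h
    rcases lt_trichotomy x.1 y.1 with hlt | heq | hgt
    · exact Or.inl hlt
    · refine Or.inr ⟨heq, ?_⟩
      by_contra hle
      rcases lt_or_eq_of_le (not_lt.1 hle) with h3 | h3
      · exact absurd h (h2 y x heq.symm h3).asymm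
      · obtain ⟨s, t⟩ := x
        obtain ⟨s', t'⟩ := y
        obtain rfl : s = s' := heq
        obtain rfl := Fin.ext h3
        exact absurd h (lt_irrefl _)
    · exact absurd h (h1 y x hgt).asymm
  · rintro (h | ⟨h, h'⟩)
    · exact h1 x y h
    · exact h2 x y h h'

theorem lt_iff_finSigmaFinEquiv_symm {m : ℕ} {n : Fin m → ℕ} (r r' : Fin (∑ s, n s)) :
    r < r' ↔ (finSigmaFinEquiv.symm r).1 < (finSigmaFinEquiv.symm r').1 ∨
      ((finSigmaFinEquiv.symm r).1 = (finSigmaFinEquiv.symm r').1 ∧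
        ((finSigmaFinEquiv.symm r).2 : ℕ) < (finSigmaFinEquiv.symm r').2) := by
  rw [← finSigmaFinEquiv_lt, Equiv.apply_symm_apply, Equiv.apply_symm_apply]

/-- Two bijections with initial segments that induce the same order have the same values. -/
theorem equiv_val_eq_of_lt_iff {α : Type*} {n m : ℕ} (e : α ≃ Fin n) (f : α ≃ Fin m)
    (h : ∀ a b, e a < e b ↔ f a < f b) (a : α) : (e a : ℕ) = f a := by
  obtain rfl : n = m := by simpa using Fintype.card_congr (e.symm.trans f)
  let o : Fin n ≃o Fin n :=
    { toEquiv := e.symm.trans f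
      map_rel_iff' := by
        intro x y
        rw [← not_lt, ← not_lt]
        have := h (e.symm y) (e.symm x)
        simp only [Equiv.apply_symm_apply] at this
        exact not_congr this.symm }
  -- A finite linear order has no automorphism except the identity.
  have h1 : o = OrderIso.refl _ := Subsingleton.elim _ _
  have h2 : o (e a) = e a := by rw [h1]; rfl
  rw [← h2]
  simp [o]

theorem equiv_eq_of_lt_iff {α : Type*} {n : ℕ} (e f : α ≃ Fin n)
    (h : ∀ a b, e a < e b ↔ f a < f b) : e = f :=
  Equiv.ext fun a => Fin.ext (equiv_val_eq_of_lt_iff e f h a)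

/-- The bijection from the disjoint union of the blocks to the blocks permuted by `σ`. -/
def blockSigma {m : ℕ} (σ : Equiv.Perm (Fin m)) (p : Fin m → ℕ) :
    ((s : Fin m) × Fin (p s)) ≃ Fin (∑ s, p (σ.symm s)) :=
  finSigmaFinEquiv.trans (blockEquiv σ p)

theorem blockEquiv_symm_finSigma {m : ℕ} (σ : Equiv.Perm (Fin m)) (p : Fin m → ℕ)
    (x : (s : Fin m) × Fin (p (σ.symm s))) :
    (blockEquiv σ p).symm (finSigmaFinEquiv x) = finSigmaFinEquiv ⟨σ.symm x.1, x.2⟩ := by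
  simp only [blockEquiv, Equiv.symm_trans_apply, Equiv.symm_apply_apply, Equiv.symm_symm]
  rfl

theorem blockEquiv_apply_symm {m : ℕ} (σ : Equiv.Perm (Fin m)) (p : Fin m → ℕ)
    (x : (s : Fin m) × Fin (p (σ.symm s))) :
    blockEquiv σ p (finSigmaFinEquiv ⟨σ.symm x.1, x.2⟩) = finSigmaFinEquiv x := by
  rw [← blockEquiv_symm_finSigma, Equiv.apply_symm_apply]

/-- The image of `x` lies in the block `σ x.1`, whose size is `p (σ.symm (σ x.1))`, equal to `p x.1`
only propositionally. The existential form keeps this cast out of later computations. -/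
theorem blockEquiv_finSigma {m : ℕ} (σ : Equiv.Perm (Fin m)) (p : Fin m → ℕ)
    (x : (s : Fin m) × Fin (p s)) :
    ∃ y : (s : Fin m) × Fin (p (σ.symm s)), y.1 = σ x.1 ∧ (y.2 : ℕ) = x.2 ∧
      (⟨σ.symm y.1, y.2⟩ : (s : Fin m) × Fin (p s)) = x ∧
      blockEquiv σ p (finSigmaFinEquiv x) = finSigmaFinEquiv y := by
  obtain ⟨s, t⟩ := x
  obtain ⟨s, rfl⟩ := σ.symm.surjective s
  exact ⟨⟨s, t⟩, by simp, rfl, rfl, blockEquiv_apply_symm σ p ⟨s, t⟩⟩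

/-- This lexicographic rule is what turns the axioms for `Dcat` and `Kcat` into comparisons of
orders. -/
theorem blockSigma_lt {m : ℕ} (σ : Equiv.Perm (Fin m)) (p : Fin m → ℕ)
    (x y : (s : Fin m) × Fin (p s)) :
    blockSigma σ p x < blockSigma σ p y ↔
      σ x.1 < σ y.1 ∨ (x.1 = y.1 ∧ (x.2 : ℕ) < y.2) := by
  obtain ⟨x', h1, h2, -, h3⟩ := blockEquiv_finSigma σ p x
  obtain ⟨y', h4, h5, -, h6⟩ := blockEquiv_finSigma σ p y
  change blockEquiv σ p _ < blockEquiv σ p _ ↔ _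
  rw [h3, h6, finSigmaFinEquiv_lt, h2, h5, ← σ.injective.eq_iff (a := x.1), ← h1, ← h4]

@[simp] theorem sumEquiv_finSigma {m : ℕ} {j : Fin m → ℕ} (τ : ∀ s, Equiv.Perm (Fin (j s)))
    (x : (s : Fin m) × Fin (j s)) :
    sumEquiv τ (finSigmaFinEquiv x) = finSigmaFinEquiv ⟨x.1, τ x.1 x.2⟩ := by
  simp only [sumEquiv, Equiv.trans_apply, Equiv.symm_apply_apply]
  rfl

/-- Both ways of bracketing a union of blocks of blocks list the elements in the same lexicographic
order, so the two numberings have equal values. -/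
theorem sum_flatten_val {m : ℕ} {j : Fin m → ℕ} (i : ∀ s, Fin (j s) → ℕ)
    (x : (r : Fin (∑ s, j s)) ×
      Fin (i (finSigmaFinEquiv.symm r).1 (finSigmaFinEquiv.symm r).2)) :
    finCongr (sum_flatten i) (finSigmaFinEquiv x) =
      finSigmaFinEquiv (n := fun s => ∑ t, i s t) ⟨(finSigmaFinEquiv.symm x.1).1,
        finSigmaFinEquiv ⟨(finSigmaFinEquiv.symm x.1).2, x.2⟩⟩ := by
  let e : ((r : Fin (∑ s, j s)) ×
      Fin (i (finSigmaFinEquiv.symm r).1 (finSigmaFinEquiv.symm r).2)) ≃ Fin (∑ s, ∑ t, i s t) :=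
    ((finSigmaFinEquiv (n := j)).symm.sigmaCongrLeft (β := fun v => Fin (i v.1 v.2))).trans
      ((Equiv.sigmaAssoc fun s t => Fin (i s t)).trans
        ((Equiv.sigmaCongrRight fun _ => finSigmaFinEquiv).trans finSigmaFinEquiv))
  refine Fin.ext (equiv_val_eq_of_lt_iff (finSigmaFinEquiv.trans (finCongr (sum_flatten i))) e
    ?_ x)
  rintro ⟨r, u⟩ ⟨r', u'⟩
  refine Iff.trans (b := finSigmaFinEquiv (n := fun r : Fin (∑ s, j s) =>
    i (finSigmaFinEquiv.symm r).1 (finSigmaFinEquiv.symm r).2) ⟨r, u⟩ <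
      finSigmaFinEquiv ⟨r', u'⟩) Iff.rfl ?_
  change _ ↔
    finSigmaFinEquiv (n := fun s => ∑ t, i s t) ⟨(finSigmaFinEquiv.symm r).1,
        finSigmaFinEquiv ⟨(finSigmaFinEquiv.symm r).2, u⟩⟩ <
      finSigmaFinEquiv ⟨(finSigmaFinEquiv.symm r').1,
        finSigmaFinEquiv ⟨(finSigmaFinEquiv.symm r').2, u'⟩⟩
  rw [finSigmaFinEquiv_lt, finSigmaFinEquiv_lt]
  dsimp only
  rw [lt_iff_finSigmaFinEquiv_symm r r', ← finSigmaFinEquiv.symm.injective.eq_iff (a := r)]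
  -- The type of `u` depends on the pair belonging to `r`; once this pair is a variable it can be
  -- split, and only the cases of equal and different outer blocks remain.
  generalize finSigmaFinEquiv.symm r = v at u ⊢
  generalize finSigmaFinEquiv.symm r' = v' at u' ⊢
  obtain ⟨s, t⟩ := v
  obtain ⟨s', t'⟩ := v'
  dsimp only at u u' ⊢
  by_cases hs : s = s'
  · subst hs
    rw [← Fin.lt_def, ← Fin.lt_def, finSigmaFinEquiv_lt]
    simp
  · simp [hs]

/-! ### The operad `D_cat` -/

/-- Values are compared in `ℕ`, where the identification of `∑ s, j (σ⁻¹ s)` with `∑ s, j s` built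
into the multiplication is invisible. -/
theorem Dcat_mul_finSigma {m : ℕ} (j : Fin m → ℕ) (c : Dcat.obj m) (d : ∀ s, Dcat.obj (j s))
    (x : (s : Fin m) × Fin (j s)) :
    (((Dcat.mul m j).obj (c, d)).as (finSigmaFinEquiv x) : ℕ) =
      blockSigma c.as j ⟨x.1, (d x.1).as x.2⟩ := by
  change ((blockEquiv c.as j (sumEquiv (fun s => (d s).as) (finSigmaFinEquiv x)) : Fin _) : ℕ) = _
  rw [sumEquiv_finSigma]
  rfl

theorem Dcat_mul_lt {m : ℕ} (j : Fin m → ℕ) (c : Dcat.obj m) (d : ∀ s, Dcat.obj (j s))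
    (x y : (s : Fin m) × Fin (j s)) :
    ((Dcat.mul m j).obj (c, d)).as (finSigmaFinEquiv x) <
        ((Dcat.mul m j).obj (c, d)).as (finSigmaFinEquiv y) ↔
      c.as x.1 < c.as y.1 ∨ (x.1 = y.1 ∧ ((d x.1).as x.2 : ℕ) < (d y.1).as y.2) := by
  rw [Fin.lt_def, Dcat_mul_finSigma, Dcat_mul_finSigma, ← Fin.lt_def, blockSigma_lt]

theorem Dcat_mul_lt' {m : ℕ} (j : Fin m → ℕ) (c : Dcat.obj m) (d : ∀ s, Dcat.obj (j s))
    (r r' : Fin (∑ s, j s)) :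
    ((Dcat.mul m j).obj (c, d)).as r < ((Dcat.mul m j).obj (c, d)).as r' ↔
      c.as (finSigmaFinEquiv.symm r).1 < c.as (finSigmaFinEquiv.symm r').1 ∨
      ((finSigmaFinEquiv.symm r).1 = (finSigmaFinEquiv.symm r').1 ∧
        ((d (finSigmaFinEquiv.symm r).1).as (finSigmaFinEquiv.symm r).2 : ℕ) <
          (d (finSigmaFinEquiv.symm r').1).as (finSigmaFinEquiv.symm r').2) := by
  rw [← Dcat_mul_lt, Equiv.apply_symm_apply, Equiv.apply_symm_apply]

section

variable {T : Type} [Category.{0} T] {m : ℕ} {j : Fin m → ℕ} (c : T ⥤ Dcat.obj m)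
  (d : ∀ s, T ⥤ Dcat.obj (j s)) (t : T)

theorem Dcat_comp_obj :
    (Dcat.comp c d).obj t = (Dcat.mul m j).obj (c.obj t, fun s => (d s).obj t) := rfl

theorem Dcat_comp_lt (x y : (s : Fin m) × Fin (j s)) :
    ((Dcat.comp c d).obj t).as (finSigmaFinEquiv x) <
        ((Dcat.comp c d).obj t).as (finSigmaFinEquiv y) ↔
      (c.obj t).as x.1 < (c.obj t).as y.1 ∨
        (x.1 = y.1 ∧ (((d x.1).obj t).as x.2 : ℕ) < ((d y.1).obj t).as y.2) := by
  rw [Dcat_comp_obj]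
  exact Dcat_mul_lt j _ _ x y

theorem Dcat_comp_lt' (r r' : Fin (∑ s, j s)) :
    ((Dcat.comp c d).obj t).as r < ((Dcat.comp c d).obj t).as r' ↔
      (c.obj t).as (finSigmaFinEquiv.symm r).1 < (c.obj t).as (finSigmaFinEquiv.symm r').1 ∨
      ((finSigmaFinEquiv.symm r).1 = (finSigmaFinEquiv.symm r').1 ∧
        (((d (finSigmaFinEquiv.symm r).1).obj t).as (finSigmaFinEquiv.symm r).2 : ℕ) <
          ((d (finSigmaFinEquiv.symm r').1).obj t).as (finSigmaFinEquiv.symm r').2) := by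
  rw [Dcat_comp_obj]
  exact Dcat_mul_lt' j _ _ r r'

theorem Dcat_comp_act_lt {n n' : ℕ} (c : T ⥤ Dcat.obj n) (e : Fin n' ≃ Fin n) (i i' : Fin n') :
    ((c ⋙ Dcat.act e).obj t).as i < ((c ⋙ Dcat.act e).obj t).as i' ↔
      (c.obj t).as (e i) < (c.obj t).as (e i') := Iff.rfl

end

/-- Functors to `D_cat(n)` agree if their values induce the same orders. -/
theorem Dcat_functor_ext {T : Type} [Category.{0} T] {n : ℕ} {F G : T ⥤ Dcat.obj n}
    (h : ∀ t i i', (F.obj t).as i < (F.obj t).as i' ↔ (G.obj t).as i < (G.obj t).as i') :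
    F = G := by
  have h1 : ∀ t, F.obj t = G.obj t := fun t =>
    congrArg Codiscrete.mk (equiv_eq_of_lt_iff _ _ (h t))
  -- Morphisms cause no obligation: the hom-sets of a codiscrete category are singletons.
  exact CategoryTheory.Functor.ext h1 fun _ _ _ => rfl

theorem Dcat_one_comp (T : Type) [Category.{0} T] (j : Fin 1 → ℕ)
    (d : ∀ s, T ⥤ Dcat.obj (j s)) :
    Dcat.comp ((Functor.const T).obj Dcat.one) d =
      d 0 ⋙ Dcat.act (finCongr (Fin.sum_univ_one j)) := Dcat_functor_ext fun t i i' => by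
  obtain ⟨⟨s, x⟩, rfl⟩ := finSigmaFinEquiv.surjective i
  obtain ⟨⟨s', x'⟩, rfl⟩ := finSigmaFinEquiv.surjective i'
  obtain rfl := Subsingleton.elim s 0
  obtain rfl := Subsingleton.elim s' 0
  have h : ∀ x, finCongr (Fin.sum_univ_one j) (finSigmaFinEquiv ⟨0, x⟩) = x := fun x =>
    Fin.ext (finSigmaFinEquiv_one _)
  rw [Dcat_comp_lt, Dcat_comp_act_lt, h, h]
  simp

theorem Dcat_comp_one (T : Type) [Category.{0} T] (m : ℕ) (c : T ⥤ Dcat.obj m) :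
    Dcat.comp c (fun _ : Fin m => (Functor.const T).obj Dcat.one) =
      c ⋙ Dcat.act (finCongr (show ∑ _ : Fin m, 1 = m by simp)) :=
  Dcat_functor_ext fun t i i' => by
  obtain ⟨⟨s, x⟩, rfl⟩ := finSigmaFinEquiv.surjective i
  obtain ⟨⟨s', x'⟩, rfl⟩ := finSigmaFinEquiv.surjective i'
  have h : ∀ s x, finCongr (show ∑ _ : Fin m, 1 = m by simp)
      (finSigmaFinEquiv (n := fun _ : Fin m => 1) ⟨s, x⟩) = s := fun s x =>
    Fin.ext (by simp)
  rw [Dcat_comp_lt, Dcat_comp_act_lt, h, h]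
  simp

theorem Dcat_assoc (T : Type) [Category.{0} T] (m : ℕ) (j : Fin m → ℕ)
    (i : ∀ s, Fin (j s) → ℕ) (c : T ⥤ Dcat.obj m) (d : ∀ s, T ⥤ Dcat.obj (j s))
    (b : ∀ s t, T ⥤ Dcat.obj (i s t)) :
    Dcat.comp (Dcat.comp c d)
        (fun r => b (finSigmaFinEquiv.symm r).1 (finSigmaFinEquiv.symm r).2) =
      Dcat.comp c (fun s => Dcat.comp (d s) (b s)) ⋙ Dcat.act (finCongr (sum_flatten i)) :=
  Dcat_functor_ext fun t r r' => by
  obtain ⟨⟨r, u⟩, rfl⟩ := finSigmaFinEquiv.surjective r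
  obtain ⟨⟨r', u'⟩, rfl⟩ := finSigmaFinEquiv.surjective r'
  rw [Dcat_comp_lt, Dcat_comp_act_lt, sum_flatten_val, sum_flatten_val, Dcat_comp_lt]
  dsimp only
  rw [Dcat_comp_lt', ← finSigmaFinEquiv.symm.injective.eq_iff (a := r)]
  -- Both sides compare first by the outer block, then by the inner block, then inside it. The pairs
  -- are kept arbitrary because the types of `u` and `u'` depend on them.
  have key : ∀ (v v' : (s : Fin m) × Fin (j s)) (u : Fin (i v.1 v.2)) (u' : Fin (i v'.1 v'.2)),
      (((c.obj t).as v.1 < (c.obj t).as v'.1 ∨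
          (v.1 = v'.1 ∧ (((d v.1).obj t).as v.2 : ℕ) < ((d v'.1).obj t).as v'.2)) ∨
        (v = v' ∧ (((b v.1 v.2).obj t).as u : ℕ) < ((b v'.1 v'.2).obj t).as u')) ↔
      ((c.obj t).as v.1 < (c.obj t).as v'.1 ∨ (v.1 = v'.1 ∧
        (((Dcat.comp (d v.1) (b v.1)).obj t).as (finSigmaFinEquiv ⟨v.2, u⟩) : ℕ) <
          ((Dcat.comp (d v'.1) (b v'.1)).obj t).as (finSigmaFinEquiv ⟨v'.2, u'⟩))) := by
    rintro ⟨s, y⟩ ⟨s', y'⟩ u u'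
    dsimp only at u u' ⊢
    by_cases hs : s = s'
    · subst hs
      rw [← Fin.lt_def (a := ((Dcat.comp (d s) (b s)).obj t).as _), Dcat_comp_lt]
      simp
    · simp [hs]
  exact key _ _ u u'

theorem Dcat_equivariance_left (T : Type) [Category.{0} T] (m : ℕ) (j : Fin m → ℕ)
    (σ : Equiv.Perm (Fin m)) (c : T ⥤ Dcat.obj m) (d : ∀ s, T ⥤ Dcat.obj (j s)) :
    Dcat.comp (c ⋙ Dcat.act σ) d =
      Dcat.comp c (fun s => d (σ.symm s)) ⋙ Dcat.act (blockEquiv σ j) :=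
  Dcat_functor_ext fun t i i' => by
  obtain ⟨x, rfl⟩ := finSigmaFinEquiv.surjective i
  obtain ⟨x', rfl⟩ := finSigmaFinEquiv.surjective i'
  rw [Dcat_comp_lt, Dcat_comp_act_lt, Dcat_comp_act_lt]
  obtain ⟨y, h1, -, rfl, h⟩ := blockEquiv_finSigma σ j x
  obtain ⟨y', h1', -, rfl, h'⟩ := blockEquiv_finSigma σ j x'
  rw [h, h', Dcat_comp_lt, ← h1, ← h1', σ.symm.injective.eq_iff]

theorem Dcat_equivariance_right (T : Type) [Category.{0} T] (m : ℕ) (j : Fin m → ℕ)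
    (τ : ∀ s, Equiv.Perm (Fin (j s))) (c : T ⥤ Dcat.obj m) (d : ∀ s, T ⥤ Dcat.obj (j s)) :
    Dcat.comp c (fun s => d s ⋙ Dcat.act (τ s)) = Dcat.comp c d ⋙ Dcat.act (sumEquiv τ) :=
  Dcat_functor_ext fun t i i' => by
  obtain ⟨x, rfl⟩ := finSigmaFinEquiv.surjective i
  obtain ⟨x', rfl⟩ := finSigmaFinEquiv.surjective i'
  rw [Dcat_comp_lt, Dcat_comp_act_lt, sumEquiv_finSigma, sumEquiv_finSigma, Dcat_comp_lt]
  rfl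

theorem Dcat_isOperad : Dcat.IsOperad where
  zero := ⟨⟨⟨⟨⟨1⟩⟩, fun x =>
    congrArg Codiscrete.mk (Subsingleton.elim (α := Equiv.Perm (Fin 0)) _ _)⟩⟩,
    fun x y => ⟨⟨⟨⟨⟩⟩, fun _ => rfl⟩⟩⟩
  act_refl n := Dcat_functor_ext fun t i i' => Iff.rfl
  act_trans e f := Dcat_functor_ext fun t i i' => Iff.rfl
  one_comp := Dcat_one_comp
  comp_one := Dcat_comp_one
  assoc := Dcat_assoc
  equivariance_left := Dcat_equivariance_left
  equivariance_right := Dcat_equivariance_right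

end SymHom

namespace SymHom

/-! ### The module `K_cat` -/

namespace FAs

@[simp] theorem odot_fib {m : ℕ} {X Y : Fin m → FAs} (f : ∀ s, X s ⟶ Y s)
    (x : (s : Fin m) × Fin (Y s).card) :
    Hom.fib (odot f) (finSigmaFinEquiv x) = odotFib f x :=
  congrArg (odotFib f) (Equiv.symm_apply_apply _ _)

@[simp] theorem ofEquiv_fib {n m : ℕ} (e : Fin n ≃ Fin m) (j : Fin m) :
    Hom.fib (ofEquiv e) j = [e.symm j] := rfl

theorem flatMap_singleton_eq_map {α β : Type*} (l : List α) (f : α → β) :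
    (l.flatMap fun x => [f x]) = l.map f := by
  induction l with
  | nil => rfl
  | cons a l ih => rw [List.flatMap_cons, ih]; rfl

theorem odot_ofEquiv_fib {m : ℕ} {X Y : Fin m → FAs} (f : ∀ s, X s ⟶ Y s)
    (σ : Equiv.Perm (Fin m)) (x : (s : Fin m) × Fin (Y s).card) :
    Hom.fib (odot f ≫ ofEquiv (blockEquiv σ fun s => (Y s).card))
      (blockSigma σ (fun s => (Y s).card) x) = odotFib f x := by
  rw [comp_fib, ofEquiv_fib, List.flatMap_singleton]
  refine Eq.trans ?_ (odot_fib f x)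
  exact congrArg (Hom.fib (odot f)) (Equiv.symm_apply_apply _ _)

theorem ofEquiv_odot_ofEquiv_fib {m : ℕ} {X Y : Fin m → FAs} (f : ∀ s, X s ⟶ Y s)
    (σ τ : Equiv.Perm (Fin m)) (x : (s : Fin m) × Fin (Y s).card) :
    Hom.fib (ofEquiv (blockEquiv σ fun s => (X s).card).symm ≫ odot f ≫
        ofEquiv (blockEquiv τ fun s => (Y s).card))
      (blockSigma τ (fun s => (Y s).card) x) =
        ((f x.1).fib x.2).map fun t => blockSigma σ (fun s => (X s).card) ⟨x.1, t⟩ := by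
  rw [comp_fib, odot_ofEquiv_fib, odotFib, List.flatMap_map]
  exact flatMap_singleton_eq_map _ _

end FAs

variable {m : ℕ}

/-- The fibres of a morphism out of `m`. -/
def Kfib (x : Kcat.obj m) : Fin x.right.card → List (Fin m) := FAs.Hom.fib x.hom

/-- The fibres of a morphism under `m`. -/
def Kmap {x y : Kcat.obj m} (g : x ⟶ y) : Fin y.right.card → List (Fin x.right.card) :=
  FAs.Hom.fib g.right

/-- Targets are initial segments of `ℕ`, so an order-preserving bijection between them is the
identity, and the objects are then equal and not merely isomorphic. -/
theorem Kobj_ext {x y : Kcat.obj m} (e : Fin x.right.card ≃ Fin y.right.card)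
    (he : ∀ i j, e i < e j ↔ i < j) (h : ∀ i, Kfib x i = Kfib y (e i)) : x = y := by
  have hv := equiv_val_eq_of_lt_iff e (Equiv.refl _) he
  have hc : x.right.card = y.right.card := card_eq_of_equiv e
  obtain ⟨⟨⟨⟩⟩, ⟨n⟩, f⟩ := x
  obtain ⟨⟨⟨⟩⟩, ⟨n'⟩, g⟩ := y
  obtain rfl : n = n' := hc
  obtain rfl : e = Equiv.refl _ := Equiv.ext fun i => Fin.ext (hv i)
  obtain rfl : f = g := FAs.hom_ext h
  rfl

/-- Functors to `K_cat(m)` agree if they are isomorphic by bijections that preserve the order. -/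
theorem Kcat_functor_ext {T : Type} [Category.{0} T] {F G : T ⥤ Kcat.obj m}
    (e : ∀ t, Fin (F.obj t).right.card ≃ Fin (G.obj t).right.card)
    (he : ∀ t i j, e t i < e t j ↔ i < j)
    (hobj : ∀ t i, Kfib (F.obj t) i = Kfib (G.obj t) (e t i))
    (hmap : ∀ {t t'} (u : t ⟶ t') i,
      (Kmap (F.map u) i).map (e t) = Kmap (G.map u) (e t' i)) : F = G := by
  have hv := fun t => equiv_val_eq_of_lt_iff (e t) (Equiv.refl _) (he t)
  have ho : ∀ t, F.obj t = G.obj t := fun t => Kobj_ext (e t) (he t) (hobj t)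
  refine CategoryTheory.Functor.ext ho fun t t' u => ?_
  -- The transports between equal objects only relabel the points by casts, which match the
  -- bijections `e t`.
  have hr : ∀ {x y : Kcat.obj m} (h : x = y) i, Kmap (eqToHom h) i =
      [Fin.cast (congrArg (fun z : Kcat.obj m => z.right.card) h).symm i] := by
    rintro x _ rfl i
    rfl
  have hcomp : ∀ {x y z : Kcat.obj m} (g : x ⟶ y) (g' : y ⟶ z) i,
      Kmap (g ≫ g') i = (Kmap g' i).flatMap (Kmap g) := fun _ _ _ => rfl
  refine Under.UnderMorphism.ext (FAs.hom_ext fun i => ?_)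
  change Kmap (F.map u) i = Kmap (eqToHom _ ≫ G.map u ≫ eqToHom _) i
  have he' : ∀ t, e t = finCongr (congrArg (fun z : Kcat.obj m => z.right.card) (ho t)) :=
    fun t => Equiv.ext fun i => Fin.ext (hv t i)
  have h1 := hmap u i
  rw [he', he'] at h1
  rw [hcomp, hcomp, hr, List.flatMap_singleton]
  have h2 : Kmap (G.map u) (Fin.cast (congrArg (fun z : Kcat.obj m => z.right.card) (ho t')) i) =
      (Kmap (F.map u) i).map
        (Fin.cast (congrArg (fun z : Kcat.obj m => z.right.card) (ho t))) := h1.symm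
  erw [h2]
  rw [List.flatMap_map]
  simp only [hr]
  simp

theorem Kfib_mul (j : Fin m → ℕ) (c : Dcat.obj m) (f : ∀ s, Kcat.obj (j s))
    (x : (s : Fin m) × Fin (f s).right.card) :
    Kfib ((Kcat.mul m j).obj (c, f)) (blockSigma c.as (fun s => (f s).right.card) x) =
      (Kfib (f x.1) x.2).map fun t => finSigmaFinEquiv ⟨x.1, t⟩ := by
  exact FAs.odot_ofEquiv_fib (fun s => (f s).hom) c.as x

theorem Kmap_mul (j : Fin m → ℕ) {x y : Dcat.obj m × ∀ s, Kcat.obj (j s)} (g : x ⟶ y)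
    (v : (s : Fin m) × Fin (y.2 s).right.card) :
    Kmap ((Kcat.mul m j).map g) (blockSigma y.1.as (fun s => (y.2 s).right.card) v) =
      (Kmap (g.2 v.1) v.2).map fun t =>
        blockSigma x.1.as (fun s => (x.2 s).right.card) ⟨v.1, t⟩ := by
  exact FAs.ofEquiv_odot_ofEquiv_fib (fun s => (g.2 s).right) x.1.as y.1.as v

section

variable {T : Type} [Category.{0} T] {j : Fin m → ℕ} (c : T ⥤ Dcat.obj m)
  (d : ∀ s, T ⥤ Kcat.obj (j s)) {t t' : T}

/-- The elements of the target of `μ(c, d)`. -/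
def Kblock (t : T) : ((s : Fin m) × Fin ((d s).obj t).right.card) ≃
    Fin ((Kcat.comp c d).obj t).right.card :=
  blockSigma (c.obj t).as fun s => ((d s).obj t).right.card

theorem Kblock_lt (x y : (s : Fin m) × Fin ((d s).obj t).right.card) :
    Kblock c d t x < Kblock c d t y ↔
      (c.obj t).as x.1 < (c.obj t).as y.1 ∨ (x.1 = y.1 ∧ (x.2 : ℕ) < y.2) :=
  blockSigma_lt _ _ _ _

theorem Kfib_comp (x : (s : Fin m) × Fin ((d s).obj t).right.card) :
    Kfib ((Kcat.comp c d).obj t) (Kblock c d t x) =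
      (Kfib ((d x.1).obj t) x.2).map fun t => finSigmaFinEquiv ⟨x.1, t⟩ :=
  Kfib_mul j (c.obj t) (fun s => (d s).obj t) x

theorem Kmap_comp (u : t ⟶ t') (x : (s : Fin m) × Fin ((d s).obj t').right.card) :
    Kmap ((Kcat.comp c d).map u) (Kblock c d t' x) =
      (Kmap ((d x.1).map u) x.2).map fun i => Kblock c d t ⟨x.1, i⟩ :=
  Kmap_mul j ((c.prod' (Functor.pi' d)).map u) x

end

section

variable {T : Type} [Category.{0} T] {n : ℕ} (e : Fin n ≃ Fin m) (d : T ⥤ Kcat.obj m)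

theorem Kfib_act (t : T) (i : Fin (d.obj t).right.card) :
    Kfib ((d ⋙ Kcat.act e).obj t) i = (Kfib (d.obj t) i).map e.symm := by
  exact FAs.flatMap_singleton_eq_map _ _

theorem Kmap_act {t t' : T} (u : t ⟶ t') (i : Fin (d.obj t').right.card) :
    Kmap ((d ⋙ Kcat.act e).map u) i = Kmap (d.map u) i := rfl

end

end SymHom

namespace SymHom

section

variable {m : ℕ} {T : Type} [Category.{0} T]

/-- A variant of `Kcat_functor_ext` in which both targets are parametrized by other types. -/
theorem Kcat_functor_ext' {F G : T ⥤ Kcat.obj m} (α : T → Type)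
    (a : ∀ t, α t ≃ Fin (F.obj t).right.card) (b : ∀ t, α t ≃ Fin (G.obj t).right.card)
    (hlt : ∀ t x y, a t x < a t y ↔ b t x < b t y)
    (hfib : ∀ t x, Kfib (F.obj t) (a t x) = Kfib (G.obj t) (b t x))
    (L : ∀ {t t'} (_ : t ⟶ t'), α t' → List (α t))
    (hF : ∀ {t t'} (u : t ⟶ t') x, Kmap (F.map u) (a t' x) = (L u x).map (a t))
    (hG : ∀ {t t'} (u : t ⟶ t') x, Kmap (G.map u) (b t' x) = (L u x).map (b t)) : F = G := by
  refine Kcat_functor_ext (fun t => (a t).symm.trans (b t)) ?_ ?_ ?_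
  · intro t i j
    obtain ⟨x, rfl⟩ := (a t).surjective i
    obtain ⟨y, rfl⟩ := (a t).surjective j
    simp [hlt]
  · intro t i
    obtain ⟨x, rfl⟩ := (a t).surjective i
    simp [hfib]
  · intro t t' u i
    obtain ⟨x, rfl⟩ := (a t').surjective i
    simp [hF, hG]

/-- With a single block there is nothing to permute, so every `c` acts as the unit does. -/
theorem Kcat_one_comp (j : Fin 1 → ℕ) (c : T ⥤ Dcat.obj 1) (d : ∀ s, T ⥤ Kcat.obj (j s)) :
    Kcat.comp c d = d 0 ⋙ Kcat.act (finCongr (Fin.sum_univ_one j)) := by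
  refine Kcat_functor_ext' (fun t => (s : Fin 1) × Fin ((d s).obj t).right.card)
    (fun t => Kblock c d t)
    (fun t => Equiv.uniqueSigma fun s : Fin 1 => Fin ((d s).obj t).right.card) ?_ ?_
    (fun u x => (Kmap ((d x.1).map u) x.2).map fun y => ⟨x.1, y⟩) ?_ ?_
  · rintro t ⟨s, x⟩ ⟨s', x'⟩
    obtain rfl := Subsingleton.elim s 0
    obtain rfl := Subsingleton.elim s' 0
    refine (Kblock_lt c d ⟨0, x⟩ ⟨0, x'⟩).trans ?_
    refine Iff.trans (b := (x : ℕ) < x') (by simp) Iff.rfl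
  · rintro t ⟨s, x⟩
    obtain rfl := Subsingleton.elim s 0
    refine (Kfib_comp c d ⟨0, x⟩).trans ?_
    refine Eq.trans ?_ (Kfib_act _ (d 0) t x).symm
    refine congrArg (fun f => List.map f _) (funext fun r => ?_)
    rw [Equiv.eq_symm_apply]
    exact Fin.ext (finSigmaFinEquiv_one _)
  · rintro t t' u ⟨s, x⟩
    refine (Kmap_comp c d u ⟨s, x⟩).trans ?_
    rw [List.map_map]
    rfl
  · rintro t t' u ⟨s, x⟩
    obtain rfl := Subsingleton.elim s 0
    rw [List.map_map]
    refine (Kmap_act _ (d 0) u x).trans ?_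
    exact (List.map_id _).symm

/-- Both targets are the disjoint union of the targets of all `b s t`, ordered by the outer block,
the inner block and the place. The comparison of orders is that of `Dcat_assoc`; the fibres are
those of the `b s t`, whose labels are matched by `sum_flatten_val`. -/
theorem Kcat_assoc (j : Fin m → ℕ) (i : ∀ s, Fin (j s) → ℕ) (c : T ⥤ Dcat.obj m)
    (d : ∀ s, T ⥤ Dcat.obj (j s)) (b : ∀ s t, T ⥤ Kcat.obj (i s t)) :
    Kcat.comp (Dcat.comp c d)
        (fun r => b (finSigmaFinEquiv.symm r).1 (finSigmaFinEquiv.symm r).2) =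
      Kcat.comp c (fun s => Kcat.comp (d s) (b s)) ⋙ Kcat.act (finCongr (sum_flatten i)) := by
  refine Kcat_functor_ext' (fun t => (r : Fin (∑ s, j s)) ×
      Fin ((b (finSigmaFinEquiv.symm r).1 (finSigmaFinEquiv.symm r).2).obj t).right.card)
    (fun t => Kblock (Dcat.comp c d)
      (fun r => b (finSigmaFinEquiv.symm r).1 (finSigmaFinEquiv.symm r).2) t)
    (fun t => ((finSigmaFinEquiv (n := j)).symm.sigmaCongrLeft
        (β := fun v => Fin ((b v.1 v.2).obj t).right.card)).trans
      ((Equiv.sigmaAssoc fun s y => Fin ((b s y).obj t).right.card).trans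
        ((Equiv.sigmaCongrRight fun s => Kblock (d s) (b s) t).trans
          (Kblock c (fun s => Kcat.comp (d s) (b s)) t)))) ?_ ?_
    (fun u x => (Kmap ((b (finSigmaFinEquiv.symm x.1).1 (finSigmaFinEquiv.symm x.1).2).map u)
      x.2).map fun y => ⟨x.1, y⟩) ?_ ?_
  · rintro t ⟨r, u⟩ ⟨r', u'⟩
    rw [Kblock_lt]
    refine Iff.trans ?_ (Kblock_lt c (fun s => Kcat.comp (d s) (b s))
      ⟨(finSigmaFinEquiv.symm r).1, Kblock (d _) (b _) t ⟨(finSigmaFinEquiv.symm r).2, u⟩⟩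
      ⟨(finSigmaFinEquiv.symm r').1,
        Kblock (d _) (b _) t ⟨(finSigmaFinEquiv.symm r').2, u'⟩⟩).symm
    dsimp only
    rw [Dcat_comp_lt', ← finSigmaFinEquiv.symm.injective.eq_iff (a := r)]
    have key : ∀ (v v' : (s : Fin m) × Fin (j s)) (u : Fin ((b v.1 v.2).obj t).right.card)
        (u' : Fin ((b v'.1 v'.2).obj t).right.card),
        (((c.obj t).as v.1 < (c.obj t).as v'.1 ∨
            (v.1 = v'.1 ∧ (((d v.1).obj t).as v.2 : ℕ) < ((d v'.1).obj t).as v'.2)) ∨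
          (v = v' ∧ (u : ℕ) < u')) ↔
        ((c.obj t).as v.1 < (c.obj t).as v'.1 ∨ (v.1 = v'.1 ∧
          (Kblock (d v.1) (b v.1) t ⟨v.2, u⟩ : ℕ) < Kblock (d v'.1) (b v'.1) t ⟨v'.2, u'⟩)) := by
      rintro ⟨s, y⟩ ⟨s', y'⟩ u u'
      dsimp only at u u' ⊢
      by_cases hs : s = s'
      · subst hs
        rw [← Fin.lt_def (a := Kblock _ _ _ _), Kblock_lt]
        simp
      · simp [hs]
    exact key _ _ u u'
  · rintro t ⟨r, u⟩
    rw [Kfib_comp]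
    refine Eq.trans ?_ ((Kfib_act _ _ t _).trans (congrArg (List.map _) (Kfib_comp c
      (fun s => Kcat.comp (d s) (b s)) ⟨(finSigmaFinEquiv.symm r).1,
        Kblock (d _) (b _) t ⟨(finSigmaFinEquiv.symm r).2, u⟩⟩))).symm
    dsimp only
    rw [Kfib_comp]
    simp only [List.map_map]
    refine congrArg (fun f => List.map f _) (funext fun x => ?_)
    simp only [Function.comp_apply]
    rw [Equiv.eq_symm_apply]
    exact sum_flatten_val i ⟨r, x⟩
  · rintro t t' u ⟨r, x⟩
    rw [Kmap_comp, List.map_map]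
    rfl
  · rintro t t' u ⟨r, x⟩
    refine (Kmap_act (finCongr (sum_flatten i)) (Kcat.comp c fun s => Kcat.comp (d s) (b s)) u (Kblock c
      (fun s => Kcat.comp (d s) (b s)) t' ⟨(finSigmaFinEquiv.symm r).1,
        Kblock (d _) (b _) t' ⟨(finSigmaFinEquiv.symm r).2, x⟩⟩)).trans ?_
    refine (Kmap_comp c (fun s => Kcat.comp (d s) (b s)) u ⟨(finSigmaFinEquiv.symm r).1,
        Kblock (d _) (b _) t' ⟨(finSigmaFinEquiv.symm r).2, x⟩⟩).trans ?_
    dsimp only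
    rw [Kmap_comp, List.map_map, List.map_map]
    rfl

theorem Kcat_equivariance_left (j : Fin m → ℕ) (σ : Equiv.Perm (Fin m)) (c : T ⥤ Dcat.obj m)
    (d : ∀ s, T ⥤ Kcat.obj (j s)) :
    Kcat.comp (c ⋙ Dcat.act σ) d =
      Kcat.comp c (fun s => d (σ.symm s)) ⋙ Kcat.act (blockEquiv σ j) := by
  refine Kcat_functor_ext' (fun t => (s : Fin m) × Fin ((d (σ.symm s)).obj t).right.card)
    (fun t => (σ.symm.sigmaCongrLeft (β := fun s => Fin ((d s).obj t).right.card)).trans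
      (Kblock (c ⋙ Dcat.act σ) d t))
    (fun t => Kblock c (fun s => d (σ.symm s)) t) ?_ ?_
    (fun u x => (Kmap ((d (σ.symm x.1)).map u) x.2).map fun y => ⟨x.1, y⟩) ?_ ?_
  · rintro t ⟨s, x⟩ ⟨s', x'⟩
    refine (Kblock_lt (c ⋙ Dcat.act σ) d ⟨σ.symm s, x⟩ ⟨σ.symm s', x'⟩).trans ?_
    rw [Dcat_comp_act_lt]
    refine Iff.trans ?_ (Kblock_lt c (fun s => d (σ.symm s)) ⟨s, x⟩ ⟨s', x'⟩).symm
    simp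
  · rintro t ⟨s, x⟩
    refine (Kfib_comp (c ⋙ Dcat.act σ) d ⟨σ.symm s, x⟩).trans ?_
    refine Eq.trans ?_ ((Kfib_act _ _ t _).trans (congrArg (List.map _)
      (Kfib_comp c (fun s => d (σ.symm s)) ⟨s, x⟩))).symm
    rw [List.map_map]
    refine congrArg (fun f => List.map f _) (funext fun y => ?_)
    exact (blockEquiv_symm_finSigma σ j ⟨s, y⟩).symm
  · rintro t t' u ⟨s, x⟩
    refine (Kmap_comp (c ⋙ Dcat.act σ) d u ⟨σ.symm s, x⟩).trans ?_
    rw [List.map_map]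
    rfl
  · rintro t t' u ⟨s, x⟩
    refine (Kmap_act (blockEquiv σ j) _ u _).trans ?_
    refine (Kmap_comp c (fun s => d (σ.symm s)) u ⟨s, x⟩).trans ?_
    rw [List.map_map]
    rfl

/-- Precomposition with a morphism of noncommutative sets. -/
def Kpre {n m : ℕ} (ψ : FAs.mk n ⟶ FAs.mk m) : Kcat.obj m ⥤ Kcat.obj n := Under.map ψ

theorem Kfib_pre {n : ℕ} (ψ : FAs.mk n ⟶ FAs.mk m) (d : T ⥤ Kcat.obj m) (t : T)
    (i : Fin (d.obj t).right.card) :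
    Kfib ((d ⋙ Kpre ψ).obj t) i = (Kfib (d.obj t) i).flatMap (FAs.Hom.fib ψ) := rfl

/-- The multiplication of `K_cat` is natural for precomposition with all morphisms. -/
theorem Kcat_comp_map {i j : Fin m → ℕ} (ψ : ∀ s, FAs.mk (i s) ⟶ FAs.mk (j s))
    (c : T ⥤ Dcat.obj m) (d : ∀ s, T ⥤ Kcat.obj (j s)) :
    Kcat.comp c (fun s => d s ⋙ Kpre (ψ s)) =
      Kcat.comp c d ⋙ Kpre (FAs.odot ψ) := by
  refine Kcat_functor_ext' (fun t => (s : Fin m) × Fin ((d s).obj t).right.card)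
    (fun t => Kblock c (fun s => d s ⋙ Kpre (ψ s)) t)
    (fun t => Kblock c d t) ?_ ?_
    (fun u x => (Kmap ((d x.1).map u) x.2).map fun y => ⟨x.1, y⟩) ?_ ?_
  · intro t x y
    exact (Kblock_lt c (fun s => d s ⋙ Kpre (ψ s)) x y).trans (Kblock_lt c d x y).symm
  · rintro t ⟨s, x⟩
    refine (Kfib_comp c (fun s => d s ⋙ Kpre (ψ s)) ⟨s, x⟩).trans ?_
    refine Eq.trans ?_ (Kfib_pre (FAs.odot ψ) (Kcat.comp c d) t (Kblock c d t ⟨s, x⟩)).symm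
    rw [Kfib_comp, List.flatMap_map]
    refine (congrArg (List.map _) (Kfib_pre (ψ s) (d s) t x)).trans ?_
    rw [List.map_flatMap]
    refine congrArg (fun f => List.flatMap f _) (funext fun y => ?_)
    exact (FAs.odot_fib ψ ⟨s, y⟩).symm
  · rintro t t' u ⟨s, x⟩
    refine (Kmap_comp c (fun s => d s ⋙ Kpre (ψ s)) u ⟨s, x⟩).trans ?_
    rw [List.map_map]
    rfl
  · rintro t t' u ⟨s, x⟩
    refine Eq.trans (b := Kmap ((Kcat.comp c d).map u) (Kblock c d t' ⟨s, x⟩)) rfl ?_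
    rw [Kmap_comp, List.map_map]
    rfl

theorem odot_ofEquiv {j : Fin m → ℕ} (τ : ∀ s, Equiv.Perm (Fin (j s))) :
    FAs.odot (fun s => FAs.ofEquiv (τ s)) = FAs.ofEquiv (sumEquiv τ) := by
  refine FAs.hom_ext fun r => ?_
  obtain ⟨x, rfl⟩ := finSigmaFinEquiv.surjective r
  rw [FAs.odot_fib, FAs.ofEquiv_fib]
  change [finSigmaFinEquiv _] = _
  refine congrArg (fun y => [y]) ?_
  rw [Equiv.eq_symm_apply]
  erw [sumEquiv_finSigma]
  simp

end

theorem Kcat_isModule : Kcat.IsModule where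
  act_refl n := Kcat_functor_ext' (fun t => Fin t.right.card) (fun _ => Equiv.refl _)
    (fun _ => Equiv.refl _) (fun _ _ _ => Iff.rfl)
    (fun t x => (Kfib_act (Equiv.refl _) (𝟭 _) t x).trans (List.map_id _))
    (fun u => Kmap u) (fun _ _ => (List.map_id _).symm) (fun _ _ => (List.map_id _).symm)
  act_trans e f := Kcat_functor_ext' (fun t => Fin t.right.card) (fun _ => Equiv.refl _)
    (fun _ => Equiv.refl _) (fun _ _ _ => Iff.rfl)
    (fun t x => by
      refine (Kfib_act (e.trans f) (𝟭 _) t x).trans (Eq.trans ?_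
        (((Kfib_act e (Kcat.act f) t x).trans
          (congrArg (List.map _) (Kfib_act f (𝟭 _) t x)))).symm)
      rw [List.map_map]
      rfl)
    (fun u => Kmap u) (fun _ _ => (List.map_id _).symm) (fun _ _ => (List.map_id _).symm)
  one_comp _ _ j d := Kcat_one_comp j _ d
  assoc _ _ _ j i c d b := Kcat_assoc j i c d b
  equivariance_left _ _ _ j σ c d := Kcat_equivariance_left j σ c d
  -- Right equivariance is the case of bijections in the naturality of `μ` for precomposition with
  -- arbitrary morphisms.
  equivariance_right T _ m j τ c d := by
    refine (Kcat_comp_map (fun s => FAs.ofEquiv (τ s)) c d).trans ?_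
    rw [odot_ofEquiv]
    rfl

end SymHom

namespace SymHom

/-! ### Multilinear maps determined by generators -/

section Multilinear

variable {k : Type*} [CommRing k] {Z : Type*} [AddCommGroup Z] [Module k Z]

/-- Variables are freed one at a time: if `f` and `g` agree whenever the variables outside `t` are
generators, linearity in one more variable lets it leave the set of generators as well. -/
theorem multilinear_ext {ι : Type*} [Finite ι] {M : ι → Type*} [∀ s, AddCommGroup (M s)]
    [∀ s, Module k (M s)] {G : ι → Type*} (γ : ∀ s, G s → M s)
    (hγ : ∀ s, Submodule.span k (Set.range (γ s)) = ⊤) {f g : MultilinearMap k M Z}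
    (h : ∀ x : ∀ s, G s, f (fun s => γ s (x s)) = g (fun s => γ s (x s))) : f = g := by
  classical
  have := Fintype.ofFinite ι
  have key : ∀ (t : Finset ι) (x : ∀ s, M s), (∀ i ∉ t, x i ∈ Set.range (γ i)) → f x = g x := by
    intro t
    induction t using Finset.induction_on with
    | empty =>
      intro x hx
      choose y hy using fun i => hx i (Finset.notMem_empty i)
      rw [← funext hy]
      exact h y
    | insert i t _ ih =>
      intro x hx
      have h1 : f.toLinearMap x i = g.toLinearMap x i := by
        refine LinearMap.ext_on (hγ i) ?_
        rintro _ ⟨y, rfl⟩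
        refine ih _ fun i' hi' => ?_
        by_cases hii : i' = i
        · subst hii
          simp
        · rw [Function.update_of_ne hii]
          exact hx i' (by simp [hii, hi'])
      have h2 := LinearMap.congr_fun h1 (x i)
      simpa using h2
  ext x
  exact key Finset.univ x (by simp)

/-- The generators present `M` as a quotient of the free module on `G`, and the hypothesis `h` says
that `Φ` respects every relation between them. -/
theorem exists_linear {M G : Type*} [AddCommGroup M] [Module k M] (γ : G → M)
    (hγ : Submodule.span k (Set.range γ) = ⊤) (Φ : G → Z)
    (h : ∀ c : G →₀ k, Finsupp.linearCombination k γ c = 0 →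
      Finsupp.linearCombination k Φ c = 0) : ∃ F : M →ₗ[k] Z, ∀ g, F (γ g) = Φ g := by
  have hs : Function.Surjective (Finsupp.linearCombination k γ) := by
    rw [← LinearMap.range_eq_top, Finsupp.range_linearCombination, hγ]
  let e := (Finsupp.linearCombination k γ).quotKerEquivOfSurjective hs
  refine ⟨(LinearMap.ker (Finsupp.linearCombination k γ)).liftQ
    (Finsupp.linearCombination k Φ) (fun c hc => h c hc) ∘ₗ e.symm.toLinearMap, fun g => ?_⟩
  have : e.symm (γ g) = Submodule.Quotient.mk (Finsupp.single g 1) := by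
    rw [LinearEquiv.symm_apply_eq]
    simp [e]
  simp only [LinearMap.comp_apply, LinearEquiv.coe_coe, this]
  erw [Submodule.liftQ_apply]
  simp

/-- A function on generators extends to a multilinear map if it extends linearly in every
variable. -/
theorem exists_multilinear {n : ℕ} {M : Fin n → Type*} [∀ s, AddCommGroup (M s)]
    [∀ s, Module k (M s)] {G : Fin n → Type*} (γ : ∀ s, G s → M s)
    (hγ : ∀ s, Submodule.span k (Set.range (γ s)) = ⊤) (Φ : (∀ s, G s) → Z)
    (h : ∀ s (g : ∀ s, G s), ∃ L : M s →ₗ[k] Z, ∀ y, L (γ s y) = Φ (Function.update g s y)) :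
    ∃ F : MultilinearMap k M Z, ∀ g, F (fun s => γ s (g s)) = Φ g := by
  induction n with
  | zero =>
    exact ⟨MultilinearMap.constOfIsEmpty k M (Φ fun s => s.elim0), fun g => by
      rw [MultilinearMap.constOfIsEmpty_apply]
      exact congrArg Φ (Subsingleton.elim _ _)⟩
  | succ n ih =>
    have h1 : ∀ y : G 0, ∃ F : MultilinearMap k (fun s : Fin n => M s.succ) Z,
        ∀ g, F (fun s => γ s.succ (g s)) = Φ (Fin.cons y g) := by
      intro y
      refine ih (fun s => γ s.succ) (fun s => hγ s.succ) (fun g => Φ (Fin.cons y g)) ?_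
      intro s g
      obtain ⟨L, hL⟩ := h s.succ (Fin.cons y g)
      exact ⟨L, fun z => by rw [hL, Fin.cons_update]⟩
    choose F hF using h1
    -- The multilinear maps `F y` in the remaining variables must respect every relation between
    -- generators of the first variable. On generators of the remaining variables this is the linear
    -- extension assumed in variable `0`.
    obtain ⟨F', hF'⟩ := exists_linear (γ 0) (hγ 0) F fun c hc => by
      refine multilinear_ext (fun s : Fin n => γ s.succ) (fun s => hγ s.succ) fun g => ?_
      -- The hypothesis `h` needs a full tuple, so some `y₀` must fill the first slot; without
      -- generators there the relation `c` is itself zero.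
      by_cases hG : Nonempty (G 0)
      · obtain ⟨y₀⟩ := hG
        obtain ⟨L, hL⟩ := h 0 (Fin.cons y₀ g)
        have h2 := congrArg L hc
        rw [map_zero, Finsupp.linearCombination_apply, Finsupp.sum, map_sum] at h2
        rw [Finsupp.linearCombination_apply, Finsupp.sum, sum_apply,
          zero_apply, ← h2]
        refine Finset.sum_congr rfl fun y _ => ?_
        rw [smul_apply, hF, map_smul, hL, Fin.update_cons_zero]
      · have : IsEmpty (G 0) := not_nonempty_iff.1 hG
        have : c = 0 := Subsingleton.elim _ _
        simp [this]
    refine ⟨LinearMap.uncurryLeft F', fun g => ?_⟩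
    rw [LinearMap.uncurryLeft_apply, hF']
    refine (hF (g 0) (fun s => g s.succ)).trans ?_
    exact congrArg Φ (Fin.cons_self_tail g)

theorem cls_span_finsupp (k X : Type*) [CommRing k] :
    Submodule.span k (Set.range fun x : X => (Finsupp.single x 1 : X →₀ k)) = ⊤ := by
  have := (Finsupp.basisSingleOne (R := k) (ι := X)).span_eq
  rwa [show ⇑(Finsupp.basisSingleOne (R := k) (ι := X)) = fun x => Finsupp.single x 1 from
    Finsupp.coe_basisSingleOne] at this

/-- Multilinear families on all simplices, compatible with the simplicial operators. -/
structure SimplicialMul {k : Type u} [CommRing k] (W : SimplicialObject (ModuleCat.{u} k)) {m : ℕ}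
    (X : Fin m → SimplicialObject (ModuleCat.{u} k)) (Z : SimplicialObject (ModuleCat.{u} k)) where
  app : ∀ q : ℕ, W.obj (op ⦋q⦌) →ₗ[k]
    MultilinearMap k (fun s => (X s).obj (op ⦋q⦌)) (Z.obj (op ⦋q⦌))
  naturality : ∀ (q q' : ℕ) (φ : ⦋q'⦌ ⟶ ⦋q⦌) (c : W.obj (op ⦋q⦌))
    (y : ∀ s, (X s).obj (op ⦋q⦌)),
    (Z.map φ.op).hom (app q c y) =
      app q' ((W.map φ.op).hom c) fun s => ((X s).map φ.op).hom (y s)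

end Multilinear

end SymHom

namespace SymHom

/-! ### The action of `D_cat` on `Y₊` -/

section YPlusAction

variable {k : Type u} [CommRing k] {A : Type u} [Ring A] [Algebra k A]

theorem lmapDomain_single {X Y : Type} (f : X → Y) (x : X) :
    Finsupp.lmapDomain k k f (Finsupp.single x 1) = Finsupp.single (f x) 1 := by
  simp

theorem chain_span (k : Type u) [CommRing k] (C : Type) [Category.{0} C] (q : ℕ) :
    Submodule.span k (Set.range fun s : Fin (q + 1) ⥤ C => chain k s) = ⊤ :=
  cls_span_finsupp k (Fin (q + 1) ⥤ C)

theorem linNerve_map_chain {C : Type} [Category.{0} C] {q q' : ℕ} (φ : ⦋q'⦌ ⟶ ⦋q⦌)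
    (s : Fin (q + 1) ⥤ C) : ((linNerve k C).map φ.op).hom (chain k s) = chain k (pull s φ) := by
  exact lmapDomain_single (k := k) ((nerve C).map φ.op) s

theorem barRight_map_chain {q n m : ℕ} (ψ : FAs.mk n ⟶ FAs.mk m)
    (s : Fin (q + 1) ⥤ Kcat.obj m) :
    (((barRight k FAs).obj (op ⦋q⦌)).map ψ.op).hom (chain k s) = chain k (s ⋙ Kpre ψ) := by
  exact lmapDomain_single (k := k) (fun s : Fin (q + 1) ⥤ Kcat.obj m => s ⋙ Kpre ψ) s

/-- The map `A^{⊗ n} → A^{⊗ m}` induced by a morphism of noncommutative sets. -/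
noncomputable def Bmap (k A : Type u) [CommRing k] [Ring A] [Algebra k A] {n m : ℕ}
    (ψ : FAs.mk n ⟶ FAs.mk m) : (⨂[k] _ : Fin n, A) →ₗ[k] (⨂[k] _ : Fin m, A) :=
  ((BsymPlus k A).map ψ).hom

theorem Bmap_tprod {n m : ℕ} (ψ : FAs.mk n ⟶ FAs.mk m) (a : Fin n → A) :
    Bmap k A ψ (PiTensorProduct.tprod k a) =
      PiTensorProduct.tprod k (fun j => ((FAs.Hom.fib ψ j).map a).prod) := by
  change PiTensorProduct.lift (substMultilinear k A ψ) _ = _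
  rw [PiTensorProduct.lift.tprod]
  rfl

/-- The class in `(Y₊A)_q` of `s ⊗ x`. -/
noncomputable def YPlus.tmk {q n : ℕ} (s : Fin (q + 1) ⥤ Kcat.obj n)
    (x : ⨂[k] _ : Fin n, A) : (YPlus k A).obj (op ⦋q⦌) :=
  TensorOver.mk ((barRight k FAs).obj (op ⦋q⦌)) (BsymPlus k A) (FAs.mk n) (chain k s ⊗ₜ[k] x)

theorem YPlus.tmk_tprod {q n : ℕ} (s : Fin (q + 1) ⥤ Kcat.obj n) (a : Fin n → A) :
    YPlus.tmk s (PiTensorProduct.tprod k a) = YPlus.mk k s a := rfl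

theorem YPlus.tmk_pre {q n m : ℕ} (ψ : FAs.mk n ⟶ FAs.mk m) (s : Fin (q + 1) ⥤ Kcat.obj m)
    (x : ⨂[k] _ : Fin n, A) :
    YPlus.tmk (s ⋙ Kpre ψ) x = YPlus.tmk s (Bmap k A ψ x) := by
  refine Eq.symm ((TensorOver.condition (M := (barRight k FAs).obj (op ⦋q⦌))
    (N := BsymPlus k A) ψ (chain k s) x).trans ?_)
  erw [barRight_map_chain]
  rfl

theorem YPlus.mk_pre {q n m : ℕ} (ψ : FAs.mk n ⟶ FAs.mk m) (s : Fin (q + 1) ⥤ Kcat.obj m)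
    (a : Fin n → A) :
    YPlus.mk k (s ⋙ Kpre ψ) a = YPlus.mk k s fun j => ((FAs.Hom.fib ψ j).map a).prod := by
  rw [← YPlus.tmk_tprod, YPlus.tmk_pre, Bmap_tprod]
  rfl

theorem YPlus.mk_act {q n m : ℕ} (e : Fin n ≃ Fin m) (s : Fin (q + 1) ⥤ Kcat.obj m)
    (a : Fin n → A) : YPlus.mk k (s ⋙ Kcat.act e) a = YPlus.mk k s fun j => a (e.symm j) := by
  refine (YPlus.mk_pre (FAs.ofEquiv e) s a).trans ?_
  simp

theorem YPlus.map_tmk {q q' n : ℕ} (φ : ⦋q'⦌ ⟶ ⦋q⦌) (s : Fin (q + 1) ⥤ Kcat.obj n)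
    (x : ⨂[k] _ : Fin n, A) :
    ((YPlus k A).map φ.op).hom (YPlus.tmk s x) = YPlus.tmk (pull s φ) x := by
  refine (TensorOver.map_mk ((barRight k FAs).map φ.op) (𝟙 (BsymPlus k A)) (FAs.mk n)
    (chain k s) x).trans ?_
  have : (((barRight k FAs).map φ.op).app (op (FAs.mk n))).hom (chain k s) = chain k (pull s φ) :=
    linNerve_map_chain φ s
  rw [this]
  rfl

theorem YPlus.map_mk {q q' n : ℕ} (φ : ⦋q'⦌ ⟶ ⦋q⦌) (s : Fin (q + 1) ⥤ Kcat.obj n)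
    (a : Fin n → A) : ((YPlus k A).map φ.op).hom (YPlus.mk k s a) = YPlus.mk k (pull s φ) a :=
  YPlus.map_tmk φ s _

/-- A linear map out of `(Y₊A)_q` is determined by its values on the classes of simple tensors. -/
theorem YPlus.hom_ext {q : ℕ} {Z : Type*} [AddCommGroup Z] [Module k Z]
    {f g : (YPlus k A).obj (op ⦋q⦌) →ₗ[k] Z}
    (h : ∀ n (s : Fin (q + 1) ⥤ Kcat.obj n) (a : Fin n → A),
      f (YPlus.mk k s a) = g (YPlus.mk k s a)) : f = g := by
  refine TensorOver.hom_ext fun X y x => ?_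
  have h1 : (TensorProduct.mk k _ _).compr₂
      (f ∘ₗ TensorOver.mk ((barRight k FAs).obj (op ⦋q⦌)) (BsymPlus k A) X) =
      (TensorProduct.mk k _ _).compr₂
      (g ∘ₗ TensorOver.mk ((barRight k FAs).obj (op ⦋q⦌)) (BsymPlus k A) X) := by
    refine LinearMap.ext_on (chain_span k (Kcat.obj X.card) q) ?_
    rintro _ ⟨s, rfl⟩
    refine PiTensorProduct.ext ?_
    ext a
    exact h X.card s a
  exact LinearMap.congr_fun (LinearMap.congr_fun h1 y) x

theorem YPlus.mk_span (k A : Type u) [CommRing k] [Ring A] [Algebra k A] (q : ℕ) :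
    Submodule.span k (Set.range fun g : (n : ℕ) × (Fin (q + 1) ⥤ Kcat.obj n) × (Fin n → A) =>
      YPlus.mk k g.2.1 g.2.2) = ⊤ := by
  rw [← Submodule.ker_mkQ (Submodule.span k _), LinearMap.ker_eq_top]
  refine YPlus.hom_ext fun n s a => ?_
  rw [LinearMap.zero_apply, Submodule.mkQ_apply, Submodule.Quotient.mk_eq_zero]
  exact Submodule.subset_span ⟨⟨n, s, a⟩, rfl⟩

theorem YPlus.tmk_span (k A : Type u) [CommRing k] [Ring A] [Algebra k A] (q : ℕ) :
    Submodule.span k (Set.range fun g : (n : ℕ) × (Fin (q + 1) ⥤ Kcat.obj n) ×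
      (⨂[k] _ : Fin n, A) => YPlus.tmk g.2.1 g.2.2) = ⊤ := by
  refine top_unique ((YPlus.mk_span k A q).symm.le.trans (Submodule.span_mono ?_))
  rintro _ ⟨⟨n, s, a⟩, rfl⟩
  exact ⟨⟨n, s, PiTensorProduct.tprod k a⟩, rfl⟩

/-- The multiplication `A^{⊗ j₁} × … × A^{⊗ j_m} → A^{⊗ (j₁ + … + j_m)}`. -/
theorem exists_tensorConcat (k A : Type u) [CommRing k] [Ring A] [Algebra k A] {m : ℕ}
    (j : Fin m → ℕ) : ∃ F : MultilinearMap k (fun s => ⨂[k] _ : Fin (j s), A)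
      (⨂[k] _ : Fin (∑ s, j s), A), ∀ v : ∀ s, Fin (j s) → A,
      F (fun s => PiTensorProduct.tprod k (v s)) = PiTensorProduct.tprod k fun r =>
        v (finSigmaFinEquiv.symm r).1 (finSigmaFinEquiv.symm r).2 := by
  refine exists_multilinear (G := fun s => Fin (j s) → A)
    (fun s (a : Fin (j s) → A) => PiTensorProduct.tprod k a)
    (fun s => PiTensorProduct.span_tprod_eq_top) _ ?_
  intro s v
  -- Changing one entry of the block `s` changes exactly one entry of the concatenation, which is
  -- why the result is multilinear in the entries of this block.
  have key : ∀ (d : DecidableEq (Fin (j s))) (w : Fin (j s) → A) (i : Fin (j s)) (x : A),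
      (fun r : Fin (∑ s, j s) => Function.update v s (@Function.update _ _ d w i x)
        (finSigmaFinEquiv.symm r).1 (finSigmaFinEquiv.symm r).2) =
      Function.update (fun r : Fin (∑ s, j s) => Function.update v s w
        (finSigmaFinEquiv.symm r).1 (finSigmaFinEquiv.symm r).2) (finSigmaFinEquiv ⟨s, i⟩) x := by
    intro d w i x
    obtain rfl : d = instDecidableEqFin _ := Subsingleton.elim _ _
    funext r
    obtain ⟨⟨s', i'⟩, rfl⟩ := finSigmaFinEquiv.surjective r
    simp only [Function.update_apply, EmbeddingLike.apply_eq_iff_eq]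
    rw [Equiv.symm_apply_apply]
    by_cases hs : s' = s
    · subst hs
      simp [Function.update_apply]
    · rw [Function.update_of_ne hs, if_neg (fun h => hs (congrArg Sigma.fst h)),
        Function.update_of_ne hs]
  refine ⟨PiTensorProduct.lift
    { toFun := fun w => PiTensorProduct.tprod k fun r => Function.update v s w
        (finSigmaFinEquiv.symm r).1 (finSigmaFinEquiv.symm r).2
      map_update_add' := fun w i x y => by simp only [key, MultilinearMap.map_update_add]
      map_update_smul' := fun w i c x => by simp only [key, MultilinearMap.map_update_smul] },
    fun w => ?_⟩
  rw [PiTensorProduct.lift.tprod]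
  rfl

/-- The multiplication `A^{⊗ j₁} × … × A^{⊗ j_m} → A^{⊗ (j₁ + … + j_m)}`. -/
noncomputable def tensorConcat (k A : Type u) [CommRing k] [Ring A] [Algebra k A] {m : ℕ}
    (j : Fin m → ℕ) :
    MultilinearMap k (fun s => ⨂[k] _ : Fin (j s), A) (⨂[k] _ : Fin (∑ s, j s), A) :=
  (exists_tensorConcat k A j).choose

theorem tensorConcat_tprod {m : ℕ} {j : Fin m → ℕ} (v : ∀ s, Fin (j s) → A) :
    tensorConcat k A j (fun s => PiTensorProduct.tprod k (v s)) = PiTensorProduct.tprod k fun r =>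
        v (finSigmaFinEquiv.symm r).1 (finSigmaFinEquiv.symm r).2 :=
  (exists_tensorConcat k A j).choose_spec v

/-- Each fibre of a block sum lies inside one block, so multiplying along fibres commutes with
concatenation. This is the algebra half of the compatibility with `⊗` over `ΔS₊`; the simplicial
half is `Kcat_comp_map`. -/
theorem tensorConcat_map {m : ℕ} {i j : Fin m → ℕ} (ψ : ∀ s, FAs.mk (i s) ⟶ FAs.mk (j s))
    (x : ∀ s, ⨂[k] _ : Fin (i s), A) :
    tensorConcat k A j (fun s => Bmap k A (ψ s) (x s)) =
      Bmap k A (FAs.odot ψ) (tensorConcat k A i x) := by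
  have : (tensorConcat k A j).compLinearMap (fun s => Bmap k A (ψ s)) =
      (Bmap k A (FAs.odot ψ)).compMultilinearMap (tensorConcat k A i) := by
    refine multilinear_ext (G := fun s => Fin (i s) → A)
      (fun s (a : Fin (i s) → A) => PiTensorProduct.tprod k a)
      (fun s => PiTensorProduct.span_tprod_eq_top) fun v => ?_
    rw [MultilinearMap.compLinearMap_apply, LinearMap.compMultilinearMap_apply]
    simp only [Bmap_tprod]
    rw [tensorConcat_tprod, tensorConcat_tprod, Bmap_tprod]
    refine congrArg _ (funext fun r => ?_)
    obtain ⟨y, rfl⟩ := finSigmaFinEquiv.surjective r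
    erw [FAs.odot_fib]
    refine (congrArg (fun z : (s : Fin m) × Fin (j s) =>
      ((FAs.Hom.fib (ψ z.1) z.2).map (v z.1)).prod) (Equiv.symm_apply_apply _ y)).trans ?_
    simp only [FAs.odotFib, List.map_map]
    refine congrArg List.prod (List.map_congr_left fun t _ => ?_)
    exact (congrArg (fun z : (s : Fin m) × Fin (i s) => v z.1 z.2)
      (Equiv.symm_apply_apply finSigmaFinEquiv ⟨y.1, t⟩)).symm
  exact MultilinearMap.congr_fun this x

/-- The generators of `(Y₊A)_q`. -/
abbrev YGen (k A : Type u) [CommRing k] [Ring A] [Algebra k A] (q : ℕ) : Type u :=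
  (n : ℕ) × (Fin (q + 1) ⥤ Kcat.obj n) × (⨂[k] _ : Fin n, A)

/-- The action on generators. -/
noncomputable def actGen {m q : ℕ} (c : Fin (q + 1) ⥤ Dcat.obj m) (g : Fin m → YGen k A q) :
    (YPlus k A).obj (op ⦋q⦌) :=
  YPlus.tmk (Kcat.comp c fun s => (g s).2.1)
    (tensorConcat k A (fun s => (g s).1) fun s => (g s).2.2)

/-- The relation on generators imposed by the tensor product over `ΔS₊`. -/
def YRel {q : ℕ} (a b : YGen k A q) : Prop :=
  ∃ ψ : FAs.mk a.1 ⟶ FAs.mk b.1, a.2.1 = b.2.1 ⋙ Kpre ψ ∧ b.2.2 = Bmap k A ψ a.2.2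

theorem YRel.refl {q : ℕ} (a : YGen k A q) : YRel a a := by
  refine ⟨𝟙 _, ?_, ?_⟩
  · exact (congrArg (fun F => a.2.1 ⋙ F) (Kcat_isModule.act_refl a.1)).symm
  · rw [Bmap, CategoryTheory.Functor.map_id]
    rfl

/-- Moving `ψ s` across the tensor sign in every argument becomes moving the single morphism
`FAs.odot ψ` across it in the result. -/
theorem actGen_eq {m q : ℕ} (c : Fin (q + 1) ⥤ Dcat.obj m) (a b : Fin m → YGen k A q)
    (h : ∀ s, YRel (a s) (b s)) : actGen c a = actGen c b := by
  choose ψ h1 h2 using h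
  rw [actGen, actGen, funext h1, funext h2, Kcat_comp_map, YPlus.tmk_pre, tensorConcat_map]

theorem actGen_linear {m q : ℕ} (c : Fin (q + 1) ⥤ Dcat.obj m) (g : Fin m → YGen k A q)
    (s : Fin m) (n : ℕ) (f : Fin (q + 1) ⥤ Kcat.obj n) :
    ∃ L : (⨂[k] _ : Fin n, A) →ₗ[k] (YPlus k A).obj (op ⦋q⦌),
      ∀ x, L x = actGen c (Function.update g s ⟨n, f, x⟩) := by
  have key : ∀ g₀ : Fin m → YGen k A q,
      ∃ L : (⨂[k] _ : Fin (g₀ s).1, A) →ₗ[k] (YPlus k A).obj (op ⦋q⦌),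
        ∀ x, L x = actGen c (Function.update g₀ s ⟨(g₀ s).1, (g₀ s).2.1, x⟩) := by
    intro g₀
    refine ⟨TensorOver.mk ((barRight k FAs).obj (op ⦋q⦌)) (BsymPlus k A)
        (FAs.mk (∑ s, (g₀ s).1)) ∘ₗ
      TensorProduct.mk k _ _ (chain k (Kcat.comp c fun s => (g₀ s).2.1)) ∘ₗ
      (tensorConcat k A fun s => (g₀ s).1).toLinearMap (fun s => (g₀ s).2.2) s, fun x => ?_⟩
    have : Function.update g₀ s ⟨(g₀ s).1, (g₀ s).2.1, x⟩ = fun s' =>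
        ⟨(g₀ s').1, (g₀ s').2.1, Function.update (fun s => (g₀ s).2.2) s x s'⟩ := by
      funext s'
      by_cases hs : s' = s
      · subst hs
        simp
      · simp [hs]
    rw [this]
    rfl
  have h := key (Function.update g s ⟨n, f, 0⟩)
  have h2 : Function.update g s (⟨n, f, 0⟩ : YGen k A q) s = ⟨n, f, 0⟩ := by simp
  simp only [Function.update_idem] at h
  rw [h2] at h
  exact h

theorem tmk_eq_rel {q n n' : ℕ} (ψ : FAs.mk n ⟶ FAs.mk n') (f : Fin (q + 1) ⥤ Kcat.obj n')
    (x : ⨂[k] _ : Fin n, A) {m : ℕ} (c : Fin (q + 1) ⥤ Dcat.obj m) (g : Fin m → YGen k A q)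
    (s : Fin m) :
    actGen c (Function.update g s ⟨n, f ⋙ Kpre ψ, x⟩) =
      actGen c (Function.update g s ⟨n', f, Bmap k A ψ x⟩) := by
  refine actGen_eq c _ _ fun s' => ?_
  by_cases hs : s' = s
  · subst hs
    rw [Function.update_self, Function.update_self]
    exact ⟨ψ, rfl, rfl⟩
  · rw [Function.update_of_ne hs, Function.update_of_ne hs]
    exact YRel.refl _

-- By `exists_multilinear` it suffices to extend linearly in one slot. There the map is given on
-- simplices tensored with elements of `A^{⊗ n}`, and the relation of the tensor product over `ΔS₊`
-- is respected by `tmk_eq_rel`.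
open Classical in
theorem actGen_exists {m q : ℕ} (c : Fin (q + 1) ⥤ Dcat.obj m) :
    ∃ F : MultilinearMap k (fun _ : Fin m => (YPlus k A).obj (op ⦋q⦌)) ((YPlus k A).obj (op ⦋q⦌)),
      ∀ g : Fin m → YGen k A q, F (fun s => YPlus.tmk (g s).2.1 (g s).2.2) = actGen c g := by
  refine exists_multilinear (G := fun _ => YGen k A q) (fun _ g => YPlus.tmk g.2.1 g.2.2)
    (fun _ => YPlus.tmk_span k A q) (actGen c) ?_
  intro s g
  have hex : ∀ (X : FAs) (f : Fin (q + 1) ⥤ Kcat.obj X.card),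
      ∃ L : (BsymPlus k A).obj X →ₗ[k] (YPlus k A).obj (op ⦋q⦌),
        ∀ x, L x = actGen c (Function.update g s ⟨X.card, f, x⟩) := fun X f =>
    actGen_linear (k := k) (A := A) c g s X.card f
  choose Λ hΛ using hex
  let B : ∀ X : FAs, ((barRight k FAs).obj (op ⦋q⦌)).obj (op X) ⊗[k] (BsymPlus k A).obj X →ₗ[k]
      (YPlus k A).obj (op ⦋q⦌) := fun X =>
    TensorProduct.lift (Finsupp.lift (((BsymPlus k A).obj X) →ₗ[k] (YPlus k A).obj (op ⦋q⦌)) k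
      (Fin (q + 1) ⥤ Kcat.obj X.card) (Λ X))
  have hB : ∀ (X : FAs) (f : Fin (q + 1) ⥤ Kcat.obj X.card) (x : (BsymPlus k A).obj X),
      B X (chain k f ⊗ₜ x) = Λ X f x := by
    intro X f x
    refine (TensorProduct.lift.tmul _ _).trans ?_
    refine LinearMap.congr_fun (?_ : _ = Λ X f) x
    exact (Finsupp.linearCombination_single k (1 : k) f).trans (one_smul k _)
  refine ⟨(tensorRel ((barRight k FAs).obj (op ⦋q⦌)) (BsymPlus k A)).liftQ
    (DirectSum.toModule k FAs _ B) ?_, ?_⟩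
  · refine Submodule.span_le.2 ?_
    rintro _ ⟨X, Y, ψ, y, x, rfl⟩
    simp only [SetLike.mem_coe, LinearMap.mem_ker, map_sub, DirectSum.toModule_lof]
    rw [sub_eq_zero]
    have : (B Y ∘ₗ (TensorProduct.mk k _ _).flip ((BsymPlus k A).map ψ x)) =
        (B X ∘ₗ (TensorProduct.mk k _ _).flip x) ∘ₗ
          (((barRight k FAs).obj (op ⦋q⦌)).map ψ.op).hom := by
      refine LinearMap.ext_on (chain_span k (Kcat.obj Y.card) q) ?_
      rintro _ ⟨f, rfl⟩
      refine (hB Y f _).trans (Eq.trans ?_ (congrArg (fun z => B X (z ⊗ₜ x))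
        (barRight_map_chain (k := k) ψ f)).symm)
      refine Eq.trans ?_ (hB X (f ⋙ Kpre ψ) x).symm
      refine (hΛ _ _ _).trans (Eq.trans ?_ (hΛ _ _ _).symm)
      exact (tmk_eq_rel ψ f x c g s).symm
    exact LinearMap.congr_fun this y
  · intro g'
    refine ((tensorRel _ _).liftQ_apply _ _).trans ?_
    refine (DirectSum.toModule_lof k _ _).trans ?_
    exact (hB (FAs.mk g'.1) g'.2.1 g'.2.2).trans (hΛ _ _ _)

end YPlusAction

end SymHom

namespace SymHom

section YPlusAction

variable {k : Type u} [CommRing k] {A : Type u} [Ring A] [Algebra k A]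

/-- The action of a simplex of `N D_cat(m)` on `(Y₊A)_q`. -/
noncomputable def YAct (k A : Type u) [CommRing k] [Ring A] [Algebra k A] {m q : ℕ}
    (c : Fin (q + 1) ⥤ Dcat.obj m) :
    MultilinearMap k (fun _ : Fin m => (YPlus k A).obj (op ⦋q⦌)) ((YPlus k A).obj (op ⦋q⦌)) :=
  (actGen_exists c).choose

theorem YAct_mk {m q : ℕ} (c : Fin (q + 1) ⥤ Dcat.obj m) {j : Fin m → ℕ}
    (f : ∀ s, Fin (q + 1) ⥤ Kcat.obj (j s)) (v : ∀ s, Fin (j s) → A) :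
    YAct k A c (fun s => YPlus.mk k (f s) (v s)) = YPlus.mk k (Kcat.comp c f) fun r =>
      v (finSigmaFinEquiv.symm r).1 (finSigmaFinEquiv.symm r).2 := by
  refine ((actGen_exists c).choose_spec
    fun s => ⟨j s, f s, PiTensorProduct.tprod k (v s)⟩).trans ?_
  rw [← YPlus.tmk_tprod, ← tensorConcat_tprod]
  rfl

/-- The action of `k[N D_cat(m)]` on `(Y₊A)_q`. -/
noncomputable def YActLin (k A : Type u) [CommRing k] [Ring A] [Algebra k A] (m q : ℕ) :
    (linNerve k (Dcat.obj m)).obj (op ⦋q⦌) →ₗ[k] MultilinearMap k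
      (fun _ : Fin m => (YPlus k A).obj (op ⦋q⦌)) ((YPlus k A).obj (op ⦋q⦌)) :=
  Finsupp.linearCombination k (fun c : Fin (q + 1) ⥤ Dcat.obj m => YAct k A c)

theorem YActLin_chain {m q : ℕ} (c : Fin (q + 1) ⥤ Dcat.obj m) :
    YActLin k A m q (chain k c) = YAct k A c :=
  (Finsupp.linearCombination_single k (1 : k) c).trans (one_smul k _)

/-- The generators `YPlus.mk`, as a family. -/
noncomputable abbrev YPlus.gen (k A : Type u) [CommRing k] [Ring A] [Algebra k A] (q : ℕ)
    (g : (n : ℕ) × (Fin (q + 1) ⥤ Kcat.obj n) × (Fin n → A)) : (YPlus k A).obj (op ⦋q⦌) :=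
  YPlus.mk k g.2.1 g.2.2

theorem YActLin_naturality (m q q' : ℕ) (φ : ⦋q'⦌ ⟶ ⦋q⦌)
    (c : (linNerve k (Dcat.obj m)).obj (op ⦋q⦌)) (y : Fin m → (YPlus k A).obj (op ⦋q⦌)) :
    ((YPlus k A).map φ.op).hom (YActLin k A m q c y) =
      YActLin k A m q' (((linNerve k (Dcat.obj m)).map φ.op).hom c)
        fun s => ((YPlus k A).map φ.op).hom (y s) := by
  let L₁ : (linNerve k (Dcat.obj m)).obj (op ⦋q⦌) →ₗ[k] MultilinearMap k
      (fun _ : Fin m => (YPlus k A).obj (op ⦋q⦌)) ((YPlus k A).obj (op ⦋q'⦌)) :=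
    LinearMap.compMultilinearMapₗ k ((YPlus k A).map φ.op).hom ∘ₗ YActLin k A m q
  let L₂ : (linNerve k (Dcat.obj m)).obj (op ⦋q⦌) →ₗ[k] MultilinearMap k
      (fun _ : Fin m => (YPlus k A).obj (op ⦋q⦌)) ((YPlus k A).obj (op ⦋q'⦌)) :=
    MultilinearMap.compLinearMapₗ (fun _ => ((YPlus k A).map φ.op).hom) ∘ₗ YActLin k A m q' ∘ₗ
      ((linNerve k (Dcat.obj m)).map φ.op).hom
  have : L₁ = L₂ := by
    refine LinearMap.ext_on (chain_span k (Dcat.obj m) q) ?_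
    rintro _ ⟨c, rfl⟩
    refine multilinear_ext (fun _ => YPlus.gen k A q) (fun _ => YPlus.mk_span k A q) fun g => ?_
    change ((YPlus k A).map φ.op).hom (YActLin k A m q (chain k c) _) =
      YActLin k A m q' (((linNerve k (Dcat.obj m)).map φ.op).hom (chain k c))
        fun s => ((YPlus k A).map φ.op).hom (YPlus.mk k (g s).2.1 (g s).2.2)
    rw [linNerve_map_chain, YActLin_chain, YActLin_chain]
    simp only [YPlus.map_mk]
    rw [YAct_mk, YAct_mk, YPlus.map_mk]
    rfl
  exact MultilinearMap.congr_fun (LinearMap.congr_fun this c) y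

theorem YAct_one (q : ℕ) (y : Fin 1 → (YPlus k A).obj (op ⦋q⦌)) :
    YAct k A ((Functor.const (Fin (q + 1))).obj Dcat.one) y = y 0 := by
  have : YAct k A ((Functor.const (Fin (q + 1))).obj Dcat.one) =
      MultilinearMap.ofSubsingleton k _ _ (0 : Fin 1) LinearMap.id := by
    refine multilinear_ext (fun _ => YPlus.gen k A q) (fun _ => YPlus.mk_span k A q) fun g => ?_
    refine (YAct_mk _ (fun s => (g s).2.1) (fun s => (g s).2.2)).trans ?_
    rw [Kcat_isModule.one_comp, YPlus.mk_act]
    refine congrArg (YPlus.mk k (g 0).2.1) (funext fun r => ?_)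
    have : (finCongr (Fin.sum_univ_one fun s => (g s).1)).symm r = finSigmaFinEquiv ⟨0, r⟩ :=
      (Equiv.symm_apply_eq _).2 (Fin.ext (finSigmaFinEquiv_one (n := fun s => (g s).1) ⟨0, r⟩).symm)
    refine (congrArg (fun z => (g (finSigmaFinEquiv.symm z).1).2.2
      (finSigmaFinEquiv.symm z).2) this).trans ?_
    exact congrArg (fun z : (s : Fin 1) × Fin (g s).1 => (g z.1).2.2 z.2)
      (Equiv.symm_apply_apply (finSigmaFinEquiv (n := fun s => (g s).1)) ⟨0, r⟩)
  rw [this]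
  rfl

theorem YAct_equivariance (m q : ℕ) (σ : Equiv.Perm (Fin m)) (c : Fin (q + 1) ⥤ Dcat.obj m)
    (y : Fin m → (YPlus k A).obj (op ⦋q⦌)) :
    YAct k A (c ⋙ Dcat.act σ) y = YAct k A c fun s => y (σ.symm s) := by
  have : YAct k A (c ⋙ Dcat.act σ) = (YAct k A c).domDomCongr σ.symm := by
    refine multilinear_ext (fun _ => YPlus.gen k A q) (fun _ => YPlus.mk_span k A q) fun g => ?_
    rw [MultilinearMap.domDomCongr_apply]
    refine (YAct_mk _ (fun s => (g s).2.1) (fun s => (g s).2.2)).trans ?_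
    refine Eq.trans ?_ (YAct_mk c (fun s => (g (σ.symm s)).2.1)
      (fun s => (g (σ.symm s)).2.2)).symm
    rw [Kcat_isModule.equivariance_left, YPlus.mk_act]
    refine congrArg (YPlus.mk k _) (funext fun r => ?_)
    obtain ⟨x, rfl⟩ := finSigmaFinEquiv.surjective r
    rw [blockEquiv_symm_finSigma]
    refine (congrArg (fun z : (s : Fin m) × Fin (g s).1 => (g z.1).2.2 z.2)
      (Equiv.symm_apply_apply finSigmaFinEquiv _)).trans ?_
    exact (congrArg (fun z : (s : Fin m) × Fin (g (σ.symm s)).1 => (g (σ.symm z.1)).2.2 z.2)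
      (Equiv.symm_apply_apply finSigmaFinEquiv x)).symm
  rw [this]
  rfl

theorem YAct_assoc (q m : ℕ) (j : Fin m → ℕ) (c : Fin (q + 1) ⥤ Dcat.obj m)
    (d : ∀ s, Fin (q + 1) ⥤ Dcat.obj (j s)) (y : ∀ s, Fin (j s) → (YPlus k A).obj (op ⦋q⦌)) :
    YAct k A (Dcat.comp c d)
        (fun r => y (finSigmaFinEquiv.symm r).1 (finSigmaFinEquiv.symm r).2) =
      YAct k A c fun s => YAct k A (d s) (y s) := by
  -- Both sides are read as multilinear maps in the variables indexed by pairs `⟨s, t⟩`, so that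
  -- they may be compared on generators.
  have : (YAct k A (Dcat.comp c d)).domDomCongr finSigmaFinEquiv.symm =
      (YAct k A c).compMultilinearMap (fun s => YAct k A (d s)) := by
    refine multilinear_ext (ι := (s : Fin m) × Fin (j s)) (fun _ => YPlus.gen k A q)
      (fun _ => YPlus.mk_span k A q) fun g => ?_
    rw [MultilinearMap.domDomCongr_apply]
    refine (YAct_mk _ (fun r => (g (finSigmaFinEquiv.symm r)).2.1)
      (fun r => (g (finSigmaFinEquiv.symm r)).2.2)).trans ?_
    have h : ∀ s, YAct k A (d s) (fun t => YPlus.gen k A q (g ⟨s, t⟩)) = _ := fun s =>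
      YAct_mk (d s) (fun t => (g ⟨s, t⟩).2.1) (fun t => (g ⟨s, t⟩).2.2)
    refine Eq.trans ?_ ((congrArg (YAct k A c) (funext h)).trans
      (YAct_mk c _ _)).symm
    have h1 := Kcat_isModule.assoc _ m j (fun s t => (g ⟨s, t⟩).1) c d
      (fun s t => (g ⟨s, t⟩).2.1)
    refine (congrArg (fun F => YPlus.mk k F _) h1).trans ?_
    rw [YPlus.mk_act]
    refine congrArg (YPlus.mk k _) (funext fun r => ?_)
    -- The simplices agree by associativity of `Kcat`. It remains to see that both sides read the
    -- same entry of the same argument, and `sum_flatten_val` matches the two numberings of the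
    -- entries.
    obtain ⟨x, rfl⟩ := (finCongr (sum_flatten fun s t => (g ⟨s, t⟩).1)).surjective r
    rw [Equiv.symm_apply_apply]
    obtain ⟨⟨r, u⟩, rfl⟩ := finSigmaFinEquiv.surjective x
    refine Eq.trans ?_ (congrArg (fun z => (g ⟨(finSigmaFinEquiv.symm z).1,
        (finSigmaFinEquiv.symm (finSigmaFinEquiv.symm z).2).1⟩).2.2
          (finSigmaFinEquiv.symm (finSigmaFinEquiv.symm z).2).2)
      (sum_flatten_val (fun s t => (g ⟨s, t⟩).1) ⟨r, u⟩)).symm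
    refine (congrArg (fun z : (r : Fin (∑ s, j s)) × Fin (g (finSigmaFinEquiv.symm r)).1 =>
      (g (finSigmaFinEquiv.symm z.1)).2.2 z.2)
      (Equiv.symm_apply_apply finSigmaFinEquiv _)).trans ?_
    refine Eq.symm ((congrArg (fun z : (s : Fin m) × Fin (∑ t, (g ⟨s, t⟩).1) =>
      (g ⟨z.1, (finSigmaFinEquiv.symm z.2).1⟩).2.2 (finSigmaFinEquiv.symm z.2).2)
      (Equiv.symm_apply_apply finSigmaFinEquiv _)).trans ?_)
    exact congrArg (fun z : (t : Fin (j (finSigmaFinEquiv.symm r).1)) ×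
      Fin (g ⟨(finSigmaFinEquiv.symm r).1, t⟩).1 =>
        (g ⟨(finSigmaFinEquiv.symm r).1, z.1⟩).2.2 z.2)
      (Equiv.symm_apply_apply finSigmaFinEquiv _)
  exact MultilinearMap.congr_fun this fun v => y v.1 v.2

/-- The structure of a `D_sm`-algebra on `Y₊A`. -/
noncomputable def YAlgebra (k A : Type u) [CommRing k] [Ring A] [Algebra k A] :
    SimplicialAlgebra Dcat (YPlus k A) where
  act := YActLin k A
  naturality := YActLin_naturality
  one_act q y := by rw [YActLin_chain, YAct_one]
  equivariance m q σ c y := by rw [YActLin_chain, YActLin_chain, YAct_equivariance]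
  assoc q m j c d y := by
    rw [YActLin_chain, YActLin_chain, YAct_assoc]
    simp only [YActLin_chain]

end YPlusAction

end SymHom

namespace SymHom

/-! ### Words -/

section Words

variable {L : Type} [LinearOrder L] {q : ℕ}

/-- The number of letters `i` among the first `t` letters of the word `w`. -/
def cnt (w : Fin q → L) (i : L) (t : ℕ) : ℕ := ∑ r : Fin q, if (r : ℕ) < t ∧ w r = i then 1 else 0

/-- The number of inversions of a word. -/
def inv (w : Fin q → L) : ℕ := ∑ x, ∑ y, if x < y ∧ w y < w x then 1 else 0

/-- The sign of a word. -/
def wsign (w : Fin q → L) : ℤ := (-1) ^ inv w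

theorem cnt_zero (w : Fin q → L) (i : L) : cnt w i 0 = 0 := by simp [cnt]

theorem cnt_mono (w : Fin q → L) (i : L) : Monotone (cnt w i) := by
  intro t t' h
  refine Finset.sum_le_sum fun r _ => ?_
  split_ifs with h1 h2
  · rfl
  · exact absurd ⟨h1.1.trans_le h, h1.2⟩ h2
  · simp
  · rfl

theorem cnt_succ (w : Fin q → L) (i : L) (a : Fin q) :
    cnt w i (a + 1) = cnt w i a + if w a = i then 1 else 0 := by
  have : (if w a = i then 1 else 0) = ∑ r, if r = a then (if w a = i then 1 else 0) else 0 := by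
    simp
  rw [this, cnt, cnt, ← Finset.sum_add_distrib]
  refine Finset.sum_congr rfl fun r _ => ?_
  by_cases hr : r = a
  · subst hr
    simp
  · have : (r : ℕ) ≠ a := fun h => hr (Fin.ext h)
    have h2 : (r : ℕ) < a + 1 ↔ (r : ℕ) < a := by omega
    simp [hr, h2]

theorem cnt_of_le (w : Fin q → L) (i : L) {t : ℕ} (h : q ≤ t) : cnt w i t = cnt w i q := by
  refine Finset.sum_congr rfl fun r _ => ?_
  have h1 : (r : ℕ) < t := r.2.trans_le h
  simp [h1]

theorem cnt_remove_le (w : Fin (q + 1) → L) (pos : Fin (q + 1)) (j : L) {t : ℕ} (h : t ≤ pos) :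
    cnt w j t = cnt (w ∘ pos.succAbove) j t := by
  rw [cnt, Fin.sum_univ_succAbove _ pos, if_neg (by omega), zero_add, cnt]
  refine Finset.sum_congr rfl fun r _ => ?_
  have : ((pos.succAbove r : Fin (q + 1)) : ℕ) < t ↔ (r : ℕ) < t := by
    simp only [Fin.succAbove, Fin.lt_def]
    split_ifs with h1 <;> simp at h1 ⊢ <;> omega
  simp [this]

theorem cnt_remove_gt (w : Fin (q + 1) → L) (pos : Fin (q + 1)) (j : L) {t : ℕ} (h : pos ≤ t) :
    cnt w j (t + 1) = cnt (w ∘ pos.succAbove) j t + if w pos = j then 1 else 0 := by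
  rw [cnt, Fin.sum_univ_succAbove _ pos, add_comm, cnt]
  congr 1
  · refine Finset.sum_congr rfl fun r _ => ?_
    have : ((pos.succAbove r : Fin (q + 1)) : ℕ) < t + 1 ↔ (r : ℕ) < t := by
      simp only [Fin.succAbove, Fin.lt_def]
      split_ifs with h1 <;> simp at h1 ⊢ <;> omega
    simp [this]
  · have : (pos : ℕ) < t + 1 := by omega
    simp [this]

/-- The inversions that involve the place `pos` are those with smaller letters behind it and those
with larger letters in front of it. -/
theorem inv_remove (w : Fin (q + 1) → L) (pos : Fin (q + 1)) :
    inv w = inv (w ∘ pos.succAbove) +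
      (∑ y : Fin q, if (pos : ℕ) ≤ y ∧ w (pos.succAbove y) < w pos then 1 else 0) +
      ∑ x : Fin q, if (x : ℕ) < pos ∧ w pos < w (pos.succAbove x) then 1 else 0 := by
  have h1 : ∀ x : Fin q, pos.succAbove x < pos ↔ (x : ℕ) < pos := fun x => by
    rw [Fin.succAbove_lt_iff_castSucc_lt, Fin.lt_def, Fin.val_castSucc]
  have h2 : ∀ x : Fin q, pos < pos.succAbove x ↔ (pos : ℕ) ≤ x := fun x => by
    rw [Fin.lt_succAbove_iff_le_castSucc, Fin.le_def, Fin.val_castSucc]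
  rw [inv, Fin.sum_univ_succAbove _ pos, Fin.sum_univ_succAbove _ pos]
  simp only [Fin.sum_univ_succAbove _ pos, lt_self_iff_false, false_and, if_false, zero_add,
    Finset.sum_add_distrib, h1, h2, (Fin.strictMono_succAbove pos).lt_iff_lt]
  rw [inv]
  simp only [Function.comp_apply]
  omega

/-- Exchanging neighbours can only change whether this very pair is an inversion. A correction on
each side avoids subtraction in `ℕ`. -/
theorem inv_swap (w : Fin q → L) {a b : Fin q} (hab : (a : ℕ) + 1 = b) :
    inv (w ∘ Equiv.swap a b) + (if w b < w a then 1 else 0) =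
      inv w + if w a < w b then 1 else 0 := by
  have hne : a ≠ b := fun h => by rw [h] at hab; omega
  have e1 : inv (w ∘ Equiv.swap a b) = ∑ x, ∑ y,
      if Equiv.swap a b x < Equiv.swap a b y ∧ w y < w x then 1 else 0 := by
    rw [inv, ← Equiv.sum_comp (Equiv.swap a b)]
    refine Finset.sum_congr rfl fun x _ => ?_
    rw [← Equiv.sum_comp (Equiv.swap a b)]
    simp
  -- The corrections are spread over the double sum, concentrated at one pair, so that the identity
  -- can be checked termwise.
  have e2 : ∀ (u v : Fin q) (c : ℕ), c = ∑ x, ∑ y, if x = u ∧ y = v then c else 0 := by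
    intro u v c
    simp [ite_and]
  rw [e1, inv, e2 a b (if w b < w a then 1 else 0), e2 b a (if w a < w b then 1 else 0),
    ← Finset.sum_add_distrib, ← Finset.sum_add_distrib]
  refine Finset.sum_congr rfl fun x _ => ?_
  rw [← Finset.sum_add_distrib, ← Finset.sum_add_distrib]
  refine Finset.sum_congr rfl fun y _ => ?_
  by_cases hxa : x = a
  · subst hxa
    by_cases hyb : y = b
    · subst hyb
      have h1 : x < y := Fin.lt_def.2 (by omega)
      simp [h1, h1.not_gt, hne]
    · by_cases hyx : y = x
      · subst hyx
        simp [hyb]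
      · have h1 : (y : ℕ) ≠ b := fun h => hyb (Fin.ext h)
        have h2 : (y : ℕ) ≠ x := fun h => hyx (Fin.ext h)
        have h3 : b < y ↔ x < y := by rw [Fin.lt_def, Fin.lt_def]; omega
        simp [Equiv.swap_apply_of_ne_of_ne hyx hyb, hyb, hyx, h3]
  · by_cases hxb : x = b
    · subst hxb
      by_cases hya : y = a
      · subst hya
        have h1 : y < x := Fin.lt_def.2 (by omega)
        simp [h1, h1.not_gt, hxa]
      · by_cases hyx : y = x
        · subst hyx
          simp [hya]
        · have h1 : (y : ℕ) ≠ a := fun h => hya (Fin.ext h)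
          have h2 : (y : ℕ) ≠ x := fun h => hyx (Fin.ext h)
          have h3 : a < y ↔ x < y := by rw [Fin.lt_def, Fin.lt_def]; omega
          simp [Equiv.swap_apply_of_ne_of_ne hya hyx, hya, hxa, h3]
    · have h1 : (x : ℕ) ≠ a := fun h => hxa (Fin.ext h)
      have h2 : (x : ℕ) ≠ b := fun h => hxb (Fin.ext h)
      rw [Equiv.swap_apply_of_ne_of_ne hxa hxb]
      by_cases hya : y = a
      · subst hya
        have h3 : x < b ↔ x < y := by rw [Fin.lt_def, Fin.lt_def]; omega
        simp [hxa, hxb, h3]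
      · by_cases hyb : y = b
        · subst hyb
          have h3 : x < a ↔ x < y := by rw [Fin.lt_def, Fin.lt_def]; omega
          simp [hxa, hxb, h3]
        · rw [Equiv.swap_apply_of_ne_of_ne hya hyb]
          simp [hxa, hxb]

theorem wsign_swap (w : Fin q → L) {a b : Fin q} (hab : (a : ℕ) + 1 = b) (h : w a ≠ w b) :
    wsign (w ∘ Equiv.swap a b) = -wsign w := by
  have := inv_swap w hab
  rw [wsign, wsign]
  rcases lt_or_gt_of_ne h with h1 | h1
  · rw [if_neg h1.asymm, if_pos h1] at this
    rw [show inv (w ∘ Equiv.swap a b) = inv w + 1 by omega, pow_succ]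
    ring
  · rw [if_neg h1.asymm, if_pos h1] at this
    rw [show inv w = inv (w ∘ Equiv.swap a b) + 1 by omega, pow_succ]
    ring

/-- A prefix contains both exchanged places or neither of them, unless it ends between them, which
means that its length is `b`. -/
theorem cnt_swap (w : Fin q → L) {a b : Fin q} (hab : (a : ℕ) + 1 = b) (j : L) {t : ℕ}
    (ht : t ≠ b) : cnt (w ∘ Equiv.swap a b) j t = cnt w j t := by
  rw [cnt, ← Equiv.sum_comp (Equiv.swap a b)]
  refine Finset.sum_congr rfl fun r _ => ?_
  have : (Equiv.swap a b r : ℕ) < t ↔ (r : ℕ) < t := by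
    by_cases hra : r = a
    · subst hra
      rw [Equiv.swap_apply_left]
      omega
    · by_cases hrb : r = b
      · subst hrb
        rw [Equiv.swap_apply_right]
        omega
      · rw [Equiv.swap_apply_of_ne_of_ne hra hrb]
  simp [this]

theorem card_filter_val_lt (n r : ℕ) :
    (Finset.univ.filter fun t : Fin n => (t : ℕ) < r).card = min r n := by
  rw [Finset.card_filter]
  induction n with
  | zero => simp
  | succ n ih =>
    rw [Fin.sum_univ_castSucc]
    simp only [Fin.val_castSucc, Fin.val_last, ih]
    split_ifs <;> omega

/-- A downward closed subset of `Fin n` is an initial segment, so its cardinality is its endpoint.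
-/
theorem lt_card_filter_iff {n : ℕ} (P : Fin n → Prop) [DecidablePred P]
    (hP : ∀ s t, s ≤ t → P t → P s) (t : Fin n) :
    (t : ℕ) < (Finset.univ.filter P).card ↔ P t := by
  constructor
  · intro h
    by_contra hn
    have : (Finset.univ.filter P) ⊆ Finset.univ.filter fun s : Fin n => (s : ℕ) < t := by
      intro s hs
      simp only [Finset.mem_filter, Finset.mem_univ, true_and] at hs ⊢
      by_contra hle
      exact hn (hP _ _ (Fin.le_def.2 (not_lt.1 hle)) hs)
    have h2 := Finset.card_le_card this
    rw [card_filter_val_lt] at h2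
    omega
  · intro h
    have : (Finset.univ.filter fun s : Fin n => (s : ℕ) < t + 1) ⊆ Finset.univ.filter P := by
      intro s hs
      simp only [Finset.mem_filter, Finset.mem_univ, true_and] at hs ⊢
      exact hP _ _ (Fin.le_def.2 (Nat.lt_succ_iff.1 hs)) h
    have h2 := Finset.card_le_card this
    rw [card_filter_val_lt] at h2
    have := t.2
    omega

end Words

end SymHom

namespace SymHom

/-! ### Faces of words and the Leibniz rule for shuffles -/

section Leibniz

variable {L : Type} [LinearOrder L] {q : ℕ}

/-- The step function of the letter `i`, on all natural numbers. -/
def steps (w : Fin q → L) (i : L) : ℕ →o ℕ := ⟨cnt w i, cnt_mono w i⟩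

/-- The monotone injection that omits the value `l`. -/
def face (l : ℕ) : ℕ →o ℕ :=
  ⟨fun t => if t < l then t else t + 1, fun s t h => by dsimp only; split_ifs <;> omega⟩

theorem steps_apply (w : Fin q → L) (i : L) (t : ℕ) : steps w i t = cnt w i t := rfl

theorem face_apply (l t : ℕ) : face l t = if t < l then t else t + 1 := rfl

/-- The words with prescribed numbers of letters. -/
def words [Fintype L] (q : ℕ) (p : L → ℕ) : Finset (Fin q → L) :=
  Finset.univ.filter fun w => ∀ i, cnt w i q = p i

theorem mem_words [Fintype L] {p : L → ℕ} {w : Fin q → L} :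
    w ∈ words q p ↔ ∀ i, cnt w i q = p i := by simp [words]

/-- The letter affected by the face `r`. -/
def facePos (q r : ℕ) : Fin (q + 1) := ⟨min r q, by omega⟩

/-- The relation between a face `r` of a word `w` and a face `l` of the letter `i` together with the
word `w'` that is left. -/
structure FaceCorr (w : Fin (q + 1) → L) (r : ℕ) (i : L) (l : ℕ) (w' : Fin q → L) : Prop where
  le : r ≤ q + 1
  letter : w (facePos q r) = i
  rest : w ∘ (facePos q r).succAbove = w'
  lt_iff : ∀ t ≤ q, t < r ↔ cnt w' i t < l
  count : cnt w i r = l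

/-- The face `r` of `w` does not lie between two different letters. -/
def GoodFace (w : Fin (q + 1) → L) (r : ℕ) : Prop :=
  ∀ a b : Fin (q + 1), (a : ℕ) + 1 = b → (b : ℕ) = r → w a = w b

instance (w : Fin (q + 1) → L) (r : ℕ) : Decidable (GoodFace w r) := by
  unfold GoodFace; infer_instance

/-- A word is a lattice path, and the face `r` skips its vertex `r`. If the steps before and after
this vertex carry the same letter, or the vertex is an end of the path, then only the count of this
one letter jumps there. -/
theorem GoodFace.corr {w : Fin (q + 1) → L} {r : ℕ} (h : GoodFace w r) (hr : r ≤ q + 1) :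
    FaceCorr w r (w (facePos q r)) (cnt w (w (facePos q r)) r)
      (w ∘ (facePos q r).succAbove) where
  le := hr
  letter := rfl
  rest := rfl
  count := rfl
  lt_iff t ht := by
    -- The removed letter is the one after the vertex `r`, except at the end vertex `r = q + 1`,
    -- where it is the last letter `q`.
    have hpos : ((facePos q r : Fin (q + 1)) : ℕ) = min r q := rfl
    constructor
    · intro htr
      rw [← cnt_remove_le w (facePos q r) _ (by omega)]
      -- This is where goodness enters: the step that leads to the vertex `r` has the letter in
      -- question too, so its count was smaller before.
      have hlast : w ⟨r - 1, by omega⟩ = w (facePos q r) := by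
        by_cases hrq : r ≤ q
        · exact h _ _ (by simp [hpos]; omega) (by omega)
        · exact congrArg w (Fin.ext (by simp [hpos]; omega))
      have h1 := cnt_succ w (w (facePos q r)) ⟨r - 1, by omega⟩
      rw [if_pos hlast] at h1
      have h2 := cnt_mono w (w (facePos q r)) (show t ≤ r - 1 by omega)
      simp only [show r - 1 + 1 = r by omega] at h1
      omega
    · intro hlt
      by_contra htr
      have h1 := cnt_remove_gt w (facePos q r) (w (facePos q r)) (t := t) (by omega)
      rw [if_pos rfl] at h1
      have h2 := cnt_succ w (w (facePos q r)) (facePos q r)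
      rw [if_pos rfl] at h2
      have h3 := cnt_mono w (w (facePos q r))
        (show ((facePos q r : Fin (q + 1)) : ℕ) + 1 ≤ t + 1 by omega)
      have h4 : ((facePos q r : Fin (q + 1)) : ℕ) = r := by omega
      rw [h4] at h2 h3
      omega

/-- The face of a word that corresponds to the face `l` of the letter `i`. -/
def faceIdx (i : L) (l : ℕ) (w' : Fin q → L) : ℕ :=
  (Finset.univ.filter fun t : Fin (q + 1) => cnt w' i t < l).card

/-- The converse construction: insert `i` at the first vertex of `w'` where its count has reached
`l`, at the end if this never happens. By monotonicity of the count this vertex is the number of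
vertices with count below `l`. -/
theorem faceIdx_corr (i : L) (l : ℕ) (w' : Fin q → L) (hl : l ≤ cnt w' i q + 1) :
    FaceCorr ((facePos q (faceIdx i l w')).insertNth i w' : Fin (q + 1) → L) (faceIdx i l w')
      i l w' := by
  have hr : faceIdx i l w' ≤ q + 1 := (Finset.card_le_univ _).trans (by simp)
  have hlt : ∀ t ≤ q, t < faceIdx i l w' ↔ cnt w' i t < l := fun t ht =>
    lt_card_filter_iff (fun t : Fin (q + 1) => cnt w' i t < l)
      (fun s t hst h => (cnt_mono w' i (Fin.le_def.1 hst)).trans_lt h) ⟨t, by omega⟩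
  generalize faceIdx i l w' = r at hr hlt
  have hrest : ((facePos q r).insertNth i w' : Fin (q + 1) → L) ∘ (facePos q r).succAbove = w' := by
    funext x
    simp
  refine ⟨hr, by simp, hrest, hlt, ?_⟩
  have hpos : ((facePos q r : Fin (q + 1)) : ℕ) = min r q := rfl
  by_cases hrq : r ≤ q
  · rw [cnt_remove_le _ (facePos q r) i (by omega), hrest]
    have h1 := hlt r hrq
    rcases Nat.eq_zero_or_pos r with h0 | h0
    · subst h0
      rw [cnt_zero] at h1 ⊢
      omega
    · have h2 := hlt (r - 1) (by omega)
      have h3 := cnt_succ w' i ⟨r - 1, by omega⟩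
      simp only [show r - 1 + 1 = r by omega] at h3
      split_ifs at h3 <;> omega
  · obtain rfl : r = q + 1 := by omega
    rw [cnt_remove_gt _ (facePos q (q + 1)) i (by omega), hrest]
    have h1 := hlt q le_rfl
    simp
    omega

namespace FaceCorr

variable {w : Fin (q + 1) → L} {r : ℕ} {i : L} {l : ℕ} {w' : Fin q → L}

/-- Beyond the skipped vertex the extra letter has raised the count of `i` by one and changed no
other count. So a good face of a shuffled simplex is the shuffle of a face of the factor `i` with
the other factors. -/
theorem face_steps (h : FaceCorr w r i l w') (j : L) {t : ℕ} (ht : t ≤ q) :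
    cnt w j (face r t) = Function.update (steps w') i ((face l).comp (steps w' i)) j t := by
  have hpos : ((facePos q r : Fin (q + 1)) : ℕ) = min r q := rfl
  have hle := h.le
  have h1 := h.lt_iff t ht
  have h2 : cnt w j (face r t) = cnt w' j t + if t < r then 0 else if j = i then 1 else 0 := by
    by_cases htr : t < r
    · have := cnt_remove_le w (facePos q r) j (t := t) (by omega)
      rw [h.rest] at this
      rw [face_apply, if_pos htr, this, if_pos htr, add_zero]
    · have := cnt_remove_gt w (facePos q r) j (t := t) (by omega)
      rw [h.rest, h.letter] at this
      rw [face_apply, if_neg htr, this, if_neg htr]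
      simp [eq_comm]
  rw [h2]
  by_cases hj : j = i
  · subst hj
    simp only [if_true, Function.update_self, OrderHom.comp_coe, Function.comp_apply]
    rw [face_apply, steps_apply]
    by_cases htr : t < r
    · rw [if_pos htr, if_pos (h1.1 htr), add_zero]
    · rw [if_neg htr, if_neg fun hh => htr (h1.2 hh)]
  · simp [hj, steps_apply]

theorem content (h : FaceCorr w r i l w') (j : L) :
    cnt w j (q + 1) = cnt w' j q + if j = i then 1 else 0 := by
  have hpos : ((facePos q r : Fin (q + 1)) : ℕ) = min r q := rfl
  have := cnt_remove_gt w (facePos q r) j (t := q) (by omega)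
  rw [h.rest, h.letter] at this
  simp [this, eq_comm]

/-- In `w'` the count of `i` passes from below `l` to at least `l` exactly at the vertex `r`, so the
preceding letter of `w'` must be `i`. -/
theorem good (h : FaceCorr w r i l w') : GoodFace w r := by
  intro a b hab hb
  have hpos : ((facePos q r : Fin (q + 1)) : ℕ) = min r q := rfl
  have hbpos : b = facePos q r := Fin.ext (by omega)
  rw [hbpos, h.letter]
  have h1 := h.lt_iff a (by omega)
  have h2 := h.lt_iff b (by omega)
  have h3 := cnt_succ w' i ⟨a, by omega⟩
  have h4 : w' ⟨a, by omega⟩ = i := by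
    by_contra hne
    rw [if_neg hne] at h3
    simp only [hab] at h3
    omega
  rw [← h4, ← h.rest]
  refine congrArg w (Fin.ext ?_)
  rw [Fin.succAbove_of_castSucc_lt]
  · rfl
  · rw [Fin.lt_def]
    simp
    omega

theorem eq_faceIdx (h : FaceCorr w r i l w') : faceIdx i l w' = r := by
  rw [faceIdx, Finset.filter_congr (q := fun t : Fin (q + 1) => (t : ℕ) < r) fun t _ =>
    (h.lt_iff t (by omega)).symm, card_filter_val_lt]
  exact min_eq_left h.le

theorem eq_insertNth (h : FaceCorr w r i l w') :
    ((facePos q r).insertNth i w' : Fin (q + 1) → L) = w := by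
  rw [← h.letter, ← h.rest]
  exact Fin.insertNth_self_removeNth _ _

/-- Removing the letter at place `n` removes `A` inversions with smaller letters behind it and `B`
with larger letters in front of it. Sort the `n` letters in front by size, and the letters smaller
than `i` by place; the two exponents then differ by `2 * B`. -/
theorem sign [Fintype L] (h : FaceCorr w r i l w') {p : L → ℕ} (hp : ∀ j, cnt w j (q + 1) = p j) :
    (-1 : ℤ) ^ r * wsign w = (-1) ^ (∑ t with t < i, p t + l) * wsign w' := by
  have hpos : ((facePos q r : Fin (q + 1)) : ℕ) = min r q := rfl
  have hle := h.le
  set n : ℕ := ((facePos q r : Fin (q + 1)) : ℕ) with hn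
  have hinv := inv_remove w (facePos q r)
  have hrest : ∀ x, w ((facePos q r).succAbove x) = w' x := fun x => congrFun h.rest x
  simp only [hrest, h.letter, h.rest, ← hn] at hinv
  set A := ∑ y : Fin q, if n ≤ (y : ℕ) ∧ w' y < i then 1 else 0 with hA
  set B := ∑ x : Fin q, if (x : ℕ) < n ∧ i < w' x then 1 else 0 with hB
  have h1 : n = B + cnt w' i n + ∑ x : Fin q, if (x : ℕ) < n ∧ w' x < i then 1 else 0 := by
    have : n = ∑ x : Fin q, if (x : ℕ) < n then 1 else 0 := by
      rw [← Finset.card_filter, card_filter_val_lt]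
      omega
    conv_lhs => rw [this]
    rw [hB, cnt, ← Finset.sum_add_distrib, ← Finset.sum_add_distrib]
    refine Finset.sum_congr rfl fun x _ => ?_
    rcases lt_trichotomy (w' x) i with h1 | h1 | h1
    · simp [h1, h1.ne, h1.not_gt]
    · simp [h1]
    · simp [h1, h1.ne', h1.not_gt]
  have h2 : ∑ t with t < i, p t = A + ∑ x : Fin q, if (x : ℕ) < n ∧ w' x < i then 1 else 0 := by
    have e1 : ∑ t with t < i, p t = ∑ t with t < i, ∑ x : Fin q, if w' x = t then 1 else 0 := by
      refine Finset.sum_congr rfl fun t ht => ?_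
      rw [← hp, h.content, if_neg (Finset.mem_filter.1 ht).2.ne, add_zero, cnt]
      simp
    rw [e1, Finset.sum_comm, hA, ← Finset.sum_add_distrib]
    refine Finset.sum_congr rfl fun x _ => ?_
    rw [Finset.sum_ite_eq]
    simp only [Finset.mem_filter, Finset.mem_univ, true_and]
    by_cases hx : w' x < i
    · by_cases hxn : (x : ℕ) < n
      · simp [hx, hxn, not_le.2 hxn]
      · simp [hx, hxn, not_lt.1 hxn]
    · simp [hx]
  have h3 : r + cnt w' i n = n + l := by
    by_cases hrq : r ≤ q
    · have := cnt_remove_le w (facePos q r) i (t := r) (by omega)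
      rw [h.rest, h.count] at this
      rw [show n = r by omega, this]
    · have := cnt_remove_gt w (facePos q r) i (t := q) (by omega)
      obtain rfl : r = q + 1 := by omega
      rw [h.rest, h.letter, if_pos rfl, h.count] at this
      rw [show n = q by omega]
      omega
  rw [wsign, wsign, ← pow_add, ← pow_add]
  rw [show r + inv w = (∑ t with t < i, p t + l + inv w') + 2 * B by omega, pow_add, pow_mul]
  simp

end FaceCorr

/-- Exchange the two different letters that meet at the face. The two paths differ only in the
vertex that the face skips, while the sign of the word is reversed, so the terms cancel under an
involution without fixed points. -/
theorem sum_badFace [Fintype L] {M : Type*} [AddCommGroup M] (p : L → ℕ)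
    (Ev : (L → ℕ →o ℕ) → M)
    (hEv : ∀ f g : L → ℕ →o ℕ, (∀ i, ∀ t ≤ q, f i t = g i t) → Ev f = Ev g) :
    ∑ x ∈ (words (q + 1) p ×ˢ Finset.range (q + 2)).filter fun x => ¬ GoodFace x.1 x.2,
      ((-1 : ℤ) ^ x.2 * wsign x.1) • Ev (fun j => (steps x.1 j).comp (face x.2)) = 0 := by
  have hbad : ∀ x : (Fin (q + 1) → L) × ℕ, ¬ GoodFace x.1 x.2 →
      ∃ ab : Fin (q + 1) × Fin (q + 1), (ab.1 : ℕ) + 1 = ab.2 ∧ (ab.2 : ℕ) = x.2 ∧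
        x.1 ab.1 ≠ x.1 ab.2 := by
    intro x hx
    simp only [GoodFace, not_forall] at hx
    obtain ⟨a, b, h1, h2, h3⟩ := hx
    exact ⟨(a, b), h1, h2, h3⟩
  let g : (x : (Fin (q + 1) → L) × ℕ) → ¬ GoodFace x.1 x.2 → (Fin (q + 1) → L) × ℕ :=
    fun x h => (x.1 ∘ Equiv.swap (hbad x h).choose.1 (hbad x h).choose.2, x.2)
  have hg : ∀ x h, ∃ a b : Fin (q + 1), (a : ℕ) + 1 = b ∧ (b : ℕ) = x.2 ∧ x.1 a ≠ x.1 b ∧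
      g x h = (x.1 ∘ Equiv.swap a b, x.2) := fun x h =>
    ⟨_, _, (hbad x h).choose_spec.1, (hbad x h).choose_spec.2.1, (hbad x h).choose_spec.2.2, rfl⟩
  have hgood : ∀ x h, ¬ GoodFace (g x h).1 (g x h).2 := by
    intro x h
    obtain ⟨a, b, h1, h2, h3, h4⟩ := hg x h
    rw [h4]
    intro hh
    refine h3 ?_
    have := hh a b h1 h2
    simpa using this.symm
  refine Finset.sum_involution (fun x hx => g x (Finset.mem_filter.1 hx).2) ?_ ?_ ?_ ?_
  · intro x hx
    obtain ⟨a, b, h1, h2, h3, h4⟩ := hg x (Finset.mem_filter.1 hx).2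
    rw [h4]
    have hE : Ev (fun j => (steps (x.1 ∘ Equiv.swap a b) j).comp (face x.2)) =
        Ev (fun j => (steps x.1 j).comp (face x.2)) := by
      refine hEv _ _ fun j t _ => cnt_swap x.1 h1 j ?_
      rw [face_apply]
      split_ifs <;> omega
    simp only [hE, wsign_swap x.1 h1 h3]
    simp
  · intro x hx _ heq
    obtain ⟨a, b, h1, h2, h3, h4⟩ := hg x (Finset.mem_filter.1 hx).2
    rw [h4] at heq
    have := congrFun (congrArg Prod.fst heq) a
    simp only [Function.comp_apply, Equiv.swap_apply_left] at this
    exact h3 this.symm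
  · intro x hx
    refine Finset.mem_filter.2 ⟨?_, hgood x (Finset.mem_filter.1 hx).2⟩
    obtain ⟨a, b, h1, h2, h3, h4⟩ := hg x (Finset.mem_filter.1 hx).2
    have hx1 := Finset.mem_product.1 (Finset.mem_filter.1 hx).1
    rw [h4]
    refine Finset.mem_product.2 ⟨mem_words.2 fun i => ?_, hx1.2⟩
    rw [cnt_swap x.1 h1 i (by omega)]
    exact mem_words.1 hx1.1 i
  · intro x hx
    obtain ⟨a, b, h1, h2, h3, h4⟩ := hg x (Finset.mem_filter.1 hx).2
    obtain ⟨a', b', h1', h2', h3', h4'⟩ := hg (g x (Finset.mem_filter.1 hx).2) (hgood x (Finset.mem_filter.1 hx).2)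
    refine h4'.trans ?_
    -- The exchanged pair is determined by the face, which does not change; so exchanging twice
    -- restores the word.
    have hb : b' = b := Fin.ext (by rw [h2', h4, h2])
    have ha : a' = a := Fin.ext (by rw [hb] at h1'; omega)
    rw [h4, ha, hb]
    refine Prod.ext (funext fun y => ?_) rfl
    simp

/-- The boundary of a sum over shuffles, as an identity on words. -/
theorem words_leibniz [Fintype L] {M : Type*} [AddCommGroup M] (p : L → ℕ)
    (Ev : (L → ℕ →o ℕ) → M)
    (hEv : ∀ f g : L → ℕ →o ℕ, (∀ i, ∀ t ≤ q, f i t = g i t) → Ev f = Ev g) :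
    ∑ w ∈ words (q + 1) p, ∑ r ∈ Finset.range (q + 2),
      ((-1 : ℤ) ^ r * wsign w) • Ev (fun j => (steps w j).comp (face r)) =
    ∑ i, ∑ l ∈ Finset.range (p i + 1),
      ∑ w ∈ Finset.univ.filter fun w : Fin q → L =>
        ∀ j, cnt w j q + (if j = i then 1 else 0) = p j,
      ((-1 : ℤ) ^ (∑ t with t < i, p t + l) * wsign w) •
        Ev (Function.update (steps w) i ((face l).comp (steps w i))) := by
  -- The bad faces contribute zero. The good ones correspond, by removing and inserting a letter as
  -- in `FaceCorr`, to the faces of the single letters.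
  rw [← Finset.sum_product', ← Finset.sum_filter_add_sum_filter_not _
    (fun x : (Fin (q + 1) → L) × ℕ => GoodFace x.1 x.2), sum_badFace p Ev hEv, add_zero]
  simp only [← Finset.sum_product']
  rw [← Finset.sum_sigma Finset.univ (fun i => Finset.range (p i + 1) ×ˢ
    Finset.univ.filter fun w : Fin q → L => ∀ j, cnt w j q + (if j = i then 1 else 0) = p j)
    (fun x => ((-1 : ℤ) ^ (∑ t with t < x.1, p t + x.2.1) * wsign x.2.2) •
        Ev (Function.update (steps x.2.2) x.1 ((face x.2.1).comp (steps x.2.2 x.1))))]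
  have hmem : ∀ x : (Fin (q + 1) → L) × ℕ,
      x ∈ (words (q + 1) p ×ˢ Finset.range (q + 2)).filter
        (fun x : (Fin (q + 1) → L) × ℕ => GoodFace x.1 x.2) ↔
      (∀ i, cnt x.1 i (q + 1) = p i) ∧ x.2 ≤ q + 1 ∧ GoodFace x.1 x.2 := by
    intro x
    rw [Finset.mem_filter, Finset.mem_product, mem_words, Finset.mem_range, and_assoc,
      Nat.lt_succ_iff]
  have hmem' : ∀ y : (_ : L) × ℕ × (Fin q → L),
      y ∈ Finset.univ.sigma (fun i => Finset.range (p i + 1) ×ˢ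
        Finset.univ.filter fun w : Fin q → L =>
          ∀ j, cnt w j q + (if j = i then 1 else 0) = p j) ↔
      y.2.1 ≤ p y.1 ∧ ∀ j, cnt y.2.2 j q + (if j = y.1 then 1 else 0) = p j := by
    intro y
    simp
  have hcorr : ∀ y : (_ : L) × ℕ × (Fin q → L),
      (y.2.1 ≤ p y.1 ∧ ∀ j, cnt y.2.2 j q + (if j = y.1 then 1 else 0) = p j) →
      FaceCorr ((facePos q (faceIdx y.1 y.2.1 y.2.2)).insertNth y.1 y.2.2 : Fin (q + 1) → L)
        (faceIdx y.1 y.2.1 y.2.2) y.1 y.2.1 y.2.2 := by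
    intro y hy
    refine faceIdx_corr _ _ _ ?_
    have := hy.2 y.1
    rw [if_pos rfl] at this
    omega
  refine Finset.sum_bij'
    (fun x _ => (⟨x.1 (facePos q x.2), cnt x.1 (x.1 (facePos q x.2)) x.2,
      x.1 ∘ (facePos q x.2).succAbove⟩ : (_ : L) × ℕ × (Fin q → L)))
    (fun y _ => ((facePos q (faceIdx y.1 y.2.1 y.2.2)).insertNth y.1 y.2.2,
      faceIdx y.1 y.2.1 y.2.2)) ?_ ?_ ?_ ?_ ?_
  · intro x hx
    rw [hmem] at hx
    rw [hmem']
    have h := hx.2.2.corr hx.2.1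
    exact ⟨(cnt_mono _ _ hx.2.1).trans (hx.1 _).le, fun j => (h.content j).symm.trans (hx.1 j)⟩
  · intro y hy
    rw [hmem'] at hy
    rw [hmem]
    have h := hcorr y hy
    exact ⟨fun j => (h.content j).trans (hy.2 j), h.le, h.good⟩
  · intro x hx
    rw [hmem] at hx
    have h := hx.2.2.corr hx.2.1
    refine Prod.ext ?_ h.eq_faceIdx
    dsimp only
    rw [h.eq_faceIdx, h.eq_insertNth]
  · intro y hy
    rw [hmem'] at hy
    have h := hcorr y hy
    dsimp only
    rw [h.letter, h.rest, h.count]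
  · intro x hx
    rw [hmem] at hx
    have h := hx.2.2.corr hx.2.1
    dsimp only
    rw [h.sign hx.1]
    congr 1
    exact hEv _ _ fun j t ht => h.face_steps j ht

end Leibniz

end SymHom

namespace SymHom

/-! ### Composition of shuffles: refined alphabets -/

section Glue

theorem cnt_lt {L : Type} [LinearOrder L] {q : ℕ} (w : Fin q → L) {x y : Fin q} (h : x < y) :
    cnt w (w x) x < cnt w (w x) y := by
  have h1 := cnt_succ w (w x) x
  rw [if_pos rfl] at h1
  have h2 := cnt_mono w (w x) (show (x : ℕ) + 1 ≤ y from h)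
  omega

/-- The alphabet obtained from `L` by replacing each letter `l` by the alphabet `K l`, with the
lexicographic order. -/
structure Refined {L : Type} (K : L → Type) where
  fst : L
  snd : K fst

/-- A refined alphabet as a sigma type. -/
def Refined.equiv {L : Type} (K : L → Type) : Refined K ≃ (l : L) × K l where
  toFun x := ⟨x.1, x.2⟩
  invFun x := ⟨x.1, x.2⟩

variable {L : Type} [LinearOrder L] {K : L → Type} [∀ l, LinearOrder (K l)]

noncomputable instance : LinearOrder (Refined K) :=
  LinearOrder.lift' (fun x => (toLex ⟨x.1, x.2⟩ : Σₗ l, K l))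
    fun x y h => (Refined.equiv K).injective (toLex.injective h)

instance [Fintype L] [∀ l, Fintype (K l)] : Fintype (Refined K) :=
  Fintype.ofEquiv _ (Refined.equiv K).symm

omit [LinearOrder L] [∀ l, LinearOrder (K l)] in
theorem Refined.sum_eq [Fintype L] [∀ l, Fintype (K l)] {M : Type*} [AddCommMonoid M]
    (f : Refined K → M) : ∑ x, f x = ∑ l, ∑ κ, f ⟨l, κ⟩ := by
  rw [← (Refined.equiv K).symm.sum_comp, Fintype.sum_sigma]
  rfl

theorem Refined.lt_iff (a b : Refined K) :
    a < b ↔ a.1 < b.1 ∨ ∃ h : a.1 = b.1, h ▸ a.2 < b.2 :=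
  Sigma.Lex.lt_def (a := toLex ⟨a.1, a.2⟩) (b := toLex ⟨b.1, b.2⟩)

theorem Refined.mk_lt_mk {l : L} {x y : K l} : (⟨l, x⟩ : Refined K) < ⟨l, y⟩ ↔ x < y := by
  rw [Refined.lt_iff]
  simp

theorem Refined.fst_le {a b : Refined K} (h : a < b) : a.1 ≤ b.1 := by
  rcases (Refined.lt_iff a b).1 h with h | ⟨h, _⟩
  · exact h.le
  · exact h.le

theorem Refined.lt_of_fst {a b : Refined K} (h : a.1 < b.1) : a < b :=
  (Refined.lt_iff a b).2 (Or.inl h)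

variable {q : ℕ} [Fintype L] {P : L → ℕ}

theorem sum_cnt {L : Type} [LinearOrder L] [Fintype L] (w : Fin q → L) : ∑ l, cnt w l q = q := by
  simp only [cnt, Fin.is_lt, true_and]
  rw [Finset.sum_comm]
  simp

/-- Sends a place of the word to its letter and the number of this letter before that place. -/
noncomputable def rankEquiv (w : Fin q → L) (h : ∀ l, cnt w l q = P l) :
    Fin q ≃ (l : L) × Fin (P l) :=
  Equiv.ofBijective (fun x => ⟨w x, cnt w (w x) x, by
    rw [← h]
    have h1 := cnt_succ w (w x) x
    rw [if_pos rfl] at h1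
    have h2 := cnt_mono w (w x) (show (x : ℕ) + 1 ≤ q from x.2)
    omega⟩) (by
    rw [Fintype.bijective_iff_injective_and_card]
    constructor
    · intro x y hxy
      have h1 : w x = w y := congrArg Sigma.fst hxy
      have h2 : cnt w (w x) x = cnt w (w y) y :=
        congrArg (fun u : (l : L) × Fin (P l) => (u.2 : ℕ)) hxy
      rcases lt_trichotomy x y with h3 | h3 | h3
      · have := cnt_lt w h3
        rw [h2, h1] at this
        exact absurd this (lt_irrefl _)
      · exact h3
      · have := cnt_lt w h3
        rw [← h2, ← h1] at this
        exact absurd this (lt_irrefl _)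
    · rw [Fintype.card_sigma]
      simp only [Fintype.card_fin]
      rw [← funext h, sum_cnt])

theorem rankEquiv_fst (w : Fin q → L) (h : ∀ l, cnt w l q = P l) (x : Fin q) :
    (rankEquiv w h x).1 = w x := rfl

theorem rankEquiv_snd (w : Fin q → L) (h : ∀ l, cnt w l q = P l) (x : Fin q) :
    ((rankEquiv w h x).2 : ℕ) = cnt w (w x) x := rfl

/-- The word obtained from `w` by replacing the letters `l` by the letters of `v l`. -/
noncomputable def glue (w : Fin q → L) (h : ∀ l, cnt w l q = P l) (v : ∀ l, Fin (P l) → K l) :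
    Fin q → Refined K :=
  fun x => ⟨(rankEquiv w h x).1, v _ (rankEquiv w h x).2⟩

/-- At a place with outer letter `l`, the number of earlier `l`'s is the place of `v l` that is
read. So the composite of the two step functions counts the refined letter. -/
theorem cnt_glue_of_le (w : Fin q → L) (h : ∀ l, cnt w l q = P l) (v : ∀ l, Fin (P l) → K l)
    (l : L) (κ : K l) {t : ℕ} (ht : t ≤ q) :
    cnt (glue w h v) ⟨l, κ⟩ t = cnt (v l) κ (cnt w l t) := by
  induction t with
  | zero => simp [cnt_zero]
  | succ t ih =>
    have h1 := cnt_succ (glue w h v) (⟨l, κ⟩ : Refined K) ⟨t, ht⟩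
    have h2 := cnt_succ w l ⟨t, ht⟩
    dsimp only at h1 h2
    rw [h1, h2, ih (by omega)]
    by_cases hl : w ⟨t, ht⟩ = l
    · subst hl
      rw [if_pos rfl]
      have h3 := cnt_succ (v (w ⟨t, ht⟩)) κ (rankEquiv w h ⟨t, ht⟩).2
      refine Eq.trans ?_ h3.symm
      congr 1
      refine if_congr ?_ rfl rfl
      constructor
      · intro hh
        exact eq_of_heq (Refined.mk.inj hh).2
      · intro hh
        exact congrArg (fun z => (⟨_, z⟩ : Refined K)) hh
    · rw [if_neg hl, if_neg fun hh => hl (congrArg Refined.fst hh), add_zero]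
      rfl

theorem cnt_glue (w : Fin q → L) (h : ∀ l, cnt w l q = P l) (v : ∀ l, Fin (P l) → K l)
    (l : L) (κ : K l) (t : ℕ) :
    cnt (glue w h v) ⟨l, κ⟩ t = cnt (v l) κ (cnt w l t) := by
  rcases le_total t q with ht | ht
  · exact cnt_glue_of_le w h v l κ ht
  · rw [cnt_of_le _ _ ht, cnt_of_le w _ ht, cnt_glue_of_le w h v l κ le_rfl]

/-- Places with different outer letters are inverted exactly when they are inverted in `w`. Places
with the same outer letter `l` are never inverted in `w`, and they form, in the same order, the
places of `v l`. -/
theorem inv_glue (w : Fin q → L) (h : ∀ l, cnt w l q = P l) (v : ∀ l, Fin (P l) → K l) :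
    inv (glue w h v) = inv w + ∑ l, inv (v l) := by
  let G : (l : L) × Fin (P l) → Refined K := fun u => ⟨u.1, v u.1 u.2⟩
  have h1 : ∑ l, inv (v l) = ∑ x, ∑ y, if (rankEquiv w h x).1 = (rankEquiv w h y).1 ∧
      ((rankEquiv w h x).2 : ℕ) < (rankEquiv w h y).2 ∧
      G (rankEquiv w h y) < G (rankEquiv w h x) then 1 else 0 := by
    rw [(rankEquiv w h).sum_comp (fun u => ∑ y, if u.1 = (rankEquiv w h y).1 ∧
      (u.2 : ℕ) < (rankEquiv w h y).2 ∧ G (rankEquiv w h y) < G u then 1 else 0),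
      Fintype.sum_sigma]
    refine Finset.sum_congr rfl fun l _ => Finset.sum_congr rfl fun a _ => ?_
    rw [(rankEquiv w h).sum_comp (fun u => if l = u.1 ∧
      (a : ℕ) < u.2 ∧ G u < G ⟨l, a⟩ then 1 else 0), Fintype.sum_sigma,
      Finset.sum_eq_single l]
    · refine Finset.sum_congr rfl fun b _ => ?_
      refine if_congr ?_ rfl rfl
      rw [Fin.lt_def]
      exact ⟨fun hh => ⟨rfl, hh.1, Refined.mk_lt_mk.2 hh.2⟩,
        fun hh => ⟨hh.2.1, Refined.mk_lt_mk.1 hh.2.2⟩⟩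
    · intro l' _ hl
      refine Finset.sum_eq_zero fun b _ => if_neg fun hh => hl hh.1.symm
    · simp
  rw [h1, inv, inv, ← Finset.sum_add_distrib]
  refine Finset.sum_congr rfl fun x _ => ?_
  rw [← Finset.sum_add_distrib]
  refine Finset.sum_congr rfl fun y _ => ?_
  have hx : glue w h v x = G (rankEquiv w h x) := rfl
  have hy : glue w h v y = G (rankEquiv w h y) := rfl
  rw [hx, hy]
  simp only [rankEquiv_fst, rankEquiv_snd]
  rcases lt_trichotomy (w x) (w y) with hxy | hxy | hxy
  · have h2 : ¬ G (rankEquiv w h y) < G (rankEquiv w h x) := fun hh =>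
      absurd (Refined.fst_le hh) (not_le.2 hxy)
    simp [h2, hxy.not_gt]
  · have h3 : x < y ↔ cnt w (w x) x < cnt w (w y) y := by
      constructor
      · intro hh
        have := cnt_lt w hh
        rwa [← hxy]
      · intro hh
        by_contra hn
        rw [← hxy] at hh
        exact absurd hh (not_lt.2 (cnt_mono w (w x) (Fin.le_def.1 (not_lt.1 hn))))
    simp [hxy, h3]
  · have h2 : G (rankEquiv w h y) < G (rankEquiv w h x) := Refined.lt_of_fst hxy
    simp [h2, hxy, hxy.ne']

omit [Fintype L] in
theorem cnt_fst [∀ l, Fintype (K l)] (w : Fin q → Refined K) (l : L) (t : ℕ) :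
    cnt (fun x => (w x).1) l t = ∑ κ, cnt w ⟨l, κ⟩ t := by
  simp only [cnt]
  rw [Finset.sum_comm]
  refine Finset.sum_congr rfl fun r _ => ?_
  by_cases h : (w r).1 = l
  · subst h
    rw [Finset.sum_eq_single (w r).2]
    · exact if_congr ⟨fun h => ⟨h.1, rfl⟩, fun h => ⟨h.1, rfl⟩⟩ rfl rfl
    · intro κ _ hκ
      exact if_neg fun hh => hκ (eq_of_heq (Refined.mk.inj hh.2).2).symm
    · simp
  · rw [if_neg fun hh => h hh.2]
    exact (Finset.sum_eq_zero fun κ _ => if_neg fun hh => h (congrArg Refined.fst hh.2)).symm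

/-- Shuffles of shuffles are shuffles. -/
theorem words_comp [∀ l, Fintype (K l)] {M : Type*} [AddCommGroup M] (p : Refined K → ℕ)
    (hP : ∀ l, P l = ∑ κ, p ⟨l, κ⟩) (Ev : (Refined K → ℕ →o ℕ) → M) :
    ∑ w ∈ words q P, ∑ v ∈ Fintype.piFinset fun l => words (P l) (fun κ => p ⟨l, κ⟩),
      (wsign w * ∏ l, wsign (v l)) • Ev (fun x => (steps (v x.1) x.2).comp (steps w x.1)) =
    ∑ w ∈ words q p, wsign w • Ev (steps w) := by
  rw [← Finset.sum_product']
  have hc : ∀ x : (Fin q → L) × (∀ l, Fin (P l) → K l),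
      x ∈ words q P ×ˢ Fintype.piFinset (fun l => words (P l) (fun κ => p ⟨l, κ⟩)) →
      ∀ l, cnt x.1 l q = P l := fun x hx => mem_words.1 (Finset.mem_product.1 hx).1
  refine Finset.sum_bij (fun x hx => glue x.1 (hc x hx) x.2) ?_ ?_ ?_ ?_
  · intro x hx
    have h2 := Fintype.mem_piFinset.1 (Finset.mem_product.1 hx).2
    refine mem_words.2 fun i => ?_
    refine (cnt_glue x.1 (hc x hx) x.2 i.1 i.2 q).trans ?_
    rw [hc x hx]
    exact mem_words.1 (h2 i.1) i.2
  · rintro ⟨w, v⟩ hx ⟨w', v'⟩ hx' h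
    have h1 : w = w' := funext fun r => congrArg Refined.fst (congrFun h r)
    subst h1
    refine Prod.ext rfl (funext fun l => funext fun a => ?_)
    have h2 := congrFun h ((rankEquiv w (hc (w, v) hx)).symm ⟨l, a⟩)
    dsimp only [glue] at h2
    rw [Equiv.apply_symm_apply] at h2
    exact eq_of_heq (Refined.mk.inj h2).2
  · intro w hw
    -- A refined word is taken apart into its word of outer letters and, for each `l`, the inner
    -- letters over `l` read in order.
    have hw1 : ∀ l, cnt (fun x => (w x).1) l q = P l := fun l => by
      rw [cnt_fst, hP]
      exact Finset.sum_congr rfl fun κ _ => mem_words.1 hw _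
    have hex : ∀ l (a : Fin (P l)), ∃ κ : K l, w ((rankEquiv _ hw1).symm ⟨l, a⟩) = ⟨l, κ⟩ := by
      intro l a
      have h1 : (w ((rankEquiv _ hw1).symm ⟨l, a⟩)).1 = l :=
        congrArg Sigma.fst (Equiv.apply_symm_apply (rankEquiv _ hw1) ⟨l, a⟩)
      generalize w ((rankEquiv _ hw1).symm ⟨l, a⟩) = z at h1
      subst h1
      exact ⟨z.2, rfl⟩
    choose v hv using hex
    have hglue : glue _ hw1 v = w := by
      funext x
      have h2 := hv (rankEquiv _ hw1 x).1 (rankEquiv _ hw1 x).2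
      refine h2.symm.trans (congrArg w ?_)
      exact Equiv.symm_apply_apply (rankEquiv _ hw1) x
    refine ⟨(fun x => (w x).1, v), Finset.mem_product.2 ⟨mem_words.2 hw1,
      Fintype.mem_piFinset.2 fun l => mem_words.2 fun κ => ?_⟩, hglue⟩
    have := cnt_glue _ hw1 v l κ q
    rw [hglue, hw1] at this
    exact this.symm.trans (mem_words.1 hw _)
  · intro x hx
    have h1 : steps (glue x.1 (hc x hx) x.2) =
        fun y => (steps (x.2 y.1) y.2).comp (steps x.1 y.1) := by
      funext y
      ext t
      exact cnt_glue x.1 (hc x hx) x.2 y.1 y.2 t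
    rw [h1]
    congr 1
    simp only [wsign, inv_glue, pow_add, Finset.prod_pow_eq_pow_sum]

end Glue

/-! ### Renaming the letters, and words with a single letter -/

section Reorder

variable {L L' : Type} [LinearOrder L] [LinearOrder L'] {q : ℕ}

theorem cnt_comp_equiv (φ : L ≃ L') (w : Fin q → L) (i : L) (t : ℕ) :
    cnt (fun x => φ (w x)) (φ i) t = cnt w i t := by
  simp [cnt]

/-- A pair of places gains or loses an inversion exactly when `φ` reverses the order of its two
letters. Each reversed pair of letters accounts for `p x * p y` pairs of places, whatever the word.
-/
theorem wsign_comp_equiv [Fintype L] (φ : L ≃ L') (w : Fin q → L) {p : L → ℕ}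
    (hp : ∀ i, cnt w i q = p i) :
    wsign (fun x => φ (w x)) =
      (-1) ^ (∑ x, ∑ y with x < y ∧ φ y < φ x, p x * p y) * wsign w := by
  let P : L → L → Prop := fun x y => x < y ∧ φ y < φ x
  have h1 : ∑ x, ∑ y with x < y ∧ φ y < φ x, p x * p y =
      ∑ a, ∑ b, if P (w a) (w b) then 1 else 0 := by
    have e : ∀ (a b : Fin q), (if P (w a) (w b) then 1 else 0) =
        ∑ x, ∑ y, if x < y ∧ φ y < φ x then
          (if w a = x then 1 else 0) * (if w b = y then 1 else 0) else 0 := by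
      intro a b
      rw [Finset.sum_eq_single (w a), Finset.sum_eq_single (w b)]
      · simp [P]
      · intro y _ hy
        simp [hy.symm]
      · simp
      · intro x _ hx
        simp [hx.symm]
      · simp
    have hp' : ∀ i, p i = ∑ a, if w a = i then 1 else 0 := fun i => by
      rw [← hp]
      simp [cnt]
    simp only [e]
    have e2 : ∀ a : Fin q, ∑ b : Fin q, ∑ x, ∑ y, (if x < y ∧ φ y < φ x then
          (if w a = x then 1 else 0) * (if w b = y then 1 else 0) else 0) =
        ∑ x, ∑ y, if x < y ∧ φ y < φ x then (if w a = x then 1 else 0) * p y else 0 := by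
      intro a
      rw [Finset.sum_comm]
      refine Finset.sum_congr rfl fun x _ => ?_
      rw [Finset.sum_comm]
      refine Finset.sum_congr rfl fun y _ => ?_
      rw [hp' y]
      by_cases hxy : x < y ∧ φ y < φ x
      · simp only [if_pos hxy]
        rw [Finset.mul_sum]
      · simp only [if_neg hxy, Finset.sum_const_zero]
    simp only [e2]
    rw [Finset.sum_comm]
    refine Finset.sum_congr rfl fun x _ => ?_
    rw [Finset.sum_comm, Finset.sum_filter]
    refine Finset.sum_congr rfl fun y _ => ?_
    by_cases hxy : x < y ∧ φ y < φ x
    · simp only [if_pos hxy]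
      rw [hp' x, Finset.sum_mul]
    · simp only [if_neg hxy, Finset.sum_const_zero]
  -- For a reversed pair of letters it does not matter which of them comes first in the word, so
  -- ordered pairs of letters may be exchanged for ordered pairs of places.
  have h2 : ∑ a, ∑ b, (if P (w a) (w b) then 1 else 0) =
      ∑ a, ∑ b, if a < b ∧ (P (w a) (w b) ∨ P (w b) (w a)) then 1 else 0 := by
    have e1 : ∀ a b : Fin q, (if P (w a) (w b) then 1 else 0) =
        (if a < b ∧ P (w a) (w b) then 1 else 0) + if b < a ∧ P (w a) (w b) then 1 else 0 := by
      intro a b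
      rcases lt_trichotomy a b with h | h | h
      · simp [h, h.not_gt]
      · subst h
        simp [P]
      · simp [h, h.not_gt]
    have e2 : ∀ a b : Fin q, (if a < b ∧ (P (w a) (w b) ∨ P (w b) (w a)) then 1 else 0) =
        (if a < b ∧ P (w a) (w b) then 1 else 0) + if a < b ∧ P (w b) (w a) then 1 else 0 := by
      intro a b
      by_cases h : P (w a) (w b)
      · have : ¬ P (w b) (w a) := fun h' => absurd h.1 h'.1.not_gt
        simp [h, this]
      · simp [h]
    simp only [e1, e2, Finset.sum_add_distrib]
    congr 1
    rw [Finset.sum_comm]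
  -- A pair that changes its status is counted once on the left; a pair inverted both before and
  -- after is counted twice, and does not affect the parity.
  have h3 : inv (fun x => φ (w x)) + inv w =
      ∑ a, ∑ b, (if a < b ∧ (P (w a) (w b) ∨ P (w b) (w a)) then 1 else 0) +
        2 * ∑ a, ∑ b, if a < b ∧ w b < w a ∧ φ (w b) < φ (w a) then 1 else 0 := by
    simp only [inv, Finset.mul_sum, ← Finset.sum_add_distrib]
    refine Finset.sum_congr rfl fun a _ => Finset.sum_congr rfl fun b _ => ?_
    by_cases hab : a < b
    · simp only [hab, true_and, P]
      rcases lt_trichotomy (w a) (w b) with h | h | h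
      · rcases lt_or_gt_of_ne (φ.injective.ne h.ne) with h' | h'
        · simp [h, h', h.not_gt, h'.not_gt]
        · simp [h, h', h.not_gt]
      · simp [h]
      · rcases lt_or_gt_of_ne (φ.injective.ne h.ne) with h' | h'
        · simp [h, h', h.not_gt, h'.le]
        · simp [h, h', h.not_gt, h'.not_gt]
    · simp [hab]
  rw [h1, h2, wsign, wsign, ← pow_add]
  set D := ∑ a, ∑ b, (if a < b ∧ (P (w a) (w b) ∨ P (w b) (w a)) then 1 else 0)
  have h4 : ((-1 : ℤ)) ^ (inv (fun x => φ (w x)) + 2 * inv w) = (-1) ^ (D + inv w) := by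
    rw [show inv (fun x => φ (w x)) + 2 * inv w = D + inv w +
      2 * ∑ a, ∑ b, (if a < b ∧ w b < w a ∧ φ (w b) < φ (w a) then 1 else 0) by omega,
      pow_add, pow_mul]
    simp
  rw [← h4, pow_add, pow_mul]
  simp

/-- Renaming and reordering the letters changes the sum over shuffles by a sign. -/
theorem words_reorder [Fintype L] [Fintype L'] {M : Type*} [AddCommGroup M] (φ : L ≃ L')
    (p : L → ℕ) (p' : L' → ℕ) (hp : ∀ i, p' (φ i) = p i) (Ev : (L → ℕ →o ℕ) → M) :
    ∑ w ∈ words q p', wsign w • Ev (fun i => steps w (φ i)) =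
      (-1 : ℤ) ^ (∑ x, ∑ y with x < y ∧ φ y < φ x, p x * p y) •
        ∑ w ∈ words q p, wsign w • Ev (steps w) := by
  rw [Finset.smul_sum]
  symm
  refine Finset.sum_bij' (fun w _ x => φ (w x)) (fun w _ x => φ.symm (w x)) ?_ ?_ ?_ ?_ ?_
  · intro w hw
    rw [mem_words] at hw ⊢
    intro i
    obtain ⟨i, rfl⟩ := φ.surjective i
    rw [cnt_comp_equiv, hp, hw]
  · intro w hw
    rw [mem_words] at hw ⊢
    intro i
    have := cnt_comp_equiv φ.symm w (φ i) q
    rw [Equiv.symm_apply_apply] at this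
    rw [this, hw, hp]
  · intro w _
    simp
  · intro w _
    simp
  · intro w hw
    rw [wsign_comp_equiv φ w (mem_words.1 hw), ← smul_smul]
    congr 2
    refine congrArg Ev (funext fun i => ?_)
    ext t
    exact (cnt_comp_equiv φ w i t).symm

theorem cnt_const (i j : L) (t : ℕ) :
    cnt (fun _ : Fin q => i) j t = if j = i then min t q else 0 := by
  by_cases h : j = i
  · subst h
    rw [if_pos rfl, ← card_filter_val_lt, Finset.card_filter]
    simp [cnt]
  · simp [cnt, h, Ne.symm h]

/-- If only one letter occurs there is only one word. -/
theorem words_single [Fintype L] {M : Type*} [AddCommGroup M] (p : L → ℕ) (i : L)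
    (hq : p i = q) (hp : ∀ j, j ≠ i → p j = 0) (Ev : (L → ℕ →o ℕ) → M) :
    ∑ w ∈ words q p, wsign w • Ev (steps w) = Ev (steps fun _ : Fin q => i) := by
  have : words q p = {fun _ => i} := by
    ext w
    rw [mem_words, Finset.mem_singleton]
    constructor
    · intro h
      funext x
      by_contra hx
      have h1 := cnt_succ w (w x) x
      rw [if_pos rfl] at h1
      have h2 := cnt_mono w (w x) (show (x : ℕ) + 1 ≤ q from x.2)
      have h3 := (h (w x)).trans (hp _ hx)
      omega
    · rintro rfl j
      rw [cnt_const]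
      by_cases h : j = i
      · simp [h, hq]
      · simp [h, hp]
  rw [this, Finset.sum_singleton]
  simp [wsign, inv]

end Reorder

end SymHom

namespace SymHom

/-! ### Simplicial operators from monotone maps of `ℕ`, and the normalized differential -/

section Operators

variable {k : Type u} [CommRing k]

/-- The simplicial operator given by a monotone map, with the values cut off at `n`. -/
def clamp (f : ℕ →o ℕ) (q n : ℕ) : ⦋q⦌ ⟶ ⦋n⦌ :=
  SimplexCategory.mkHom ⟨fun t => ⟨min (f t) n, by omega⟩, fun s t h =>
    Fin.le_def.2 (min_le_min_right n (f.monotone (Fin.le_def.1 h)))⟩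

theorem clamp_apply (f : ℕ →o ℕ) (q n : ℕ) (t : Fin (q + 1)) :
    ((clamp f q n).toOrderHom t : ℕ) = min (f t) n := rfl

theorem simplex_hom_ext {q n : ℕ} {φ ψ : ⦋q⦌ ⟶ ⦋n⦌}
    (h : ∀ t : Fin (q + 1), (φ.toOrderHom t : ℕ) = ψ.toOrderHom t) : φ = ψ := by
  ext t : 3
  exact Fin.ext (h t)

theorem clamp_congr {f g : ℕ →o ℕ} {q : ℕ} (n : ℕ) (h : ∀ t ≤ q, f t = g t) :
    clamp f q n = clamp g q n :=
  simplex_hom_ext fun t => by rw [clamp_apply, clamp_apply, h t (by omega)]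

/-- The bound on `f` makes the cut-off at the intermediate dimension inactive; without it the
composite would be different. -/
theorem clamp_comp {f g : ℕ →o ℕ} {q n' : ℕ} (n : ℕ) (h : ∀ t ≤ q, f t ≤ n') :
    clamp f q n' ≫ clamp g n' n = clamp (g.comp f) q n :=
  simplex_hom_ext fun t => by
    have h1 : min (f t) n' = f t := min_eq_left (h t (by omega))
    change min (g (min (f t) n')) n = min (g (f t)) n
    rw [h1]

theorem delta_eq_clamp {n : ℕ} (r : Fin (n + 2)) :
    SimplexCategory.δ r = clamp (face r) n (n + 1) :=
  simplex_hom_ext fun t => by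
    rw [clamp_apply, face_apply]
    change ((r.succAbove t : Fin (n + 2)) : ℕ) = _
    rw [Fin.succAbove]
    simp only [Fin.lt_def, Fin.val_castSucc]
    split_ifs <;> simp <;> omega

theorem stepMap_eq_clamp {q n b : ℕ} (w : Fin q → Fin n) (v : Fin n)
    (h : Finset.card {r | w r = v} = b) : stepMap w v h = clamp (steps w v) q b :=
  simplex_hom_ext fun t => by
    have h1 : ((stepMap w v h).toOrderHom t : ℕ) = cnt w v t := by
      rw [cnt, ← Finset.card_filter]
      rfl
    have h2 : cnt w v t ≤ b := by
      rw [← h1]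
      exact Nat.lt_succ_iff.1 ((stepMap w v h).toOrderHom t).2
    rw [clamp_apply, h1, steps_apply, min_eq_left h2]

/-- A simplicial operator applied to a simplex. -/
def pl (X : SimplicialObject (ModuleCat.{u} k)) (f : ℕ →o ℕ) (q n : ℕ) :
    X.obj (op ⦋n⦌) →ₗ[k] X.obj (op ⦋q⦌) :=
  (X.map (clamp f q n).op).hom

variable (X : SimplicialObject (ModuleCat.{u} k))

theorem map_map_apply {a b c : ℕ} (φ : ⦋a⦌ ⟶ ⦋b⦌) (ψ : ⦋b⦌ ⟶ ⦋c⦌) (x : X.obj (op ⦋c⦌)) :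
    (X.map φ.op).hom ((X.map ψ.op).hom x) = (X.map (φ ≫ ψ).op).hom x := by
  rw [op_comp, X.map_comp]
  rfl

theorem pl_congr {f g : ℕ →o ℕ} {q : ℕ} (n : ℕ) (h : ∀ t ≤ q, f t = g t) :
    pl X f q n = pl X g q n := by
  rw [pl, pl, clamp_congr n h]

theorem pl_pl {f g : ℕ →o ℕ} {q n' n : ℕ} (h : ∀ t ≤ q, f t ≤ n') (x : X.obj (op ⦋n⦌)) :
    pl X f q n' (pl X g n' n x) = pl X (g.comp f) q n x := by
  rw [pl, pl, pl, map_map_apply, clamp_comp n h]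

theorem pl_self {f : ℕ →o ℕ} {n : ℕ} (h : ∀ t ≤ n, f t = t) (x : X.obj (op ⦋n⦌)) :
    pl X f n n x = x := by
  have : clamp f n n = 𝟙 _ := simplex_hom_ext fun t => by
    rw [clamp_apply, h t (by omega)]
    change min (t : ℕ) n = t
    omega
  rw [pl, this, op_id, X.map_id]
  rfl

/-- The codegeneracy that repeats the value `r`. -/
def degen (r : ℕ) : ℕ →o ℕ :=
  ⟨fun t => if t ≤ r then t else t - 1, fun s t h => by dsimp only; split_ifs <;> omega⟩

theorem degen_apply (r t : ℕ) : degen r t = if t ≤ r then t else t - 1 := rfl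

theorem sigma_eq_clamp {n : ℕ} (r : Fin (n + 1)) :
    SimplexCategory.σ r = clamp (degen r) (n + 1) n :=
  simplex_hom_ext fun t => by
    rw [clamp_apply, degen_apply]
    change ((r.predAbove t : Fin (n + 1)) : ℕ) = _
    rw [Fin.predAbove]
    simp only [Fin.lt_def, Fin.val_castSucc]
    split_ifs <;> simp <;> omega

theorem sigma_hom_eq {n : ℕ} (r : Fin (n + 1)) : (X.σ r).hom = pl X (degen r) (n + 1) n := by
  rw [pl, ← sigma_eq_clamp]
  rfl

/-- A monotone map that takes the same value at `r` and `r + 1` factors through the codegeneracy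
repeating `r`; the other factor is obtained by omitting the vertex `r`. -/
theorem pl_degenerate {f : ℕ →o ℕ} {q n r : ℕ} (hr : r ≤ q) (h : f r = f (r + 1))
    (x : X.obj (op ⦋n⦌)) :
    pl X f (q + 1) n x = (X.σ (⟨r, by omega⟩ : Fin (q + 1))).hom (pl X (f.comp (face r)) q n x) := by
  rw [sigma_hom_eq, pl_pl]
  · refine congrArg (fun z : X.obj (op ⦋n⦌) →ₗ[k] X.obj (op ⦋q + 1⦌) => z x)
      (pl_congr X n fun t _ => ?_)
    change f t = f (face r (degen r t))
    rw [degen_apply, face_apply]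
    by_cases h1 : t ≤ r
    · rw [if_pos h1]
      by_cases h2 : t < r
      · rw [if_pos h2]
      · rw [if_neg h2, show t = r by omega, h]
    · rw [if_neg h1, if_neg (by omega)]
      congr 1
      omega
  · intro t ht
    rw [degen_apply]
    simp only
    split_ifs <;> omega

theorem sigma_mem_degenerate {q : ℕ} (r : Fin (q + 1)) (x : X.obj (op ⦋q⦌)) :
    (X.σ r).hom x ∈ degenerate X (q + 1) :=
  Submodule.mem_iSup_of_mem r ⟨x, rfl⟩

/-- The class of a simplex in the normalized complex, as a linear map. -/
noncomputable def clsL (n : ℕ) : X.obj (op ⦋n⦌) →ₗ[k] Tot (normalized X) :=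
  Tot.of (normalized X) n ∘ₗ (degenerate X n).mkQ

theorem clsL_eq_zero {n : ℕ} {x : X.obj (op ⦋n⦌)} (h : x ∈ degenerate X n) : clsL X n x = 0 := by
  have : (degenerate X n).mkQ x = 0 := (Submodule.Quotient.mk_eq_zero _).2 h
  exact (congrArg (Tot.of (normalized X) n) this).trans (map_zero _)

theorem Tot.d_of (C : ChainComplex (ModuleCat.{u} k) ℕ) (n : ℕ) (x : C.X n) :
    Tot.d C (Tot.of C n x) = Tot.of C (n - 1) ((C.d n (n - 1)).hom x) := by
  rw [Tot.d, Tot.of, DirectSum.toModule_lof]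
  rfl

theorem Tot.map_of {C D : ChainComplex (ModuleCat.{u} k) ℕ} (f : C ⟶ D) (n : ℕ) (x : C.X n) :
    Tot.map f (Tot.of C n x) = Tot.of D n ((f.f n).hom x) := by
  rw [Tot.map, Tot.of, DirectSum.toModule_lof]
  rfl

theorem d_clsL_zero (x : X.obj (op ⦋0⦌)) : Tot.d (normalized X) (clsL X 0 x) = 0 := by
  refine (Tot.d_of _ _ _).trans ?_
  have : (normalized X).d 0 (0 - 1) = 0 := (normalized X).shape _ _ (by simp)
  rw [this]
  exact map_zero _

/-- Writing the faces as `face r` on `ℕ` brings the differential into the form to which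
`words_leibniz` applies. -/
theorem d_clsL_succ (n : ℕ) (x : X.obj (op ⦋n + 1⦌)) :
    Tot.d (normalized X) (clsL X (n + 1) x) =
      ∑ r ∈ Finset.range (n + 2), (-1 : ℤ) ^ r • clsL X n (pl X (face r) n (n + 1) x) := by
  refine (Tot.d_of _ _ _).trans ?_
  have h1 : ((normalized X).d (n + 1) n).hom ((degenerate X (n + 1)).mkQ x) =
      (degenerate X n).mkQ ((AlgebraicTopology.AlternatingFaceMapComplex.objD X n).hom x) := by
    rw [normalized_d]
    rfl
  refine (congrArg (Tot.of (normalized X) n) h1).trans ?_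
  have h2 : (AlgebraicTopology.AlternatingFaceMapComplex.objD X n).hom x =
      ∑ r : Fin (n + 2), (-1 : ℤ) ^ (r : ℕ) • pl X (face r) n (n + 1) x := by
    simp only [AlgebraicTopology.AlternatingFaceMapComplex.objD, ModuleCat.hom_sum,
      LinearMap.sum_apply]
    refine Finset.sum_congr rfl fun r _ => ?_
    rw [pl, ← delta_eq_clamp]
    rfl
  rw [h2, ← Fin.sum_univ_eq_sum_range
    (fun r => (-1 : ℤ) ^ r • clsL X n (pl X (face r) n (n + 1) x))]
  refine (map_sum (clsL X n) _ _).trans ?_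
  refine Finset.sum_congr rfl fun r _ => ?_
  exact map_zsmul (clsL X n) _ _

theorem cls_span (X : SimplicialObject (ModuleCat.{u} k)) :
    Submodule.span k (Set.range fun g : (n : ℕ) × X.obj (op ⦋n⦌) => clsL X g.1 g.2) = ⊤ := by
  rw [eq_top_iff]
  intro z _
  induction z using DirectSum.induction_on with
  | zero => exact zero_mem _
  | of n x =>
    obtain ⟨y, rfl⟩ := (degenerate X n).mkQ_surjective x
    exact Submodule.subset_span ⟨⟨n, y⟩, rfl⟩
  | add x y hx hy => exact add_mem (hx trivial) (hy trivial)

end Operators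

/-! ### Multilinear extension over an arbitrary finite index type -/

section Extend

/-- `exists_multilinear` for any finite index type. -/
theorem exists_multilinear' {k : Type*} [CommRing k] {Z : Type*} [AddCommGroup Z] [Module k Z]
    {L : Type*} [Fintype L] [DecidableEq L] {M : L → Type*} [∀ s, AddCommGroup (M s)]
    [∀ s, Module k (M s)] {G : L → Type*} (γ : ∀ s, G s → M s)
    (hγ : ∀ s, Submodule.span k (Set.range (γ s)) = ⊤) (Φ : (∀ s, G s) → Z)
    (h : ∀ s (g : ∀ s, G s), ∃ T : M s →ₗ[k] Z, ∀ y, T (γ s y) = Φ (Function.update g s y)) :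
    ∃ F : MultilinearMap k M Z, ∀ g, F (fun s => γ s (g s)) = Φ g := by
  let e := Fintype.equivFin L
  obtain ⟨F, hF⟩ := exists_multilinear (M := fun s => M (e.symm s)) (G := fun s => G (e.symm s))
    (fun s => γ (e.symm s)) (fun s => hγ (e.symm s))
    (fun g => Φ ((e.piCongrLeft' G).symm g)) (fun s g => by
      obtain ⟨T, hT⟩ := h (e.symm s) ((e.piCongrLeft' G).symm g)
      refine ⟨T, fun y => ?_⟩
      rw [hT]
      exact congrArg Φ (Function.piCongrLeft'_symm_update G e g s y).symm)
  refine ⟨(MultilinearMap.domDomCongrLinearEquiv' k k M Z e).symm F, fun g => ?_⟩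
  refine Eq.trans (b := F (fun s => γ (e.symm s) (g (e.symm s)))) rfl ?_
  rw [hF]
  exact congrArg Φ ((e.piCongrLeft' G).symm_apply_apply g)

end Extend

/-! ### The shuffle map of a multilinear map of simplicial modules -/

section ShuffleMap

variable {k : Type u} [CommRing k] {L : Type} [Fintype L] [LinearOrder L]

/-- A multilinear map of simplicial `k`-modules, with factors indexed by `L`. -/
structure NatMul (X : L → SimplicialObject (ModuleCat.{u} k))
    (Z : SimplicialObject (ModuleCat.{u} k)) where
  app : ∀ q : ℕ, MultilinearMap k (fun i => (X i).obj (op ⦋q⦌)) (Z.obj (op ⦋q⦌))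
  naturality : ∀ (q q' : ℕ) (φ : ⦋q'⦌ ⟶ ⦋q⦌) (y : ∀ i, (X i).obj (op ⦋q⦌)),
    (Z.map φ.op).hom (app q y) = app q' fun i => ((X i).map φ.op).hom (y i)

variable {X : L → SimplicialObject (ModuleCat.{u} k)} {Z : SimplicialObject (ModuleCat.{u} k)}
  (μ : NatMul X Z)

omit [Fintype L] [LinearOrder L] in
theorem NatMul.pl_app (f : ℕ →o ℕ) (q n : ℕ) (y : ∀ i, (X i).obj (op ⦋n⦌)) :
    pl Z f q n (μ.app n y) = μ.app q fun i => pl (X i) f q n (y i) :=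
  μ.naturality _ _ _ _

/-- The value of `μ` on simplices of several dimensions, made into `q`-simplices by operators. -/
noncomputable def NatMul.eval (q : ℕ) (g : ∀ i, (n : ℕ) × (X i).obj (op ⦋n⦌))
    (f : L → ℕ →o ℕ) : Z.obj (op ⦋q⦌) :=
  μ.app q fun i => pl (X i) (f i) q (g i).1 (g i).2

/-- The sum over all shuffles of length `q`. -/
noncomputable def NatMul.shSum (q : ℕ) (g : ∀ i, (n : ℕ) × (X i).obj (op ⦋n⦌)) :
    Tot (normalized Z) :=
  ∑ w ∈ words q fun i => (g i).1, wsign w • clsL Z q (μ.eval q g (steps w))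

/-- The sum over all shuffles, as a multilinear map for fixed dimensions. -/
noncomputable def NatMul.shMul (q : ℕ) (p : L → ℕ) :
    MultilinearMap k (fun i => (X i).obj (op ⦋p i⦌)) (Tot (normalized Z)) :=
  ∑ w ∈ words q p, ((wsign w : ℤ) : k) • (clsL Z q).compMultilinearMap
    ((μ.app q).compLinearMap fun i => pl (X i) (steps w i) q (p i))

theorem NatMul.shMul_apply (q : ℕ) (p : L → ℕ) (x : ∀ i, (X i).obj (op ⦋p i⦌)) :
    μ.shMul q p x = μ.shSum q fun i => ⟨p i, x i⟩ := by
  rw [shMul, sum_apply, shSum]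
  refine Finset.sum_congr rfl fun w _ => ?_
  rw [smul_apply, Int.cast_smul_eq_zsmul]
  rfl

/-- Let `r` be the place where the letter `i` occurs with exactly `j` earlier occurrences. The
degeneracy `σ j` makes the factor `i` constant along this step, and the other factors are constant
there because their letters are not read. So all factors, hence their product, are degenerate at
`r`. -/
theorem NatMul.eval_degenerate {q : ℕ} {p : L → ℕ} {w : Fin (q + 1) → L}
    (hw : w ∈ words (q + 1) p) (g : ∀ i, (n : ℕ) × (X i).obj (op ⦋n⦌)) (i : L) {n : ℕ}
    (hn : p i = n + 1) (j : Fin (n + 1)) (y : (X i).obj (op ⦋n⦌))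
    (hi : g i = ⟨n + 1, ((X i).σ j).hom y⟩) :
    μ.eval (q + 1) g (steps w) ∈ degenerate Z (q + 1) := by
  obtain ⟨r, hr⟩ := (rankEquiv w (mem_words.1 hw)).surjective ⟨i, ⟨j, by omega⟩⟩
  have hwr : w r = i := congrArg Sigma.fst hr
  have hcr : cnt w i r = j := by
    rw [← hwr]
    exact congrArg (fun u : (l : L) × Fin (p l) => (u.2 : ℕ)) hr
  have hcr' : cnt w i (r + 1) = j + 1 := by
    rw [cnt_succ, if_pos hwr, hcr]
  have hrq : (r : ℕ) ≤ q := by omega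
  have h1 : ∀ i', ∃ z, pl (X i') (steps w i') (q + 1) (g i').1 (g i').2 =
      ((X i').σ ⟨r, by omega⟩).hom z := by
    intro i'
    by_cases hii : i' = i
    · subst hii
      rw [hi]
      dsimp only
      rw [sigma_hom_eq, pl_pl]
      · exact ⟨_, pl_degenerate (X i') hrq (by
          change degen j (cnt w i' r) = degen j (cnt w i' (r + 1))
          rw [hcr, hcr', degen_apply, degen_apply]
          simp) y⟩
      · intro t ht
        have := cnt_mono w i' ht
        rw [mem_words.1 hw i', hn] at this
        exact this
    · refine ⟨_, pl_degenerate (X i') hrq ?_ _⟩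
      rw [steps_apply, steps_apply, cnt_succ, if_neg fun h => hii (h.symm.trans hwr), add_zero]
  choose z hz using h1
  rw [NatMul.eval, funext hz]
  have h2 := μ.naturality _ _ (SimplexCategory.σ (⟨r, by omega⟩ : Fin (q + 1))) z
  have h3 : (μ.app (q + 1) fun i => ((X i).σ ⟨r, by omega⟩).hom (z i)) =
      (Z.σ ⟨r, by omega⟩).hom (μ.app q z) := h2.symm
  rw [h3]
  exact sigma_mem_degenerate Z _ _

theorem NatMul.shSum_degenerate (q : ℕ) (g : ∀ i, (n : ℕ) × (X i).obj (op ⦋n⦌)) (i : L) {n : ℕ}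
    (j : Fin (n + 1)) (y : (X i).obj (op ⦋n⦌)) (hi : g i = ⟨n + 1, ((X i).σ j).hom y⟩) :
    μ.shSum q g = 0 := by
  have hn : (g i).1 = n + 1 := congrArg Sigma.fst hi
  refine Finset.sum_eq_zero fun w hw => ?_
  cases q with
  | zero =>
    have := mem_words.1 hw i
    rw [cnt_zero] at this
    omega
  | succ q => rw [clsL_eq_zero Z (μ.eval_degenerate hw g i hn j y hi), smul_zero]

theorem exists_Tot_linear {X : SimplicialObject (ModuleCat.{u} k)} {M : Type*} [AddCommGroup M]
    [Module k M] (T : ∀ n, X.obj (op ⦋n⦌) →ₗ[k] M)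
    (hT : ∀ n (j : Fin (n + 1)) y, T (n + 1) ((X.σ j).hom y) = 0) :
    ∃ F : Tot (normalized X) →ₗ[k] M, ∀ n y, F (clsL X n y) = T n y := by
  have h : ∀ n, degenerate X n ≤ LinearMap.ker (T n) := by
    intro n
    cases n with
    | zero => exact bot_le
    | succ n =>
      refine iSup_le fun j => ?_
      rintro _ ⟨y, rfl⟩
      exact hT n j y
  refine ⟨DirectSum.toModule k ℕ _ fun n => (degenerate X n).liftQ (T n) (h n), fun n y => ?_⟩
  exact DirectSum.toModule_lof k n _

/-- For fixed dimensions the sum over shuffles is multilinear (`NatMul.shMul`). In one slot the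
dimension may vary, and the linear maps for its different values descend together to normalized
chains because degenerate simplices are killed. -/
theorem NatMul.exists_shuffle : ∃ F : MultilinearMap k (fun i => Tot (normalized (X i)))
    (Tot (normalized Z)), ∀ g : ∀ i, (n : ℕ) × (X i).obj (op ⦋n⦌),
      F (fun i => clsL (X i) (g i).1 (g i).2) = μ.shSum (∑ i, (g i).1) g := by
  refine exists_multilinear' (fun i (g : (n : ℕ) × (X i).obj (op ⦋n⦌)) => clsL (X i) g.1 g.2)
    (fun i => cls_span (X i)) (fun g => μ.shSum (∑ i, (g i).1) g) ?_
  intro s g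
  have key : ∀ (g : ∀ i, (n : ℕ) × (X i).obj (op ⦋n⦌)) (a : (n : ℕ) × (X s).obj (op ⦋n⦌)),
      g s = a → ∃ T : (X s).obj (op ⦋a.1⦌) →ₗ[k] Tot (normalized Z), ∀ y,
        T y = μ.shSum (∑ i, (Function.update g s ⟨a.1, y⟩ i).1)
          (Function.update g s ⟨a.1, y⟩) := by
    rintro g _ rfl
    refine ⟨(μ.shMul (∑ i, (g i).1) fun i => (g i).1).toLinearMap (fun i => (g i).2) s,
      fun y => ?_⟩
    have h1 : Function.update g s ⟨(g s).1, y⟩ =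
        fun i => ⟨(g i).1, Function.update (fun i => (g i).2) s y i⟩ := by
      funext i
      by_cases h : i = s
      · subst h
        simp
      · simp [h]
    rw [h1, MultilinearMap.toLinearMap_apply, NatMul.shMul_apply]
  have h2 : ∀ n, ∃ T : (X s).obj (op ⦋n⦌) →ₗ[k] Tot (normalized Z), ∀ y,
      T y = μ.shSum (∑ i, (Function.update g s ⟨n, y⟩ i).1) (Function.update g s ⟨n, y⟩) := by
    intro n
    -- The simplex `0` only fixes the dimension `n` in slot `s`.
    obtain ⟨T, hT⟩ := key (Function.update g s ⟨n, 0⟩) ⟨n, 0⟩ (Function.update_self _ _ _)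
    refine ⟨T, fun y => (hT y).trans ?_⟩
    rw [Function.update_idem]
  choose T hT using h2
  obtain ⟨F, hF⟩ := exists_Tot_linear T fun n j y => by
    rw [hT]
    exact μ.shSum_degenerate _ _ s j y (Function.update_self _ _ _)
  exact ⟨F, fun y => (hF _ _).trans (hT _ _)⟩

/-- The shuffle map. -/
noncomputable def NatMul.shuffle :
    MultilinearMap k (fun i => Tot (normalized (X i))) (Tot (normalized Z)) :=
  μ.exists_shuffle.choose

theorem NatMul.shuffle_cls (g : ∀ i, (n : ℕ) × (X i).obj (op ⦋n⦌)) {q : ℕ}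
    (hq : ∑ i, (g i).1 = q) :
    μ.shuffle (fun i => clsL (X i) (g i).1 (g i).2) = μ.shSum q g := by
  subst hq
  exact μ.exists_shuffle.choose_spec g

omit [Fintype L] [LinearOrder L] in
theorem NatMul.eval_congr (q : ℕ) (g : ∀ i, (n : ℕ) × (X i).obj (op ⦋n⦌)) {f f' : L → ℕ →o ℕ}
    (h : ∀ i, ∀ t ≤ q, f i t = f' i t) : μ.eval q g f = μ.eval q g f' := by
  rw [eval, eval]
  refine congrArg (μ.app q) (funext fun i => ?_)
  rw [pl_congr (X i) _ (h i)]

omit [Fintype L] [LinearOrder L] in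
theorem NatMul.pl_eval (q q' : ℕ) (a : ℕ →o ℕ) (ha : ∀ t ≤ q, a t ≤ q')
    (g : ∀ i, (n : ℕ) × (X i).obj (op ⦋n⦌)) (f : L → ℕ →o ℕ) :
    pl Z a q q' (μ.eval q' g f) = μ.eval q g fun i => (f i).comp a := by
  rw [eval, NatMul.pl_app, eval]
  refine congrArg (μ.app q) (funext fun i => ?_)
  rw [pl_pl _ ha]

/-- This is `words_leibniz`, evaluated by letting a family of monotone maps act on the factors and
taking the class of their product. -/
theorem NatMul.d_shuffle (g : ∀ i, (n : ℕ) × (X i).obj (op ⦋n⦌)) :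
    Tot.d (normalized Z) (μ.shuffle fun i => clsL (X i) (g i).1 (g i).2) =
      ∑ i, (-1 : ℤ) ^ (∑ t with t < i, (g t).1) •
        μ.shuffle (Function.update (fun i => clsL (X i) (g i).1 (g i).2) i
          (Tot.d (normalized (X i)) (clsL (X i) (g i).1 (g i).2))) := by
  obtain ⟨q', hq'⟩ : ∃ q, ∑ i, (g i).1 = q := ⟨_, rfl⟩
  cases q' with
  | zero =>
    have h0 : ∀ i, (g i).1 = 0 := fun i => Finset.sum_eq_zero_iff.1 hq' i (Finset.mem_univ i)
    rw [μ.shuffle_cls g hq', shSum, map_sum]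
    refine (Finset.sum_eq_zero fun w _ => ?_).trans (Finset.sum_eq_zero fun i _ => ?_).symm
    · rw [map_zsmul, d_clsL_zero, smul_zero]
    · have : Tot.d (normalized (X i)) (clsL (X i) (g i).1 (g i).2) = 0 := by
        have h1 := h0 i
        generalize g i = a at h1
        obtain ⟨n, y⟩ := a
        obtain rfl : n = 0 := h1
        exact d_clsL_zero _ _
      rw [this, MultilinearMap.map_update_zero, smul_zero]
  | succ q =>
    rw [μ.shuffle_cls g hq', shSum, map_sum]
    have hL : ∀ w ∈ words (q + 1) (fun i => (g i).1),
        Tot.d (normalized Z) (wsign w • clsL Z (q + 1) (μ.eval (q + 1) g (steps w))) =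
        ∑ r ∈ Finset.range (q + 2), ((-1 : ℤ) ^ r * wsign w) •
          clsL Z q (μ.eval q g fun j => (steps w j).comp (face r)) := by
      intro w _
      rw [map_zsmul, d_clsL_succ, Finset.smul_sum]
      refine Finset.sum_congr rfl fun r _ => ?_
      rw [μ.pl_eval, smul_smul, mul_comm]
      intro t ht
      rw [face_apply]
      split_ifs <;> omega
    rw [Finset.sum_congr rfl hL, words_leibniz (fun i => (g i).1)
      (fun f => clsL Z q (μ.eval q g f)) fun f f' h => by rw [μ.eval_congr q g h]]
    refine Finset.sum_congr rfl fun i _ => ?_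
    obtain ⟨a, ha⟩ : ∃ a, g i = a := ⟨_, rfl⟩
    obtain ⟨n, y⟩ := a
    cases n with
    | zero =>
      have h1 : Tot.d (normalized (X i)) (clsL (X i) (g i).1 (g i).2) = 0 := by
        rw [ha]
        exact d_clsL_zero _ _
      rw [h1, MultilinearMap.map_update_zero, smul_zero]
      -- A factor of dimension zero has no faces. On the side of words, no word can have one letter
      -- `i` fewer than zero.
      refine Finset.sum_eq_zero fun l _ => Finset.sum_eq_zero fun w hw => ?_
      have h2 := (Finset.mem_filter.1 hw).2 i
      rw [if_pos rfl, ha] at h2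
      exact absurd h2 (Nat.succ_ne_zero _)
    | succ n =>
      have h1 : Tot.d (normalized (X i)) (clsL (X i) (g i).1 (g i).2) =
          ∑ r ∈ Finset.range (n + 2), (-1 : ℤ) ^ r • clsL (X i) n (pl (X i) (face r) n (n + 1) y) := by
        rw [ha]
        exact d_clsL_succ _ _ _
      rw [h1, MultilinearMap.map_update_sum, Finset.smul_sum, ha]
      refine Finset.sum_congr rfl fun l _ => ?_
      -- Multilinearity is over `k`, so the integral sign is first cast into `k`.
      have h2 : Function.update (fun i => clsL (X i) (g i).1 (g i).2) i
          ((-1 : ℤ) ^ l • clsL (X i) n (pl (X i) (face l) n (n + 1) y)) =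
          Function.update (fun i => clsL (X i) (g i).1 (g i).2) i
          ((((-1) ^ l : ℤ) : k) • clsL (X i) n (pl (X i) (face l) n (n + 1) y)) := by
        rw [Int.cast_smul_eq_zsmul]
      rw [h2, MultilinearMap.map_update_smul, Int.cast_smul_eq_zsmul]
      obtain ⟨g', hg'⟩ : ∃ g', g' = Function.update g i ⟨n, pl (X i) (face l) n (n + 1) y⟩ := ⟨_, rfl⟩
      have hgi : g' i = ⟨n, pl (X i) (face l) n (n + 1) y⟩ := by rw [hg', Function.update_self]
      have hgj : ∀ j, j ≠ i → g' j = g j := fun j hj => by rw [hg', Function.update_of_ne hj]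
      have h3 : Function.update (fun i => clsL (X i) (g i).1 (g i).2) i
          (clsL (X i) n (pl (X i) (face l) n (n + 1) y)) =
          fun j => clsL (X j) (g' j).1 (g' j).2 := by
        funext j
        by_cases hj : j = i
        · subst hj
          rw [Function.update_self, hgi]
        · rw [Function.update_of_ne hj, hgj j hj]
      have h4 : ∀ j, (g' j).1 + (if j = i then 1 else 0) = (g j).1 := by
        intro j
        by_cases hj : j = i
        · subst hj
          rw [hgi, ha, if_pos rfl]
        · rw [hgj j hj, if_neg hj, add_zero]
      have h5 : ∑ j, (g' j).1 = q := by
        have : ∑ j, ((g' j).1 + (if j = i then 1 else 0)) = q + 1 := by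
          rw [← hq']
          exact Finset.sum_congr rfl fun j _ => h4 j
        rw [Finset.sum_add_distrib] at this
        simpa using this
      rw [h3, μ.shuffle_cls g' h5, shSum, Finset.smul_sum, Finset.smul_sum]
      -- Words with one `i` fewer than prescribed by `g` are the shuffles for the tuple `g'`, in
      -- which the factor `i` is replaced by its face.
      have h6 : (Finset.univ.filter fun w : Fin q → L =>
          ∀ j, cnt w j q + (if j = i then 1 else 0) = (g j).1) = words q fun j => (g' j).1 := by
        refine Finset.filter_congr fun w _ => forall_congr' fun j => ?_
        rw [← h4 j]
        exact Nat.add_right_cancel_iff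
      rw [h6]
      refine Finset.sum_congr rfl fun w hw => ?_
      rw [smul_smul, smul_smul, pow_add, mul_assoc]
      congr 2
      rw [eval, eval]
      refine congrArg (μ.app q) (funext fun j => ?_)
      by_cases hj : j = i
      · subst hj
        have h7 : ∀ t ≤ q, steps w j t ≤ n := fun t ht => by
          have h8 := cnt_mono w j ht
          rwa [mem_words.1 hw j, hgi] at h8
        rw [Function.update_self, ha, hgi]
        exact (pl_pl (X j) h7 y).symm
      · rw [Function.update_of_ne hj, hgj j hj]

end ShuffleMap

end SymHom

namespace SymHom

/-! ### Naturality, units and composition of shuffle maps -/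

section ShuffleProperties

variable {k : Type u} [CommRing k]

theorem Tot.map_clsL {X Y : SimplicialObject (ModuleCat.{u} k)} (θ : X ⟶ Y) (n : ℕ)
    (x : X.obj (op ⦋n⦌)) :
    Tot.map (normalizedMap θ) (clsL X n x) = clsL Y n ((θ.app (op ⦋n⦌)).hom x) := by
  refine (Tot.map_of _ _ _).trans ?_
  refine congrArg (Tot.of (normalized Y) n) ?_
  rfl

theorem Tot.map_id (C : ChainComplex (ModuleCat.{u} k) ℕ) (x : Tot C) :
    Tot.map (𝟙 C) x = x := by
  have : Tot.map (𝟙 C) = LinearMap.id := DirectSum.linearMap_ext k fun n =>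
    LinearMap.ext fun y => Tot.map_of (𝟙 C) n y
  rw [this]
  rfl

theorem pl_natural {X Y : SimplicialObject (ModuleCat.{u} k)} (θ : X ⟶ Y) (f : ℕ →o ℕ) (q n : ℕ)
    (x : X.obj (op ⦋n⦌)) :
    pl Y f q n ((θ.app (op ⦋n⦌)).hom x) = (θ.app (op ⦋q⦌)).hom (pl X f q n x) :=
  (ConcreteCategory.congr_hom (θ.naturality (clamp f q n).op) x).symm

variable {L : Type} [Fintype L] [LinearOrder L]

/-- The identity, as a multilinear map with one factor. -/
def NatMul.single (X : SimplicialObject (ModuleCat.{u} k)) : NatMul (fun _ : Unit => X) X where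
  app q := MultilinearMap.ofSubsingleton k _ _ () LinearMap.id
  naturality _ _ _ _ := rfl

section Single

variable {X : L → SimplicialObject (ModuleCat.{u} k)} {Z : SimplicialObject (ModuleCat.{u} k)}
  (μ : NatMul X Z)

/-- If the other factors have dimension zero, only the constant word in the letter `i` is left, and
its sign is trivial. -/
theorem NatMul.shuffle_of_single (g : ∀ i, (n : ℕ) × (X i).obj (op ⦋n⦌)) (i : L)
    (h : ∀ j, j ≠ i → (g j).1 = 0) :
    μ.shuffle (fun i => clsL (X i) (g i).1 (g i).2) =
      clsL Z (g i).1 (μ.eval (g i).1 g (steps fun _ : Fin (g i).1 => i)) := by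
  have hq : ∑ j, (g j).1 = (g i).1 := Finset.sum_eq_single i (fun j _ hj => h j hj) (by simp)
  rw [μ.shuffle_cls g hq, shSum, words_single (q := (g i).1) (fun j => (g j).1) i rfl h
    (fun f => clsL Z (g i).1 (μ.eval (g i).1 g f))]

omit [Fintype L] in
theorem pl_steps_const (X : SimplicialObject (ModuleCat.{u} k)) (i : L) {n : ℕ}
    (x : X.obj (op ⦋n⦌)) : pl X (steps (fun _ : Fin n => i) i) n n x = x :=
  pl_self X (fun t ht => by rw [steps_apply, cnt_const, if_pos rfl, min_eq_left ht]) x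

end Single

theorem NatMul.single_shuffle (X : SimplicialObject (ModuleCat.{u} k)) (n : ℕ)
    (x : X.obj (op ⦋n⦌)) : (NatMul.single X).shuffle (fun _ => clsL X n x) = clsL X n x := by
  refine ((NatMul.single X).shuffle_of_single (fun _ => ⟨n, x⟩) () fun j hj =>
    absurd (Subsingleton.elim _ _) hj).trans ?_
  refine congrArg (clsL X n) ?_
  exact pl_steps_const X () x

variable {K : L → Type} [∀ l, Fintype (K l)] [∀ l, LinearOrder (K l)]
  {X : ∀ l, K l → SimplicialObject (ModuleCat.{u} k)} {Y : L → SimplicialObject (ModuleCat.{u} k)}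
  {Z : SimplicialObject (ModuleCat.{u} k)}

/-- Shuffle maps are compatible with composition. -/
theorem NatMul.shuffle_comp (μ : NatMul Y Z) (ν : ∀ l, NatMul (X l) (Y l))
    (g : ∀ l κ, (n : ℕ) × (X l κ).obj (op ⦋n⦌)) {q : ℕ} (hq : ∑ l, ∑ κ, (g l κ).1 = q) :
    μ.shuffle (fun l => (ν l).shuffle fun κ => clsL (X l κ) (g l κ).1 (g l κ).2) =
      ∑ w ∈ words q fun x : Refined K => (g x.1 x.2).1, wsign w •
        clsL Z q (μ.app q fun l => (ν l).eval q (g l) fun κ => steps w ⟨l, κ⟩) := by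
  have h1 : ∀ l, ((ν l).shuffle fun κ => clsL (X l κ) (g l κ).1 (g l κ).2) =
      ∑ v ∈ words (∑ κ, (g l κ).1) (fun κ => (g l κ).1), ((wsign v : ℤ) : k) •
        clsL (Y l) (∑ κ, (g l κ).1) ((ν l).eval (∑ κ, (g l κ).1) (g l) (steps v)) := by
    intro l
    rw [(ν l).shuffle_cls (g l) rfl, shSum]
    refine Finset.sum_congr rfl fun v _ => ?_
    rw [Int.cast_smul_eq_zsmul]
  rw [funext h1, MultilinearMap.map_sum_finset]
  simp only [MultilinearMap.map_smul_univ]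
  -- After multilinear expansion the summands are indexed by an outer word and an inner word for
  -- each letter, and these are merged into words in the refined alphabet.
  rw [← words_comp (P := fun l => ∑ κ, (g l κ).1) (fun x : Refined K => (g x.1 x.2).1)
    (fun _ => rfl) (fun f => clsL Z q (μ.app q fun l => (ν l).eval q (g l) fun κ => f ⟨l, κ⟩)),
    Finset.sum_comm]
  refine Finset.sum_congr rfl fun v _ => ?_
  rw [μ.shuffle_cls (fun l => ⟨∑ κ, (g l κ).1,
    (ν l).eval (∑ κ, (g l κ).1) (g l) (steps (v l))⟩) hq, shSum, ← Int.cast_prod,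
    Int.cast_smul_eq_zsmul, Finset.smul_sum]
  refine Finset.sum_congr rfl fun w hw => ?_
  rw [smul_smul, mul_comm]
  congr 2
  rw [eval]
  refine congrArg (μ.app q) (funext fun l => ?_)
  refine (ν l).pl_eval _ _ _ (fun t ht => ?_) _ _
  exact (cnt_mono w l ht).trans (mem_words.1 hw l).le

end ShuffleProperties

/-! ### The alphabet of an operation and its arguments -/

/-- The letters of the factors `C ⊗ X₁ ⊗ … ⊗ X_n`. -/
inductive Letter (n : ℕ) : Type where
  | oper
  | arg (s : Fin n)

namespace Letter

variable {n : ℕ}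

/-- The letters are numbered by `0, …, n`. -/
def equiv (n : ℕ) : Letter n ≃ Fin (n + 1) where
  toFun
    | oper => 0
    | arg s => s.succ
  invFun := Fin.cases oper arg
  left_inv x := by cases x <;> rfl
  right_inv x := by refine Fin.cases ?_ (fun s => ?_) x <;> simp

noncomputable instance : LinearOrder (Letter n) :=
  LinearOrder.lift' (equiv n) (equiv n).injective

instance : Fintype (Letter n) := Fintype.ofEquiv _ (equiv n).symm

theorem lt_iff_equiv (x y : Letter n) : x < y ↔ equiv n x < equiv n y := Iff.rfl

@[simp] theorem op_lt_arg (s : Fin n) : (oper : Letter n) < arg s := Fin.succ_pos s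

@[simp] theorem not_lt_op (x : Letter n) : ¬ x < oper := Fin.not_lt_zero _

@[simp] theorem arg_lt_arg (s t : Fin n) : (arg s : Letter n) < arg t ↔ s < t :=
  Fin.succ_lt_succ_iff

theorem sum_eq {M : Type*} [AddCommMonoid M] (f : Letter n → M) :
    ∑ x, f x = f oper + ∑ s, f (arg s) := by
  rw [← (equiv n).symm.sum_comp, Fin.sum_univ_succ]
  rfl

/-- A family indexed by letters. -/
@[reducible] def elim {M : Letter n → Sort*} (c : M oper) (x : ∀ s, M (arg s)) (l : Letter n) : M l :=
  match l with
  | oper => c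
  | arg s => x s

@[simp] theorem elim_op {M : Letter n → Sort*} (c : M oper) (x : ∀ s, M (arg s)) :
    (elim c x : ∀ l, M l) oper = c := rfl

@[simp] theorem elim_arg {M : Letter n → Sort*} (c : M oper) (x : ∀ s, M (arg s)) (s : Fin n) :
    (elim c x : ∀ l, M l) (arg s) = x s := rfl

theorem elim_eta {M : Letter n → Sort*} (x : ∀ l, M l) :
    (elim (x oper) (fun s => x (arg s)) : ∀ l, M l) = x := by
  funext l
  cases l <;> rfl

theorem elim_update_arg [DecidableEq (Letter n)] {M : Letter n → Type*} (c : M oper)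
    (x : ∀ s, M (arg s)) (s : Fin n) (y : M (arg s)) :
    (elim c (Function.update x s y) : ∀ l, M l) = Function.update (elim c x) (arg s) y := by
  funext l
  cases l with
  | oper => rw [Function.update_of_ne (by simp)]
  | arg t =>
    by_cases h : t = s
    · subst h
      simp
    · rw [Function.update_of_ne (by simpa using h)]
      simp [h]

theorem elim_update_op [DecidableEq (Letter n)] {M : Letter n → Type*} (c c' : M oper)
    (x : ∀ s, M (arg s)) :
    (elim c' x : ∀ l, M l) = Function.update (elim c x) oper c' := by
  funext l
  cases l with
  | oper => simp
  | arg t => rw [Function.update_of_ne (by simp)]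

variable {k : Type*} [CommRing k] {M : Letter n → Type*} [∀ l, AddCommGroup (M l)]
  [∀ l, Module k (M l)] {Z : Type*} [AddCommGroup Z] [Module k Z]

/-- A multilinear map, as a linear map in the operation. -/
noncomputable def curry (F : MultilinearMap k M Z) :
    M oper →ₗ[k] MultilinearMap k (fun s => M (arg s)) Z where
  toFun c :=
    { toFun := fun x => F (elim c x)
      map_update_add' := by
        intro d x s y z
        obtain rfl : d = instDecidableEqFin _ := Subsingleton.elim _ _
        simp only [elim_update_arg, F.map_update_add]
      map_update_smul' := by
        intro d x s a y
        obtain rfl : d = instDecidableEqFin _ := Subsingleton.elim _ _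
        simp only [elim_update_arg, F.map_update_smul] }
  map_add' c c' := by
    ext x
    change F (elim (c + c') x) = F (elim c x) + F (elim c' x)
    rw [elim_update_op 0 (c + c'), F.map_update_add, ← elim_update_op, ← elim_update_op]
  map_smul' a c := by
    ext x
    change F (elim (a • c) x) = a • F (elim c x)
    rw [elim_update_op 0 (a • c), F.map_update_smul, ← elim_update_op]

theorem curry_apply (F : MultilinearMap k M Z) (c : M oper) (x : ∀ s, M (arg s)) :
    curry F c x = F (elim c x) := rfl

/-- The inverse of `curry`. -/
def uncurry (T : M oper →ₗ[k] MultilinearMap k (fun s => M (arg s)) Z) : MultilinearMap k M Z where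
  toFun x := T (x oper) fun s => x (arg s)
  map_update_add' := by
    intro d x l y z
    cases l with
    | oper => simp
    | arg t =>
      have h : ∀ y, (fun s => Function.update x (arg t) y (arg s)) =
          Function.update (fun s => x (arg s)) t y := fun y => by
        funext s
        by_cases hs : s = t
        · subst hs
          simp
        · simp [hs]
      simp [h]
  map_update_smul' := by
    intro d x l a y
    cases l with
    | oper => simp
    | arg t =>
      have h : ∀ y, (fun s => Function.update x (arg t) y (arg s)) =
          Function.update (fun s => x (arg s)) t y := fun y => by
        funext s
        by_cases hs : s = t
        · subst hs
          simp
        · simp [hs]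
      simp [h]

end Letter

/-! ### Chain maps with an operation and its arguments as factors -/

section ChainMul

variable {k : Type u} [CommRing k] {W : SimplicialObject (ModuleCat.{u} k)} {m : ℕ}
  {X : Fin m → SimplicialObject (ModuleCat.{u} k)} {Z : SimplicialObject (ModuleCat.{u} k)}

/-- The factors `W, X₁, …, X_m`. -/
abbrev factors (W : SimplicialObject (ModuleCat.{u} k)) {m : ℕ}
    (X : Fin m → SimplicialObject (ModuleCat.{u} k)) :
    Letter m → SimplicialObject (ModuleCat.{u} k) := Letter.elim W X

namespace SimplicialMul

variable (μ : SimplicialMul W X Z)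

/-- A `SimplicialMul` as a multilinear map with factors indexed by letters. -/
def natMul : NatMul (factors W X) Z where
  app q := Letter.uncurry (M := fun l => ((factors W X) l).obj (op ⦋q⦌)) (μ.app q)
  naturality q q' φ y := μ.naturality q q' φ (y .oper) fun s => y (.arg s)

/-- The chain map induced by a `SimplicialMul` through the shuffle maps. -/
noncomputable def chainMul : Tot (normalized W) →ₗ[k]
    MultilinearMap k (fun s => Tot (normalized (X s))) (Tot (normalized Z)) :=
  Letter.curry (M := fun l => Tot (normalized ((factors W X) l))) μ.natMul.shuffle

/-- Generators for the factors. -/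
def gens (c : (n : ℕ) × W.obj (op ⦋n⦌)) (x : ∀ s, (n : ℕ) × (X s).obj (op ⦋n⦌)) :
    ∀ l : Letter m, (n : ℕ) × ((factors W X) l).obj (op ⦋n⦌) :=
  Letter.elim (M := fun l => (n : ℕ) × ((factors W X) l).obj (op ⦋n⦌)) c x

theorem chainMul_eq (c : (n : ℕ) × W.obj (op ⦋n⦌)) (x : ∀ s, (n : ℕ) × (X s).obj (op ⦋n⦌)) :
    μ.chainMul (clsL W c.1 c.2) (fun s => clsL (X s) (x s).1 (x s).2) =
      μ.natMul.shuffle fun l => clsL ((factors W X) l) (gens c x l).1 (gens c x l).2 := by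
  refine Eq.trans (Letter.curry_apply (M := fun l => Tot (normalized ((factors W X) l)))
    μ.natMul.shuffle _ _) ?_
  refine congrArg μ.natMul.shuffle (funext fun l => ?_)
  cases l <;> rfl

/-- Numbering the letters by `0, …, m` preserves their order, so it carries words to elements of
`Shuffle a p` with the same sign and the same degeneracies. -/
theorem chainMul_cls (a : ℕ) (c : W.obj (op ⦋a⦌)) (p : Fin m → ℕ)
    (x : ∀ s, (X s).obj (op ⦋p s⦌)) :
    μ.chainMul (clsL W a c) (fun s => clsL (X s) (p s) (x s)) =
      ∑ w : Shuffle a p, w.sign • clsL Z (a + ∑ s, p s) (μ.app (a + ∑ s, p s)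
        ((W.map w.fst.op).hom c) fun s => ((X s).map (w.snd s).op).hom (x s)) := by
  refine (μ.chainMul_eq ⟨a, c⟩ fun s => ⟨p s, x s⟩).trans ?_
  rw [μ.natMul.shuffle_cls (q := a + ∑ s, p s) _ (by rw [Letter.sum_eq]; rfl), NatMul.shSum]
  symm
  have hcount : ∀ (w : Fin (a + ∑ s, p s) → Letter m) (l : Letter m),
      Finset.card {r | Letter.equiv m (w r) = Letter.equiv m l} =
        cnt w l (a + ∑ s, p s) := by
    intro w l
    rw [cnt, Finset.card_filter]
    simp
  have hst : ∀ (w : Fin (a + ∑ s, p s) → Fin (m + 1)) (l : Letter m),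
      steps w (Letter.equiv m l) = steps (fun r => (Letter.equiv m).symm (w r)) l := by
    intro w l
    ext t
    have := cnt_comp_equiv (Letter.equiv m) (fun r => (Letter.equiv m).symm (w r)) l t
    simp only [Equiv.apply_symm_apply] at this
    exact this
  refine Finset.sum_bij' (fun w _ r => (Letter.equiv m).symm (w.1 r))
    (fun w hw => ⟨fun r => Letter.equiv m (w r), ?_, fun s => ?_⟩) ?_ ?_ ?_ ?_ ?_
  · exact (hcount w .oper).trans (mem_words.1 hw .oper)
  · exact (hcount w (.arg s)).trans (mem_words.1 hw (.arg s))
  · intro w _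
    refine mem_words.2 fun l => ?_
    rw [← hcount]
    simp only [Equiv.apply_symm_apply]
    cases l with
    | oper => exact w.2.1
    | arg s => exact w.2.2 s
  · intro w _
    exact Finset.mem_univ _
  · intro w _
    exact Subtype.ext (funext fun r => Equiv.apply_symm_apply _ _)
  · intro w _
    exact funext fun r => Equiv.symm_apply_apply _ _
  · intro w _
    have hsign : w.sign = wsign fun r => (Letter.equiv m).symm (w.1 r) := by
      rw [wsign, Shuffle.sign, Finset.card_filter, Fintype.sum_prod_type, inv]
      simp only [Letter.lt_iff_equiv, Equiv.apply_symm_apply]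
    rw [hsign]
    congr 2
    rw [NatMul.eval]
    change _ = μ.app _ _ _
    congr 1
    · refine congrArg (μ.app (a + ∑ s, p s)) ?_
      rw [Shuffle.fst, stepMap_eq_clamp]
      exact congrArg (fun f => pl W f (a + ∑ s, p s) a c) (hst w.1 .oper)
    · funext s
      rw [Shuffle.snd, stepMap_eq_clamp]
      exact congrArg (fun f => pl (X s) f (a + ∑ s, p s) (p s) (x s)) (hst w.1 (.arg s))

end SimplicialMul

end ChainMul

end SymHom

namespace SymHom

/-! ### Leibniz rule, unit laws and naturality for the induced chain maps -/

namespace SimplicialMul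

variable {k : Type u} [CommRing k]

section Basic

variable {W : SimplicialObject (ModuleCat.{u} k)} {m : ℕ}
  {X : Fin m → SimplicialObject (ModuleCat.{u} k)} {Z : SimplicialObject (ModuleCat.{u} k)}
  (μ : SimplicialMul W X Z)

theorem chainMul_apply (c : Tot (normalized W)) (x : ∀ s, Tot (normalized (X s))) :
    μ.chainMul c x =
      μ.natMul.shuffle (Letter.elim (M := fun l => Tot (normalized (factors W X l))) c x) := rfl

theorem clsL_gens (c : (n : ℕ) × W.obj (op ⦋n⦌)) (x : ∀ s, (n : ℕ) × (X s).obj (op ⦋n⦌)) :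
    (fun l => clsL (factors W X l) (gens c x l).1 (gens c x l).2) =
      Letter.elim (M := fun l => Tot (normalized (factors W X l))) (clsL W c.1 c.2)
        (fun s => clsL (X s) (x s).1 (x s).2) := by
  funext l
  cases l <;> rfl

theorem chainMul_leibniz (c : (n : ℕ) × W.obj (op ⦋n⦌)) (x : ∀ s, (n : ℕ) × (X s).obj (op ⦋n⦌)) :
    Tot.d (normalized Z) (μ.chainMul (clsL W c.1 c.2) fun s => clsL (X s) (x s).1 (x s).2) =
      μ.chainMul (Tot.d (normalized W) (clsL W c.1 c.2)) (fun s => clsL (X s) (x s).1 (x s).2) +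
      ∑ s, (-1 : ℤ) ^ (c.1 + ∑ t with t < s, (x t).1) •
        μ.chainMul (clsL W c.1 c.2) (Function.update (fun s => clsL (X s) (x s).1 (x s).2) s
          (Tot.d (normalized (X s)) (clsL (X s) (x s).1 (x s).2))) := by
  rw [chainMul_eq, μ.natMul.d_shuffle, Letter.sum_eq]
  congr 1
  · rw [Finset.filter_false_of_mem fun x _ => Letter.not_lt_op x, Finset.sum_empty, pow_zero,
      one_smul, chainMul_apply, clsL_gens]
    refine congrArg μ.natMul.shuffle ?_
    exact (Letter.elim_update_op (M := fun l => Tot (normalized (factors W X l))) _ _ _).symm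
  · refine Finset.sum_congr rfl fun s _ => ?_
    have h : ∑ t with t < Letter.arg s, (gens c x t).1 = c.1 + ∑ t with t < s, (x t).1 := by
      rw [Finset.sum_filter, Finset.sum_filter, Letter.sum_eq, if_pos (Letter.op_lt_arg s)]
      simp only [Letter.arg_lt_arg]
      rfl
    rw [h, chainMul_apply, clsL_gens]
    refine congrArg (fun z => _ • μ.natMul.shuffle z) ?_
    exact (Letter.elim_update_arg (M := fun l => Tot (normalized (factors W X l))) _ _ _ _).symm

theorem chainMul_isChainMap :
    IsChainMap (C := normalized W) (X := fun s => normalized (X s)) (Z := normalized Z)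
      μ.chainMul where
  degree a c p x := by
    obtain ⟨c, rfl⟩ := (degenerate W a).mkQ_surjective c
    choose y hy using fun s => (degenerate (X s) (p s)).mkQ_surjective (x s)
    obtain rfl := funext hy
    change μ.chainMul (clsL W a c) (fun s => clsL (X s) (p s) (y s)) ∈ _
    rw [μ.chainMul_cls]
    refine Submodule.sum_mem _ fun w _ => zsmul_mem ?_ _
    exact ⟨_, rfl⟩
  leibniz a c p x := by
    obtain ⟨c, rfl⟩ := (degenerate W a).mkQ_surjective c
    choose y hy using fun s => (degenerate (X s) (p s)).mkQ_surjective (x s)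
    obtain rfl := funext hy
    exact μ.chainMul_leibniz ⟨a, c⟩ fun s => ⟨p s, y s⟩

/-- Two multilinear maps on complexes agree if they agree on classes of simplices. -/
theorem chain_ext {M : Type*} [AddCommGroup M] [Module k M]
    {F G : Tot (normalized W) →ₗ[k] MultilinearMap k (fun s => Tot (normalized (X s))) M}
    (h : ∀ (c : (n : ℕ) × W.obj (op ⦋n⦌)) (x : ∀ s, (n : ℕ) × (X s).obj (op ⦋n⦌)),
      F (clsL W c.1 c.2) (fun s => clsL (X s) (x s).1 (x s).2) =
        G (clsL W c.1 c.2) (fun s => clsL (X s) (x s).1 (x s).2)) : F = G := by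
  refine LinearMap.ext_on (cls_span W) ?_
  rintro _ ⟨c, rfl⟩
  exact multilinear_ext (fun s (g : (n : ℕ) × (X s).obj (op ⦋n⦌)) => clsL (X s) g.1 g.2)
    (fun s => cls_span (X s)) fun x => h c x

/-- Arguments of dimension zero leave only the word consisting of the letter `oper`, so the chain
map is the simplicial operation with totally degenerate arguments. It serves for the right unit law
of operads. -/
theorem chainMul_units (z : ∀ s, (X s).obj (op ⦋0⦌)) (θ : W ⟶ Z)
    (h : ∀ q f c, μ.app q c (fun s => pl (X s) f q 0 (z s)) = (θ.app (op ⦋q⦌)).hom c)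
    (c : Tot (normalized W)) :
    μ.chainMul c (fun s => clsL (X s) 0 (z s)) = Tot.map (normalizedMap θ) c := by
  have key : ∀ c : (n : ℕ) × W.obj (op ⦋n⦌), μ.chainMul (clsL W c.1 c.2)
      (fun s => clsL (X s) 0 (z s)) = Tot.map (normalizedMap θ) (clsL W c.1 c.2) := by
    intro c
    rw [Tot.map_clsL, μ.chainMul_eq c fun s => ⟨0, z s⟩,
      μ.natMul.shuffle_of_single _ Letter.oper fun j hj => by
        cases j with
        | oper => exact absurd rfl hj
        | arg s => rfl]
    refine congrArg (clsL Z c.1) ?_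
    rw [← h c.1 (steps (fun _ : Fin c.1 => Letter.oper (n := 0)) Letter.oper)]
    change μ.app c.1 (pl W (steps (fun _ : Fin c.1 => Letter.oper) Letter.oper) c.1 c.1 c.2) _ = _
    rw [pl_steps_const]
    refine congrArg (μ.app c.1 c.2) (funext fun s => ?_)
    exact congrArg (fun φ : ⦋c.1⦌ ⟶ ⦋0⦌ => ((X s).map φ.op).hom (z s)) (simplex_hom_ext (q := c.1) (n := 0)
      fun t => (Nat.min_zero _).trans (Nat.min_zero _).symm)
  let F : Tot (normalized W) →ₗ[k] Tot (normalized Z) :=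
    { toFun := fun c => μ.chainMul c (fun s => clsL (X s) 0 (z s))
      map_add' := fun a b => by simp
      map_smul' := fun a b => by simp }
  have hF : F = Tot.map (normalizedMap θ) := by
    refine LinearMap.ext_on (cls_span W) ?_
    rintro _ ⟨c, rfl⟩
    exact key c
  exact LinearMap.congr_fun hF c

end Basic

/-- The counterpart of `chainMul_units` for an operation of dimension zero with one argument. It
serves for the left unit law of operads and for the unit law of algebras. -/
theorem chainMul_unit {W Z : SimplicialObject (ModuleCat.{u} k)}
    {X : Fin 1 → SimplicialObject (ModuleCat.{u} k)} (μ : SimplicialMul W X Z)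
    (z : W.obj (op ⦋0⦌)) (θ : X 0 ⟶ Z)
    (h : ∀ q f x, μ.app q (pl W f q 0 z) x = (θ.app (op ⦋q⦌)).hom (x 0))
    (x : ∀ s, Tot (normalized (X s))) :
    μ.chainMul (clsL W 0 z) x = Tot.map (normalizedMap θ) (x 0) := by
  have key : (μ.chainMul (clsL W 0 z)).toLinearMap x 0 = Tot.map (normalizedMap θ) := by
    refine LinearMap.ext_on (cls_span (X 0)) ?_
    rintro _ ⟨y, rfl⟩
    obtain ⟨g, hg⟩ : ∃ g : ∀ s, (n : ℕ) × (X s).obj (op ⦋n⦌), g 0 = y :=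
      ⟨Fin.cons y fun s => s.elim0, rfl⟩
    have h1 : Function.update x 0 (clsL (X 0) y.1 y.2) =
        fun s => clsL (X s) (g s).1 (g s).2 := by
      funext s
      obtain rfl : s = 0 := Subsingleton.elim _ _
      rw [Function.update_self, hg]
    rw [MultilinearMap.toLinearMap_apply, h1, Tot.map_clsL, μ.chainMul_eq ⟨0, z⟩ g,
      μ.natMul.shuffle_of_single _ (Letter.arg 0) fun j hj => by
        cases j with
        | oper => rfl
        | arg s => exact absurd (congrArg Letter.arg (Subsingleton.elim s 0)) hj]
    subst hg
    refine congrArg (clsL Z (g 0).1) ?_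
    refine (h _ _ _).trans ?_
    exact congrArg _ (pl_steps_const (X 0) (Letter.arg 0) (g 0).2)
  have h2 := LinearMap.congr_fun key (x 0)
  rwa [MultilinearMap.toLinearMap_apply, Function.update_eq_self] at h2

/-- Naturality of the chain map induced by a `SimplicialMul`. -/
theorem chainMul_map {W W' : SimplicialObject (ModuleCat.{u} k)} {m : ℕ}
    {X X' : Fin m → SimplicialObject (ModuleCat.{u} k)}
    {Z Z' : SimplicialObject (ModuleCat.{u} k)} (μ : SimplicialMul W X Z)
    (μ' : SimplicialMul W' X' Z') (ρ : W ⟶ W') (τ : ∀ s, X s ⟶ X' s) (θ : Z ⟶ Z')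
    (h : ∀ q c x, μ'.app q ((ρ.app (op ⦋q⦌)).hom c) (fun s => ((τ s).app (op ⦋q⦌)).hom (x s)) =
      (θ.app (op ⦋q⦌)).hom (μ.app q c x)) (c : Tot (normalized W))
    (x : ∀ s, Tot (normalized (X s))) :
    μ'.chainMul (Tot.map (normalizedMap ρ) c) (fun s => Tot.map (normalizedMap (τ s)) (x s)) =
      Tot.map (normalizedMap θ) (μ.chainMul c x) := by
  let F : Tot (normalized W) →ₗ[k] MultilinearMap k (fun s => Tot (normalized (X s)))
      (Tot (normalized Z')) :=
    (MultilinearMap.compLinearMapₗ (fun s => Tot.map (normalizedMap (τ s)))) ∘ₗ μ'.chainMul ∘ₗ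
      Tot.map (normalizedMap ρ)
  let G : Tot (normalized W) →ₗ[k] MultilinearMap k (fun s => Tot (normalized (X s)))
      (Tot (normalized Z')) :=
    { toFun := fun c => (Tot.map (normalizedMap θ)).compMultilinearMap (μ.chainMul c)
      map_add' := fun a b => by
        ext y
        simp
      map_smul' := fun a b => by
        ext y
        simp }
  have hFG : F = G := by
    refine chain_ext fun c x => ?_
    change μ'.chainMul (Tot.map (normalizedMap ρ) (clsL W c.1 c.2))
      (fun s => Tot.map (normalizedMap (τ s)) (clsL (X s) (x s).1 (x s).2)) =
      Tot.map (normalizedMap θ) (μ.chainMul (clsL W c.1 c.2) fun s => clsL (X s) (x s).1 (x s).2)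
    simp only [Tot.map_clsL]
    rw [μ.chainMul_eq, μ'.chainMul_eq ⟨c.1, _⟩ (fun s => ⟨(x s).1, _⟩),
      μ.natMul.shuffle_cls _ rfl, μ'.natMul.shuffle_cls (q := ∑ i, (gens c x i).1) _
        (by rw [Letter.sum_eq, Letter.sum_eq]; rfl), NatMul.shSum, NatMul.shSum, map_sum]
    refine Finset.sum_congr ?_ fun w _ => ?_
    · congr 1
      funext l
      cases l <;> rfl
    · rw [map_zsmul, Tot.map_clsL]
      refine congrArg (fun z => wsign w • clsL Z' _ z) ?_
      refine Eq.trans ?_ (h _ _ _)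
      change μ'.app _ _ _ = _
      congr 1
      · exact congrArg (μ'.app _) (pl_natural ρ _ _ _ _)
      · funext s
        exact pl_natural (τ s) _ _ _ _
  exact congrArg (fun H : Tot (normalized W) →ₗ[k] MultilinearMap k
    (fun s => Tot (normalized (X s))) (Tot (normalized Z')) => H c x) hFG

end SimplicialMul

end SymHom

namespace SymHom

namespace SimplicialMul

variable {k : Type u} [CommRing k]

/-! ### Equivariance with Koszul signs -/

section Equivariance

variable {W W' : SimplicialObject (ModuleCat.{u} k)} {m : ℕ}
  {V : Fin m → SimplicialObject (ModuleCat.{u} k)} {Z Z' : SimplicialObject (ModuleCat.{u} k)}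

/-- The permutation of the letters induced by a permutation of the arguments. -/
def letterPerm (σ : Equiv.Perm (Fin m)) : Letter m ≃ Letter m where
  toFun := Letter.elim (M := fun _ => Letter m) .oper fun s => .arg (σ s)
  invFun := Letter.elim (M := fun _ => Letter m) .oper fun s => .arg (σ.symm s)
  left_inv x := by cases x <;> simp
  right_inv x := by cases x <;> simp

/-- Both sides are sums over words in letters that differ by a permutation of the arguments, so
`words_reorder` compares them. The letter `oper` stays the smallest and takes part in no reversed
pair, so the sign is that of the arguments alone. -/
theorem equivariance_cls (σ : Equiv.Perm (Fin m)) (μ : SimplicialMul W V Z)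
    (μ' : SimplicialMul W' (fun s => V (σ.symm s)) Z') (ρ : W' ⟶ W) (θ : Z' ⟶ Z)
    (h : ∀ q c d, μ.app q ((ρ.app (op ⦋q⦌)).hom c) d =
      (θ.app (op ⦋q⦌)).hom (μ'.app q c fun s => d (σ.symm s)))
    (c : (n : ℕ) × W'.obj (op ⦋n⦌)) (d : ∀ s, (n : ℕ) × (V s).obj (op ⦋n⦌)) :
    μ.chainMul (Tot.map (normalizedMap ρ) (clsL W' c.1 c.2))
        (fun s => clsL (V s) (d s).1 (d s).2) =
      permSign σ (fun s => (d s).1) • Tot.map (normalizedMap θ)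
        (μ'.chainMul (clsL W' c.1 c.2)
          fun s => clsL (V (σ.symm s)) (d (σ.symm s)).1 (d (σ.symm s)).2) := by
  let g := gens (W := W) (X := V) ⟨c.1, (ρ.app (op ⦋c.1⦌)).hom c.2⟩ d
  let g' := gens (W := W') (X := fun s => V (σ.symm s)) c (fun s => d (σ.symm s))
  have hq : ∑ i, (g' i).1 = ∑ i, (g i).1 := by
    rw [Letter.sum_eq, Letter.sum_eq]
    exact congrArg (c.1 + ·) (Equiv.sum_comp σ.symm fun s => (d s).1)
  rw [Tot.map_clsL, μ.chainMul_eq ⟨c.1, (ρ.app (op ⦋c.1⦌)).hom c.2⟩ d,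
    μ'.chainMul_eq c fun s => d (σ.symm s), μ.natMul.shuffle_cls g rfl,
    μ'.natMul.shuffle_cls g' hq, NatMul.shSum, NatMul.shSum, map_sum]
  have hword := words_reorder (q := ∑ i, (g i).1) (letterPerm σ) (fun i => (g i).1)
    (fun i => (g' i).1) (fun i => by
      cases i with
      | oper => rfl
      | arg s => exact congrArg (fun s => (d s).1) (σ.symm_apply_apply s))
    (fun f => clsL Z (∑ i, (g i).1) (μ.natMul.eval (∑ i, (g i).1) g f))
  have hsign : (-1 : ℤ) ^ (∑ x, ∑ y with x < y ∧ letterPerm σ y < letterPerm σ x,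
      (g x).1 * (g y).1) = permSign σ fun s => (d s).1 := by
    rw [permSign, Letter.sum_eq]
    congr 1
    have h0 : ∑ y with Letter.oper < y ∧ letterPerm σ y < letterPerm σ Letter.oper,
        (g Letter.oper).1 * (g y).1 = 0 := by
      rw [Finset.filter_false_of_mem fun y _ hy => Letter.not_lt_op _ hy.2, Finset.sum_empty]
    rw [h0, zero_add]
    refine Finset.sum_congr rfl fun s _ => ?_
    rw [Finset.sum_filter, Finset.sum_filter, Letter.sum_eq,
      if_neg fun hy => Letter.not_lt_op _ hy.1, zero_add]
    refine Finset.sum_congr rfl fun t _ => ?_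
    refine if_congr ?_ rfl rfl
    rw [Letter.arg_lt_arg]
    exact and_congr Iff.rfl (Letter.arg_lt_arg _ _)
  rw [hsign] at hword
  have hE : ∀ w : Fin (∑ i, (g i).1) → Letter m,
      clsL Z (∑ i, (g i).1) (μ.natMul.eval (∑ i, (g i).1) g fun i => steps w (letterPerm σ i)) =
      Tot.map (normalizedMap θ) (clsL Z' (∑ i, (g i).1)
        (μ'.natMul.eval (∑ i, (g i).1) g' (steps w))) := by
    intro w
    rw [Tot.map_clsL]
    refine congrArg (clsL Z (∑ i, (g i).1)) ?_
    have h1 := h (∑ i, (g i).1) (pl W' (steps w .oper) (∑ i, (g i).1) c.1 c.2)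
      fun s => pl (V s) (steps w (.arg (σ s))) (∑ i, (g i).1) (d s).1 (d s).2
    rw [← pl_natural] at h1
    refine h1.trans ?_
    refine congrArg (fun z => (θ.app (op ⦋∑ i, (g i).1⦌)).hom (μ'.app (∑ i, (g i).1)
      (pl W' (steps w .oper) (∑ i, (g i).1) c.1 c.2) z)) (funext fun s => ?_)
    rw [σ.apply_symm_apply]
    rfl
  -- The sign is its own inverse and may be moved to the other side.
  have hsq : permSign σ (fun s => (d s).1) * permSign σ (fun s => (d s).1) = 1 := by
    rw [permSign, ← mul_pow]
    simp
  have h2 := congrArg (fun z => permSign σ (fun s => (d s).1) • z) hword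
  simp only [smul_smul, hsq, one_smul] at h2
  rw [← h2]
  refine congrArg (fun z => permSign σ (fun s => (d s).1) • z) ?_
  refine Finset.sum_congr rfl fun w _ => ?_
  rw [hE, map_zsmul]

theorem equivariance (σ : Equiv.Perm (Fin m)) (μ : SimplicialMul W V Z)
    (μ' : SimplicialMul W' (fun s => V (σ.symm s)) Z') (ρ : W' ⟶ W) (θ : Z' ⟶ Z)
    (h : ∀ q c d, μ.app q ((ρ.app (op ⦋q⦌)).hom c) d =
      (θ.app (op ⦋q⦌)).hom (μ'.app q c fun s => d (σ.symm s)))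
    (c : Tot (normalized W')) (p : Fin m → ℕ) (d : ∀ s, (normalized (V s)).X (p s)) :
    μ.chainMul (Tot.map (normalizedMap ρ) c) (fun s => Tot.of _ _ (d s)) =
      permSign σ p • Tot.map (normalizedMap θ)
        (μ'.chainMul c fun s => Tot.of _ _ (d (σ.symm s))) := by
  choose y hy using fun s => (degenerate (V s) (p s)).mkQ_surjective (d s)
  obtain rfl := funext hy
  let F : Tot (normalized W') →ₗ[k] Tot (normalized Z) :=
    { toFun := fun c => μ.chainMul (Tot.map (normalizedMap ρ) c) fun s => clsL (V s) (p s) (y s)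
      map_add' := fun a b => by simp
      map_smul' := fun a b => by simp }
  let G : Tot (normalized W') →ₗ[k] Tot (normalized Z) :=
    { toFun := fun c => permSign σ p • Tot.map (normalizedMap θ)
        (μ'.chainMul c fun s => clsL (V (σ.symm s)) (p (σ.symm s)) (y (σ.symm s)))
      map_add' := fun a b => by simp
      map_smul' := fun a b => by
        simp only [map_smul, smul_apply, RingHom.id_apply]
        rw [smul_comm] }
  have hFG : F = G := by
    refine LinearMap.ext_on (cls_span W') ?_
    rintro _ ⟨c, rfl⟩
    exact equivariance_cls σ μ μ' ρ θ h c fun s => ⟨p s, y s⟩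
  exact LinearMap.congr_fun hFG c

end Equivariance

end SimplicialMul

end SymHom

namespace SymHom

/-! ### Refining the alphabet of an operation and its arguments -/

section LetterFamily

variable {n : ℕ} (K₀ : Type) (K₁ : Fin n → Type)

/-- The alphabets that refine an operation and its arguments. -/
def Alphabets : Letter n → Type := Letter.elim K₀ K₁

noncomputable instance [LinearOrder K₀] [∀ s, LinearOrder (K₁ s)] (l : Letter n) :
    LinearOrder (Alphabets K₀ K₁ l) :=
  Letter.elim (M := fun l => LinearOrder (Alphabets K₀ K₁ l)) (inferInstanceAs (LinearOrder K₀))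
    (fun s => inferInstanceAs (LinearOrder (K₁ s))) l

instance [Fintype K₀] [∀ s, Fintype (K₁ s)] (l : Letter n) : Fintype (Alphabets K₀ K₁ l) :=
  Letter.elim (M := fun l => Fintype (Alphabets K₀ K₁ l)) (inferInstanceAs (Fintype K₀))
    (fun s => inferInstanceAs (Fintype (K₁ s))) l

end LetterFamily

namespace SimplicialMul

/-! ### The letters of a twofold composition and the interchange sign -/

section AssocLetters

variable {m : ℕ} (j : Fin m → ℕ)

/-- The alphabets for a composite operation with its arguments. -/
abbrev LeftAlph : Letter (∑ s, j s) → Type := Alphabets (Letter m) fun _ => Unit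

/-- The alphabets for an operation with composite arguments. -/
abbrev RightAlph : Letter m → Type := Alphabets Unit fun s => Letter (j s)

/-- The letter of the operation. -/
def left₀ : Refined (LeftAlph j) := ⟨.oper, Letter.oper⟩

/-- The letters of the inner operations. -/
def left₁ (s : Fin m) : Refined (LeftAlph j) := ⟨.oper, Letter.arg s⟩

/-- The letters of the arguments. -/
def left₂ (r : Fin (∑ s, j s)) : Refined (LeftAlph j) := ⟨.arg r, ()⟩

/-- The letter of the operation. -/
def right₀ : Refined (RightAlph j) := ⟨.oper, ()⟩

/-- The letters of the inner operations. -/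
def right₁ (s : Fin m) : Refined (RightAlph j) := ⟨.arg s, Letter.oper⟩

/-- The letters of the arguments. -/
def right₂ (s : Fin m) (t : Fin (j s)) : Refined (RightAlph j) := ⟨.arg s, Letter.arg t⟩

variable {j}

theorem left_cases {P : Refined (LeftAlph j) → Prop} (h₀ : P (left₀ j)) (h₁ : ∀ s, P (left₁ j s))
    (h₂ : ∀ r, P (left₂ j r)) (x : Refined (LeftAlph j)) : P x := by
  obtain ⟨l, κ⟩ := x
  cases l with
  | oper => exact Letter.rec (motive := fun κ => P ⟨.oper, κ⟩) h₀ h₁ κ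
  | arg r => exact h₂ r

theorem left_sum {M : Type*} [AddCommMonoid M] (f : Refined (LeftAlph j) → M) :
    ∑ x, f x = f (left₀ j) + ∑ s, f (left₁ j s) + ∑ r, f (left₂ j r) := by
  rw [Refined.sum_eq, Letter.sum_eq]
  refine congrArg₂ (· + ·) (Letter.sum_eq (fun κ => f ⟨.oper, κ⟩)) ?_
  refine Finset.sum_congr rfl fun r _ => ?_
  exact Fintype.sum_unique fun κ : Unit => f ⟨.arg r, κ⟩

variable (j) in
/-- The two ways of writing the letters of a twofold composition. -/
def assocEquiv : Refined (LeftAlph j) ≃ Refined (RightAlph j) where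
  toFun x := Letter.elim (M := fun l => LeftAlph j l → Refined (RightAlph j))
    (Letter.elim (M := fun _ => Refined (RightAlph j)) (right₀ j) (right₁ j))
    (fun r _ => right₂ j (finSigmaFinEquiv.symm r).1 (finSigmaFinEquiv.symm r).2) x.1 x.2
  invFun x := Letter.elim (M := fun l => RightAlph j l → Refined (LeftAlph j))
    (fun _ => left₀ j)
    (fun s => Letter.elim (M := fun _ => Refined (LeftAlph j)) (left₁ j s)
      fun t => left₂ j (finSigmaFinEquiv ⟨s, t⟩)) x.1 x.2
  left_inv x := by
    induction x using left_cases with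
    | h₀ => rfl
    | h₁ s => rfl
    | h₂ r => exact congrArg (left₂ j) (finSigmaFinEquiv.apply_symm_apply r)
  right_inv x := by
    obtain ⟨l, κ⟩ := x
    cases l with
    | oper => rfl
    | arg s =>
      change Letter (j s) at κ
      cases κ with
      | oper => rfl
      | arg t =>
        exact congrArg (fun v : (s : Fin m) × Fin (j s) => right₂ j v.1 v.2)
          (finSigmaFinEquiv.symm_apply_apply ⟨s, t⟩)

theorem not_lt_left₀ (x : Refined (LeftAlph j)) : ¬ x < left₀ j := by
  intro h
  induction x using left_cases with
  | h₀ => exact lt_irrefl _ h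
  | h₁ s =>
    exact Letter.not_lt_op (Letter.arg s)
      ((Refined.mk_lt_mk (K := LeftAlph j) (l := .oper)).1 h)
  | h₂ r => exact absurd (Refined.fst_le h) (not_le.2 (Letter.op_lt_arg r))

theorem not_lt_right₀ (x : Refined (RightAlph j)) : ¬ x < right₀ j := by
  intro h
  obtain ⟨l, κ⟩ := x
  cases l with
  | oper => exact absurd (Refined.mk_lt_mk.1 h) (lt_irrefl _)
  | arg s => exact absurd (Refined.fst_le h) (not_le.2 (Letter.op_lt_arg s))

theorem left₁_lt_left₁ {s t : Fin m} : left₁ j s < left₁ j t ↔ s < t :=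
  (Refined.mk_lt_mk (K := LeftAlph j) (l := .oper)).trans (Letter.arg_lt_arg s t)

theorem right₂_lt_right₂_self {s : Fin m} {t u : Fin (j s)} :
    right₂ j s t < right₂ j s u ↔ t < u :=
  (Refined.mk_lt_mk (K := RightAlph j) (l := .arg s)).trans (Letter.arg_lt_arg t u)

theorem right₁_lt_right₁ {s t : Fin m} (h : right₁ j s < right₁ j t) : s < t := by
  rcases lt_or_eq_of_le (Refined.fst_le h) with h1 | h1
  · exact (Letter.arg_lt_arg _ _).1 h1
  · obtain rfl : s = t := Letter.arg.inj h1
    exact absurd h (lt_irrefl _)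

theorem right₂_lt_right₁ {s t : Fin m} (u : Fin (j s)) :
    right₂ j s u < right₁ j t ↔ s < t := by
  constructor
  · intro h
    rcases lt_or_eq_of_le (Refined.fst_le h) with h1 | h1
    · exact (Letter.arg_lt_arg _ _).1 h1
    · obtain rfl : s = t := Letter.arg.inj h1
      exact absurd (Refined.mk_lt_mk.1 h) (Letter.not_lt_op _)
  · intro h
    exact Refined.lt_of_fst ((Letter.arg_lt_arg _ _).2 h)

theorem right₂_lt_right₂ {v v' : (s : Fin m) × Fin (j s)}
    (h : right₂ j v.1 v.2 < right₂ j v'.1 v'.2) : finSigmaFinEquiv v < finSigmaFinEquiv v' := by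
  obtain ⟨s, u⟩ := v
  obtain ⟨t, u'⟩ := v'
  rw [finSigmaFinEquiv_lt]
  rcases lt_or_eq_of_le (Refined.fst_le h) with h1 | h1
  · exact Or.inl ((Letter.arg_lt_arg _ _).1 h1)
  · obtain rfl : s = t := Letter.arg.inj h1
    exact Or.inr ⟨rfl, right₂_lt_right₂_self.1 h⟩

/-- In the left order all inner operations precede all arguments; in the right order the arguments
of the inner operation `s` precede the inner operation `t` when `s < t`. These pairs are the only
ones reversed by `assocEquiv`, and they give the interchange sign. -/
theorem assoc_sign (a : ℕ) (b : Fin m → ℕ) (e : ∀ s, Fin (j s) → ℕ)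
    (p : Refined (LeftAlph j) → ℕ) (h₁ : ∀ s, p (left₁ j s) = b s)
    (h₂ : ∀ r, p (left₂ j r) = e (finSigmaFinEquiv.symm r).1 (finSigmaFinEquiv.symm r).2) :
    (-1 : ℤ) ^ (∑ x, ∑ y with x < y ∧ assocEquiv j y < assocEquiv j x, p x * p y) =
      interchangeSign b fun s => ∑ t, e s t := by
  rw [interchangeSign]
  congr 1
  have hz : ∀ (x y : Refined (LeftAlph j)), ¬ (x < y ∧ assocEquiv j y < assocEquiv j x) →
      (if x < y ∧ assocEquiv j y < assocEquiv j x then p x * p y else 0) = 0 :=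
    fun x y h => if_neg h
  have e0 : ∀ y, (if left₀ j < y ∧ assocEquiv j y < assocEquiv j (left₀ j) then
      p (left₀ j) * p y else 0) = 0 := fun y => hz _ _ fun h => not_lt_right₀ _ h.2
  have e1 : ∀ x, (if x < left₀ j ∧ assocEquiv j (left₀ j) < assocEquiv j x then
      p x * p (left₀ j) else 0) = 0 := fun x => hz _ _ fun h => not_lt_left₀ _ h.1
  have e2 : ∀ s t, (if left₁ j s < left₁ j t ∧
      assocEquiv j (left₁ j t) < assocEquiv j (left₁ j s) then
      p (left₁ j s) * p (left₁ j t) else 0) = 0 := fun s t => hz _ _ fun h =>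
    absurd (right₁_lt_right₁ h.2)
      (not_lt.2 (left₁_lt_left₁.1 h.1).le)
  have e3 : ∀ r s, (if left₂ j r < left₁ j s ∧
      assocEquiv j (left₁ j s) < assocEquiv j (left₂ j r) then
      p (left₂ j r) * p (left₁ j s) else 0) = 0 := fun r s => hz _ _ fun h =>
    absurd (Refined.fst_le h.1) (not_le.2 (Letter.op_lt_arg r))
  have e4 : ∀ r r', (if left₂ j r < left₂ j r' ∧
      assocEquiv j (left₂ j r') < assocEquiv j (left₂ j r) then
      p (left₂ j r) * p (left₂ j r') else 0) = 0 := fun r r' => hz _ _ fun h => by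
    have h1 := right₂_lt_right₂ h.2
    rw [Equiv.apply_symm_apply, Equiv.apply_symm_apply] at h1
    have h2 := (Letter.arg_lt_arg _ _).1
      (lt_of_le_of_ne (Refined.fst_le h.1) fun h3 => by
        obtain rfl : r = r' := Letter.arg.inj h3
        exact absurd h.1 (lt_irrefl _))
    exact absurd h1 h2.not_gt
  have e5 : ∀ t r, (if left₁ j t < left₂ j r ∧
      assocEquiv j (left₂ j r) < assocEquiv j (left₁ j t) then
      p (left₁ j t) * p (left₂ j r) else 0) =
      if (finSigmaFinEquiv.symm r).1 < t then
        e (finSigmaFinEquiv.symm r).1 (finSigmaFinEquiv.symm r).2 * b t else 0 := by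
    intro t r
    rw [h₁, h₂, mul_comm]
    refine if_congr ?_ rfl rfl
    exact ⟨fun h => (right₂_lt_right₁ _).1 h.2,
      fun h => ⟨Refined.lt_of_fst (Letter.op_lt_arg r), (right₂_lt_right₁ _).2 h⟩⟩
  simp only [Finset.sum_filter, left_sum, e0, e1, e2, e3, e4, e5, Finset.sum_const_zero,
    zero_add, add_zero]
  have e6 : ∀ t, ∑ r : Fin (∑ s, j s), (if (finSigmaFinEquiv.symm r).1 < t then
      e (finSigmaFinEquiv.symm r).1 (finSigmaFinEquiv.symm r).2 * b t else 0) =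
      ∑ s, if s < t then (∑ u, e s u) * b t else 0 := by
    intro t
    rw [finSigmaFinEquiv.symm.sum_comp (fun v : (s : Fin m) × Fin (j s) =>
      if v.1 < t then e v.1 v.2 * b t else 0), Fintype.sum_sigma]
    refine Finset.sum_congr rfl fun s _ => ?_
    dsimp only
    by_cases h : s < t
    · simp only [if_pos h, Finset.sum_mul]
    · simp only [if_neg h, Finset.sum_const_zero]
  simp only [e6]
  exact Finset.sum_comm

end AssocLetters

/-! ### Associativity of the induced chain maps -/

section Assoc

variable {k : Type u} [CommRing k] {W U Z Z' : SimplicialObject (ModuleCat.{u} k)} {m : ℕ}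
  {j : Fin m → ℕ} {V Y : Fin m → SimplicialObject (ModuleCat.{u} k)}
  {X : ∀ s, Fin (j s) → SimplicialObject (ModuleCat.{u} k)}

/-- Each side is a composite of shuffle maps, hence by `NatMul.shuffle_comp` a sum over words in a
refined alphabet. Identity maps `NatMul.single` are inserted where a factor is not composed.
`assocEquiv` identifies the two alphabets, and `h` identifies the values. -/
theorem assoc_cls (α : SimplicialMul W V U)
    (β : SimplicialMul U
      (fun r : Fin (∑ s, j s) => X (finSigmaFinEquiv.symm r).1 (finSigmaFinEquiv.symm r).2) Z')
    (γ : SimplicialMul W Y Z) (δ : ∀ s, SimplicialMul (V s) (X s) (Y s)) (θ : Z ⟶ Z')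
    (h : ∀ q c d (x : ∀ s t, (X s t).obj (op ⦋q⦌)), β.app q (α.app q c d)
      (fun r => x (finSigmaFinEquiv.symm r).1 (finSigmaFinEquiv.symm r).2) =
      (θ.app (op ⦋q⦌)).hom (γ.app q c fun s => (δ s).app q (d s) (x s)))
    (c : (n : ℕ) × W.obj (op ⦋n⦌)) (d : ∀ s, (n : ℕ) × (V s).obj (op ⦋n⦌))
    (x : ∀ s t, (n : ℕ) × (X s t).obj (op ⦋n⦌)) :
    β.chainMul (α.chainMul (clsL W c.1 c.2) fun s => clsL (V s) (d s).1 (d s).2)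
        (fun r => clsL _ (x (finSigmaFinEquiv.symm r).1 (finSigmaFinEquiv.symm r).2).1
          (x (finSigmaFinEquiv.symm r).1 (finSigmaFinEquiv.symm r).2).2) =
      interchangeSign (fun s => (d s).1) (fun s => ∑ t, (x s t).1) •
        Tot.map (normalizedMap θ) (γ.chainMul (clsL W c.1 c.2)
          fun s => (δ s).chainMul (clsL (V s) (d s).1 (d s).2)
            fun t => clsL (X s t) (x s t).1 (x s t).2) := by
  let X' := fun r : Fin (∑ s, j s) => X (finSigmaFinEquiv.symm r).1 (finSigmaFinEquiv.symm r).2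
  let x' := fun r : Fin (∑ s, j s) => x (finSigmaFinEquiv.symm r).1 (finSigmaFinEquiv.symm r).2
  let FL : ∀ l, LeftAlph j l → SimplicialObject (ModuleCat.{u} k) :=
    Letter.elim (M := fun l => LeftAlph j l → SimplicialObject (ModuleCat.{u} k))
      (factors W V) fun r _ => X' r
  let gL : ∀ l κ, (n : ℕ) × (FL l κ).obj (op ⦋n⦌) :=
    Letter.elim (M := fun l => ∀ κ, (n : ℕ) × (FL l κ).obj (op ⦋n⦌)) (gens c d) fun r _ => x' r
  let νL : ∀ l, NatMul (FL l) (factors U X' l) :=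
    Letter.elim (M := fun l => NatMul (FL l) (factors U X' l)) α.natMul
      fun r => NatMul.single (X' r)
  let FR : ∀ l, RightAlph j l → SimplicialObject (ModuleCat.{u} k) :=
    Letter.elim (M := fun l => RightAlph j l → SimplicialObject (ModuleCat.{u} k))
      (fun _ => W) fun s => factors (V s) (X s)
  let gR : ∀ l κ, (n : ℕ) × (FR l κ).obj (op ⦋n⦌) :=
    Letter.elim (M := fun l => ∀ κ, (n : ℕ) × (FR l κ).obj (op ⦋n⦌)) (fun _ => c)
      fun s => gens (d s) (x s)
  let νR : ∀ l, NatMul (FR l) (factors W Y l) :=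
    Letter.elim (M := fun l => NatMul (FR l) (factors W Y l)) (NatMul.single W)
      fun s => (δ s).natMul
  have hL : β.chainMul (α.chainMul (clsL W c.1 c.2) fun s => clsL (V s) (d s).1 (d s).2)
      (fun r => clsL _ (x' r).1 (x' r).2) =
      β.natMul.shuffle fun l => (νL l).shuffle fun κ => clsL (FL l κ) (gL l κ).1 (gL l κ).2 := by
    rw [chainMul_apply]
    refine congrArg β.natMul.shuffle (funext fun l => ?_)
    cases l with
    | oper => exact α.chainMul_eq c d
    | arg r => exact (NatMul.single_shuffle (X' r) (x' r).1 (x' r).2).symm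
  have hR : (γ.chainMul (clsL W c.1 c.2) fun s => (δ s).chainMul (clsL (V s) (d s).1 (d s).2)
      fun t => clsL (X s t) (x s t).1 (x s t).2) =
      γ.natMul.shuffle fun l => (νR l).shuffle fun κ => clsL (FR l κ) (gR l κ).1 (gR l κ).2 := by
    rw [chainMul_apply]
    refine congrArg γ.natMul.shuffle (funext fun l => ?_)
    cases l with
    | oper => exact (NatMul.single_shuffle W c.1 c.2).symm
    | arg s => exact (δ s).chainMul_eq (d s) (x s)
  obtain ⟨q, hq⟩ : ∃ q, ∑ l, ∑ κ, (gL l κ).1 = q := ⟨_, rfl⟩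
  have hp : ∀ i : Refined (LeftAlph j), (gR (assocEquiv j i).1 (assocEquiv j i).2).1 =
      (gL i.1 i.2).1 := left_cases rfl (fun s => rfl) (fun r => rfl)
  have hq' : ∑ l, ∑ κ, (gR l κ).1 = q := by
    rw [← hq, ← Refined.sum_eq (fun i : Refined (LeftAlph j) => (gL i.1 i.2).1),
      ← Refined.sum_eq (fun i : Refined (RightAlph j) => (gR i.1 i.2).1),
      ← (assocEquiv j).sum_comp]
    exact Finset.sum_congr rfl fun i _ => hp i
  refine hL.trans ?_
  rw [hR, β.natMul.shuffle_comp νL gL hq, γ.natMul.shuffle_comp νR gR hq', map_sum]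
  have hword := words_reorder (q := q) (assocEquiv j) (fun i => (gL i.1 i.2).1)
    (fun i => (gR i.1 i.2).1) hp
    (fun f => clsL Z' q (β.natMul.app q fun l => (νL l).eval q (gL l) fun κ => f ⟨l, κ⟩))
  rw [assoc_sign c.1 (fun s => (d s).1) (fun s t => (x s t).1) _ (fun s => rfl) (fun r => rfl)]
    at hword
  have hE : ∀ w : Fin q → Refined (RightAlph j),
      clsL Z' q (β.natMul.app q fun l => (νL l).eval q (gL l) fun κ =>
        steps w (assocEquiv j ⟨l, κ⟩)) =
      Tot.map (normalizedMap θ) (clsL Z q (γ.natMul.app q fun l =>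
        (νR l).eval q (gR l) fun κ => steps w ⟨l, κ⟩)) := by
    intro w
    rw [Tot.map_clsL]
    refine congrArg (clsL Z' q) ?_
    exact h q (pl W (steps w (right₀ j)) q c.1 c.2)
      (fun s => pl (V s) (steps w (right₁ j s)) q (d s).1 (d s).2)
      (fun s t => pl (X s t) (steps w (right₂ j s t)) q (x s t).1 (x s t).2)
  have hsq : interchangeSign (fun s => (d s).1) (fun s => ∑ t, (x s t).1) *
      interchangeSign (fun s => (d s).1) (fun s => ∑ t, (x s t).1) = 1 := by
    rw [interchangeSign, ← mul_pow]
    simp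
  have h2 := congrArg
    (fun z => interchangeSign (fun s => (d s).1) (fun s => ∑ t, (x s t).1) • z) hword
  simp only [smul_smul, hsq, one_smul] at h2
  rw [← h2]
  refine congrArg (fun z => interchangeSign _ _ • z) ?_
  refine Finset.sum_congr rfl fun w _ => ?_
  rw [map_zsmul]
  exact congrArg (fun z => wsign w • z) (hE w)

theorem assoc (α : SimplicialMul W V U)
    (β : SimplicialMul U
      (fun r : Fin (∑ s, j s) => X (finSigmaFinEquiv.symm r).1 (finSigmaFinEquiv.symm r).2) Z')
    (γ : SimplicialMul W Y Z) (δ : ∀ s, SimplicialMul (V s) (X s) (Y s)) (θ : Z ⟶ Z')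
    (h : ∀ q c d (x : ∀ s t, (X s t).obj (op ⦋q⦌)), β.app q (α.app q c d)
      (fun r => x (finSigmaFinEquiv.symm r).1 (finSigmaFinEquiv.symm r).2) =
      (θ.app (op ⦋q⦌)).hom (γ.app q c fun s => (δ s).app q (d s) (x s)))
    (c : Tot (normalized W)) (b : Fin m → ℕ) (d : ∀ s, (normalized (V s)).X (b s))
    (e : ∀ s, Fin (j s) → ℕ) (x : ∀ s t, (normalized (X s t)).X (e s t)) :
    β.chainMul (α.chainMul c fun s => Tot.of _ _ (d s))
        (fun r => Tot.of _ _ (x (finSigmaFinEquiv.symm r).1 (finSigmaFinEquiv.symm r).2)) =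
      interchangeSign b (fun s => ∑ t, e s t) • Tot.map (normalizedMap θ)
        (γ.chainMul c fun s => (δ s).chainMul (Tot.of _ _ (d s)) fun t => Tot.of _ _ (x s t)) := by
  choose y hy using fun s => (degenerate (V s) (b s)).mkQ_surjective (d s)
  obtain rfl := funext hy
  choose z hz using fun s t => (degenerate (X s t) (e s t)).mkQ_surjective (x s t)
  obtain rfl := funext fun s => funext (hz s)
  let D : ∀ s, Tot (normalized (V s)) := fun s => clsL (V s) (b s) (y s)
  let x' := fun s t => clsL (X s t) (e s t) (z s t)
  let F : Tot (normalized W) →ₗ[k] Tot (normalized Z') :=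
    { toFun := fun c => β.chainMul (α.chainMul c D)
        fun r => x' (finSigmaFinEquiv.symm r).1 (finSigmaFinEquiv.symm r).2
      map_add' := fun a b => by simp
      map_smul' := fun a b => by simp }
  let G : Tot (normalized W) →ₗ[k] Tot (normalized Z') :=
    { toFun := fun c => interchangeSign b (fun s => ∑ t, e s t) • Tot.map (normalizedMap θ)
        (γ.chainMul c fun s => (δ s).chainMul (D s) (x' s))
      map_add' := fun a b => by simp
      map_smul' := fun a b => by
        simp only [map_smul, smul_apply, RingHom.id_apply]
        rw [smul_comm] }
  have hFG : F = G := by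
    refine LinearMap.ext_on (cls_span W) ?_
    rintro _ ⟨c, rfl⟩
    exact assoc_cls α β γ δ θ h c (fun s => ⟨b s, y s⟩) fun s t => ⟨e s t, z s t⟩
  exact LinearMap.congr_fun hFG c

end Assoc

end SimplicialMul

end SymHom

namespace SymHom

/-! ### Functoriality of linearized nerves and normalization -/

section Linearization

variable {k : Type u} [CommRing k]

theorem linNerveMap_chain {C D : Type} [Category.{0} C] [Category.{0} D] (F : C ⥤ D) {q : ℕ}
    (s : Fin (q + 1) ⥤ C) :
    ((linNerveMap k F).app (op ⦋q⦌)).hom (chain k s) = chain k (s ⋙ F) :=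
  lmapDomain_single (k := k) (fun s : Fin (q + 1) ⥤ C => s ⋙ F) s

theorem chain_linear_ext {C : Type} [Category.{0} C] {q : ℕ} {M : Type*} [AddCommGroup M]
    [Module k M] {f g : (linNerve k C).obj (op ⦋q⦌) →ₗ[k] M}
    (h : ∀ s : Fin (q + 1) ⥤ C, f (chain k s) = g (chain k s)) : f = g := by
  refine LinearMap.ext_on (chain_span k C q) ?_
  rintro _ ⟨s, rfl⟩
  exact h s

theorem linNerve_hom_ext {C : Type} [Category.{0} C] {X : SimplicialObject (ModuleCat.{u} k)}
    {f g : linNerve k C ⟶ X} (h : ∀ (q : ℕ) (s : Fin (q + 1) ⥤ C),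
      (f.app (op ⦋q⦌)).hom (chain k s) = (g.app (op ⦋q⦌)).hom (chain k s)) : f = g := by
  ext ⟨⟨q⟩⟩ : 2
  exact chain_linear_ext (h q)

theorem linNerveMap_id (C : Type) [Category.{0} C] : linNerveMap k (𝟭 C) = 𝟙 _ :=
  linNerve_hom_ext fun q s => linNerveMap_chain (𝟭 C) s

theorem linNerveMap_comp {C D E : Type} [Category.{0} C] [Category.{0} D] [Category.{0} E]
    (F : C ⥤ D) (G : D ⥤ E) : linNerveMap k (F ⋙ G) = linNerveMap k F ≫ linNerveMap k G :=
  linNerve_hom_ext fun q s => by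
    refine (linNerveMap_chain (F ⋙ G) s).trans ?_
    refine ((congrArg ((linNerveMap k G).app (op ⦋q⦌)).hom (linNerveMap_chain F s)).trans
      (linNerveMap_chain G (s ⋙ F))).symm

theorem normalized_hom_ext {X : SimplicialObject (ModuleCat.{u} k)}
    {C : ChainComplex (ModuleCat.{u} k) ℕ} {f g : normalized X ⟶ C}
    (h : ∀ n (x : X.obj (op ⦋n⦌)),
      (f.f n).hom ((degenerate X n).mkQ x) = (g.f n).hom ((degenerate X n).mkQ x)) : f = g := by
  ext n : 1
  exact ModuleCat.hom_ext (Submodule.linearMap_qext _ (LinearMap.ext (h n)))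

theorem normalizedMap_id (X : SimplicialObject (ModuleCat.{u} k)) : normalizedMap (𝟙 X) = 𝟙 _ :=
  normalized_hom_ext fun _ _ => rfl

theorem normalizedMap_comp {X Y Z : SimplicialObject (ModuleCat.{u} k)} (f : X ⟶ Y) (g : Y ⟶ Z) :
    normalizedMap (f ≫ g) = normalizedMap f ≫ normalizedMap g :=
  normalized_hom_ext fun _ _ => rfl

end Linearization

/-! ### The operad multiplication on linearized nerves -/

section NerveMul

variable (k : Type u) [CommRing k] (P : CatOperadData) (m : ℕ) (j : Fin m → ℕ)

theorem exists_nerveMul {q : ℕ} (c : Fin (q + 1) ⥤ P.obj m) :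
    ∃ F : MultilinearMap k (fun s => (linNerve k (P.obj (j s))).obj (op ⦋q⦌))
      ((linNerve k (P.obj (∑ s, j s))).obj (op ⦋q⦌)),
      ∀ d, F (fun s => chain k (d s)) = chain k (P.comp c d) :=
  exists_multilinear (fun s => chain k) (fun s => chain_span k (P.obj (j s)) q)
    (fun d => chain k (P.comp c d)) fun s g =>
      ⟨Finsupp.lmapDomain k k fun y => P.comp c (Function.update g s y), fun y =>
        lmapDomain_single (k := k) (fun y => P.comp c (Function.update g s y)) y⟩

/-- The multiplication of an operad in categories, on linearized nerves, in a fixed degree. -/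
noncomputable def nerveMulApp (q : ℕ) : (linNerve k (P.obj m)).obj (op ⦋q⦌) →ₗ[k]
    MultilinearMap k (fun s => (linNerve k (P.obj (j s))).obj (op ⦋q⦌))
      ((linNerve k (P.obj (∑ s, j s))).obj (op ⦋q⦌)) :=
  Finsupp.linearCombination k fun c : Fin (q + 1) ⥤ P.obj m => (exists_nerveMul k P m j c).choose

theorem nerveMulApp_chain {q : ℕ} (c : Fin (q + 1) ⥤ P.obj m)
    (d : ∀ s, Fin (q + 1) ⥤ P.obj (j s)) :
    nerveMulApp k P m j q (chain k c) (fun s => chain k (d s)) = chain k (P.comp c d) := by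
  refine Eq.trans ?_ ((exists_nerveMul k P m j c).choose_spec d)
  refine congrArg (fun F : MultilinearMap k (fun s => (linNerve k (P.obj (j s))).obj (op ⦋q⦌))
      ((linNerve k (P.obj (∑ s, j s))).obj (op ⦋q⦌)) => F fun s => chain k (d s)) ?_
  exact (Finsupp.linearCombination_single k (1 : k) c).trans (one_smul k _)

variable {k P m j}

theorem nerve_multilinear_ext {q : ℕ} {M : Type*} [AddCommGroup M] [Module k M]
    {F G : (linNerve k (P.obj m)).obj (op ⦋q⦌) →ₗ[k]
      MultilinearMap k (fun s => (linNerve k (P.obj (j s))).obj (op ⦋q⦌)) M}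
    (h : ∀ (c : Fin (q + 1) ⥤ P.obj m) (d : ∀ s, Fin (q + 1) ⥤ P.obj (j s)), F (chain k c) (fun s => chain k (d s)) =
      G (chain k c) (fun s => chain k (d s))) : F = G :=
  chain_linear_ext fun c => multilinear_ext (fun s => chain k)
    (fun s => chain_span k (P.obj (j s)) q) fun d => h c d

variable (k P m j)

/-- The multiplication of an operad in categories, on linearized nerves. -/
noncomputable def nerveMul : SimplicialMul (linNerve k (P.obj m))
    (fun s => linNerve k (P.obj (j s))) (linNerve k (P.obj (∑ s, j s))) where
  app := nerveMulApp k P m j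
  naturality q q' φ c y := by
    let F : (linNerve k (P.obj m)).obj (op ⦋q⦌) →ₗ[k] MultilinearMap k
        (fun s => (linNerve k (P.obj (j s))).obj (op ⦋q⦌))
        ((linNerve k (P.obj (∑ s, j s))).obj (op ⦋q'⦌)) :=
      (LinearMap.compMultilinearMapₗ k ((linNerve k (P.obj (∑ s, j s))).map φ.op).hom) ∘ₗ
        nerveMulApp k P m j q
    let G : (linNerve k (P.obj m)).obj (op ⦋q⦌) →ₗ[k] MultilinearMap k
        (fun s => (linNerve k (P.obj (j s))).obj (op ⦋q⦌))
        ((linNerve k (P.obj (∑ s, j s))).obj (op ⦋q'⦌)) :=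
      (MultilinearMap.compLinearMapₗ fun s => ((linNerve k (P.obj (j s))).map φ.op).hom) ∘ₗ
        nerveMulApp k P m j q' ∘ₗ ((linNerve k (P.obj m)).map φ.op).hom
    have hFG : F = G := by
      refine nerve_multilinear_ext fun c d => ?_
      change ((linNerve k (P.obj (∑ s, j s))).map φ.op).hom
          (nerveMulApp k P m j q (chain k c) fun s => chain k (d s)) =
        nerveMulApp k P m j q' (((linNerve k (P.obj m)).map φ.op).hom (chain k c))
          fun s => ((linNerve k (P.obj (j s))).map φ.op).hom (chain k (d s))
      simp only [linNerve_map_chain, nerveMulApp_chain]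
      rfl
    exact congrArg (fun H : (linNerve k (P.obj m)).obj (op ⦋q⦌) →ₗ[k] MultilinearMap k
        (fun s => (linNerve k (P.obj (j s))).obj (op ⦋q⦌))
        ((linNerve k (P.obj (∑ s, j s))).obj (op ⦋q'⦌)) => H c y) hFG

variable {k P m j}

theorem nerveMul_chain {q : ℕ} (c : Fin (q + 1) ⥤ P.obj m)
    (d : ∀ s, Fin (q + 1) ⥤ P.obj (j s)) :
    (nerveMul k P m j).app q (chain k c) (fun s => chain k (d s)) = chain k (P.comp c d) :=
  nerveMulApp_chain k P m j c d

theorem pl_const {C : Type} [Category.{0} C] (x : C) (f : ℕ →o ℕ) (q n : ℕ) :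
    pl (linNerve k C) f q n (chain k ((Functor.const (Fin (n + 1))).obj x)) =
      chain k ((Functor.const (Fin (q + 1))).obj x) :=
  linNerve_map_chain _ _

end NerveMul

end SymHom

namespace SymHom

/-! ### Renaming the variables of multilinear maps -/

section Reindex

variable {k : Type*} [CommRing k] {ι κ : Type*} {M : κ → Type*} [∀ i, AddCommGroup (M i)]
  [∀ i, Module k (M i)] {Z : Type*} [AddCommGroup Z] [Module k Z]

/-- Multilinear maps of dependent families, with renamed variables. -/
def reindexMultilinear (e : ι ≃ κ) (F : MultilinearMap k (fun i => M (e i)) Z) :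
    MultilinearMap k M Z where
  toFun y := F fun i => y (e i)
  map_update_add' := by
    classical
    intro d y l a b
    obtain rfl : d = fun a b => Classical.propDecidable (a = b) := Subsingleton.elim _ _
    obtain ⟨i, rfl⟩ := e.surjective l
    simp only [Function.update_comp_eq_of_injective' _ e.injective]
    exact F.map_update_add _ _ _ _
  map_update_smul' := by
    classical
    intro d y l a b
    obtain rfl : d = fun a b => Classical.propDecidable (a = b) := Subsingleton.elim _ _
    obtain ⟨i, rfl⟩ := e.surjective l
    simp only [Function.update_comp_eq_of_injective' _ e.injective]
    exact F.map_update_smul _ _ _ _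

/-- A linear map of the only variable, as a multilinear map. -/
def multilinearOfUnique {M : Fin 1 → Type*} [∀ i, AddCommGroup (M i)] [∀ i, Module k (M i)]
    (L : M 0 →ₗ[k] Z) : MultilinearMap k M Z where
  toFun y := L (y 0)
  map_update_add' := by
    intro d y l a b
    obtain rfl : l = 0 := Subsingleton.elim _ _
    simp
  map_update_smul' := by
    intro d y l a b
    obtain rfl : l = 0 := Subsingleton.elim _ _
    simp

end Reindex

/-! ### Normalized chains of a one-point category -/

section OnePoint

variable (k : Type u) [CommRing k] (C : Type) [Category.{0} C]

/-- A string in positive dimension equals the degeneracy of any of its faces, there being at most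
one string in each dimension. -/
theorem degenerate_linNerve_eq_top (h : ∀ q, Subsingleton (Fin (q + 1) ⥤ C)) (n : ℕ) :
    degenerate (linNerve k C) (n + 1) = ⊤ := by
  rw [eq_top_iff, ← chain_span k C (n + 1), Submodule.span_le]
  rintro _ ⟨s, rfl⟩
  refine Submodule.mem_iSup_of_mem 0 ⟨chain k (pull s (SimplexCategory.δ 0)), ?_⟩
  refine (linNerve_map_chain (SimplexCategory.σ 0) _).trans ?_
  exact congrArg (chain k) ((h (n + 1)).elim _ _)

/-- The normalized complex of a one-point category. -/
noncomputable def normalizedOnePoint (h : ∀ q, Nonempty (Unique (Fin (q + 1) ⥤ C))) :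
    normalized (linNerve k C) ≅
      (ChainComplex.single₀ (ModuleCat.{u} k)).obj (ModuleCat.of k k) := by
  have hz : ∀ n, Limits.IsZero ((normalized (linNerve k C)).X (n + 1)) := fun n => by
    have := degenerate_linNerve_eq_top k C (fun q => (h q).elim fun _ => inferInstance) n
    have : Subsingleton ((normalized (linNerve k C)).X (n + 1)) :=
      Submodule.Quotient.subsingleton_iff.2 this
    exact ModuleCat.isZero_of_subsingleton _
  let _ : Unique (Fin (0 + 1) ⥤ C) := (h 0).some
  let e₀ : (normalized (linNerve k C)).X 0 ≅
      ((ChainComplex.single₀ (ModuleCat.{u} k)).obj (ModuleCat.of k k)).X 0 :=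
    (LinearEquiv.toModuleIso ((Submodule.quotEquivOfEqBot (degenerate (linNerve k C) 0) rfl).trans
      (Finsupp.uniqueLinearEquiv (α := Fin (0 + 1) ⥤ C) k k default))) ≪≫
      (HomologicalComplex.singleObjXSelf (ComplexShape.down ℕ) 0 (ModuleCat.of k k)).symm
  refine HomologicalComplex.Hom.isoOfComponents (fun n => match n with
    | 0 => e₀
    | n + 1 => (hz n).iso (HomologicalComplex.isZero_single_obj_X _ _ _ _ (Nat.succ_ne_zero n))) ?_
  rintro i j rfl
  exact (hz j).eq_of_src _ _

end OnePoint

/-! ### The chain operad of an operad in categories -/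

section ChainOperad

variable (k : Type u) [CommRing k] {P : CatOperadData} (hP : P.IsOperad)

theorem unique_functor_of_zero (hP : P.IsOperad) (q : ℕ) :
    Nonempty (Unique (Fin (q + 1) ⥤ P.obj 0)) := by
  obtain ⟨⟨_⟩, h⟩ := hP.zero
  refine ⟨⟨⟨(Functor.const _).obj default⟩, fun F => ?_⟩⟩
  refine CategoryTheory.Functor.ext (fun X => Subsingleton.elim _ _) fun X Y f => ?_
  have := (h (F.obj X) (F.obj Y)).some
  exact Subsingleton.elim _ _

/-- The unit of the chain operad. -/
noncomputable def chainOne (P : CatOperadData) : (normalizedNerve k P 1).X 0 :=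
  (degenerate (linNerve k (P.obj 1)) 0).mkQ (chain k ((Functor.const (Fin (0 + 1))).obj P.one))

variable {k}

theorem nerveMul_one_left (hP : P.IsOperad) {j : Fin 1 → ℕ} (q : ℕ)
    (x : ∀ s, (linNerve k (P.obj (j s))).obj (op ⦋q⦌)) :
    (nerveMul k P 1 j).app q (chain k ((Functor.const (Fin (q + 1))).obj P.one)) x =
      ((linNerveMap k (P.act (finCongr (Fin.sum_univ_one j)))).app (op ⦋q⦌)).hom (x 0) := by
  have : (nerveMul k P 1 j).app q (chain k ((Functor.const (Fin (q + 1))).obj P.one)) =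
      multilinearOfUnique (M := fun s => (linNerve k (P.obj (j s))).obj (op ⦋q⦌))
        ((linNerveMap k (P.act (finCongr (Fin.sum_univ_one j)))).app (op ⦋q⦌)).hom := by
    refine multilinear_ext (fun s => chain k) (fun s => chain_span k (P.obj (j s)) q) fun d => ?_
    refine (nerveMul_chain _ _).trans ?_
    refine Eq.trans ?_ (linNerveMap_chain _ (d 0)).symm
    rw [hP.one_comp]
  exact congrArg (fun F : MultilinearMap k (fun s => (linNerve k (P.obj (j s))).obj (op ⦋q⦌)) _ =>
    F x) this

theorem nerveMul_one_right (hP : P.IsOperad) (m q : ℕ) (c : (linNerve k (P.obj m)).obj (op ⦋q⦌)) :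
    (nerveMul k P m fun _ => 1).app q c
        (fun _ => chain k ((Functor.const (Fin (q + 1))).obj P.one)) =
      ((linNerveMap k (P.act (finCongr (show ∑ _ : Fin m, 1 = m by simp)))).app (op ⦋q⦌)).hom
        c := by
  let F : (linNerve k (P.obj m)).obj (op ⦋q⦌) →ₗ[k]
      (linNerve k (P.obj (∑ _ : Fin m, 1))).obj (op ⦋q⦌) :=
    { toFun := fun c => (nerveMul k P m fun _ => 1).app q c
        fun _ => chain k ((Functor.const (Fin (q + 1))).obj P.one)
      map_add' := fun a b => by simp
      map_smul' := fun a b => by simp }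
  have : F = ((linNerveMap k (P.act (finCongr (show ∑ _ : Fin m, 1 = m by simp)))).app
      (op ⦋q⦌)).hom := by
    refine chain_linear_ext fun c => ?_
    refine (nerveMul_chain _ _).trans ?_
    rw [hP.comp_one]
    exact (linNerveMap_chain _ _).symm
  exact LinearMap.congr_fun this c

/-- The identity is multilinear in three groups of variables and is extended from strings in two
stages: first in `x`, with strings for `c` and `d`, and then in `c` and `d`, with `x` fixed. -/
theorem nerveMul_assoc (hP : P.IsOperad) {m : ℕ} {j : Fin m → ℕ} {i : ∀ s, Fin (j s) → ℕ} (q : ℕ)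
    (c : (linNerve k (P.obj m)).obj (op ⦋q⦌))
    (d : ∀ s, (linNerve k (P.obj (j s))).obj (op ⦋q⦌))
    (x : ∀ s t, (linNerve k (P.obj (i s t))).obj (op ⦋q⦌)) :
    (nerveMul k P (∑ s, j s)
        fun r => i (finSigmaFinEquiv.symm r).1 (finSigmaFinEquiv.symm r).2).app q
        ((nerveMul k P m j).app q c d)
        (fun r => x (finSigmaFinEquiv.symm r).1 (finSigmaFinEquiv.symm r).2) =
      ((linNerveMap k (P.act (finCongr (sum_flatten i)))).app (op ⦋q⦌)).hom
        ((nerveMul k P m fun s => ∑ t, i s t).app q c fun s =>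
          (nerveMul k P (j s) (i s)).app q (d s) (x s)) := by
  let θ := ((linNerveMap k (P.act (finCongr (sum_flatten i)))).app (op ⦋q⦌)).hom
  let β := (nerveMul k P (∑ s, j s)
        fun r => i (finSigmaFinEquiv.symm r).1 (finSigmaFinEquiv.symm r).2).app q
  let γ := (nerveMul k P m fun s => ∑ t, i s t).app q
  let δ := fun s => (nerveMul k P (j s) (i s)).app q
  have h1 : ∀ (c : Fin (q + 1) ⥤ P.obj m) (d : ∀ s, Fin (q + 1) ⥤ P.obj (j s))
      (x : ∀ s t, (linNerve k (P.obj (i s t))).obj (op ⦋q⦌)),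
      β ((nerveMul k P m j).app q (chain k c) fun s => chain k (d s))
        (fun r => x (finSigmaFinEquiv.symm r).1 (finSigmaFinEquiv.symm r).2) =
      θ (γ (chain k c) fun s => δ s (chain k (d s)) (x s)) := by
    intro c d x
    have : reindexMultilinear (M := fun v : (s : Fin m) × Fin (j s) =>
        (linNerve k (P.obj (i v.1 v.2))).obj (op ⦋q⦌)) finSigmaFinEquiv.symm
        (β ((nerveMul k P m j).app q (chain k c) fun s => chain k (d s))) =
        (θ.compMultilinearMap ((γ (chain k c)).compMultilinearMap
          fun s => δ s (chain k (d s)))) := by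
      refine multilinear_ext (fun v => chain k) (fun v => chain_span k (P.obj (i v.1 v.2)) q)
        fun b => ?_
      refine (congrArg (fun z => β z fun r => chain k (b (finSigmaFinEquiv.symm r)))
        (nerveMul_chain c d)).trans ?_
      refine (nerveMul_chain (P.comp c d) fun r => b (finSigmaFinEquiv.symm r)).trans ?_
      refine Eq.trans ?_ (congrArg θ ((congrArg (γ (chain k c)) (funext fun s =>
        nerveMul_chain (d s) fun t => b ⟨s, t⟩)).trans (nerveMul_chain c _))).symm
      refine Eq.trans ?_ (linNerveMap_chain _ _).symm
      exact congrArg (chain k) (hP.assoc _ m j i c d fun s t => b ⟨s, t⟩)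
    exact congrArg (fun F : MultilinearMap k (fun v : (s : Fin m) × Fin (j s) =>
        (linNerve k (P.obj (i v.1 v.2))).obj (op ⦋q⦌)) _ => F fun v => x v.1 v.2) this
  let x' := fun r : Fin (∑ s, j s) => x (finSigmaFinEquiv.symm r).1 (finSigmaFinEquiv.symm r).2
  let B : (linNerve k (P.obj (∑ s, j s))).obj (op ⦋q⦌) →ₗ[k] _ :=
    { toFun := fun z => β z x'
      map_add' := fun a b => by simp
      map_smul' := fun a b => by simp }
  let D : ∀ s, (linNerve k (P.obj (j s))).obj (op ⦋q⦌) →ₗ[k]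
      (linNerve k (P.obj (∑ t, i s t))).obj (op ⦋q⦌) := fun s =>
    { toFun := fun z => δ s z (x s)
      map_add' := fun a b => by simp
      map_smul' := fun a b => by simp }
  have h2 : (LinearMap.compMultilinearMapₗ k B) ∘ₗ (nerveMul k P m j).app q =
      (LinearMap.compMultilinearMapₗ k θ) ∘ₗ (MultilinearMap.compLinearMapₗ D) ∘ₗ γ :=
    nerve_multilinear_ext fun c d => h1 c d x
  exact congrArg (fun F : (linNerve k (P.obj m)).obj (op ⦋q⦌) →ₗ[k] MultilinearMap k
    (fun s => (linNerve k (P.obj (j s))).obj (op ⦋q⦌)) _ => F c d) h2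

theorem nerveMul_equivariance_left (hP : P.IsOperad) {m : ℕ} {j : Fin m → ℕ}
    (σ : Equiv.Perm (Fin m)) (q : ℕ) (c : (linNerve k (P.obj m)).obj (op ⦋q⦌))
    (d : ∀ s, (linNerve k (P.obj (j s))).obj (op ⦋q⦌)) :
    (nerveMul k P m j).app q (((linNerveMap k (P.act σ)).app (op ⦋q⦌)).hom c) d =
      ((linNerveMap k (P.act (blockEquiv σ j))).app (op ⦋q⦌)).hom
        ((nerveMul k P m fun s => j (σ.symm s)).app q c fun s => d (σ.symm s)) := by
  let R : MultilinearMap k (fun s => (linNerve k (P.obj (j (σ.symm s)))).obj (op ⦋q⦌))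
      ((linNerve k (P.obj (∑ s, j (σ.symm s)))).obj (op ⦋q⦌)) →ₗ[k]
      MultilinearMap k (fun s => (linNerve k (P.obj (j s))).obj (op ⦋q⦌))
        ((linNerve k (P.obj (∑ s, j (σ.symm s)))).obj (op ⦋q⦌)) :=
    { toFun := fun F => reindexMultilinear
        (M := fun s => (linNerve k (P.obj (j s))).obj (op ⦋q⦌)) σ.symm F
      map_add' := fun F G => rfl
      map_smul' := fun a F => rfl }
  have h : (nerveMul k P m j).app q ∘ₗ ((linNerveMap k (P.act σ)).app (op ⦋q⦌)).hom =
      (LinearMap.compMultilinearMapₗ k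
        ((linNerveMap k (P.act (blockEquiv σ j))).app (op ⦋q⦌)).hom) ∘ₗ R ∘ₗ
        (nerveMul k P m fun s => j (σ.symm s)).app q := by
    refine nerve_multilinear_ext fun c d => ?_
    refine (congrArg (fun z => (nerveMul k P m j).app q z fun s => chain k (d s))
      (linNerveMap_chain (P.act σ) c)).trans ?_
    refine (nerveMul_chain _ _).trans ?_
    refine Eq.trans ?_ (congrArg ((linNerveMap k (P.act (blockEquiv σ j))).app (op ⦋q⦌)).hom
      (nerveMul_chain c fun s => d (σ.symm s))).symm
    refine Eq.trans ?_ (linNerveMap_chain _ _).symm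
    exact congrArg (chain k) (hP.equivariance_left _ m j σ c d)
  exact congrArg (fun F : (linNerve k (P.obj m)).obj (op ⦋q⦌) →ₗ[k] MultilinearMap k
    (fun s => (linNerve k (P.obj (j s))).obj (op ⦋q⦌)) _ => F c d) h

theorem nerveMul_equivariance_right (hP : P.IsOperad) {m : ℕ} {j : Fin m → ℕ}
    (τ : ∀ s, Equiv.Perm (Fin (j s))) (q : ℕ) (c : (linNerve k (P.obj m)).obj (op ⦋q⦌))
    (d : ∀ s, (linNerve k (P.obj (j s))).obj (op ⦋q⦌)) :
    (nerveMul k P m j).app q c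
        (fun s => ((linNerveMap k (P.act (τ s))).app (op ⦋q⦌)).hom (d s)) =
      ((linNerveMap k (P.act (sumEquiv τ))).app (op ⦋q⦌)).hom
        ((nerveMul k P m j).app q c d) := by
  have h : (MultilinearMap.compLinearMapₗ
        fun s => ((linNerveMap k (P.act (τ s))).app (op ⦋q⦌)).hom) ∘ₗ (nerveMul k P m j).app q =
      (LinearMap.compMultilinearMapₗ k
        ((linNerveMap k (P.act (sumEquiv τ))).app (op ⦋q⦌)).hom) ∘ₗ (nerveMul k P m j).app q := by
    refine nerve_multilinear_ext fun c d => ?_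
    refine (congrArg ((nerveMul k P m j).app q (chain k c)) (funext fun s =>
      linNerveMap_chain (P.act (τ s)) (d s))).trans ?_
    refine (nerveMul_chain _ _).trans ?_
    refine Eq.trans ?_ (congrArg ((linNerveMap k (P.act (sumEquiv τ))).app (op ⦋q⦌)).hom
      (nerveMul_chain c d)).symm
    refine Eq.trans ?_ (linNerveMap_chain _ _).symm
    exact congrArg (chain k) (hP.equivariance_right _ m j τ c d)
  exact congrArg (fun F : (linNerve k (P.obj m)).obj (op ⦋q⦌) →ₗ[k] MultilinearMap k
    (fun s => (linNerve k (P.obj (j s))).obj (op ⦋q⦌)) _ => F c d) h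

variable (k)

/-- The operad in chain complexes induced by an operad in categories. -/
noncomputable def chainOperad (hP : P.IsOperad) : ChainOperad k (normalizedNerve k P) where
  act e := normalizedMap (linNerveMap k (P.act e))
  one := chainOne k P
  mul m j := (nerveMul k P m j).chainMul
  mul_isChainMap m j := (nerveMul k P m j).chainMul_isChainMap
  zero := ⟨normalizedOnePoint k (P.obj 0) (unique_functor_of_zero hP)⟩
  act_refl n := by
    rw [hP.act_refl, linNerveMap_id, normalizedMap_id]
  act_trans e f := by
    rw [hP.act_trans, linNerveMap_comp, normalizedMap_comp]
  one_mul j d := by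
    refine (nerveMul k P 1 j).chainMul_unit (chain k ((Functor.const (Fin (0 + 1))).obj P.one))
      _ (fun q f x => ?_) d
    refine Eq.trans ?_ (nerveMul_one_left hP q x)
    exact congrArg (fun z => (nerveMul k P 1 j).app q z x) (pl_const _ _ _ _)
  mul_one m c := by
    refine (nerveMul k P m fun _ => 1).chainMul_units
      (fun _ => chain k ((Functor.const (Fin (0 + 1))).obj P.one)) _ (fun q f c => ?_) c
    refine Eq.trans ?_ (nerveMul_one_right hP m q c)
    exact congrArg ((nerveMul k P m fun _ => 1).app q c) (funext fun _ => pl_const _ _ _ _)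
  assoc m j i c b d e x := SimplicialMul.assoc (W := linNerve k (P.obj m))
    (U := linNerve k (P.obj (∑ s, j s))) (Z := linNerve k (P.obj (∑ s, ∑ t, i s t)))
    (V := fun s => linNerve k (P.obj (j s))) (Y := fun s => linNerve k (P.obj (∑ t, i s t)))
    (X := fun s t => linNerve k (P.obj (i s t))) (nerveMul k P m j)
    (nerveMul k P (∑ s, j s) fun r => i (finSigmaFinEquiv.symm r).1 (finSigmaFinEquiv.symm r).2)
    (nerveMul k P m fun s => ∑ t, i s t) (fun s => nerveMul k P (j s) (i s))
    (linNerveMap k (P.act (finCongr (sum_flatten i))))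
    (fun q c d x => nerveMul_assoc hP q c d x) c b d e x
  equivariance_left m j σ c p d := SimplicialMul.equivariance σ (nerveMul k P m j)
    (nerveMul k P m fun s => j (σ.symm s)) (linNerveMap k (P.act σ))
    (linNerveMap k (P.act (blockEquiv σ j))) (fun q c d => nerveMul_equivariance_left hP σ q c d)
    c p d
  equivariance_right m j τ c d := by
    have h := SimplicialMul.chainMul_map (nerveMul k P m j) (nerveMul k P m j) (𝟙 _)
      (fun s => linNerveMap k (P.act (τ s))) (linNerveMap k (P.act (sumEquiv τ)))
      (fun q c d => nerveMul_equivariance_right hP τ q c d) c d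
    rw [normalizedMap_id, Tot.map_id] at h
    exact h

theorem chainOperad_isInduced (hP : P.IsOperad) : (chainOperad k hP).IsInduced P where
  act e := rfl
  one := rfl
  mul m j a p c d := by
    refine ((nerveMul k P m j).chainMul_cls a (chain k c) p fun s => chain k (d s)).trans ?_
    refine Finset.sum_congr rfl fun w _ => ?_
    refine congrArg (fun z => w.sign • clsL (linNerve k (P.obj (∑ s, j s))) (a + ∑ s, p s) z) ?_
    refine Eq.trans ?_ (nerveMul_chain _ _)
    simp only [linNerve_map_chain]

end ChainOperad

end SymHom

namespace SymHom

/-! ### The chain algebra of a simplicial algebra -/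

section ChainAlgebra

variable {k : Type u} [CommRing k] {P : CatOperadData} {Y : SimplicialObject (ModuleCat.{u} k)}
  (S : SimplicialAlgebra P Y)

/-- The action of a simplicial algebra, as a `SimplicialMul`. -/
def SimplicialAlgebra.mul (n : ℕ) :
    SimplicialMul (linNerve k (P.obj n)) (fun _ : Fin n => Y) Y where
  app := S.act n
  naturality := S.naturality n

theorem SimplicialAlgebra.mul_equivariance (n q : ℕ) (σ : Equiv.Perm (Fin n))
    (c : (linNerve k (P.obj n)).obj (op ⦋q⦌)) (y : Fin n → Y.obj (op ⦋q⦌)) :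
    S.act n q (((linNerveMap k (P.act σ)).app (op ⦋q⦌)).hom c) y =
      S.act n q c fun s => y (σ.symm s) := by
  let F : (linNerve k (P.obj n)).obj (op ⦋q⦌) →ₗ[k] Y.obj (op ⦋q⦌) :=
    { toFun := fun c => S.act n q (((linNerveMap k (P.act σ)).app (op ⦋q⦌)).hom c) y
      map_add' := fun a b => by simp
      map_smul' := fun a b => by simp }
  let G : (linNerve k (P.obj n)).obj (op ⦋q⦌) →ₗ[k] Y.obj (op ⦋q⦌) :=
    { toFun := fun c => S.act n q c fun s => y (σ.symm s)
      map_add' := fun a b => by simp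
      map_smul' := fun a b => by simp }
  have : F = G := chain_linear_ext fun c =>
    (congrArg (fun z => S.act n q z y) (linNerveMap_chain (P.act σ) c)).trans
      (S.equivariance n q σ c y)
  exact LinearMap.congr_fun this c

theorem SimplicialAlgebra.mul_assoc (q m : ℕ) (j : Fin m → ℕ)
    (c : (linNerve k (P.obj m)).obj (op ⦋q⦌))
    (d : ∀ s, (linNerve k (P.obj (j s))).obj (op ⦋q⦌)) (y : ∀ s, Fin (j s) → Y.obj (op ⦋q⦌)) :
    S.act (∑ s, j s) q ((nerveMul k P m j).app q c d)
        (fun r => y (finSigmaFinEquiv.symm r).1 (finSigmaFinEquiv.symm r).2) =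
      S.act m q c fun s => S.act (j s) q (d s) (y s) := by
  let y' := fun r : Fin (∑ s, j s) => y (finSigmaFinEquiv.symm r).1 (finSigmaFinEquiv.symm r).2
  let B : (linNerve k (P.obj (∑ s, j s))).obj (op ⦋q⦌) →ₗ[k] Y.obj (op ⦋q⦌) :=
    { toFun := fun z => S.act (∑ s, j s) q z y'
      map_add' := fun a b => by simp
      map_smul' := fun a b => by simp }
  let D : ∀ s, (linNerve k (P.obj (j s))).obj (op ⦋q⦌) →ₗ[k] Y.obj (op ⦋q⦌) := fun s =>
    { toFun := fun z => S.act (j s) q z (y s)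
      map_add' := fun a b => by simp
      map_smul' := fun a b => by simp }
  have h : (LinearMap.compMultilinearMapₗ k B) ∘ₗ (nerveMul k P m j).app q =
      (MultilinearMap.compLinearMapₗ D) ∘ₗ S.act m q :=
    nerve_multilinear_ext fun c d =>
      (congrArg B (nerveMul_chain c d)).trans (S.assoc q m j c d y)
  exact congrArg (fun F : (linNerve k (P.obj m)).obj (op ⦋q⦌) →ₗ[k] MultilinearMap k
    (fun s => (linNerve k (P.obj (j s))).obj (op ⦋q⦌)) _ => F c d) h

theorem Tot.map_normalizedMap_id (X : SimplicialObject (ModuleCat.{u} k))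
    (x : Tot (normalized X)) : Tot.map (normalizedMap (𝟙 X)) x = x := by
  rw [normalizedMap_id, Tot.map_id]

/-- The algebra structure on the normalized complex of a simplicial algebra. -/
noncomputable def chainAlgebra (hP : P.IsOperad) : ChainAlgebra (chainOperad k hP) (normalized Y)
    where
  act n := (S.mul n).chainMul
  act_isChainMap n := (S.mul n).chainMul_isChainMap
  one_act x := by
    refine ((S.mul 1).chainMul_unit (chain k ((Functor.const (Fin (0 + 1))).obj P.one)) (𝟙 Y)
      (fun q f x => ?_) x).trans (Tot.map_normalizedMap_id Y (x 0))
    refine Eq.trans ?_ (S.one_act q x)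
    exact congrArg (fun z => S.act 1 q z x) (pl_const _ _ _ _)
  equivariance n σ c p x := by
    refine (SimplicialMul.equivariance σ (S.mul n) (S.mul n) (linNerveMap k (P.act σ)) (𝟙 Y)
      (fun q c y => S.mul_equivariance n q σ c y) c p x).trans ?_
    rw [Tot.map_normalizedMap_id]
  assoc m j c b d e x := by
    refine (SimplicialMul.assoc (W := linNerve k (P.obj m))
      (U := linNerve k (P.obj (∑ s, j s))) (Z := Y)
      (V := fun s => linNerve k (P.obj (j s))) (Y := fun _ => Y)
      (X := fun s t => Y) (nerveMul k P m j) (S.mul (∑ s, j s)) (S.mul m) (fun s => S.mul (j s))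
      (𝟙 Y) (fun q c d y => S.mul_assoc q m j c d y) c b d e x).trans ?_
    rw [Tot.map_normalizedMap_id]

theorem chainAlgebra_isInduced (hP : P.IsOperad) : (chainAlgebra S hP).IsInduced S :=
  fun n a p c y => (S.mul n).chainMul_cls a c p y

end ChainAlgebra

end SymHom

namespace SymHom

/-! ### Contraction of the nerve of a category with an initial object -/

section Prepend

variable {C : Type} [Category.{0} C] {x₀ : C} (hI : Limits.IsInitial x₀)

/-- A string of morphisms, preceded by the initial object. -/
def prepend {q : ℕ} (s : Fin (q + 1) ⥤ C) : Fin (q + 2) ⥤ C :=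
  ComposableArrows.precomp (n := q) s (hI.to (ComposableArrows.left (n := q) s))

theorem pull_pull {a b c : ℕ} (s : Fin (c + 1) ⥤ C) (φ : ⦋a⦌ ⟶ ⦋b⦌) (ψ : ⦋b⦌ ⟶ ⦋c⦌) :
    pull (pull s ψ) φ = pull s (φ ≫ ψ) := rfl

/-- The first morphism of a string that starts at an initial object carries no information, so the
string is determined by its tail. -/
theorem eq_prepend {q : ℕ} (F : Fin (q + 2) ⥤ C) (h : F.obj 0 = x₀) :
    F = prepend hI (pull F (SimplexCategory.δ 0)) := by
  subst h
  refine ComposableArrows.ext_succ rfl rfl ?_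
  exact hI.hom_ext _ _

/-- If `ψ` fixes the vertex `0` and is `φ` on the others, the pulled back string again starts at the
initial object, and its tail is the pull-back of the tail. -/
theorem pull_prepend {q q' : ℕ} (s : Fin (q + 1) ⥤ C) (φ : ⦋q'⦌ ⟶ ⦋q⦌) (ψ : ⦋q' + 1⦌ ⟶ ⦋q + 1⦌)
    (h₀ : ψ.toOrderHom 0 = 0) (h : SimplexCategory.δ 0 ≫ ψ = φ ≫ SimplexCategory.δ 0) :
    pull (prepend hI s) ψ = prepend hI (pull s φ) := by
  have h1 : (pull (prepend hI s) ψ).obj 0 = x₀ := congrArg (prepend hI s).obj h₀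
  refine (eq_prepend hI _ h1).trans (congrArg (prepend hI) ?_)
  rw [pull_pull, h]
  rfl

theorem pull_prepend_succ {q : ℕ} (s : Fin (q + 2) ⥤ C) (i : Fin (q + 2)) :
    pull (prepend hI s) (SimplexCategory.δ i.succ) =
      prepend hI (pull s (SimplexCategory.δ i)) := by
  refine pull_prepend hI s _ _ ?_ ?_
  · exact Fin.succ_succAbove_zero i
  · exact SimplexCategory.δ_comp_δ (Fin.zero_le i)

theorem pull_prepend_sigma {q : ℕ} (s : Fin (q + 1) ⥤ C) (i : Fin (q + 1)) :
    pull (prepend hI s) (SimplexCategory.σ i.succ) =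
      prepend hI (pull s (SimplexCategory.σ i)) := by
  refine pull_prepend hI s _ _ ?_ ?_
  · change i.succ.predAbove 0 = 0
    rw [Fin.predAbove, dif_neg (by simp)]
    rfl
  · exact SimplexCategory.δ_comp_σ_of_le (Fin.zero_le _)

theorem pull_prepend_one (s : Fin (0 + 1) ⥤ C) :
    pull (prepend hI s) (SimplexCategory.δ 1) = (Functor.const (Fin (0 + 1))).obj x₀ :=
  ComposableArrows.ext₀ rfl

variable (k : Type u) [CommRing k]

/-- The contraction of the linearized nerve of a category with an initial object. -/
noncomputable def prependL (q : ℕ) : (linNerve k C).obj (op ⦋q⦌) →ₗ[k]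
    (linNerve k C).obj (op ⦋q + 1⦌) :=
  Finsupp.lmapDomain k k fun s : Fin (q + 1) ⥤ C => prepend hI s

theorem prependL_chain {q : ℕ} (s : Fin (q + 1) ⥤ C) :
    prependL hI k q (chain k s) = chain k (prepend hI s) :=
  lmapDomain_single (k := k) (fun s : Fin (q + 1) ⥤ C => prepend hI s) s

theorem delta_zero_prependL {q : ℕ} (x : (linNerve k C).obj (op ⦋q⦌)) :
    ((linNerve k C).δ 0).hom (prependL hI k q x) = x := by
  have : ((linNerve k C).δ 0).hom ∘ₗ prependL hI k q = LinearMap.id := chain_linear_ext fun s =>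
    (congrArg ((linNerve k C).δ 0).hom (prependL_chain hI k s)).trans
      (linNerve_map_chain (SimplexCategory.δ 0) (prepend hI s))
  exact LinearMap.congr_fun this x

theorem delta_succ_prependL {q : ℕ} (i : Fin (q + 2)) (x : (linNerve k C).obj (op ⦋q + 1⦌)) :
    ((linNerve k C).δ i.succ).hom (prependL hI k (q + 1) x) =
      prependL hI k q (((linNerve k C).δ i).hom x) := by
  have : ((linNerve k C).δ i.succ).hom ∘ₗ prependL hI k (q + 1) =
      prependL hI k q ∘ₗ ((linNerve k C).δ i).hom := chain_linear_ext fun s => by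
    refine (congrArg ((linNerve k C).δ i.succ).hom (prependL_chain hI k s)).trans ?_
    refine (linNerve_map_chain (SimplexCategory.δ i.succ) (prepend hI s)).trans ?_
    rw [pull_prepend_succ]
    refine (prependL_chain hI k _).symm.trans ?_
    exact (congrArg (prependL hI k q) (linNerve_map_chain (SimplexCategory.δ i) s)).symm
  exact LinearMap.congr_fun this x

theorem sigma_succ_prependL {q : ℕ} (i : Fin (q + 1)) (x : (linNerve k C).obj (op ⦋q⦌)) :
    ((linNerve k C).σ i.succ).hom (prependL hI k q x) =
      prependL hI k (q + 1) (((linNerve k C).σ i).hom x) := by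
  have : ((linNerve k C).σ i.succ).hom ∘ₗ prependL hI k q =
      prependL hI k (q + 1) ∘ₗ ((linNerve k C).σ i).hom := chain_linear_ext fun s => by
    refine (congrArg ((linNerve k C).σ i.succ).hom (prependL_chain hI k s)).trans ?_
    refine (linNerve_map_chain (SimplexCategory.σ i.succ) (prepend hI s)).trans ?_
    rw [pull_prepend_sigma]
    refine (prependL_chain hI k _).symm.trans ?_
    exact (congrArg (prependL hI k (q + 1)) (linNerve_map_chain (SimplexCategory.σ i) s)).symm
  exact LinearMap.congr_fun this x

/-- The sum of the coefficients of a chain. -/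
noncomputable def coeffSum (q : ℕ) : (linNerve k C).obj (op ⦋q⦌) →ₗ[k] k :=
  Finsupp.linearCombination k fun _ : Fin (q + 1) ⥤ C => (1 : k)

theorem coeffSum_chain {q : ℕ} (s : Fin (q + 1) ⥤ C) : coeffSum k q (chain k s) = 1 :=
  (Finsupp.linearCombination_single k (1 : k) s).trans (one_smul k _)

theorem coeffSum_map {q q' : ℕ} (φ : ⦋q'⦌ ⟶ ⦋q⦌) (x : (linNerve k C).obj (op ⦋q⦌)) :
    coeffSum k q' (((linNerve k C).map φ.op).hom x) = coeffSum k q x := by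
  have : coeffSum k q' ∘ₗ ((linNerve k C).map φ.op).hom = coeffSum k q :=
    chain_linear_ext fun s => (congrArg (coeffSum k q') (linNerve_map_chain φ s)).trans
      ((coeffSum_chain k _).trans (coeffSum_chain k s).symm)
  exact LinearMap.congr_fun this x

theorem delta_one_prependL (x : (linNerve k C).obj (op ⦋0⦌)) :
    ((linNerve k C).δ 1).hom (prependL hI k 0 x) =
      coeffSum k 0 x • chain k ((Functor.const (Fin (0 + 1))).obj x₀) := by
  have : ((linNerve k C).δ 1).hom ∘ₗ prependL hI k 0 = LinearMap.toSpanSingleton k _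
      (chain k ((Functor.const (Fin (0 + 1))).obj x₀)) ∘ₗ coeffSum k 0 :=
    chain_linear_ext fun s => by
      refine (congrArg ((linNerve k C).δ 1).hom (prependL_chain hI k s)).trans ?_
      refine (linNerve_map_chain (SimplexCategory.δ 1) (prepend hI s)).trans ?_
      rw [pull_prepend_one]
      refine Eq.symm ((congrArg (fun z => z • chain k ((Functor.const (Fin (0 + 1))).obj x₀))
        (coeffSum_chain k s)).trans (one_smul k _))
  exact LinearMap.congr_fun this x

theorem objD_apply (X : SimplicialObject (ModuleCat.{u} k)) (n : ℕ) (x : X.obj (op ⦋n + 1⦌)) :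
    (AlgebraicTopology.AlternatingFaceMapComplex.objD X n).hom x =
      ∑ i : Fin (n + 2), (-1 : ℤ) ^ (i : ℕ) • (X.δ i).hom x := by
  simp [AlgebraicTopology.AlternatingFaceMapComplex.objD, ModuleCat.hom_sum]

/-- For an edge from the initial object to a vertex, `d_0` gives the vertex and `d_1` the initial
object; summed over `x`, the latter gives the augmentation. -/
theorem objD_prependL_zero (x : (linNerve k C).obj (op ⦋0⦌)) :
    (AlgebraicTopology.AlternatingFaceMapComplex.objD (linNerve k C) 0).hom (prependL hI k 0 x) =
      x - coeffSum k 0 x • chain k ((Functor.const (Fin (0 + 1))).obj x₀) := by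
  rw [objD_apply, Fin.sum_univ_two]
  refine (congrArg₂ (fun a b => (-1 : ℤ) ^ ((0 : Fin 2) : ℕ) • a + (-1 : ℤ) ^ ((1 : Fin 2) : ℕ) • b)
    (delta_zero_prependL hI k x) (delta_one_prependL hI k x)).trans ?_
  simp [sub_eq_add_neg]

/-- With `s` for prepending, `d_0 s = 1` and `d_{i+1} s = s d_i`, so the alternating sum telescopes
to `d s + s d = 1`. -/
theorem objD_prependL_succ (n : ℕ) (x : (linNerve k C).obj (op ⦋n + 1⦌)) :
    (AlgebraicTopology.AlternatingFaceMapComplex.objD (linNerve k C) (n + 1)).hom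
        (prependL hI k (n + 1) x) =
      x - prependL hI k n
        ((AlgebraicTopology.AlternatingFaceMapComplex.objD (linNerve k C) n).hom x) := by
  rw [objD_apply, Fin.sum_univ_succ, objD_apply, map_sum, sub_eq_add_neg, ← Finset.sum_neg_distrib]
  refine congrArg₂ (· + ·) ?_ (Finset.sum_congr rfl fun i _ => ?_)
  · refine (one_smul ℤ _).trans (delta_zero_prependL hI k x)
  · refine (congrArg (fun z => (-1 : ℤ) ^ (i.succ : ℕ) • z) (delta_succ_prependL hI k i x)).trans ?_
    rw [map_zsmul, Fin.val_succ, pow_succ]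
    simp

/-- The contraction of the normalized complex. -/
noncomputable def prependN (q : ℕ) : (normalized (linNerve k C)).X q →ₗ[k]
    (normalized (linNerve k C)).X (q + 1) :=
  (degenerate (linNerve k C) q).mapQ (degenerate (linNerve k C) (q + 1)) (prependL hI k q) (by
    cases q with
    | zero => exact bot_le
    | succ q =>
      refine iSup_le fun j => ?_
      rintro _ ⟨x, rfl⟩
      -- Prepending turns `σ_j` into `σ_{j+1}`, so it preserves degenerate chains.
      refine Submodule.mem_iSup_of_mem j.succ ⟨prependL hI k q x, ?_⟩
      exact sigma_succ_prependL hI k j x)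

theorem normalized_d_mkQ (X : SimplicialObject (ModuleCat.{u} k)) (n : ℕ)
    (x : X.obj (op ⦋n + 1⦌)) : ((normalized X).d (n + 1) n).hom ((degenerate X (n + 1)).mkQ x) =
      (degenerate X n).mkQ ((AlgebraicTopology.AlternatingFaceMapComplex.objD X n).hom x) := by
  rw [normalized_d]
  rfl

theorem d_prependN_succ (n : ℕ) (x : (normalized (linNerve k C)).X (n + 1)) :
    ((normalized (linNerve k C)).d (n + 2) (n + 1)).hom (prependN hI k (n + 1) x) =
      x - prependN hI k n (((normalized (linNerve k C)).d (n + 1) n).hom x) := by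
  obtain ⟨x, rfl⟩ := (degenerate (linNerve k C) (n + 1)).mkQ_surjective x
  refine (normalized_d_mkQ k (linNerve k C) (n + 1) (prependL hI k (n + 1) x)).trans ?_
  refine (congrArg (degenerate (linNerve k C) (n + 1)).mkQ (objD_prependL_succ hI k n x)).trans ?_
  refine (map_sub _ _ _).trans (congrArg (fun z => (degenerate (linNerve k C) (n + 1)).mkQ x - z) ?_)
  exact (congrArg (prependN hI k n) (normalized_d_mkQ k (linNerve k C) n x)).symm

end Prepend

end SymHom

namespace SymHom

/-! ### Augmentations of linearized nerves, and exactness -/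

section Augmentation

variable (k : Type u) [CommRing k] (C : Type) [Category.{0} C]

theorem exists_aug : ∃ F : Tot (normalized (linNerve k C)) →ₗ[k] k,
    (∀ x, F (clsL _ 0 x) = coeffSum k 0 x) ∧ ∀ q x, F (clsL _ (q + 1) x) = 0 := by
  obtain ⟨F, hF⟩ := exists_Tot_linear (X := linNerve k C) (M := k)
    (fun n => match n with
      | 0 => coeffSum k 0
      | _ + 1 => 0) fun n j y => rfl
  exact ⟨F, fun x => hF 0 x, fun q x => hF (q + 1) x⟩

/-- The augmentation of the normalized complex of a linearized nerve. -/
noncomputable def aug : Tot (normalized (linNerve k C)) →ₗ[k] k := (exists_aug k C).choose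

variable {k C}

theorem aug_clsL_zero (x : (linNerve k C).obj (op ⦋0⦌)) : aug k C (clsL _ 0 x) = coeffSum k 0 x :=
  (exists_aug k C).choose_spec.1 x

theorem aug_clsL_succ (q : ℕ) (x : (linNerve k C).obj (op ⦋q + 1⦌)) :
    aug k C (clsL _ (q + 1) x) = 0 :=
  (exists_aug k C).choose_spec.2 q x

theorem aug_clsL_of_ne {q : ℕ} (h : q ≠ 0) (x : (linNerve k C).obj (op ⦋q⦌)) :
    aug k C (clsL _ q x) = 0 := by
  obtain ⟨q, rfl⟩ := Nat.exists_eq_succ_of_ne_zero h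
  exact aug_clsL_succ q x

theorem aug_chain_zero (s : Fin (0 + 1) ⥤ C) : aug k C (clsL _ 0 (chain k s)) = 1 :=
  (aug_clsL_zero _).trans (coeffSum_chain k s)

variable (k C) in
/-- The classes of strings of morphisms in the normalized complex. -/
noncomputable abbrev chainCls (g : (n : ℕ) × (Fin (n + 1) ⥤ C)) : Tot (normalized (linNerve k C)) :=
  clsL (linNerve k C) g.1 (chain k g.2)

variable (k C) in
theorem chainCls_span : Submodule.span k (Set.range (chainCls k C)) = ⊤ := by
  rw [eq_top_iff, ← cls_span, Submodule.span_le]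
  rintro _ ⟨⟨n, x⟩, rfl⟩
  have hx : x ∈ Submodule.span k (Set.range fun s : Fin (n + 1) ⥤ C => chain k s) := by
    rw [chain_span]
    exact Submodule.mem_top
  have := Submodule.mem_map_of_mem (f := clsL (linNerve k C) n) hx
  rw [Submodule.map_span] at this
  refine Submodule.span_mono ?_ this
  rintro _ ⟨_, ⟨s, rfl⟩, rfl⟩
  exact ⟨⟨n, s⟩, rfl⟩

theorem aug_map {D : Type} [Category.{0} D] (F : C ⥤ D) (x : Tot (normalized (linNerve k C))) :
    aug k D (Tot.map (normalizedMap (linNerveMap k F)) x) = aug k C x := by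
  have : aug k D ∘ₗ Tot.map (normalizedMap (linNerveMap k F)) = aug k C := by
    refine LinearMap.ext_on (chainCls_span k C) ?_
    rintro _ ⟨⟨n, s⟩, rfl⟩
    refine (congrArg (aug k D) (Tot.map_clsL (linNerveMap k F) n (chain k s))).trans ?_
    refine (congrArg (fun z => aug k D (clsL _ n z)) (linNerveMap_chain F s)).trans ?_
    cases n with
    | zero => exact (aug_chain_zero _).trans (aug_chain_zero _).symm
    | succ n => exact (aug_clsL_succ n _).trans (aug_clsL_succ n _).symm
  exact LinearMap.congr_fun this x

/-- In total degree zero there is one empty shuffle, and a product of vertices is a single vertex.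
In positive total degree some factor has positive degree, so both sides vanish. -/
theorem aug_nerveMul {P : CatOperadData} {m : ℕ} {j : Fin m → ℕ}
    (c : Tot (normalizedNerve k P m)) (d : ∀ s, Tot (normalizedNerve k P (j s))) :
    aug k _ ((nerveMul k P m j).chainMul c d) = aug k _ c * ∏ s, aug k _ (d s) := by
  let F : Tot (normalizedNerve k P m) →ₗ[k]
      MultilinearMap k (fun s => Tot (normalizedNerve k P (j s))) k :=
    (LinearMap.compMultilinearMapₗ k (aug k _)) ∘ₗ (nerveMul k P m j).chainMul
  let G : Tot (normalizedNerve k P m) →ₗ[k]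
      MultilinearMap k (fun s => Tot (normalizedNerve k P (j s))) k :=
    (LinearMap.toSpanSingleton k _ ((MultilinearMap.mkPiAlgebra k (Fin m) k).compLinearMap
      fun s => aug k (P.obj (j s)))) ∘ₗ aug k (P.obj m)
  have hFG : F = G := by
    refine LinearMap.ext_on (chainCls_span k (P.obj m)) ?_
    rintro _ ⟨⟨a, c⟩, rfl⟩
    refine multilinear_ext (fun s => chainCls k (P.obj (j s)))
      (fun s => chainCls_span k (P.obj (j s))) fun x => ?_
    choose p d hd using fun s => (⟨(x s).1, (x s).2, rfl⟩ : ∃ n d, x s = ⟨n, d⟩)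
    obtain rfl := funext hd
    change aug k _ ((nerveMul k P m j).chainMul (clsL _ a (chain k c))
      fun s => clsL _ (p s) (chain k (d s))) =
      aug k _ (clsL _ a (chain k c)) * ∏ s, aug k _ (clsL _ (p s) (chain k (d s)))
    by_cases h : a + ∑ s, p s = 0
    · obtain ⟨rfl, hp⟩ := add_eq_zero.1 h
      obtain rfl : p = fun _ => 0 :=
        funext fun s => Finset.sum_eq_zero_iff.1 hp s (Finset.mem_univ s)
      have h1 := (nerveMul k P m j).chainMul_eq ⟨0, chain k c⟩ fun s => ⟨0, chain k (d s)⟩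
      rw [NatMul.shuffle_of_single _ _ Letter.oper fun l hl => by
        cases l with
        | oper => exact absurd rfl hl
        | arg s => rfl] at h1
      refine (congrArg (aug k _) h1).trans ?_
      refine (aug_clsL_zero _).trans ?_
      rw [aug_chain_zero]
      simp only [aug_chain_zero, Finset.prod_const_one, mul_one]
      refine Eq.trans (congrArg (coeffSum k 0) (Eq.trans ?_ (nerveMul_chain
        (pull c (clamp (steps (fun _ : Fin 0 => Letter.oper (n := m)) Letter.oper) 0 0))
        fun s => pull (d s) (clamp (steps (fun _ : Fin 0 => Letter.oper (n := m))
          (Letter.arg s)) 0 0)))) (coeffSum_chain k _)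
      have h2 := linNerve_map_chain (k := k)
        (clamp (steps (fun _ : Fin 0 => Letter.oper (n := m)) Letter.oper) 0 0) c
      have h3 := fun s => linNerve_map_chain (k := k)
        (clamp (steps (fun _ : Fin 0 => Letter.oper (n := m)) (Letter.arg s)) 0 0) (d s)
      exact congrArg₂ (fun a b => (nerveMul k P m j).app 0 a b) h2 (funext h3)
    · rw [(nerveMul k P m j).chainMul_cls, map_sum]
      have h0 : aug k _ (clsL _ a (chain k c)) *
          ∏ s, aug k _ (clsL _ (p s) (chain k (d s))) = 0 := by
        by_cases ha : a = 0
        · have hp : ∃ s, p s ≠ 0 := by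
            by_contra! hp
            exact h (by simp [ha, hp])
          obtain ⟨s, hs⟩ := hp
          rw [Finset.prod_eq_zero (Finset.mem_univ s) (aug_clsL_of_ne hs _), mul_zero]
        · rw [aug_clsL_of_ne ha, zero_mul]
      rw [h0]
      refine Finset.sum_eq_zero fun w _ => ?_
      rw [map_zsmul, aug_clsL_of_ne h, smul_zero]
  exact congrArg (fun F : Tot (normalizedNerve k P m) →ₗ[k]
      MultilinearMap k (fun s => Tot (normalizedNerve k P (j s))) k => F c d) hFG

section Exact

theorem aug_exact {x₀ : C} (hI : Limits.IsInitial x₀) : Function.Exact ((normalized (linNerve k C)).d 1 0).hom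
    (fun x => aug k C (Tot.of (normalized (linNerve k C)) 0 x)) := by
  intro y
  obtain ⟨y, rfl⟩ := (degenerate (linNerve k C) 0).mkQ_surjective y
  change aug k C (clsL (linNerve k C) 0 y) = 0 ↔ _
  rw [aug_clsL_zero]
  constructor
  · intro h
    refine ⟨(degenerate (linNerve k C) 1).mkQ (prependL hI k 0 y), ?_⟩
    refine (normalized_d_mkQ k (linNerve k C) 0 _).trans ?_
    refine congrArg (degenerate (linNerve k C) 0).mkQ ?_
    rw [objD_prependL_zero, h, zero_smul, sub_zero]
  · rintro ⟨z, hz⟩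
    obtain ⟨z, rfl⟩ := (degenerate (linNerve k C) 1).mkQ_surjective z
    have h1 : aug k C (clsL (linNerve k C) 0 y) = aug k C (clsL (linNerve k C) 0
        ((AlgebraicTopology.AlternatingFaceMapComplex.objD (linNerve k C) 0).hom z)) :=
      congrArg (fun w => aug k C (Tot.of (normalized (linNerve k C)) 0 w))
        (hz.symm.trans (normalized_d_mkQ k (linNerve k C) 0 z))
    rw [aug_clsL_zero, aug_clsL_zero, objD_apply, Fin.sum_univ_two, map_add, map_zsmul,
      map_zsmul] at h1
    refine h1.trans ?_
    refine (congrArg₂ (fun a b => (-1 : ℤ) ^ ((0 : Fin 2) : ℕ) • a +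
      (-1 : ℤ) ^ ((1 : Fin 2) : ℕ) • b) (coeffSum_map k (SimplexCategory.δ 0) z)
      (coeffSum_map k (SimplexCategory.δ 1) z)).trans ?_
    simp

/-- A cycle of positive degree is the boundary of the chain obtained by prepending the initial
object. -/
theorem normalized_exact {x₀ : C} (hI : Limits.IsInitial x₀) (q : ℕ) :
    Function.Exact ((normalized (linNerve k C)).d (q + 2) (q + 1)).hom
      ((normalized (linNerve k C)).d (q + 1) q).hom := by
  intro y
  constructor
  · intro h
    refine ⟨prependN hI k (q + 1) y, ?_⟩
    rw [d_prependN_succ, h, map_zero, sub_zero]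
  · rintro ⟨z, rfl⟩
    exact ConcreteCategory.congr_hom ((normalized (linNerve k C)).d_comp_d (q + 2) (q + 1) q) z

theorem aug_surjective (x₀ : C) :
    Function.Surjective (fun x => aug k C (Tot.of (normalized (linNerve k C)) 0 x)) := by
  intro a
  refine ⟨(degenerate (linNerve k C) 0).mkQ
    (a • chain k ((Functor.const (Fin (0 + 1))).obj x₀)), ?_⟩
  refine (aug_clsL_zero _).trans ?_
  rw [map_smul, coeffSum_chain, smul_eq_mul, mul_one]

end Exact

end Augmentation

/-- Any object of a codiscrete category is initial. -/
def codiscreteInitial {α : Type} (x : Codiscrete α) : Limits.IsInitial x :=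
  Limits.IsInitial.ofUniqueHom (fun _ => ⟨⟩) fun _ _ => rfl

end SymHom

namespace SymHom

/-! ### Bases of quotients of free modules -/

section QuotientBasis

variable {k : Type*} [CommRing k] {X ι : Type*} (f : ι → X) (hf : Function.Injective f)
  (N : Submodule k (X →₀ k))

/-- `N` contains the basis vectors outside the range of `f`, and its elements have no component
along the range. Restriction of coefficients to the range therefore inverts the map given by the
remaining basis vectors. -/
theorem exists_quotient_basis (h₁ : ∀ x ∉ Set.range f, Finsupp.single x 1 ∈ N)
    (h₂ : N ≤ LinearMap.ker (Finsupp.lcomapDomain (R := k) (M := k) f hf)) :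
    ∃ b : Module.Basis ι k ((X →₀ k) ⧸ N), ∀ i, b i = N.mkQ (Finsupp.single (f i) 1) := by
  let g : ((X →₀ k) ⧸ N) →ₗ[k] (ι →₀ k) := N.liftQ (Finsupp.lcomapDomain f hf) h₂
  let h : (ι →₀ k) →ₗ[k] ((X →₀ k) ⧸ N) :=
    Finsupp.linearCombination k fun i => N.mkQ (Finsupp.single (f i) 1)
  have hc : ∀ i, Finsupp.lcomapDomain (R := k) (M := k) f hf (Finsupp.single (f i) 1) =
      Finsupp.single i 1 := fun i => by
    ext i'
    change (Finsupp.single (f i) (1 : k)) (f i') = _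
    by_cases hi : i = i'
    · subst hi
      simp
    · rw [Finsupp.single_eq_of_ne (fun e => hi (hf e.symm)), Finsupp.single_eq_of_ne (Ne.symm hi)]
  have hg : ∀ i, g (N.mkQ (Finsupp.single (f i) 1)) = Finsupp.single i 1 := hc
  have hh : ∀ i, h (Finsupp.single i 1) = N.mkQ (Finsupp.single (f i) 1) := fun i => by
    simp [h]
  refine ⟨Module.Basis.ofRepr (LinearEquiv.ofLinearMap g h ?_ ?_), fun i => ?_⟩
  · refine Finsupp.lhom_ext' fun i => LinearMap.ext_ring ?_
    change g (h (Finsupp.single i 1)) = Finsupp.single i 1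
    rw [hh, hg]
  · refine Submodule.linearMap_qext _ (Finsupp.lhom_ext' fun x => LinearMap.ext_ring ?_)
    change h (g (N.mkQ (Finsupp.single x 1))) = N.mkQ (Finsupp.single x 1)
    by_cases hx : x ∈ Set.range f
    · obtain ⟨i, rfl⟩ := hx
      rw [hg, hh]
    · rw [(Submodule.Quotient.mk_eq_zero N).2 (h₁ x hx) |> (Eq.trans (Submodule.mkQ_apply _ _)),
        map_zero, map_zero]
  · exact hh i

end QuotientBasis

/-! ### Degenerate strings -/

section DegenerateStrings

variable {C : Type} [Category.{0} C]

/-- The strings in the image of a degeneracy. -/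
def DegenerateString (q : ℕ) (s : Fin (q + 1) ⥤ C) : Prop :=
  match q with
  | 0 => False
  | r + 1 => ∃ (j : Fin (r + 1)) (t : Fin (r + 1) ⥤ C), pull t (SimplexCategory.σ j) = s

theorem DegenerateString.comp {D : Type} [Category.{0} D] (F : C ⥤ D) {q : ℕ}
    {s : Fin (q + 1) ⥤ C} (h : DegenerateString q s) : DegenerateString q (s ⋙ F) := by
  cases q with
  | zero => exact h
  | succ q =>
    obtain ⟨j, t, rfl⟩ := h
    exact ⟨j, t ⋙ F, rfl⟩

theorem DegenerateString.chain_mem {k : Type u} [CommRing k] {q : ℕ} {s : Fin (q + 1) ⥤ C}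
    (h : DegenerateString q s) : chain k s ∈ degenerate (linNerve k C) q := by
  cases q with
  | zero => exact h.elim
  | succ q =>
    obtain ⟨j, t, rfl⟩ := h
    exact Submodule.mem_iSup_of_mem j ⟨chain k t, linNerve_map_chain (SimplexCategory.σ j) t⟩

theorem degenerate_linNerve_le {k : Type u} [CommRing k] {q : ℕ} {M : Type*} [AddCommGroup M]
    [Module k M] (g : (linNerve k C).obj (op ⦋q⦌) →ₗ[k] M)
    (h : ∀ s : Fin (q + 1) ⥤ C, DegenerateString q s → g (chain k s) = 0) :
    degenerate (linNerve k C) q ≤ LinearMap.ker g := by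
  cases q with
  | zero => exact bot_le
  | succ q =>
    refine iSup_le fun j => ?_
    rintro _ ⟨x, rfl⟩
    have : g ∘ₗ ((linNerve k C).σ j).hom = 0 := chain_linear_ext fun t =>
      (congrArg g (linNerve_map_chain (SimplexCategory.σ j) t)).trans (h _ ⟨j, t, rfl⟩)
    exact LinearMap.congr_fun this x

end DegenerateStrings

/-! ### Freeness over the symmetric groups and the `E_∞` property -/

section Free

variable (n q : ℕ)

/-- The nondegenerate strings that start at the identity. -/
def NormalString : Type u :=
  ULift.{u} {s : Fin (q + 1) ⥤ Dcat.obj n // ¬ DegenerateString q s ∧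
    (s.obj 0 : Codiscrete (Equiv.Perm (Fin n))).as = 1}

variable {n q}

theorem Dcat_act_as (σ : Equiv.Perm (Fin n)) (x : Dcat.obj n) :
    ((Dcat.act σ).obj x : Codiscrete (Equiv.Perm (Fin n))).as =
      (x : Codiscrete (Equiv.Perm (Fin n))).as * σ :=
  Equiv.ext fun i => Fin.ext rfl

/-- The orbit of a normal string. -/
def NormalString.orbit (x : NormalString.{u} n q × Equiv.Perm (Fin n)) : Fin (q + 1) ⥤ Dcat.obj n :=
  x.1.down.1 ⋙ Dcat.act x.2

theorem act_mul (s : Fin (q + 1) ⥤ Dcat.obj n) (σ τ : Equiv.Perm (Fin n)) :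
    (s ⋙ Dcat.act σ) ⋙ Dcat.act τ = s ⋙ Dcat.act (σ * τ) := by
  rw [Functor.assoc]
  exact congrArg (fun F => s ⋙ F) (Dcat_isOperad.act_trans τ σ).symm

theorem act_one (s : Fin (q + 1) ⥤ Dcat.obj n) :
    s ⋙ Dcat.act (1 : Equiv.Perm (Fin n)) = s :=
  (congrArg (fun F => s ⋙ F) (Dcat_isOperad.act_refl n)).trans s.comp_id

theorem NormalString.orbit_injective :
    Function.Injective (NormalString.orbit : NormalString.{u} n q × _ → _) := by
  rintro ⟨⟨⟨s, hs, hs'⟩⟩, σ⟩ ⟨⟨⟨t, ht, ht'⟩⟩, τ⟩ h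
  change s ⋙ Dcat.act σ = t ⋙ Dcat.act τ at h
  have h1 : σ = τ := by
    have := congrArg (fun F : Fin (q + 1) ⥤ Dcat.obj n =>
      (F.obj 0 : Codiscrete (Equiv.Perm (Fin n))).as) h
    have h2 := (Dcat_act_as σ (s.obj 0)).symm.trans (this.trans (Dcat_act_as τ (t.obj 0)))
    rwa [hs', ht', one_mul, one_mul] at h2
  subst h1
  have h3 : (s ⋙ Dcat.act σ) ⋙ Dcat.act σ⁻¹ = (t ⋙ Dcat.act σ) ⋙ Dcat.act σ⁻¹ :=
    congrArg (fun F => F ⋙ Dcat.act σ⁻¹) h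
  rw [act_mul, act_mul, mul_inv_cancel, act_one, act_one] at h3
  subst h3
  rfl

/-- Translating by the inverse of the first vertex makes a string start at the identity, and
translations preserve degeneracy in both directions. So the nondegenerate strings are exactly the
translates of the normal ones. -/
theorem NormalString.mem_range_orbit (s : Fin (q + 1) ⥤ Dcat.obj n) :
    s ∈ Set.range (NormalString.orbit : NormalString.{u} n q × _ → _) ↔ ¬ DegenerateString q s := by
  constructor
  · rintro ⟨⟨⟨⟨t, ht, ht'⟩⟩, σ⟩, rfl⟩ h
    have h1 := h.comp (Dcat.act σ⁻¹)
    change DegenerateString q ((t ⋙ Dcat.act σ) ⋙ Dcat.act σ⁻¹) at h1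
    rw [act_mul, mul_inv_cancel, act_one] at h1
    exact ht h1
  · intro h
    refine ⟨⟨⟨⟨s ⋙ Dcat.act (s.obj 0 : Codiscrete (Equiv.Perm (Fin n))).as⁻¹, fun h1 => ?_, ?_⟩⟩,
      (s.obj 0 : Codiscrete (Equiv.Perm (Fin n))).as⟩, ?_⟩
    · have h2 := h1.comp (Dcat.act (s.obj 0 : Codiscrete (Equiv.Perm (Fin n))).as)
      rw [act_mul, inv_mul_cancel, act_one] at h2
      exact h h2
    · exact (Dcat_act_as _ (s.obj 0)).trans (mul_inv_cancel _)
    · change (s ⋙ Dcat.act _) ⋙ Dcat.act _ = s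
      rw [act_mul, inv_mul_cancel, act_one]

/-- Degeneracies send strings to strings, so the degenerate chains are spanned by degenerate strings
and the nondegenerate ones give a basis of the quotient. Indexing them by a normal string and a
permutation exhibits the free action. -/
theorem exists_free_basis (k : Type u) [CommRing k] (n q : ℕ) :
    ∃ b : Module.Basis (NormalString.{u} n q × Equiv.Perm (Fin n)) k ((normalizedNerve k Dcat n).X q),
      ∀ x, b x = (degenerate (linNerve k (Dcat.obj n)) q).mkQ (chain k (NormalString.orbit x)) := by
  refine exists_quotient_basis (k := k) NormalString.orbit NormalString.orbit_injective
    (degenerate (linNerve k (Dcat.obj n)) q) (fun s hs => ?_) ?_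
  · rw [NormalString.mem_range_orbit, not_not] at hs
    exact hs.chain_mem
  · refine degenerate_linNerve_le _ fun s hs => ?_
    refine Finsupp.ext fun x => ?_
    change (Finsupp.single s (1 : k)) (NormalString.orbit x) = 0
    refine Finsupp.single_eq_of_ne fun h => ?_
    exact (NormalString.mem_range_orbit s).1 ⟨x, h⟩ hs

/-- The operad `D_ch` is an `E_∞`-operad. -/
theorem chainOperad_isEInfinity (k : Type u) [CommRing k] :
    (chainOperad k Dcat_isOperad).IsEInfinity where
  resolution := by
    have hI := fun n => codiscreteInitial (⟨1⟩ : Codiscrete (Equiv.Perm (Fin n)))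
    refine ⟨fun n => aug k (Dcat.obj n), fun n q x => ?_, aug_chain_zero _, fun n m e c => ?_,
      fun m j c d => aug_nerveMul c d, fun n => ⟨aug_surjective ⟨1⟩, aug_exact (hI n),
        normalized_exact (hI n)⟩⟩
    · obtain ⟨x, rfl⟩ := (degenerate (linNerve k (Dcat.obj n)) (q + 1)).mkQ_surjective x
      exact aug_clsL_succ q x
    · exact aug_map (Dcat.act e) c
  free n q := by
    obtain ⟨b, hb⟩ := exists_free_basis k n q
    refine ⟨NormalString.{u} n q, b, fun i σ => ?_⟩
    rw [hb, hb]
    refine Eq.symm ((congrArg (degenerate (linNerve k (Dcat.obj n)) q).mkQ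
      (linNerveMap_chain (Dcat.act σ) _)).trans ?_)
    refine congrArg (fun z => (degenerate (linNerve k (Dcat.obj n)) q).mkQ (chain k z)) ?_
    exact (act_mul i.down.1 1 σ).trans (by rw [one_mul, NormalString.orbit])

end Free

end SymHom

namespace SymHom

/-! ### Descending bilinear maps along surjections -/

section Descend

variable {k : Type*} [CommRing k] {M M' N N' Z : Type*} [AddCommGroup M] [Module k M]
  [AddCommGroup M'] [Module k M'] [AddCommGroup N] [Module k N] [AddCommGroup N'] [Module k N']
  [AddCommGroup Z] [Module k Z]

theorem exists_descend {π : M →ₗ[k] N} (hπ : Function.Surjective π) (F : M →ₗ[k] Z)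
    (h : ∀ x, π x = 0 → F x = 0) : ∃ G : N →ₗ[k] Z, ∀ x, G (π x) = F x := by
  refine ⟨(LinearMap.ker π).liftQ F (fun x hx => h x hx) ∘ₗ
    (π.quotKerEquivOfSurjective hπ).symm.toLinearMap, fun x => ?_⟩
  have : (π.quotKerEquivOfSurjective hπ).symm (π x) = Submodule.Quotient.mk x := by
    rw [LinearEquiv.symm_apply_eq]
    simp
  simp only [LinearMap.comp_apply, LinearEquiv.coe_coe, this]
  exact Submodule.liftQ_apply _ _ _

theorem exists_descend₂ {π : M →ₗ[k] N} (hπ : Function.Surjective π) {π' : M' →ₗ[k] N'}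
    (hπ' : Function.Surjective π') (F : M →ₗ[k] M' →ₗ[k] Z) (h : ∀ x y, π x = 0 → F x y = 0)
    (h' : ∀ x y, π' y = 0 → F x y = 0) :
    ∃ G : N →ₗ[k] N' →ₗ[k] Z, ∀ x y, G (π x) (π' y) = F x y := by
  obtain ⟨G, hG⟩ := exists_descend hπ F fun x hx => LinearMap.ext fun y => h x y hx
  obtain ⟨H, hH⟩ := exists_descend hπ' G.flip fun y hy => LinearMap.ext fun z => by
    obtain ⟨x, rfl⟩ := hπ z
    rw [LinearMap.flip_apply, hG]
    exact h' x y hy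
  refine ⟨H.flip, fun x y => ?_⟩
  rw [LinearMap.flip_apply, hH, LinearMap.flip_apply, hG]

end Descend

/-! ### Cycles and homology classes in the direct sum of a complex -/

section Cycles

variable {k : Type u} [CommRing k] (X : ChainComplex (ModuleCat.{u} k) ℕ)

theorem Tot.of_injective (n : ℕ) : Function.Injective (Tot.of X n) :=
  DirectSum.of_injective (β := fun n => X.X n) n

/-- The homogeneous cycles of degree `n`. -/
noncomputable def cyclesT (n : ℕ) : Submodule k (Tot X) :=
  LinearMap.range (Tot.of X n) ⊓ LinearMap.ker (Tot.d X)

theorem Tot.d_of_eq_zero_iff {n : ℕ} (x : X.X n) :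
    Tot.d X (Tot.of X n x) = 0 ↔ (X.d n (n - 1)).hom x = 0 := by
  rw [Tot.d_of]
  exact map_eq_zero_iff _ (Tot.of_injective X (n - 1))

/-- In degree zero the shape has no outgoing relation and `n - 1` is truncated to `0`; with either
index the differential is zero. -/
theorem exists_next (n : ℕ) :
    ∃ j, (ComplexShape.down ℕ).next n = j ∧ ∀ x : X.X n, (X.d n j).hom x = 0 ↔
      (X.d n (n - 1)).hom x = 0 := by
  cases n with
  | zero =>
    refine ⟨_, rfl, fun x => ?_⟩
    rw [X.shape 0 _ (by simp), X.shape 0 (0 - 1) (by simp)]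
    simp
  | succ n => exact ⟨n, ChainComplex.next_nat_succ n, fun x => Iff.rfl⟩

theorem iCycles_injective (n : ℕ) : Function.Injective (X.iCycles n).hom :=
  (ModuleCat.mono_iff_injective (X.iCycles n)).1 inferInstance

theorem homologyπ_surjective (n : ℕ) : Function.Surjective (X.homologyπ n).hom :=
  (ModuleCat.epi_iff_surjective (X.homologyπ n)).1 inferInstance

theorem exists_iCycles {n : ℕ} (x : X.X n) (h : (X.d n (n - 1)).hom x = 0) :
    ∃ z : X.cycles n, (X.iCycles n).hom z = x := by
  obtain ⟨j, hj, hd⟩ := exists_next X n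
  have h1 := (ShortComplex.mk _ _ (X.iCycles_d n j)).exact_of_f_is_kernel
    (X.cyclesIsKernel n j hj)
  exact (ShortComplex.moduleCat_exact_iff _).1 h1 x ((hd x).2 h)

theorem d_iCycles {n : ℕ} (z : X.cycles n) (j : ℕ) :
    (X.d n j).hom ((X.iCycles n).hom z) = 0 :=
  ConcreteCategory.congr_hom (X.iCycles_d n j) z

theorem homologyπ_eq_zero_iff {n : ℕ} (z : X.cycles n) :
    (X.homologyπ n).hom z = 0 ↔ ∃ u : X.X (n + 1), (X.d (n + 1) n).hom u = (X.iCycles n).hom z := by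
  have h1 := (ShortComplex.mk _ _ (X.toCycles_comp_homologyπ (n + 1) n)).exact_of_g_is_cokernel
    (X.homologyIsCokernel (n + 1) n (ChainComplex.prev ℕ n))
  constructor
  · intro h
    obtain ⟨u, hu⟩ := (ShortComplex.moduleCat_exact_iff _).1 h1 z h
    exact ⟨u, (ConcreteCategory.congr_hom (X.toCycles_i (n + 1) n) u).symm.trans
      (congrArg (X.iCycles n).hom hu)⟩
  · rintro ⟨u, hu⟩
    have h2 : (X.toCycles (n + 1) n).hom u = z := iCycles_injective X n
      ((ConcreteCategory.congr_hom (X.toCycles_i (n + 1) n) u).trans hu)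
    rw [← h2]
    exact ConcreteCategory.congr_hom (X.toCycles_comp_homologyπ (n + 1) n) u

/-- Cycles as elements of the direct sum. -/
noncomputable def cyclesEquiv (n : ℕ) : X.cycles n ≃ₗ[k] cyclesT X n :=
  LinearEquiv.ofBijective ((Tot.of X n ∘ₗ (X.iCycles n).hom).codRestrict (cyclesT X n)
    fun z => ⟨⟨_, rfl⟩, (Tot.d_of_eq_zero_iff X _).2 (d_iCycles X z _)⟩) (by
    constructor
    · intro a b h
      exact iCycles_injective X n (Tot.of_injective X n (congrArg Subtype.val h))
    · rintro ⟨_, ⟨x, rfl⟩, hx⟩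
      obtain ⟨z, rfl⟩ := exists_iCycles X x ((Tot.d_of_eq_zero_iff X x).1 hx)
      exact ⟨z, rfl⟩)

theorem cyclesEquiv_coe {n : ℕ} (z : X.cycles n) :
    (cyclesEquiv X n z : Tot X) = Tot.of X n ((X.iCycles n).hom z) := rfl

/-- The homology class of a homogeneous cycle. -/
noncomputable def homologyClass (n : ℕ) : cyclesT X n →ₗ[k] X.homology n :=
  (X.homologyπ n).hom ∘ₗ (cyclesEquiv X n).symm.toLinearMap

theorem homologyClass_cyclesEquiv {n : ℕ} (z : X.cycles n) :
    homologyClass X n (cyclesEquiv X n z) = (X.homologyπ n).hom z :=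
  congrArg (X.homologyπ n).hom ((cyclesEquiv X n).symm_apply_apply z)

theorem homologyClass_surjective (n : ℕ) : Function.Surjective (homologyClass X n) := by
  intro h
  obtain ⟨z, rfl⟩ := homologyπ_surjective X n h
  exact ⟨_, homologyClass_cyclesEquiv X z⟩

theorem Tot.d_component (w : Tot X) (n : ℕ) :
    (Tot.d X w : Tot X) n = (X.d (n + 1) n).hom (w (n + 1)) := by
  let F : Tot X →ₗ[k] X.X n := DirectSum.component k ℕ (fun n => X.X n) n ∘ₗ Tot.d X
  let G : Tot X →ₗ[k] X.X n :=
    (X.d (n + 1) n).hom ∘ₗ DirectSum.component k ℕ (fun n => X.X n) (n + 1)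
  have : F = G := by
    refine DirectSum.linearMap_ext k fun m => LinearMap.ext fun x => ?_
    change (Tot.d X (Tot.of X m x) : Tot X) n = (X.d (n + 1) n).hom ((Tot.of X m x : Tot X) (n + 1))
    rw [Tot.d_of]
    by_cases hm : m = n + 1
    · subst hm
      exact (DirectSum.lof_apply (M := fun n => X.X n) k _ _).trans
        (congrArg (X.d (n + 1) n).hom (DirectSum.lof_apply (M := fun n => X.X n) k _ x).symm)
    · have h2 : (Tot.of X m x : Tot X) (n + 1) = 0 := DirectSum.of_eq_of_ne _ _ _ (Ne.symm hm)
      rw [h2, map_zero]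
      by_cases hn : m - 1 = n
      -- Truncated subtraction leaves this one exceptional case, where the differential vanishes by
      -- the shape of the complex.
      · obtain ⟨rfl, rfl⟩ : m = 0 ∧ n = 0 := by omega
        rw [X.shape 0 (0 - 1) (by simp)]
        exact congrArg (fun w : Tot X => w 0) (map_zero (Tot.of X 0))
      · exact DirectSum.of_eq_of_ne _ _ _ (Ne.symm hn)
  exact LinearMap.congr_fun this w

/-- If `w` bounds an element `u` that need not be homogeneous, it already bounds the component of
`u` in degree `n + 1`. -/
theorem homologyClass_eq_zero_iff {n : ℕ} (w : cyclesT X n) :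
    homologyClass X n w = 0 ↔ (w : Tot X) ∈ LinearMap.range (Tot.d X) := by
  obtain ⟨z, rfl⟩ := (cyclesEquiv X n).surjective w
  rw [homologyClass_cyclesEquiv, homologyπ_eq_zero_iff, cyclesEquiv_coe]
  constructor
  · rintro ⟨u, hu⟩
    refine ⟨Tot.of X (n + 1) u, ?_⟩
    rw [Tot.d_of, ← hu]
    rfl
  · rintro ⟨u, hu⟩
    refine ⟨u (n + 1), ?_⟩
    rw [← Tot.d_component, hu]
    exact DirectSum.lof_apply (M := fun n => X.X n) k _ _

theorem homologyClass_eq_iff {n : ℕ} (w w' : cyclesT X n) :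
    homologyClass X n w = homologyClass X n w' ↔
      (w : Tot X) - w' ∈ LinearMap.range (Tot.d X) := by
  rw [← sub_eq_zero, ← map_sub, homologyClass_eq_zero_iff]
  rfl

end Cycles

end SymHom

namespace SymHom

/-! ### Operations of degree zero acting on cycles -/

section Augmented

variable {k : Type u} [CommRing k] {P : ℕ → ChainComplex (ModuleCat.{u} k) ℕ}

/-- Augmentations of an operad that make its complexes acyclic in degree zero. -/
structure ChainOperad.IsAugmentation (O : ChainOperad k P) (ε : ∀ n, Tot (P n) →ₗ[k] k) : Prop where
  one : ε 1 (Tot.of _ _ O.one) = 1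
  act : ∀ (n m : ℕ) (e : Fin n ≃ Fin m) (c : Tot (P m)), ε n (Tot.map (O.act e) c) = ε m c
  mul : ∀ (m : ℕ) (j : Fin m → ℕ) (c : Tot (P m)) (d : ∀ s, Tot (P (j s))),
    ε _ (O.mul m j c d) = ε m c * ∏ s, ε (j s) (d s)
  surjective : ∀ n, ∃ c : (P n).X 0, ε n (Tot.of _ _ c) = 1
  exact : ∀ (n : ℕ) (c : (P n).X 0), ε n (Tot.of _ _ c) = 0 →
    ∃ b : (P n).X 1, Tot.d _ (Tot.of _ _ b) = Tot.of _ _ c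

theorem cyclesT.exists_of {X : ChainComplex (ModuleCat.{u} k) ℕ} {n : ℕ} {w : Tot X}
    (h : w ∈ cyclesT X n) (h' : w ∈ LinearMap.range (Tot.d X)) :
    ∃ u : X.X (n + 1), Tot.d X (Tot.of X (n + 1) u) = w := by
  obtain ⟨⟨x, rfl⟩, -⟩ := h
  obtain ⟨u, hu⟩ := h'
  refine ⟨u (n + 1), ?_⟩
  rw [Tot.d_of]
  change Tot.of X n ((X.d (n + 1) n).hom (u (n + 1))) = _
  rw [← Tot.d_component, hu]
  exact congrArg (Tot.of X n) (DirectSum.lof_apply (M := fun n => X.X n) k _ _)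

variable {O : ChainOperad k P} {ε : ∀ n, Tot (P n) →ₗ[k] k} (hε : O.IsAugmentation ε)
  {X : ChainComplex (ModuleCat.{u} k) ℕ} (T : ChainAlgebra O X)

theorem Tot.d_of_zero (c : X.X 0) : Tot.d X (Tot.of X 0 c) = 0 := by
  rw [Tot.d_of_eq_zero_iff, X.shape 0 (0 - 1) (by simp)]
  rfl

theorem ChainAlgebra.d_act_cycles {m a : ℕ} (c : (P m).X a) (x : Fin m → Tot X) (p : Fin m → ℕ)
    (hx : ∀ s, x s ∈ cyclesT X (p s)) :
    Tot.d X (T.act m (Tot.of _ a c) x) = T.act m (Tot.d _ (Tot.of _ a c)) x := by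
  choose y hy using fun s => (hx s).1
  obtain rfl := funext hy
  rw [(T.act_isChainMap m).leibniz, Finset.sum_eq_zero, add_zero]
  intro s _
  rw [show Tot.d X (Tot.of X (p s) (y s)) = 0 from (hx s).2]
  refine (congrArg _ ((T.act m (Tot.of _ a c)).map_coord_zero s ?_)).trans (smul_zero _)
  rw [Function.update_self]

theorem ChainAlgebra.act_mem_cycles {m : ℕ} (c : (P m).X 0) (x : Fin m → Tot X) (p : Fin m → ℕ)
    (hx : ∀ s, x s ∈ cyclesT X (p s)) {n : ℕ} (hn : ∑ s, p s = n) :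
    T.act m (Tot.of _ 0 c) x ∈ cyclesT X n := by
  subst hn
  constructor
  · choose y hy using fun s => (hx s).1
    obtain rfl := funext hy
    have := (T.act_isChainMap m).degree 0 c p y
    rwa [Nat.zero_add] at this
  · refine LinearMap.mem_ker.2 ?_
    rw [T.d_act_cycles c x p hx, Tot.d_of_zero, map_zero, zero_apply]

/-- The difference of the operations is the boundary of some `b` of degree one. By the Leibniz rule
the action of `b` on cycles bounds the difference of the results. -/
theorem ChainAlgebra.act_sub_mem (hε : O.IsAugmentation ε) {m : ℕ} (c c' : (P m).X 0)
    (h : ε m (Tot.of _ 0 c) = ε m (Tot.of _ 0 c')) (x : Fin m → Tot X) (p : Fin m → ℕ)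
    (hx : ∀ s, x s ∈ cyclesT X (p s)) :
    T.act m (Tot.of _ 0 c) x - T.act m (Tot.of _ 0 c') x ∈ LinearMap.range (Tot.d X) := by
  obtain ⟨b, hb⟩ := hε.exact m (c - c') (by rw [map_sub, map_sub, h, sub_self])
  refine ⟨T.act m (Tot.of _ 1 b) x, ?_⟩
  rw [T.d_act_cycles b x p hx, hb, map_sub, map_sub, sub_apply]

/-- Put a chain `u` with boundary `x s` into the slot `s` and differentiate: all other arguments and
the operation are closed, so up to sign only the term with `x s` survives. -/
theorem ChainAlgebra.act_boundary {m : ℕ} (c : (P m).X 0) (x : Fin m → Tot X) (p : Fin m → ℕ)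
    (hx : ∀ s, x s ∈ cyclesT X (p s)) (s : Fin m) (hs : x s ∈ LinearMap.range (Tot.d X)) :
    T.act m (Tot.of _ 0 c) x ∈ LinearMap.range (Tot.d X) := by
  obtain ⟨u, hu⟩ := cyclesT.exists_of (hx s) hs
  choose y hy using fun s => (hx s).1
  let g : Fin m → (n : ℕ) × X.X n := Function.update (fun t => (⟨p t, y t⟩ : (n : ℕ) × X.X n)) s ⟨p s + 1, u⟩
  have hgs : Tot.of X (g s).1 (g s).2 = Tot.of X (p s + 1) u :=
    congrArg (fun g : (n : ℕ) × X.X n => Tot.of X g.1 g.2)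
      (show g s = ⟨p s + 1, u⟩ from Function.update_self _ _ _)
  have hgt : ∀ t, t ≠ s → Tot.of X (g t).1 (g t).2 = x t := fun t ht =>
    (congrArg (fun g : (n : ℕ) × X.X n => Tot.of X g.1 g.2)
      (show g t = ⟨p t, y t⟩ from Function.update_of_ne ht _ _)).trans (hy t)
  have h := (T.act_isChainMap m).leibniz 0 c (fun t => (g t).1) fun t => (g t).2
  rw [Tot.d_of_zero, map_zero, zero_apply, zero_add,
    Finset.sum_eq_single s] at h
  · have h2 : Function.update (fun t => Tot.of X (g t).1 (g t).2) s
        (Tot.d X (Tot.of X (g s).1 (g s).2)) = x := by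
      funext t
      by_cases ht : t = s
      · subst ht
        rw [Function.update_self, hgs, hu]
      · rw [Function.update_of_ne ht, hgt t ht]
    rw [h2] at h
    have h3 : (-1 : ℤ) ^ (0 + ∑ t with t < s, (g t).1) * (-1) ^ (0 + ∑ t with t < s, (g t).1) = 1 := by
      rw [← mul_pow]
      simp
    have h4 := congrArg (fun z => (-1 : ℤ) ^ (0 + ∑ t with t < s, (g t).1) • z) h
    simp only [smul_smul, h3, one_smul] at h4
    rw [← h4]
    exact zsmul_mem (LinearMap.mem_range_self (Tot.d X) _) _
  · intro t _ ht
    rw [hgt t ht, show Tot.d X (x t) = 0 from (hx t).2]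
    refine (congrArg _ ((T.act m (Tot.of _ 0 c)).map_coord_zero t ?_)).trans (smul_zero _)
    rw [Function.update_self]
  · exact fun h => absurd (Finset.mem_univ s) h

/-- The composite operation has degree zero again. The interchange sign in associativity is trivial
because the inner operations have degree zero. -/
theorem ChainAlgebra.exists_act_act (hε : O.IsAugmentation ε) {m : ℕ} {j : Fin m → ℕ}
    (c : (P m).X 0) (d : ∀ s, (P (j s)).X 0) (x : ∀ s, Fin (j s) → Tot X)
    (e : ∀ s, Fin (j s) → ℕ) (hx : ∀ s t, x s t ∈ cyclesT X (e s t)) :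
    ∃ c' : (P (∑ s, j s)).X 0,
      ε _ (Tot.of _ 0 c') = ε m (Tot.of _ 0 c) * ∏ s, ε (j s) (Tot.of _ 0 (d s)) ∧
      T.act m (Tot.of _ 0 c) (fun s => T.act (j s) (Tot.of _ 0 (d s)) (x s)) =
        T.act (∑ s, j s) (Tot.of _ 0 c')
          fun r => x (finSigmaFinEquiv.symm r).1 (finSigmaFinEquiv.symm r).2 := by
  have h1 := (O.mul_isChainMap m j).degree 0 c (fun _ => 0) d
  rw [Finset.sum_const_zero] at h1
  obtain ⟨c', hc'⟩ := h1
  change Tot.of _ 0 c' = _ at hc'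
  refine ⟨c', by rw [hc', hε.mul], ?_⟩
  rw [hc']
  choose y hy using fun s t => (hx s t).1
  obtain rfl : (fun s t => Tot.of X (e s t) (y s t)) = x := funext fun s => funext (hy s)
  have h2 := T.assoc m j (Tot.of _ 0 c) (fun _ => 0) d e y
  rw [h2, interchangeSign]
  simp

/-- A form of `ChainAlgebra.act_sub_mem` for arities such as `∑ s, j s` and `3`, which are equal
without being syntactically the same. -/
theorem ChainAlgebra.act_compare (hε : O.IsAugmentation ε) {n n' : ℕ} (h : n = n')
    (c : (P n).X 0) (c' : (P n').X 0) (hc : ε _ (Tot.of _ 0 c) = 1) (hc' : ε _ (Tot.of _ 0 c') = 1)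
    (x : Fin n → Tot X) (x' : Fin n' → Tot X) (p : Fin n' → ℕ)
    (hx' : ∀ s, x' s ∈ cyclesT X (p s)) (hxx : ∀ s, x s = x' (Fin.cast h s)) :
    T.act n (Tot.of _ 0 c) x - T.act n' (Tot.of _ 0 c') x' ∈ LinearMap.range (Tot.d X) := by
  subst h
  obtain rfl : x = x' := funext hxx
  exact T.act_sub_mem hε c c' (hc.trans hc'.symm) x p hx'

theorem forall_finSigma {m : ℕ} {j : Fin m → ℕ} {M : Type*} (x : ∀ s, Fin (j s) → M) {n : ℕ}
    (h : ∑ s, j s = n) (x' : Fin n → M)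
    (hx : ∀ s t, x s t = x' (Fin.cast h (finSigmaFinEquiv ⟨s, t⟩))) (r : Fin (∑ s, j s)) :
    x (finSigmaFinEquiv.symm r).1 (finSigmaFinEquiv.symm r).2 = x' (Fin.cast h r) := by
  rw [hx]
  exact congrArg (fun r => x' (Fin.cast h r)) (finSigmaFinEquiv.apply_symm_apply r)

end Augmented

end SymHom

namespace SymHom

/-! ### The Pontryagin product on homology -/

section Product

variable {k : Type u} [CommRing k] {P : ℕ → ChainComplex (ModuleCat.{u} k) ℕ}
  {O : ChainOperad k P} {ε : ∀ n, Tot (P n) →ₗ[k] k} {X : ChainComplex (ModuleCat.{u} k) ℕ}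
  (T : ChainAlgebra O X)

theorem update_pair_zero {M : Type*} (a b x : M) : Function.update ![a, b] 0 x = ![x, b] := by
  funext i
  fin_cases i <;> rfl

theorem update_pair_one {M : Type*} (a b x : M) : Function.update ![a, b] 1 x = ![a, x] := by
  funext i
  fin_cases i <;> rfl

/-- The binary operation given by an operation of degree zero. -/
noncomputable def ChainAlgebra.binary (c : (P 2).X 0) : Tot X →ₗ[k] Tot X →ₗ[k] Tot X :=
  LinearMap.mk₂ k (fun x y => T.act 2 (Tot.of _ 0 c) ![x, y])
    (fun x x' y => by
      have := (T.act 2 (Tot.of _ 0 c)).map_update_add ![x, y] 0 x x'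
      simpa only [update_pair_zero] using this)
    (fun a x y => by
      have := (T.act 2 (Tot.of _ 0 c)).map_update_smul ![x, y] 0 a x
      simpa only [update_pair_zero] using this)
    (fun x y y' => by
      have := (T.act 2 (Tot.of _ 0 c)).map_update_add ![x, y] 1 y y'
      simpa only [update_pair_one] using this)
    (fun a x y => by
      have := (T.act 2 (Tot.of _ 0 c)).map_update_smul ![x, y] 1 a y
      simpa only [update_pair_one] using this)

theorem ChainAlgebra.binary_apply (c : (P 2).X 0) (x y : Tot X) :
    T.binary c x y = T.act 2 (Tot.of _ 0 c) ![x, y] := rfl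

theorem pair_mem_cycles {p q : ℕ} {x y : Tot X} (hx : x ∈ cyclesT X p) (hy : y ∈ cyclesT X q)
    (s : Fin 2) : ![x, y] s ∈ cyclesT X (![p, q] s) := by
  fin_cases s
  · exact hx
  · exact hy

theorem ChainAlgebra.binary_mem {p q n : ℕ} (h : p + q = n) (c : (P 2).X 0) {x y : Tot X}
    (hx : x ∈ cyclesT X p) (hy : y ∈ cyclesT X q) : T.binary c x y ∈ cyclesT X n :=
  T.act_mem_cycles c ![x, y] ![p, q] (pair_mem_cycles hx hy) (by
    rw [Fin.sum_univ_two]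
    exact h)

theorem ChainAlgebra.exists_homology_mul {p q n : ℕ} (h : p + q = n) (c : (P 2).X 0) :
    ∃ μ : X.homology p →ₗ[k] X.homology q →ₗ[k] X.homology n,
      ∀ (x : cyclesT X p) (y : cyclesT X q),
        μ (homologyClass X p x) (homologyClass X q y) =
          homologyClass X n ⟨T.binary c x y, T.binary_mem h c x.2 y.2⟩ := by
  let F : cyclesT X p →ₗ[k] cyclesT X q →ₗ[k] cyclesT X n :=
    LinearMap.mk₂ k (fun x y => ⟨T.binary c x y, T.binary_mem h c x.2 y.2⟩)
      (fun x x' y => Subtype.ext (by simp)) (fun a x y => Subtype.ext (by simp))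
      (fun x y y' => Subtype.ext (by simp)) (fun a x y => Subtype.ext (by simp))
  refine exists_descend₂ (homologyClass_surjective X p) (homologyClass_surjective X q)
    (F.compr₂ (homologyClass X n)) (fun x y hx => ?_) fun x y hy => ?_
  · rw [homologyClass_eq_zero_iff] at hx
    exact (homologyClass_eq_zero_iff X _).2
      (T.act_boundary c ![(x : Tot X), y] ![p, q] (pair_mem_cycles x.2 y.2) 0 hx)
  · rw [homologyClass_eq_zero_iff] at hy
    exact (homologyClass_eq_zero_iff X _).2
      (T.act_boundary c ![(x : Tot X), y] ![p, q] (pair_mem_cycles x.2 y.2) 1 hy)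

/-- Composing `c` with the nullary operation `u` and the operadic unit gives a unary operation of
augmentation one, which is homologous to the operadic unit. -/
theorem ChainAlgebra.binary_one (hε : O.IsAugmentation ε) (c : (P 2).X 0)
    (hc : ε 2 (Tot.of _ 0 c) = 1) (u : (P 0).X 0) (hu : ε 0 (Tot.of _ 0 u) = 1) {p : ℕ}
    {y : Tot X} (hy : y ∈ cyclesT X p) :
    T.binary c (T.act 0 (Tot.of _ 0 u) ![]) y - y ∈ LinearMap.range (Tot.d X) := by
  let d : ∀ s : Fin 2, (P (![0, 1] s)).X 0 := fun s => match s with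
    | 0 => u
    | 1 => O.one
  let x : ∀ s : Fin 2, Fin (![0, 1] s) → Tot X := fun s => match s with
    | 0 => (![] : Fin 0 → Tot X)
    | 1 => fun _ => y
  have hx : ∀ s t, x s t ∈ cyclesT X p := by
    refine Fin.forall_fin_two.2 ⟨fun t => ?_, fun t => hy⟩
    exact Fin.elim0 (show Fin 0 from t)
  obtain ⟨c', h1, h2⟩ := T.exists_act_act hε c d x (fun _ _ => p) hx
  have h3 : T.act 1 (Tot.of _ 0 O.one) (fun _ => y) = y := T.one_act _
  have h4 : (fun s => T.act (![0, 1] s) (Tot.of _ 0 (d s)) (x s)) =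
      ![T.act 0 (Tot.of _ 0 u) ![], y] := funext (Fin.forall_fin_two.2 ⟨rfl, h3⟩)
  have hn : ∑ s, ![0, 1] s = 1 := by simp
  rw [T.binary_apply, ← h4, h2]
  have h5 := T.act_compare hε hn c' O.one (by
      rw [h1, hc, Fin.prod_univ_two, one_mul]
      exact (congrArg₂ (· * ·) hu hε.one).trans (one_mul 1)) hε.one
    (fun r => x (finSigmaFinEquiv.symm r).1 (finSigmaFinEquiv.symm r).2) (fun _ => y) (fun _ => p)
    (fun _ => hy) (forall_finSigma x hn (fun _ => y) (Fin.forall_fin_two.2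
      ⟨fun t => Fin.elim0 (show Fin 0 from t), fun t => rfl⟩))
  rwa [h3] at h5

/-- Both bracketings are ternary operations of augmentation one, so each is homologous to a fixed
operation `c₃`. -/
theorem ChainAlgebra.binary_assoc (hε : O.IsAugmentation ε) (c : (P 2).X 0)
    (hc : ε 2 (Tot.of _ 0 c) = 1) {p q r : ℕ} {x y z : Tot X} (hx : x ∈ cyclesT X p)
    (hy : y ∈ cyclesT X q) (hz : z ∈ cyclesT X r) :
    T.binary c (T.binary c x y) z - T.binary c x (T.binary c y z) ∈
      LinearMap.range (Tot.d X) := by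
  obtain ⟨c₃, hc₃⟩ := hε.surjective 3
  have hxyz : ∀ s : Fin 3, ![x, y, z] s ∈ cyclesT X (![p, q, r] s) := by
    intro s
    fin_cases s
    · exact hx
    · exact hy
    · exact hz
  have hl : T.binary c (T.binary c x y) z - T.act 3 (Tot.of _ 0 c₃) ![x, y, z] ∈
      LinearMap.range (Tot.d X) := by
    let d : ∀ s : Fin 2, (P (![2, 1] s)).X 0 := fun s => match s with
      | 0 => c
      | 1 => O.one
    let w : ∀ s : Fin 2, Fin (![2, 1] s) → Tot X := fun s => match s with
      | 0 => ![x, y]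
      | 1 => fun _ => z
    let e : ∀ s : Fin 2, Fin (![2, 1] s) → ℕ := fun s => match s with
      | 0 => ![p, q]
      | 1 => fun _ => r
    obtain ⟨c', h1, h2⟩ := T.exists_act_act hε c d w e
      (Fin.forall_fin_two.2 ⟨pair_mem_cycles hx hy, fun t => hz⟩)
    have h4 : (fun s => T.act (![2, 1] s) (Tot.of _ 0 (d s)) (w s)) = ![T.binary c x y, z] :=
      funext (Fin.forall_fin_two.2 ⟨rfl, T.one_act fun _ => z⟩)
    have hn : ∑ s, ![2, 1] s = 3 := by simp
    rw [T.binary_apply, ← h4, h2]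
    refine T.act_compare hε hn c' c₃ (by
        rw [h1, hc, Fin.prod_univ_two, one_mul]
        exact (congrArg₂ (· * ·) hc hε.one).trans (one_mul 1)) hc₃ _ _ ![p, q, r] hxyz
      (forall_finSigma w hn ![x, y, z] (Fin.forall_fin_two.2
        ⟨Fin.forall_fin_two.2 ⟨?_, ?_⟩, Fin.forall_fin_one.2 ?_⟩))
    · rfl
    · rfl
    · rfl
  have hr : T.binary c x (T.binary c y z) - T.act 3 (Tot.of _ 0 c₃) ![x, y, z] ∈
      LinearMap.range (Tot.d X) := by
    let d : ∀ s : Fin 2, (P (![1, 2] s)).X 0 := fun s => match s with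
      | 0 => O.one
      | 1 => c
    let w : ∀ s : Fin 2, Fin (![1, 2] s) → Tot X := fun s => match s with
      | 0 => fun _ => x
      | 1 => ![y, z]
    let e : ∀ s : Fin 2, Fin (![1, 2] s) → ℕ := fun s => match s with
      | 0 => fun _ => p
      | 1 => ![q, r]
    obtain ⟨c', h1, h2⟩ := T.exists_act_act hε c d w e
      (Fin.forall_fin_two.2 ⟨fun t => hx, pair_mem_cycles hy hz⟩)
    have h4 : (fun s => T.act (![1, 2] s) (Tot.of _ 0 (d s)) (w s)) = ![x, T.binary c y z] :=
      funext (Fin.forall_fin_two.2 ⟨T.one_act fun _ => x, rfl⟩)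
    have hn : ∑ s, ![1, 2] s = 3 := by simp
    rw [T.binary_apply, ← h4, h2]
    refine T.act_compare hε hn c' c₃ (by
        rw [h1, hc, Fin.prod_univ_two, one_mul]
        exact (congrArg₂ (· * ·) hε.one hc).trans (one_mul 1)) hc₃ _ _ ![p, q, r] hxyz
      (forall_finSigma w hn ![x, y, z] (Fin.forall_fin_two.2
        ⟨Fin.forall_fin_one.2 ?_, Fin.forall_fin_two.2 ⟨?_, ?_⟩⟩))
    · rfl
    · rfl
    · rfl
  have := Submodule.sub_mem _ hl hr
  rwa [sub_sub_sub_cancel_right] at this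

theorem permSign_swap (p q : ℕ) :
    permSign (Equiv.swap (0 : Fin 2) 1) ![p, q] = (-1) ^ (p * q) := by
  refine congrArg ((-1 : ℤ) ^ ·) ?_
  simp [Fin.sum_univ_two, Finset.sum_filter]

/-- The operation `c` and its transpose have the same augmentation. Equivariance turns the transpose
into the exchange of the arguments with its Koszul sign. -/
theorem ChainAlgebra.binary_comm (hε : O.IsAugmentation ε) (c : (P 2).X 0) {p q : ℕ}
    {x y : Tot X} (hx : x ∈ cyclesT X p) (hy : y ∈ cyclesT X q) :
    T.binary c x y - (-1 : ℤ) ^ (p * q) • T.binary c y x ∈ LinearMap.range (Tot.d X) := by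
  have h1 : Tot.map (O.act (Equiv.swap (0 : Fin 2) 1)) (Tot.of _ 0 c) =
      Tot.of _ 0 (((O.act (Equiv.swap (0 : Fin 2) 1)).f 0).hom c) := Tot.map_of _ _ _
  choose g hg using fun s => (pair_mem_cycles hx hy s).1
  have h2 := T.equivariance 2 (Equiv.swap 0 1) (Tot.of _ 0 c) ![p, q] g
  have h3 : (fun s => Tot.of X (![p, q] s) (g s)) = ![x, y] := funext hg
  have h4 : (fun s => Tot.of X (![p, q] ((Equiv.swap (0 : Fin 2) 1).symm s))
      (g ((Equiv.swap (0 : Fin 2) 1).symm s))) = ![y, x] :=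
    funext fun s => (hg _).trans (by fin_cases s <;> rfl)
  rw [h3, h4, h1, permSign_swap] at h2
  rw [T.binary_apply, T.binary_apply, ← h2]
  refine T.act_sub_mem hε _ _ ?_ ![x, y] ![p, q] (pair_mem_cycles hx hy)
  rw [← h1, hε.act]

/-- The Pontryagin product on the homology of an algebra over an augmented operad. -/
theorem ChainAlgebra.exists_gradedCommAlgebra (hε : O.IsAugmentation ε) :
    ∃ R : GradedCommAlgebra fun n => X.homology n, ∀ c : (P 2).X 0, ε 2 (Tot.of _ 0 c) = 1 →
      ∀ (p q n : ℕ) (h : p + q = n) (x : cyclesT X p) (y : cyclesT X q),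
        R.mul h (homologyClass X p x) (homologyClass X q y) =
          homologyClass X n ⟨T.binary c x y, T.binary_mem h c x.2 y.2⟩ := by
  obtain ⟨u, hu⟩ := hε.surjective 0
  obtain ⟨c, hc⟩ := hε.surjective 2
  choose μ hμ using fun (p q n : ℕ) (h : p + q = n) => T.exists_homology_mul h c
  have hu' : T.act 0 (Tot.of _ 0 u) ![] ∈ cyclesT X 0 :=
    T.act_mem_cycles u ![] ![] (fun s => s.elim0) (by simp)
  refine ⟨{
    one := homologyClass X 0 ⟨_, hu'⟩
    mul := fun {p q n} h => μ p q n h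
    one_mul := fun {p} x => ?_
    mul_assoc := fun {p q r pq qr n} h₁ h₂ h₃ h₄ x y z => ?_
    mul_comm := fun {p q n} h h' x y => ?_ }, fun c' hc' p q n h x y => ?_⟩
  · obtain ⟨x, rfl⟩ := homologyClass_surjective X p x
    rw [hμ, homologyClass_eq_iff]
    exact T.binary_one hε c hc u hu x.2
  · obtain ⟨x, rfl⟩ := homologyClass_surjective X p x
    obtain ⟨y, rfl⟩ := homologyClass_surjective X q y
    obtain ⟨z, rfl⟩ := homologyClass_surjective X r z
    rw [hμ, hμ, hμ, hμ, homologyClass_eq_iff]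
    exact T.binary_assoc hε c hc x.2 y.2 z.2
  · obtain ⟨x, rfl⟩ := homologyClass_surjective X p x
    obtain ⟨y, rfl⟩ := homologyClass_surjective X q y
    rw [hμ, hμ, ← map_zsmul, homologyClass_eq_iff]
    exact T.binary_comm hε c x.2 y.2
  -- Independence of the chosen operation: `c` and `c'` both have augmentation one.
  · rw [hμ, homologyClass_eq_iff]
    exact T.act_sub_mem hε c c' (hc.trans hc'.symm) ![(x : Tot X), y] ![p, q]
      (pair_mem_cycles x.2 y.2)

/-- Transport of a graded commutative algebra structure along isomorphisms. -/
def GradedCommAlgebra.transport {H H' : ℕ → ModuleCat.{u} k} (R : GradedCommAlgebra H')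
    (e : ∀ n, H n ≅ H' n) : GradedCommAlgebra H where
  one := (e 0).inv.hom R.one
  mul {p q r} h := ((R.mul h).compl₁₂ (e p).hom.hom (e q).hom.hom).compr₂ (e r).inv.hom
  one_mul {p} x := by
    simp [R.one_mul]
  mul_assoc h₁ h₂ h₃ h₄ x y z := by
    simp [R.mul_assoc h₁ h₂ h₃ h₄]
  mul_comm {p q n} h h' x y :=
    (congrArg (e n).inv.hom (R.mul_comm h h' _ _)).trans (map_zsmul _ _ _)

theorem GradedCommAlgebra.transport_mul {H H' : ℕ → ModuleCat.{u} k} (R : GradedCommAlgebra H')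
    (e : ∀ n, H n ≅ H' n) {p q r : ℕ} (h : p + q = r) (x : H' p) (y : H' q) :
    (R.transport e).mul h ((e p).inv.hom x) ((e q).inv.hom y) = (e r).inv.hom (R.mul h x y) := by
  simp [GradedCommAlgebra.transport]

end Product

/-! ### The augmentation of the operad `D_ch` -/

section NerveAugmentation

variable (k : Type u) [CommRing k]

theorem chainOperad_isAugmentation :
    (chainOperad k Dcat_isOperad).IsAugmentation fun n => aug k (Dcat.obj n) where
  one := aug_chain_zero _
  act n m e c := aug_map (Dcat.act e) c
  mul m j c d := aug_nerveMul c d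
  surjective n := aug_surjective (C := Dcat.obj n) (⟨1⟩ : Codiscrete (Equiv.Perm (Fin n))) 1
  exact n c hc := by
    obtain ⟨b, hb⟩ := (aug_exact (k := k) (C := Dcat.obj n)
      (codiscreteInitial (⟨1⟩ : Codiscrete (Equiv.Perm (Fin n)))) c).1 hc
    exact ⟨b, (Tot.d_of _ _ _).trans (congrArg (Tot.of _ 0) hb)⟩

end NerveAugmentation

end SymHom

namespace SymHom

/-! ### Comparison of the alternating face complex with the normalized complex -/

section NormalizedHomotopy

open AlgebraicTopology AlgebraicTopology.DoldKan

variable {k : Type u} [CommRing k] (X : SimplicialObject (ModuleCat.{u} k))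

/-- The projection of the complex with differential `∑ (-1)^i d_i` onto the normalized complex. -/
noncomputable def toNormalized : (alternatingFaceMapComplex (ModuleCat.{u} k)).obj X ⟶
    normalized X where
  f n := ModuleCat.ofHom (degenerate X n).mkQ
  comm' := by
    rintro _ n rfl
    rw [alternatingFaceMapComplex_obj_d]
    exact ModuleCat.hom_ext (LinearMap.ext fun x => normalized_d_mkQ k X n x)

theorem degenerate_le_ker_PInfty (n : ℕ) :
    degenerate X n ≤ LinearMap.ker ((PInfty (X := X)).f n).hom := by
  cases n with
  | zero => exact bot_le
  | succ n =>
    refine iSup_le fun j => ?_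
    rintro _ ⟨x, rfl⟩
    exact ConcreteCategory.congr_hom (σ_comp_PInfty X j) x

/-- In the decomposition of the complementary projector every summand ends with a degeneracy. -/
theorem QInfty_mem_degenerate (n : ℕ) (x : X.obj (op ⦋n⦌)) :
    ((QInfty (X := X)).f n).hom x ∈ degenerate X n := by
  cases n with
  | zero =>
    rw [QInfty_f_0]
    exact zero_mem _
  | succ n =>
    rw [QInfty_f, decomposition_Q]
    have h : ∀ (s : Finset (Fin (n + 1))) (f : Fin (n + 1) → (X.obj (op ⦋n + 1⦌) ⟶ X.obj (op ⦋n⦌))),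
        (∑ i ∈ s, f i ≫ X.σ i.rev).hom x ∈ degenerate X (n + 1) := by
      intro s f
      rw [ModuleCat.hom_sum, LinearMap.sum_apply]
      exact Submodule.sum_mem _ fun i _ => Submodule.mem_iSup_of_mem i.rev ⟨(f i).hom x, rfl⟩
    simpa only [Category.assoc] using
      h _ (fun i => (P i).f (n + 1) ≫ X.δ i.rev.succ)

/-- The section of `toNormalized` given by the projector `PInfty`. -/
noncomputable def ofNormalized : normalized X ⟶
    (alternatingFaceMapComplex (ModuleCat.{u} k)).obj X where
  f n := ModuleCat.ofHom ((degenerate X n).liftQ ((PInfty (X := X)).f n).hom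
    (degenerate_le_ker_PInfty X n))
  comm' := by
    rintro _ n rfl
    refine ModuleCat.hom_ext (Submodule.linearMap_qext _ (LinearMap.ext fun x => ?_))
    have h := ConcreteCategory.congr_hom ((PInfty (X := X)).comm (n + 1) n) x
    refine h.trans ?_
    have h1 := normalized_d_mkQ k X n x
    rw [AlternatingFaceMapComplex.obj_d_eq]
    exact (congrArg ((degenerate X n).liftQ ((PInfty (X := X)).f n).hom
      (degenerate_le_ker_PInfty X n)) h1).symm

/-- The projection onto the normalized complex is a homotopy equivalence. -/
noncomputable def normalizedHomotopyEquiv :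
    HomotopyEquiv ((alternatingFaceMapComplex (ModuleCat.{u} k)).obj X) (normalized X) where
  hom := toNormalized X
  inv := ofNormalized X
  -- Projection followed by the section is `PInfty` itself. In the other order the composite is
  -- exactly the identity, because `PInfty` changes a simplex by a degenerate chain.
  homotopyHomInvId := (Homotopy.ofEq (by ext n x; rfl)).trans (homotopyPInftyToId X)
  homotopyInvHomId := Homotopy.ofEq (by
    ext n : 1
    refine ModuleCat.hom_ext (Submodule.linearMap_qext _ (LinearMap.ext fun x => ?_))
    have h := ConcreteCategory.congr_hom (PInfty_f_add_QInfty_f (X := X) n) x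
    refine ((Submodule.Quotient.eq _).2 ?_ :
      (degenerate X n).mkQ (((PInfty (X := X)).f n).hom x) = (degenerate X n).mkQ x)
    have h2 : ∀ a b : X.obj (op ⦋n⦌), a + b = x → b ∈ degenerate X n → a - x ∈ degenerate X n := by
      rintro a b rfl hb
      simpa using hb
    exact h2 _ _ h (QInfty_mem_degenerate X n x))

/-- An additive functor commutes with the formation of the complex of a simplicial object. -/
noncomputable def mapAlternating {V : Type*} [Category* V] [Preadditive V]
    (F : V ⥤ ModuleCat.{u} k) [F.Additive] (X : SimplicialObject V) :
    (F.mapHomologicalComplex _).obj ((alternatingFaceMapComplex V).obj X) ≅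
      (alternatingFaceMapComplex (ModuleCat.{u} k)).obj
        (((SimplicialObject.whiskering V _).obj F).obj X) :=
  HomologicalComplex.Hom.isoOfComponents (fun n => Iso.refl _) (by
    rintro _ n rfl
    have h : F.map (AlternatingFaceMapComplex.objD X n) = AlternatingFaceMapComplex.objD
        (((SimplicialObject.whiskering V _).obj F).obj X) n := by
      simp only [AlternatingFaceMapComplex.objD, F.map_sum, F.map_zsmul]
      rfl
    change 𝟙 _ ≫ _ = F.map _ ≫ 𝟙 _
    rw [alternatingFaceMapComplex_obj_d, alternatingFaceMapComplex_obj_d, h]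
    exact (Category.id_comp _).trans (Category.comp_id _).symm)

end NormalizedHomotopy

end SymHom

namespace SymHom

/-! ### Resolutions as quasi-isomorphisms -/

section QuasiIso

variable {k : Type u} [CommRing k]

theorem homologyMap_π {X Y : ChainComplex (ModuleCat.{u} k) ℕ} (f : X ⟶ Y) (n : ℕ)
    (z : X.cycles n) : (HomologicalComplex.homologyMap f n).hom ((X.homologyπ n).hom z) =
      (Y.homologyπ n).hom ((HomologicalComplex.cyclesMap f n).hom z) :=
  ConcreteCategory.congr_hom (HomologicalComplex.homologyπ_naturality f n) z

theorem iCycles_cyclesMap {X Y : ChainComplex (ModuleCat.{u} k) ℕ} (f : X ⟶ Y) (n : ℕ)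
    (z : X.cycles n) : (Y.iCycles n).hom ((HomologicalComplex.cyclesMap f n).hom z) =
      (f.f n).hom ((X.iCycles n).hom z) :=
  ConcreteCategory.congr_hom (HomologicalComplex.cyclesMap_i f n) z

/-- A resolution of a module is a quasi-isomorphism to the module. -/
theorem quasiIso_of_resolution {K Y : ChainComplex (ModuleCat.{u} k) ℕ} (f : K ⟶ Y)
    (hY : ∀ n, Subsingleton (Y.X (n + 1))) (hs : Function.Surjective (f.f 0).hom)
    (h₀ : ∀ x : K.X 0, (f.f 0).hom x = 0 → ∃ u, (K.d 1 0).hom u = x)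
    (h : ∀ (n : ℕ) (x : K.X (n + 1)), (K.d (n + 1) n).hom x = 0 →
      ∃ u, (K.d (n + 2) (n + 1)).hom u = x) : QuasiIso f := by
  refine (quasiIso_iff f).2 fun n => (quasiIsoAt_iff_isIso_homologyMap f n).2 ?_
  refine (ConcreteCategory.isIso_iff_bijective _).2 ⟨?_, ?_⟩
  · refine (injective_iff_map_eq_zero (HomologicalComplex.homologyMap f n).hom).2 fun w hw => ?_
    obtain ⟨z, rfl⟩ := homologyπ_surjective K n w
    rw [homologyMap_π, homologyπ_eq_zero_iff] at hw
    obtain ⟨v, hv⟩ := hw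
    rw [iCycles_cyclesMap] at hv
    refine (homologyπ_eq_zero_iff K z).2 ?_
    cases n with
    | zero =>
      have := hY 0
      refine h₀ _ (hv.symm.trans ?_)
      rw [Subsingleton.elim v 0, map_zero]
    | succ n => exact h n _ (d_iCycles K z n)
  · intro w
    obtain ⟨z, rfl⟩ := homologyπ_surjective Y n w
    cases n with
    | zero =>
      obtain ⟨x, hx⟩ := hs ((Y.iCycles 0).hom z)
      obtain ⟨z', hz'⟩ := exists_iCycles K x (by rw [K.shape 0 (0 - 1) (by simp)]; rfl)
      refine ⟨(K.homologyπ 0).hom z', (homologyMap_π f 0 z').trans (congrArg _ ?_)⟩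
      refine iCycles_injective Y 0 ?_
      rw [iCycles_cyclesMap, hz', hx]
    | succ n =>
      have := hY n
      refine ⟨0, (map_zero (HomologicalComplex.homologyMap f (n + 1)).hom).trans ?_⟩
      have : z = 0 := iCycles_injective Y (n + 1) (Subsingleton.elim _ _)
      rw [this, map_zero]

end QuasiIso

/-! ### The bar construction is projective in each degree -/

section Bar

variable (k : Type u) [CommRing k] {C : Type} [Category.{0} C]

/-- A simplex of the bar construction at `X`. -/
noncomputable def barChain {q : ℕ} {X : C} (s : Fin (q + 1) ⥤ Under X) :
    ((barRight k C).obj (op ⦋q⦌)).obj (op X) :=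
  chain k s

theorem barRight_map_barChain {q : ℕ} {X Y : C} (ψ : X ⟶ Y) (s : Fin (q + 1) ⥤ Under Y) :
    (((barRight k C).obj (op ⦋q⦌)).map ψ.op).hom (barChain k s) =
      barChain k (s ⋙ Under.map ψ) :=
  lmapDomain_single (k := k) (fun s : Fin (q + 1) ⥤ Under Y => s ⋙ Under.map ψ) s

theorem barRight_app_barChain {q q' : ℕ} {X : C} (φ : ⦋q'⦌ ⟶ ⦋q⦌) (s : Fin (q + 1) ⥤ Under X) :
    (((barRight k C).map φ.op).app (op X)).hom (barChain k s) = barChain k (pull s φ) :=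
  linNerve_map_chain φ s

variable {k}

theorem barRight_hom_ext {q : ℕ} {E : Cᵒᵖ ⥤ ModuleCat.{u} k}
    {f g : (barRight k C).obj (op ⦋q⦌) ⟶ E}
    (h : ∀ (X : C) (s : Fin (q + 1) ⥤ Under X),
      (f.app (op X)).hom (barChain k s) = (g.app (op X)).hom (barChain k s)) : f = g :=
  NatTrans.ext (funext fun X => ModuleCat.hom_ext
    (chain_linear_ext (C := Under X.unop) fun s => h X.unop s))

/-- A string of morphisms, as a string of objects under its first object. -/
def underHead {q : ℕ} (c : Fin (q + 1) ⥤ C) : Fin (q + 1) ⥤ Under (c.obj 0) :=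
  Under.lift c { app := fun i => c.map (homOfLE (Fin.zero_le i))
                 naturality := fun i j f => by
                  refine (Category.id_comp _).trans ?_
                  rw [← c.map_comp]
                  rfl }

/-- A string under `X` consists of a string in `C` and a morphism from `X` to its first object; the
remaining structure maps are forced. So the bar construction is free on the strings `c` in `C`, with
the generator of `c` sitting at `c.obj 0`. -/
theorem underHead_map {q : ℕ} {X : C} (s : Fin (q + 1) ⥤ Under X) :
    underHead (s ⋙ Under.forget X) ⋙ Under.map (s.obj 0).hom = s := by
  let α : (Functor.const (Fin (q + 1))).obj X ⟶ s ⋙ Under.forget X :=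
    { app := fun i => (s.obj i).hom
      naturality := fun i j f => (Category.id_comp _).trans (Under.w (s.map f)).symm }
  let β : (Functor.const (Fin (q + 1))).obj X ⟶ s ⋙ Under.forget X :=
    { app := fun i => (s.obj 0).hom ≫ (s.map (homOfLE (Fin.zero_le i))).right
      naturality := fun i j f => by
        refine (Category.id_comp _).trans ?_
        exact (Under.w (s.map (homOfLE (Fin.zero_le j)))).trans ((Under.w (s.map f)).symm.trans
          (congrArg (fun h => h ≫ (s.map f).right)
            (Under.w (s.map (homOfLE (Fin.zero_le i)))).symm)) }
  have h : β = α := by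
    ext i
    exact Under.w (s.map (homOfLE (Fin.zero_le i)))
  have h1 : underHead (s ⋙ Under.forget X) ⋙ Under.map (s.obj 0).hom = Under.lift _ β := rfl
  have h2 : s = Under.lift _ α := rfl
  rw [h1, h]
  exact h2.symm

/-- The map out of the bar construction determined by the images of the strings of objects under
their first object. -/
noncomputable def barDesc {q : ℕ} {E : Cᵒᵖ ⥤ ModuleCat.{u} k}
    (x : ∀ c : Fin (q + 1) ⥤ C, E.obj (op (c.obj 0))) : (barRight k C).obj (op ⦋q⦌) ⟶ E where
  app X := ModuleCat.ofHom (Finsupp.linearCombination k fun s : Fin (q + 1) ⥤ Under X.unop =>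
    (E.map (s.obj 0).hom.op).hom (x (s ⋙ Under.forget X.unop)))
  naturality X Y ψ := by
    have hl : ∀ (X : C) (s : Fin (q + 1) ⥤ Under X),
        (Finsupp.linearCombination k fun s : Fin (q + 1) ⥤ Under X =>
          (E.map (s.obj 0).hom.op).hom (x (s ⋙ Under.forget X))) (Finsupp.single s 1) =
        (E.map (s.obj 0).hom.op).hom (x (s ⋙ Under.forget X)) := fun X s =>
      (Finsupp.linearCombination_single k (1 : k) s).trans (one_smul k _)
    refine ModuleCat.hom_ext (chain_linear_ext (C := Under X.unop) fun s => ?_)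
    refine ((congrArg _ (barRight_map_barChain k ψ.unop s)).trans (hl Y.unop _)).trans ?_
    refine Eq.trans ?_ (congrArg (E.map ψ).hom (hl X.unop s)).symm
    exact ConcreteCategory.congr_hom (E.map_comp (s.obj 0).hom.op ψ) _

theorem barDesc_barChain {q : ℕ} {E : Cᵒᵖ ⥤ ModuleCat.{u} k}
    (x : ∀ c : Fin (q + 1) ⥤ C, E.obj (op (c.obj 0))) {X : C} (s : Fin (q + 1) ⥤ Under X) :
    ((barDesc x).app (op X)).hom (barChain k s) =
      (E.map (s.obj 0).hom.op).hom (x (s ⋙ Under.forget X)) :=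
  (Finsupp.linearCombination_single k (1 : k) s).trans (one_smul k _)

theorem hom_barChain {q : ℕ} {E : Cᵒᵖ ⥤ ModuleCat.{u} k}
    (f : (barRight k C).obj (op ⦋q⦌) ⟶ E) {X : C} (s : Fin (q + 1) ⥤ Under X) :
    (f.app (op X)).hom (barChain k s) = (E.map (s.obj 0).hom.op).hom
      ((f.app _).hom (barChain k (underHead (s ⋙ Under.forget X)))) := by
  conv_lhs => rw [← underHead_map s]
  refine (congrArg (f.app (op X)).hom (barRight_map_barChain k _ _).symm).trans ?_
  exact ConcreteCategory.congr_hom (f.naturality (s.obj 0).hom.op)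
    (barChain k (underHead (s ⋙ Under.forget X)))

/-- The images of the free generators are lifted one by one along the epimorphism, which is
surjective at each object. -/
instance (q : ℕ) : Projective ((barRight k C).obj (op ⦋q⦌)) where
  factors {E M} f e _ := by
    have : ∀ c : Fin (q + 1) ⥤ C, ∃ x : E.obj (op (c.obj 0)), (e.app (op (c.obj 0))).hom x =
        (f.app (op (c.obj 0))).hom (barChain k (underHead c)) := fun c => by
      have : Epi (e.app (op (c.obj 0))) := inferInstance
      exact (ModuleCat.epi_iff_surjective _).1 this _
    choose x hx using this
    refine ⟨barDesc x, barRight_hom_ext fun X s => ?_⟩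
    refine Eq.trans ?_ (hom_barChain f s).symm
    refine (congrArg (e.app (op X)).hom (barDesc_barChain x s)).trans ?_
    refine (ConcreteCategory.congr_hom (e.naturality (s.obj 0).hom.op) _).trans ?_
    exact congrArg (M.map (s.obj 0).hom.op).hom (hx (s ⋙ Under.forget X))

end Bar

end SymHom

namespace SymHom

/-! ### The bar resolution of the constant module -/

section Resolution

open AlgebraicTopology

variable (k : Type u) [CommRing k] (C : Type) [Category.{0} C]

/-- The constant right module. -/
noncomputable abbrev constRight : Cᵒᵖ ⥤ ModuleCat.{u} k :=
  (Functor.const Cᵒᵖ).obj (ModuleCat.of k k)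

/-- The bar complex. -/
noncomputable abbrev barComplex : ChainComplex (Cᵒᵖ ⥤ ModuleCat.{u} k) ℕ :=
  (alternatingFaceMapComplex (Cᵒᵖ ⥤ ModuleCat.{u} k)).obj (barRight k C)

/-- The sum of the coefficients, on the bar construction. -/
noncomputable def barAug (q : ℕ) : (barRight k C).obj (op ⦋q⦌) ⟶ constRight k C where
  app X := ModuleCat.ofHom (coeffSum (C := Under X.unop) k q)
  naturality X Y ψ := by
    refine ModuleCat.hom_ext (chain_linear_ext (C := Under X.unop) fun s => ?_)
    refine (congrArg (coeffSum (C := Under Y.unop) k q) (barRight_map_barChain k ψ.unop s)).trans ?_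
    exact (coeffSum_chain k _).trans (coeffSum_chain k s).symm

variable {C} in
theorem barAug_barChain {q : ℕ} {X : C} (s : Fin (q + 1) ⥤ Under X) :
    ((barAug k C q).app (op X)).hom (barChain k s) = (1 : k) :=
  coeffSum_chain k s

theorem barRight_map_barAug {q q' : ℕ} (φ : ⦋q'⦌ ⟶ ⦋q⦌) :
    (barRight k C).map φ.op ≫ barAug k C q' = barAug k C q :=
  barRight_hom_ext fun X s =>
    (congrArg ((barAug k C q').app (op X)).hom (barRight_app_barChain k φ s)).trans
      ((barAug_barChain k _).trans (barAug_barChain k s).symm)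

theorem barComplex_d_aug : (barComplex k C).d 1 0 ≫ barAug k C 0 = 0 := by
  rw [alternatingFaceMapComplex_obj_d, AlternatingFaceMapComplex.objD, Preadditive.sum_comp,
    Fin.sum_univ_two]
  have h : ∀ i : Fin 2, (barRight k C).map (SimplexCategory.δ i).op ≫ barAug k C 0 = barAug k C 1 := fun i =>
    barRight_map_barAug k C (SimplexCategory.δ i)
  simp only [Preadditive.zsmul_comp]
  refine (congrArg₂ (fun a b => (-1 : ℤ) ^ ((0 : Fin 2) : ℕ) • a + (-1 : ℤ) ^ ((1 : Fin 2) : ℕ) • b)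
    (h 0) (h 1)).trans ?_
  simp

/-- The augmentation of the bar complex. -/
noncomputable def barπ : barComplex k C ⟶ (ChainComplex.single₀ _).obj (constRight k C) :=
  (ChainComplex.toSingle₀Equiv _ _).symm ⟨barAug k C 0, barComplex_d_aug k C⟩

theorem barComplex_d_app (n : ℕ) (X : C)
    (x : (linNerve k (Under X)).obj (op ⦋n + 1⦌)) :
    (((barComplex k C).d (n + 1) n).app (op X)).hom x =
      (AlternatingFaceMapComplex.objD (linNerve k (Under X)) n).hom x := by
  rw [alternatingFaceMapComplex_obj_d, objD_apply, AlternatingFaceMapComplex.objD]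
  let e : ((barRight k C).obj (op ⦋n + 1⦌) ⟶ (barRight k C).obj (op ⦋n⦌)) →+
      (linNerve k (Under X)).obj (op ⦋n⦌) :=
    { toFun := fun f => (f.app (op X)).hom x, map_zero' := rfl, map_add' := fun _ _ => rfl }
  change e _ = _
  rw [map_sum]
  refine Finset.sum_congr rfl fun i _ => ?_
  rw [map_zsmul]
  rfl

/-- Quasi-isomorphisms are detected objectwise. At `X` the complex is that of the nerve of the
category under `X`, which the initial object `𝟙 X` contracts by prepending. -/
instance : QuasiIso (barπ k C) := by
  rw [HomologicalComplex.quasiIso_iff_evaluation]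
  intro X
  have h0 : (barπ k C).f 0 = barAug k C 0 := ChainComplex.toSingle₀Equiv_symm_apply_f_zero _ _
  have hI : Limits.IsInitial (Under.mk (𝟙 X.unop)) := Under.mkIdInitial
  refine quasiIso_of_resolution _ ?_ ?_ ?_ ?_
  · intro n
    refine ModuleCat.subsingleton_of_isZero (((evaluation Cᵒᵖ (ModuleCat k)).obj X).map_isZero ?_)
    exact HomologicalComplex.isZero_single_obj_X (ComplexShape.down ℕ) 0 _ _ (by simp)
  · change Function.Surjective (((barπ k C).f 0).app X).hom
    rw [h0]
    intro (a : k)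
    refine ⟨a • chain k ((Functor.const (Fin (0 + 1))).obj (Under.mk (𝟙 X.unop))), ?_⟩
    refine (map_smul (coeffSum (C := Under X.unop) k 0) a _).trans ?_
    rw [coeffSum_chain]
    exact mul_one a
  · intro (x : (linNerve k (Under X.unop)).obj (op ⦋0⦌)) hx
    change (((barπ k C).f 0).app X).hom x = 0 at hx
    rw [h0] at hx
    refine ⟨prependL hI k 0 x, (barComplex_d_app k C 0 X.unop _).trans ?_⟩
    refine (objD_prependL_zero hI k x).trans ?_
    have hx' : coeffSum (C := Under X.unop) k 0 x = 0 := hx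
    refine (congrArg (fun a : k => x - a • chain k ((Functor.const (Fin (0 + 1))).obj
      (Under.mk (𝟙 X.unop)))) hx').trans ?_
    refine (congrArg (fun z => x - z) (zero_smul k _)).trans (sub_zero _)
  · intro n (x : (linNerve k (Under X.unop)).obj (op ⦋n + 1⦌)) hx
    refine ⟨prependL hI k (n + 1) x, (barComplex_d_app k C (n + 1) X.unop _).trans ?_⟩
    refine (objD_prependL_succ hI k n x).trans ?_
    have hx' : (AlternatingFaceMapComplex.objD (linNerve k (Under X.unop)) n).hom x = 0 :=
      (barComplex_d_app k C n X.unop x).symm.trans hx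
    refine (congrArg (fun z => x - prependL hI k n z) hx').trans ?_
    exact (congrArg (fun z => x - z) (map_zero (prependL hI k n))).trans (sub_zero _)

/-- The bar resolution of the constant right module. -/
noncomputable def barResolution : ProjectiveResolution (constRight k C) where
  complex := barComplex k C
  projective n := inferInstanceAs (Projective ((barRight k C).obj (op ⦋n⦌)))
  π := barπ k C
  quasiIso := inferInstance

variable {k C} in
/-- Simplicial endomorphisms of the bar construction that preserve the augmentation are homotopic to
the identity. -/
noncomputable def barHomotopy (Φ : barRight k C ⟶ barRight k C)
    (h : Φ.app (op ⦋0⦌) ≫ barAug k C 0 = barAug k C 0) :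
    Homotopy ((alternatingFaceMapComplex _).map Φ) (𝟙 (barComplex k C)) :=
  have h0 : (barπ k C).f 0 = barAug k C 0 := ChainComplex.toSingle₀Equiv_symm_apply_f_zero _ _
  -- Both chain maps lift the identity of the constant module to its projective resolution, so the
  -- comparison theorem gives a homotopy.
  ProjectiveResolution.liftHomotopy (𝟙 _) (P := barResolution k C) (Q := barResolution k C) _ _
    (by
      refine HomologicalComplex.to_single_hom_ext ?_
      rw [(ChainComplex.single₀ _).map_id, Category.comp_id]
      change Φ.app (op ⦋0⦌) ≫ (barπ k C).f 0 = (barπ k C).f 0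
      rw [h0]
      exact h)
    (by
      rw [(ChainComplex.single₀ _).map_id, Category.comp_id]
      exact Category.id_comp _)

end Resolution

end SymHom

namespace SymHom

/-! ### Derived functors as homology of the normalized bar construction -/

section TorIso

open AlgebraicTopology

variable {k : Type u} [CommRing k] {C : Type} [Category.{0} C]

/-- The simplicial module that computes the derived functors of `k ⊗_C -`. -/
noncomputable abbrev barTensor (N : C ⥤ ModuleCat.{u} k) : SimplicialObject (ModuleCat.{u} k) :=
  barRight k C ⋙ tensorRight N

/-- The complex obtained from the bar resolution by tensoring, and the normalized complex. -/
noncomputable def barTensorIso (N : C ⥤ ModuleCat.{u} k) (n : ℕ) :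
    (((tensorRight N).mapHomologicalComplex _).obj (barComplex k C)).homology n ≅
      (normalized (barTensor N)).homology n :=
  HomologicalComplex.homologyMapIso (mapAlternating (tensorRight N) (barRight k C)) n ≪≫
    (normalizedHomotopyEquiv (barTensor N)).toHomologyIso n

theorem barTensorIso_hom (N : C ⥤ ModuleCat.{u} k) (n : ℕ) :
    (barTensorIso N n).hom = HomologicalComplex.homologyMap
      ((mapAlternating (tensorRight N) (barRight k C)).hom ≫ toNormalized (barTensor N)) n :=
  (HomologicalComplex.homologyMap_comp _ _ n).symm

/-- The derived functors of `- ⊗_C N` at the constant module are the homology of the normalized bar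
construction. -/
noncomputable def torIso (N : C ⥤ ModuleCat.{u} k) (n : ℕ) :
    tor k (constRight k C) N n ≅ (normalized (barTensor N)).homology n :=
  (barResolution k C).isoLeftDerivedObj (tensorRight N) n ≪≫ barTensorIso N n

/-- Functoriality of the bar construction in the left module. -/
noncomputable def barTensorMap {N N' : C ⥤ ModuleCat.{u} k} (β : N ⟶ N') :
    barTensor N ⟶ barTensor N' :=
  Functor.whiskerLeft (barRight k C) (tensorRightMap β)

theorem torIso_naturality {N N' : C ⥤ ModuleCat.{u} k} (β : N ⟶ N') (n : ℕ) :
    (NatTrans.leftDerived (tensorRightMap β) n).app (constRight k C) ≫ (torIso N' n).hom =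
      (torIso N n).hom ≫ HomologicalComplex.homologyMap (normalizedMap (barTensorMap β)) n := by
  have h : (((NatTrans.mapHomologicalComplex (tensorRightMap β) _).app (barComplex k C)) ≫
      (mapAlternating (tensorRight N') (barRight k C)).hom ≫ toNormalized (barTensor N')) =
      ((mapAlternating (tensorRight N) (barRight k C)).hom ≫ toNormalized (barTensor N)) ≫
        normalizedMap (barTensorMap β) := by
    ext n x
    rfl
  have h1 := (HomologicalComplex.homologyMap_comp _ _ n).symm.trans
    ((congrArg (fun f => HomologicalComplex.homologyMap f n) h).trans
      (HomologicalComplex.homologyMap_comp _ _ n))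
  rw [← barTensorIso_hom, ← barTensorIso_hom] at h1
  refine (congrArg (fun f => f ≫ (torIso N' n).hom)
    (ProjectiveResolution.leftDerived_app_eq (tensorRightMap β) (barResolution k C) n)).trans ?_
  have key : ∀ {U V V' W W' Z : ModuleCat.{u} k} (a : U ⟶ V) (b : W ≅ V') (f : V ⟶ V') (e : V ⟶ Z)
      (e' : V' ⟶ W') (g : Z ⟶ W'), f ≫ e' = e ≫ g → (a ≫ f ≫ b.inv) ≫ (b.hom ≫ e') = (a ≫ e) ≫ g := by
    intro U V V' W W' Z a b f e e' g h
    simp [h]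
  exact key _ ((barResolution k C).isoLeftDerivedObj (tensorRight N') n) _ _ _ _ h1

/-- Endomorphisms of the bar construction that preserve the augmentation act trivially. -/
theorem homologyMap_whiskerRight_bar (Φ : barRight k C ⟶ barRight k C)
    (h : Φ.app (op ⦋0⦌) ≫ barAug k C 0 = barAug k C 0) (N : C ⥤ ModuleCat.{u} k) (n : ℕ) :
    HomologicalComplex.homologyMap
      (normalizedMap (Functor.whiskerRight Φ (tensorRight N) : barTensor N ⟶ barTensor N)) n =
        𝟙 _ := by
  have h1 : ((tensorRight N).mapHomologicalComplex _).map ((alternatingFaceMapComplex _).map Φ) ≫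
      (mapAlternating (tensorRight N) (barRight k C)).hom ≫ toNormalized (barTensor N) =
      ((mapAlternating (tensorRight N) (barRight k C)).hom ≫ toNormalized (barTensor N)) ≫
        normalizedMap (Functor.whiskerRight Φ (tensorRight N) : barTensor N ⟶ barTensor N) := by
    ext n x
    rfl
  have h2 := (HomologicalComplex.homologyMap_comp _ _ n).symm.trans
    ((congrArg (fun f => HomologicalComplex.homologyMap f n) h1).trans
      (HomologicalComplex.homologyMap_comp _ _ n))
  rw [← barTensorIso_hom, ((tensorRight N).mapHomotopy (barHomotopy Φ h)).homologyMap_eq,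
    CategoryTheory.Functor.map_id, HomologicalComplex.homologyMap_id] at h2
  rw [← cancel_epi (barTensorIso N n).hom]
  exact h2.symm.trans ((Category.id_comp _).trans (Category.comp_id _).symm)

end TorIso

/-! ### Functoriality of the bar construction in the category -/

section Push

variable {k : Type u} [CommRing k] {C D : Type} [Category.{0} C] [Category.{0} D]
  (G : C ⥤ D)

open Classical in
/-- Functoriality of the tensor product in the category. -/
noncomputable def TensorOver.push {M : Cᵒᵖ ⥤ ModuleCat.{u} k} {N : C ⥤ ModuleCat.{u} k}
    {M' : Dᵒᵖ ⥤ ModuleCat.{u} k} {N' : D ⥤ ModuleCat.{u} k} (α : M ⟶ G.op ⋙ M')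
    (β : N ⟶ G ⋙ N') : TensorOver M N →ₗ[k] TensorOver M' N' :=
  (tensorRel M N).liftQ
    (DirectSum.toModule k C _ fun X =>
      TensorOver.mk M' N' (G.obj X) ∘ₗ TensorProduct.map (α.app (op X)).hom (β.app X).hom)
    (by
      refine Submodule.span_le.2 ?_
      rintro _ ⟨X, Y, f, y, x, rfl⟩
      have h1 := ConcreteCategory.congr_hom (α.naturality f.op) y
      have h2 := ConcreteCategory.congr_hom (β.naturality f) x
      change _ = _
      rw [map_sub, DirectSum.toModule_lof, DirectSum.toModule_lof]
      change TensorOver.mk M' N' _ ((α.app (op Y)).hom y ⊗ₜ (β.app Y).hom (N.map f x)) -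
        TensorOver.mk M' N' _ ((α.app (op X)).hom (M.map f.op y) ⊗ₜ (β.app X).hom x) = 0
      have h1' : (α.app (op X)).hom (M.map f.op y) =
        M'.map (G.map f).op ((α.app (op Y)).hom y) := h1
      have h2' : (β.app Y).hom (N.map f x) = N'.map (G.map f) ((β.app X).hom x) := h2
      rw [h1', h2']
      exact sub_eq_zero.2 (TensorOver.condition (M := M') (N := N') (G.map f) _ _))

theorem TensorOver.push_mk {M : Cᵒᵖ ⥤ ModuleCat.{u} k} {N : C ⥤ ModuleCat.{u} k}
    {M' : Dᵒᵖ ⥤ ModuleCat.{u} k} {N' : D ⥤ ModuleCat.{u} k} (α : M ⟶ G.op ⋙ M')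
    (β : N ⟶ G ⋙ N') (X : C) (y : M.obj (op X)) (x : N.obj X) :
    TensorOver.push G α β (TensorOver.mk M N X (y ⊗ₜ x)) =
      TensorOver.mk M' N' (G.obj X) ((α.app (op X)).hom y ⊗ₜ (β.app X).hom x) := by
  classical
  simp [TensorOver.push, TensorOver.mk]

/-- The structure maps of a diagram of objects under `X`, as a natural transformation. -/
def underHom {J : Type} [Category.{0} J] {X : C} (s : J ⥤ Under X) :
    (Functor.const J).obj X ⟶ s ⋙ Under.forget X where
  app i := (s.obj i).hom
  naturality i j f := (Category.id_comp _).trans (Under.w (s.map f)).symm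

/-- A diagram under `X` is a diagram in `C` with a natural transformation from the constant diagram
at `X`. The structure maps are compared by `HEq` since the two diagrams are only propositionally
equal. -/
theorem under_functor_ext {J : Type} [Category.{0} J] {X : C} {s s' : J ⥤ Under X}
    (h : s ⋙ Under.forget X = s' ⋙ Under.forget X) (h' : ∀ i, HEq (s.obj i).hom (s'.obj i).hom) :
    s = s' := by
  have key : ∀ (F F' : J ⥤ C) (α : (Functor.const J).obj X ⟶ F) (α' : (Functor.const J).obj X ⟶ F'),
      F = F' → (∀ i, HEq (α.app i) (α'.app i)) → Under.lift F α = Under.lift F' α' := by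
    rintro F _ α α' rfl hα
    have : α = α' := by
      ext i
      exact eq_of_heq (hα i)
    rw [this]
  exact key _ _ (underHom s) (underHom s') h h'

/-- Functoriality of the bar construction in the category. -/
noncomputable def barPush : barRight k C ⟶
    barRight k D ⋙ (Functor.whiskeringLeft Cᵒᵖ Dᵒᵖ (ModuleCat.{u} k)).obj G.op where
  app q :=
    { app := fun X => (linNerveMap k (Under.post (X := X.unop) G)).app q
      naturality := fun X Y ψ => by
        induction q using Opposite.rec with | _ q => ?_
        induction q using SimplexCategory.rec with | _ q => ?_
        refine ModuleCat.hom_ext (chain_linear_ext (C := Under X.unop) fun s => ?_)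
        refine ((congrArg _ (barRight_map_barChain k ψ.unop s)).trans
          (linNerveMap_chain (Under.post (X := Y.unop) G) _)).trans ?_
        refine Eq.trans ?_ ((congrArg _ (linNerveMap_chain (Under.post (X := X.unop) G) s)).trans
          (barRight_map_barChain k (G.map ψ.unop) _)).symm
        refine congrArg (chain k) (under_functor_ext rfl fun i => heq_of_eq ?_)
        exact G.map_comp _ _ }
  naturality q q' φ := by
    ext X : 2
    exact (linNerveMap k (Under.post (X := X.unop) G)).naturality φ

theorem barPush_barChain {q : ℕ} {X : C} (s : Fin (q + 1) ⥤ Under X) :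
    (((barPush (k := k) G).app (op ⦋q⦌)).app (op X)).hom (barChain k s) =
      barChain k (s ⋙ Under.post G) :=
  linNerveMap_chain (Under.post (X := X) G) s

/-- Functoriality of `barTensor` in the category. -/
noncomputable def barTensorPush {N : C ⥤ ModuleCat.{u} k} {N' : D ⥤ ModuleCat.{u} k}
    (β : N ⟶ G ⋙ N') : barTensor N ⟶ barTensor N' where
  app q := ModuleCat.ofHom (TensorOver.push G ((barPush G).app q) β)
  naturality q q' φ := ModuleCat.hom_ext (TensorOver.hom_ext fun X y x => by
    refine ((congrArg (TensorOver.push G ((barPush G).app q') β)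
      (TensorOver.map_mk ((barRight k C).map φ) (𝟙 N) X y x)).trans
      (TensorOver.push_mk G _ β X _ _)).trans ?_
    refine Eq.trans ?_ ((congrArg (TensorOver.map ((barRight k D).map φ) (𝟙 N'))
      (TensorOver.push_mk G ((barPush G).app q) β X y x)).trans
      (TensorOver.map_mk ((barRight k D).map φ) (𝟙 N') (G.obj X) _ _)).symm
    refine congrArg (fun z => TensorOver.mk _ N' (G.obj X) (z ⊗ₜ (β.app X).hom x)) ?_
    exact ConcreteCategory.congr_hom (congrArg (fun f => f.app (op X))
      ((barPush (k := k) G).naturality φ)) y)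

/-- The endomorphism of the bar construction induced by an endofunctor under the identity. -/
noncomputable def barEndo (E : C ⥤ C) (η : 𝟭 C ⟶ E) : barRight k C ⟶ barRight k C where
  app q :=
    { app := fun X => (linNerveMap k (Under.post (X := X.unop) E ⋙
        Under.map (η.app X.unop))).app q
      naturality := fun X Y ψ => by
        induction q using Opposite.rec with | _ q => ?_
        induction q using SimplexCategory.rec with | _ q => ?_
        refine ModuleCat.hom_ext (chain_linear_ext (C := Under X.unop) fun s => ?_)
        refine ((congrArg _ (barRight_map_barChain k ψ.unop s)).trans
          (linNerveMap_chain (Under.post (X := Y.unop) E ⋙ Under.map (η.app Y.unop)) _)).trans ?_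
        refine Eq.trans ?_ ((congrArg _ (linNerveMap_chain
          (Under.post (X := X.unop) E ⋙ Under.map (η.app X.unop)) s)).trans
          (barRight_map_barChain k ψ.unop _)).symm
        refine congrArg (chain k) (under_functor_ext rfl fun i => heq_of_eq ?_)
        change η.app Y.unop ≫ E.map (ψ.unop ≫ (s.obj i).hom) =
          ψ.unop ≫ η.app X.unop ≫ E.map (s.obj i).hom
        rw [E.map_comp, ← NatTrans.naturality_assoc]
        rfl }
  naturality q q' φ := by
    ext X : 2
    exact (linNerveMap k (Under.post (X := X.unop) E ⋙ Under.map (η.app X.unop))).naturality φ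

theorem barEndo_barChain (E : C ⥤ C) (η : 𝟭 C ⟶ E) {q : ℕ} {X : C}
    (s : Fin (q + 1) ⥤ Under X) :
    (((barEndo (k := k) E η).app (op ⦋q⦌)).app (op X)).hom (barChain k s) =
      barChain k (s ⋙ Under.post E ⋙ Under.map (η.app X)) :=
  linNerveMap_chain (Under.post (X := X) E ⋙ Under.map (η.app X)) s

theorem barEndo_barAug (E : C ⥤ C) (η : 𝟭 C ⟶ E) :
    (barEndo (k := k) E η).app (op ⦋0⦌) ≫ barAug k C 0 = barAug k C 0 :=
  barRight_hom_ext fun X s =>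
    (congrArg ((barAug k C 0).app (op X)).hom (barEndo_barChain E η s)).trans
      ((barAug_barChain k _).trans (barAug_barChain k s).symm)

end Push

end SymHom

namespace SymHom

/-! ### Invariance under functors inverse up to natural transformations -/

section PushIso

variable {k : Type u} [CommRing k] {C D : Type} [Category.{0} C] [Category.{0} D]

/-- The classes of simple tensors, which span `barTensor`. -/
noncomputable def barTensorMk (N : C ⥤ ModuleCat.{u} k) {q : ℕ} {X : C}
    (s : Fin (q + 1) ⥤ Under X) (x : N.obj X) : (barTensor N).obj (op ⦋q⦌) :=
  TensorOver.mk ((barRight k C).obj (op ⦋q⦌)) N X (barChain k s ⊗ₜ x)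

theorem barTensor_hom_ext {N : C ⥤ ModuleCat.{u} k} {Z : SimplicialObject (ModuleCat.{u} k)}
    {f g : barTensor N ⟶ Z} (h : ∀ (q : ℕ) (X : C) (s : Fin (q + 1) ⥤ Under X) (x : N.obj X),
      (f.app (op ⦋q⦌)).hom (barTensorMk N s x) = (g.app (op ⦋q⦌)).hom (barTensorMk N s x)) :
    f = g := by
  refine NatTrans.ext (funext fun q => ?_)
  induction q using Opposite.rec with | _ q => ?_
  induction q using SimplexCategory.rec with | _ q => ?_
  refine ModuleCat.hom_ext (TensorOver.hom_ext fun X y x => ?_)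
  let T : ((barRight k C).obj (op ⦋q⦌)).obj (op X) →ₗ[k] (barTensor N).obj (op ⦋q⦌) :=
    TensorOver.mk ((barRight k C).obj (op ⦋q⦌)) N X ∘ₗ (TensorProduct.mk k _ _).flip x
  have : (f.app (op ⦋q⦌)).hom ∘ₗ T = (g.app (op ⦋q⦌)).hom ∘ₗ T :=
    chain_linear_ext (C := Under X) fun s => h q X s x
  exact LinearMap.congr_fun this y

theorem barTensorMk_map (N : C ⥤ ModuleCat.{u} k) {q : ℕ} {X Y : C} (ψ : X ⟶ Y)
    (s : Fin (q + 1) ⥤ Under Y) (x : N.obj X) :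
    barTensorMk N s ((N.map ψ).hom x) = barTensorMk N (s ⋙ Under.map ψ) x :=
  (TensorOver.condition (M := (barRight k C).obj (op ⦋q⦌)) (N := N) ψ (barChain k s) x).trans
    (congrArg (fun z => TensorOver.mk ((barRight k C).obj (op ⦋q⦌)) N X (z ⊗ₜ x))
      (barRight_map_barChain k ψ s))

theorem barTensorPush_mk (G : C ⥤ D) {N : C ⥤ ModuleCat.{u} k} {N' : D ⥤ ModuleCat.{u} k}
    (β : N ⟶ G ⋙ N') {q : ℕ} {X : C} (s : Fin (q + 1) ⥤ Under X) (x : N.obj X) :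
    ((barTensorPush G β).app (op ⦋q⦌)).hom (barTensorMk N s x) =
      barTensorMk N' (s ⋙ Under.post G) ((β.app X).hom x) :=
  (TensorOver.push_mk G ((barPush G).app (op ⦋q⦌)) β X (barChain k s) x).trans
    (congrArg (fun z => TensorOver.mk ((barRight k D).obj (op ⦋q⦌)) N' (G.obj X)
      (z ⊗ₜ (β.app X).hom x)) (barPush_barChain G s))

theorem barTensorMap_mk {N N' : C ⥤ ModuleCat.{u} k} (β : N ⟶ N') {q : ℕ} {X : C}
    (s : Fin (q + 1) ⥤ Under X) (x : N.obj X) :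
    ((barTensorMap β).app (op ⦋q⦌)).hom (barTensorMk N s x) = barTensorMk N' s ((β.app X).hom x) :=
  TensorOver.map_mk (𝟙 ((barRight k C).obj (op ⦋q⦌))) β X (barChain k s) x

theorem whiskerRight_barEndo_mk (E : C ⥤ C) (η : 𝟭 C ⟶ E) (N : C ⥤ ModuleCat.{u} k) {q : ℕ}
    {X : C} (s : Fin (q + 1) ⥤ Under X) (x : N.obj X) :
    ((Functor.whiskerRight (barEndo E η) (tensorRight N) : barTensor N ⟶ barTensor N).app
      (op ⦋q⦌)).hom (barTensorMk N s x) =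
      barTensorMk N (s ⋙ Under.post E ⋙ Under.map (η.app X)) x :=
  (TensorOver.map_mk ((barEndo E η).app (op ⦋q⦌)) (𝟙 N) X (barChain k s) x).trans
    (congrArg (fun z => TensorOver.mk ((barRight k C).obj (op ⦋q⦌)) N X (z ⊗ₜ x))
      (barEndo_barChain E η s))

variable (G : C ⥤ D) (F : D ⥤ C) (η : 𝟭 D ⟶ F ⋙ G) (η' : 𝟭 C ⟶ G ⋙ F)
  (N : D ⥤ ModuleCat.{u} k)

/-- The map induced by restriction along a functor. -/
noncomputable abbrev barRestrict : barTensor (G ⋙ N) ⟶ barTensor N :=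
  barTensorPush G (𝟙 (G ⋙ N))

/-- The homotopy inverse of `barRestrict`. -/
noncomputable abbrev barExtend : barTensor N ⟶ barTensor (G ⋙ N) :=
  barTensorPush F (N' := G ⋙ N)
    ((Functor.leftUnitor N).inv ≫ Functor.whiskerRight η N ≫ (Functor.associator F G N).hom)

/-- The composite applies `η` to the coefficient; the relation of the tensor product moves `η` back
to the simplex, where it becomes the endomorphism of the bar construction. -/
theorem barExtend_barRestrict : barExtend G F η N ≫ barRestrict G N =
    Functor.whiskerRight (barEndo (F ⋙ G) η) (tensorRight N) := by
  refine barTensor_hom_ext fun q X s x => ?_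
  refine Eq.trans ?_ (whiskerRight_barEndo_mk (F ⋙ G) η N s x).symm
  refine (congrArg ((barRestrict G N).app (op ⦋q⦌)).hom (barTensorPush_mk F _ s x)).trans ?_
  refine (barTensorPush_mk G (𝟙 (G ⋙ N)) _ _).trans ?_
  exact barTensorMk_map N (η.app X) _ x

/-- Over `C` only morphisms of `C` can be moved across the tensor sign. The hypothesis `h` says that
`η` at `G.obj X` comes from such a morphism, namely `η'.app X`. -/
theorem barRestrict_barExtend (h : ∀ X, G.map (η'.app X) = η.app (G.obj X)) :
    barRestrict G N ≫ barExtend G F η N =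
      Functor.whiskerRight (barEndo (G ⋙ F) η') (tensorRight (G ⋙ N)) := by
  refine barTensor_hom_ext fun q X s x => ?_
  have h1 : ((barRestrict G N).app (op ⦋q⦌)).hom (barTensorMk (G ⋙ N) s x) =
      barTensorMk N (s ⋙ Under.post G) (show N.obj (G.obj X) from x) :=
    barTensorPush_mk G (𝟙 (G ⋙ N)) s x
  have h2 : ((barExtend G F η N).app (op ⦋q⦌)).hom
      (barTensorMk N (s ⋙ Under.post G) (show N.obj (G.obj X) from x)) =
      barTensorMk (G ⋙ N) ((s ⋙ Under.post G) ⋙ Under.post F)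
        ((N.map (η.app (G.obj X))).hom x) :=
    barTensorPush_mk F (N' := G ⋙ N) _ (s ⋙ Under.post G) (show N.obj (G.obj X) from x)
  have h3 : barTensorMk (G ⋙ N) ((s ⋙ Under.post G) ⋙ Under.post F)
      (((G ⋙ N).map (η'.app X)).hom x) =
      barTensorMk (G ⋙ N) (s ⋙ Under.post (G ⋙ F) ⋙ Under.map (η'.app X)) x :=
    barTensorMk_map (G ⋙ N) (η'.app X) _ x
  have h4 : (N.map (η.app (G.obj X))).hom x = ((G ⋙ N).map (η'.app X)).hom x :=
    congrArg (fun f => (N.map f).hom x) (h X).symm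
  rw [h4] at h2
  exact (congrArg ((barExtend G F η N).app (op ⦋q⦌)).hom h1).trans
    (h2.trans (h3.trans (whiskerRight_barEndo_mk (G ⋙ F) η' (G ⋙ N) s x).symm))

/-- Restriction along a functor with an inverse up to natural transformations under the identity
induces an isomorphism on homology. -/
noncomputable def barRestrictIso (h : ∀ X, G.map (η'.app X) = η.app (G.obj X)) (n : ℕ) :
    (normalized (barTensor (G ⋙ N))).homology n ≅ (normalized (barTensor N)).homology n where
  hom := HomologicalComplex.homologyMap (normalizedMap (barRestrict G N)) n
  inv := HomologicalComplex.homologyMap (normalizedMap (barExtend G F η N)) n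
  hom_inv_id := by
    rw [← HomologicalComplex.homologyMap_comp, ← normalizedMap_comp,
      barRestrict_barExtend G F η η' N h]
    exact homologyMap_whiskerRight_bar _ (barEndo_barAug _ _) _ n
  inv_hom_id := by
    rw [← HomologicalComplex.homologyMap_comp, ← normalizedMap_comp, barExtend_barRestrict]
    exact homologyMap_whiskerRight_bar _ (barEndo_barAug _ _) _ n

theorem barRestrict_naturality {N N' : D ⥤ ModuleCat.{u} k} (β : N ⟶ N') :
    barTensorMap (Functor.whiskerLeft G β) ≫ barRestrict G N' =
      barRestrict G N ≫ barTensorMap β := by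
  refine barTensor_hom_ext fun q X s x => ?_
  refine (congrArg ((barRestrict G N').app (op ⦋q⦌)).hom
    (barTensorMap_mk (Functor.whiskerLeft G β) s x)).trans ?_
  refine (barTensorPush_mk G (𝟙 (G ⋙ N')) s _).trans ?_
  refine Eq.trans ?_ (congrArg ((barTensorMap β).app (op ⦋q⦌)).hom
    (barTensorPush_mk G (𝟙 (G ⋙ N)) s x)).symm
  exact (barTensorMap_mk β (s ⋙ Under.post G) x).symm

end PushIso

/-! ### Passage from `ΔS` to `ΔS₊` -/

section Symmetric

/-- The functor that adjoins a new first point to a noncommutative set. -/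
def addPoint : FAs ⥤ DeltaS where
  obj X := X.card
  map {X Y} f := InducedCategory.homMk (FAs.Hom.mk (X := ⟨X.card + 1⟩) (Y := ⟨Y.card + 1⟩)
    (Fin.cons [0] fun j => (f.fib j).map Fin.succ) (by
      intro i
      rw [Fin.sum_univ_succ]
      simp only [Fin.cons_zero, Fin.cons_succ]
      refine Fin.cases ?_ (fun i => ?_) i
      · have h : ∀ l : List (Fin X.card), (l.map Fin.succ).count 0 = 0 := fun l =>
          List.count_eq_zero.2 (by simp)
        simp [h]
      · have h : ∀ l : List (Fin X.card), (l.map Fin.succ).count i.succ = l.count i := fun l =>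
          List.count_map_of_injective l _ (Fin.succ_injective _) i
        simp only [h, f.count_fib i]
        simp [(Fin.succ_ne_zero i).symm]))
  map_id X := by
    refine InducedCategory.hom_ext (FAs.hom_ext fun j => ?_)
    refine Fin.cases ?_ (fun j => ?_) j
    · rfl
    · rfl
  map_comp {X Y Z} f g := by
    refine InducedCategory.hom_ext (FAs.hom_ext fun j => ?_)
    refine Fin.cases ?_ (fun j => ?_) j
    · rfl
    · change ((g.fib j).flatMap f.fib).map Fin.succ = ((g.fib j).map Fin.succ).flatMap
        (Fin.cons [0] fun j => (f.fib j).map Fin.succ)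
      rw [List.map_flatMap, List.flatMap_map]
      rfl

/-- The inclusion of a noncommutative set in the set with a new point. -/
def toAddPoint : 𝟭 FAs ⟶ addPoint ⋙ DeltaS.incl where
  app X := FAs.Hom.mk (X := X) (Y := ⟨X.card + 1⟩) (Fin.cons [] fun j => [j]) (by
    intro i
    rw [Fin.sum_univ_succ]
    simp [List.count_singleton])
  naturality X Y f := by
    refine FAs.hom_ext fun j => ?_
    refine Fin.cases ?_ (fun j => ?_) j
    · rfl
    · change [j].flatMap f.fib = ((f.fib j).map Fin.succ).flatMap (Fin.cons [] fun j => [j])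
      rw [List.flatMap_map]
      simp only [Fin.cons_succ, List.flatMap_singleton']
      exact List.append_nil _

/-- The same inclusion, for nonempty sets. -/
def toAddPoint' : 𝟭 DeltaS ⟶ DeltaS.incl ⋙ addPoint where
  app X := InducedCategory.homMk (toAddPoint.app (DeltaS.incl.obj X))
  naturality X Y f := InducedCategory.hom_ext (toAddPoint.naturality (DeltaS.incl.map f))

variable (k : Type u) [CommRing k]

/-- Symmetric homology is the homology of the normalized complex of `Y₊`. -/
noncomputable def HSIso (A : Type u) [Ring A] [Algebra k A] (n : ℕ) :
    HS k A n ≅ (normalized (YPlus k A)).homology n :=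
  torIso (DeltaS.incl ⋙ BsymPlus k A) n ≪≫
    barRestrictIso DeltaS.incl addPoint toAddPoint toAddPoint' (BsymPlus k A) (fun _ => rfl) n

theorem HSIso_naturality {A B : Type u} [Ring A] [Algebra k A] [Ring B] [Algebra k B]
    (φ : A →ₐ[k] B) (n : ℕ) : HSMap k φ n ≫ (HSIso k B n).hom = (HSIso k A n).hom ≫
      HomologicalComplex.homologyMap (normalizedMap (YPlusMap k φ)) n := by
  have h1 := torIso_naturality (Functor.whiskerLeft DeltaS.incl (BsymPlusMap k φ)) n
  have h2 := congrArg (fun f => HomologicalComplex.homologyMap (normalizedMap f) n)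
    (barRestrict_naturality DeltaS.incl (BsymPlusMap k φ))
  rw [normalizedMap_comp, normalizedMap_comp, HomologicalComplex.homologyMap_comp,
    HomologicalComplex.homologyMap_comp] at h2
  have key : ∀ {U V U' V' W W' : ModuleCat.{u} k} (a : U ⟶ U') (t' : U' ⟶ V') (t : U ⟶ V)
      (b : V ⟶ V') (r' : V' ⟶ W') (r : V ⟶ W) (c : W ⟶ W'), a ≫ t' = t ≫ b → b ≫ r' = r ≫ c →
      a ≫ t' ≫ r' = (t ≫ r) ≫ c := by
    intro U V U' V' W W' a t' t b r' r c h h'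
    rw [← Category.assoc, h, Category.assoc, h', Category.assoc]
  exact key _ _ _ _ _ _ _ h1 h2

end Symmetric

end SymHom

/-! ### Assembly of the main theorem -/

theorem mainTheorem6 (k : Type u) [CommRing k] :
    Dcat.IsOperad ∧ Kcat.IsModule ∧
    ∃ O : ChainOperad k (normalizedNerve k Dcat), O.IsInduced Dcat ∧ O.IsEInfinity ∧
    ∃ e : ∀ (A : Type u) [Ring A] [Algebra k A] (n : ℕ),
        HS k A n ≅ (normalized (YPlus k A)).homology n,
      (∀ (A B : Type u) [Ring A] [Algebra k A] [Ring B] [Algebra k B] (φ : A →ₐ[k] B) (n : ℕ),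
        HSMap k φ n ≫ (e B n).hom = (e A n).hom ≫
          HomologicalComplex.homologyMap (normalizedMap (YPlusMap k φ)) n) ∧
      ∀ (A : Type u) [Ring A] [Algebra k A],
        ∃ S : SimplicialAlgebra Dcat (YPlus k A),
          (∀ (m q : ℕ) (j : Fin m → ℕ) (c : Fin (q + 1) ⥤ Dcat.obj m)
            (f : ∀ s, Fin (q + 1) ⥤ Kcat.obj (j s)) (v : ∀ s, Fin (j s) → A),
            S.act m q (chain k c) (fun s => YPlus.mk k (f s) (v s)) =
              YPlus.mk k (Kcat.comp c f) fun r =>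
                v (finSigmaFinEquiv.symm r).1 (finSigmaFinEquiv.symm r).2) ∧
          ∃ T : ChainAlgebra O (normalized (YPlus k A)), T.IsInduced S ∧
            ∃ R : GradedCommAlgebra (HS k A),
              ∀ c : (Fin (0 + 1) ⥤ Dcat.obj 2) →₀ k, (c.sum fun _ x => x) = 1 →
                ∀ (p q : ℕ) (y : (normalized (YPlus k A)).cycles p)
                  (z : (normalized (YPlus k A)).cycles q),
                  ∃ v : (normalized (YPlus k A)).cycles (p + q),
                    Tot.of _ _ (((normalized (YPlus k A)).iCycles (p + q)).hom v) =
                      T.act 2 (cls (linNerve k (Dcat.obj 2)) 0 c)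
                        ![Tot.of _ _ (((normalized (YPlus k A)).iCycles p).hom y),
                          Tot.of _ _ (((normalized (YPlus k A)).iCycles q).hom z)] ∧
                    R.mul rfl
                        ((e A p).inv.hom (((normalized (YPlus k A)).homologyπ p).hom y))
                        ((e A q).inv.hom (((normalized (YPlus k A)).homologyπ q).hom z)) =
                      (e A (p + q)).inv.hom
                        (((normalized (YPlus k A)).homologyπ (p + q)).hom v) := by
  refine ⟨Dcat_isOperad, Kcat_isModule, chainOperad k Dcat_isOperad,
    chainOperad_isInduced k Dcat_isOperad, chainOperad_isEInfinity k,
    fun A _ _ n => HSIso k A n, fun A B _ _ _ _ φ n => HSIso_naturality k φ n, fun A _ _ => ?_⟩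
  refine ⟨YAlgebra k A, fun m q j c f v => ?_, chainAlgebra (YAlgebra k A) Dcat_isOperad,
    chainAlgebra_isInduced (YAlgebra k A) Dcat_isOperad, ?_⟩
  · exact (congrArg (fun F => F fun s => YPlus.mk k (f s) (v s)) (YActLin_chain c)).trans
      (YAct_mk c f v)
  · obtain ⟨R, hR⟩ := (chainAlgebra (YAlgebra k A) Dcat_isOperad).exists_gradedCommAlgebra
      (chainOperad_isAugmentation k)
    refine ⟨R.transport (HSIso k A), fun c hc p q y z => ?_⟩
    -- For a chain of degree zero the sum of the coefficients is its augmentation, so the product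
    -- formula applies to this `c`.
    have h1 : aug k (Dcat.obj 2) (Tot.of _ 0
        ((degenerate (linNerve k (Dcat.obj 2)) 0).mkQ c)) = 1 :=
      (aug_clsL_zero c).trans (Eq.trans
        ((Finsupp.linearCombination_apply k c).trans (Finsupp.sum_congr fun _ _ => mul_one _)) hc)
    have h2 := hR _ h1 p q (p + q) rfl (cyclesEquiv _ p y) (cyclesEquiv _ q z)
    -- The result of the operation is a homogeneous cycle in the direct sum; `v` is the same cycle
    -- in the complex itself.
    obtain ⟨v, hv⟩ := (cyclesEquiv (normalized (YPlus k A)) (p + q)).surjective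
      ⟨(chainAlgebra (YAlgebra k A) Dcat_isOperad).binary _ (cyclesEquiv _ p y)
        (cyclesEquiv _ q z), ChainAlgebra.binary_mem _ rfl _
          (cyclesEquiv _ p y).2 (cyclesEquiv _ q z).2⟩
    refine ⟨v, congrArg Subtype.val hv, ?_⟩
    rw [← hv, homologyClass_cyclesEquiv, homologyClass_cyclesEquiv,
      homologyClass_cyclesEquiv] at h2
    exact (R.transport_mul (HSIso k A) rfl _ _).trans
      (congrArg (HSIso k A (p + q)).inv.hom h2)
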